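/- **Stability for polarized perturbations.** Fix constants $R_0>0$, $W_0\neq 0$, $W_1\in\mathbb R$ and the background (polarized double cusp) $$R_b(t,x)=R_0e^{2t}\cosh(2x),\qquad W_b(x)=W_1+W_0\arctan(e^{2x}),\qquad q_b=0 .$$ Consider, for $t\ge 0$ and $x\in\mathbb R$, the system $$R_{xx}-R_{tt}=0,$$ $$W_{tt}-W_{xx}+\tfrac{R_t}{R}W_t-\tfrac{R_x}{R}W_x+\tfrac{q_t^2-q_x^2}{2}e^{-4W}=0,$$ $$q_{tt}-q_{xx}+\tfrac{R_t}{R}q_t-\tfrac{R_x}{R}q_x-4q_tW_t+4q_xW_x=0 .$$ Let $C_0^j(\mathbb R)$ be the space of $C^j$ functions all of whose derivatives of order at most $j$ tend to $0$ at infinity, with $\|f\|_{C^j}=\sum_{i\le j}\sup|f^{(i)}|$. Let $\widetilde H^j$ be the completion of $C_c^\infty(\mathbb R)$ for the norm $\|f\|_{\widetilde H^j}^2=\sum_{i=0}^j\int_{\mathbb R}(f^{(i)}(x))^2\cosh(2x)\,dx$ (for $j\ge1$ its elements are identified with their continuous representatives). Put $$m_0(t)=\|R-R_b\|_{C^0}+\|R_t-R_{b,t}\|_{C^0},\qquad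 m_j(t)=\|R-R_b\|_{C^j}+\|R_t-R_{b,t}\|_{C^{j-1}}\quad(j\ge1),$$ $$\widetilde{\mathcal M}_j(t)=\|W-W_b\|_{\widetilde H^j}+\|\partial_t(W-W_b)\|_{\widetilde H^{j-1}}+\|q\|_{\widetilde H^j}+\|\partial_tq\|_{\widetilde H^{j-1}}\quad (j\ge 1),$$ all functions being taken at time $t$. Let $k\ge3$. For every real $B$ there is a constant $C>0$, depending only on $k$, $B$ and the background constants $R_0,W_0$, such that the following holds. Take initial data at $t=0$ with $(R-R_b)(0,\cdot)\in C_0^k$, $\partial_t(R-R_b)(0,\cdot)\in C_0^{k-1}$, $(W-W_b)(0,\cdot)\in\widetilde H^k$, $\partial_t(W-W_b)(0,\cdot)\in\widetilde H^{k-1}$, $q(0,\cdot)=q_t(0,\cdot)=0$, and with $m_0(0)<2R_0/3$ and $m_k(0)\le B$. Then there is a solution $(R,W,q)$ of class $C^{k-1}$ with these data, defined for all $t\ge0$ (with $R$ nowhere zero); it is unique, even among $C^2$ solutions on $\{t\ge 0\}$; it satisfies $q\equiv0$; for all $t\ge0$ one has $(W-W_b)(t,\cdot)\in\widetilde H^k$,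 $\partial_t(W-W_b)(t,\cdot)\in\widetilde H^{k-1}$ and $$\widetilde{\mathcal M}_k(t)\le Ce^{-t}(t+1)\left(\widetilde{\mathcal M}_k(0)+m_k(0)\right).$$ In particular the polarized double cusp is a global attractor among polarized solutions, in the sense that $\widetilde{\mathcal M}_k(t)\to0$ as $t\to\infty$ for every such solution. -/

import Mathlib

open Filter Topology MeasureTheory

namespace DoubleCusp

noncomputable section

/-- Time derivative of a function `f t x` defined for `t ≥ 0` (one-sided at `t = 0`). -/
def dt (f : ℝ → ℝ → ℝ) (t x : ℝ) : ℝ := derivWithin (fun s => f s x) (Set.Ici 0) t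

/-- Space derivative of a function `f t x`. -/
def dx (f : ℝ → ℝ → ℝ) (t x : ℝ) : ℝ := deriv (fun y => f t y) x

/-- The background `R_b = R₀ e^{2t} cosh (2x)`. -/
def Rb (R₀ : ℝ) (t x : ℝ) : ℝ := R₀ * Real.exp (2 * t) * Real.cosh (2 * x)

/-- The background `W_b = W₁ + W₀ arctan (e^{2x})` (independent of `t`). -/
def Wb (W₀ W₁ : ℝ) (_t x : ℝ) : ℝ := W₁ + W₀ * Real.arctan (Real.exp (2 * x))

/-- The functions `R, R_t, W, W_t, q, q_t` at time `t = 0`. -/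
structure InitialData where
  R : ℝ → ℝ
  Rt : ℝ → ℝ
  W : ℝ → ℝ
  Wt : ℝ → ℝ
  q : ℝ → ℝ
  qt : ℝ → ℝ

/-- `f` is of class `C^n` on the closed half plane `{t ≥ 0}`. -/
def SmoothOnFuture (n : ℕ) (f : ℝ → ℝ → ℝ) : Prop :=
  ContDiffOn ℝ n (fun p : ℝ × ℝ => f p.1 p.2) (Set.Ici 0 ×ˢ Set.univ)

/-- `(R, W, q)` is a `C^n` solution, defined for all `t ≥ 0`, with initial data `D`, of
the wave equation for `R` and the wave map equations for `(W, q)`. Used for `n ≥ 2`.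
Only the values at `t ≥ 0` matter. -/
structure IsSolution (n : ℕ) (D : InitialData) (R W q : ℝ → ℝ → ℝ) : Prop where
  smooth_R : SmoothOnFuture n R
  smooth_W : SmoothOnFuture n W
  smooth_q : SmoothOnFuture n q
  R_ne_zero : ∀ t x : ℝ, 0 ≤ t → R t x ≠ 0
  eq_R : ∀ t x : ℝ, 0 ≤ t → dx (dx R) t x - dt (dt R) t x = 0
  eq_W : ∀ t x : ℝ, 0 ≤ t →
    dt (dt W) t x - dx (dx W) t x + dt R t x / R t x * dt W t x
      - dx R t x / R t x * dx W t x
      + ((dt q t x) ^ 2 - (dx q t x) ^ 2) / 2 * Real.exp (-4 * W t x) = 0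
  eq_q : ∀ t x : ℝ, 0 ≤ t →
    dt (dt q) t x - dx (dx q) t x + dt R t x / R t x * dt q t x
      - dx R t x / R t x * dx q t x
      - 4 * dt q t x * dt W t x + 4 * dx q t x * dx W t x = 0
  init_R : ∀ x, R 0 x = D.R x
  init_Rt : ∀ x, dt R 0 x = D.Rt x
  init_W : ∀ x, W 0 x = D.W x
  init_Wt : ∀ x, dt W 0 x = D.Wt x
  init_q : ∀ x, q 0 x = D.q x
  init_qt : ∀ x, dt q 0 x = D.qt x

/-- The space `C_0^k(ℝ)`: `C^k` functions whose derivatives up to order `k` tend to `0`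
at infinity. -/
def MemC0 (k : ℕ) (f : ℝ → ℝ) : Prop :=
  ContDiff ℝ k f ∧ ∀ i ≤ k, Tendsto (iteratedDeriv i f) (cocompact ℝ) (𝓝 0)

/-- The `C^k` norm (finite sums of real suprema; used for functions in `C_0^k`, whose
derivatives up to order `k` are bounded). -/
def ckNorm (k : ℕ) (f : ℝ → ℝ) : ℝ :=
  ∑ i ∈ Finset.range (k + 1), ⨆ x : ℝ, |iteratedDeriv i f x|

/-- `m_k(0) = ‖R - R_b‖_{C^k} + ‖R_t - R_{b,t}‖_{C^{k-1}}` at `t = 0` for `k ≥ 1`, and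
`m_0(0) = ‖R - R_b‖_{C^0} + ‖R_t - R_{b,t}‖_{C^0}`; the truncated subtraction `0 - 1 = 0`
makes one formula cover both cases. -/
def mInit (R₀ : ℝ) (k : ℕ) (D : InitialData) : ℝ :=
  ckNorm k (fun x => D.R x - Rb R₀ 0 x) + ckNorm (k - 1) (fun x => D.Rt x - dt (Rb R₀) 0 x)

/-- The `cosh (2x)`-weighted Sobolev norm of order `k` of a test function. -/
def testNorm (k : ℕ) (φ : ℝ → ℝ) : ℝ :=
  Real.sqrt (∑ i ∈ Finset.range (k + 1),
    ∫ x : ℝ, (iteratedDeriv i φ x) ^ 2 * Real.cosh (2 * x))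

/-- `φ` is a sequence of smooth compactly supported functions which is Cauchy for the
weighted Sobolev norm of order `k` and converges to `f` in the weighted `L²` space. -/
def IsApprox (k : ℕ) (f : ℝ → ℝ) (φ : ℕ → ℝ → ℝ) : Prop :=
  (∀ n, ContDiff ℝ ((⊤ : ℕ∞) : WithTop ℕ∞) (φ n) ∧ HasCompactSupport (φ n)) ∧
  (∀ ε > 0, ∃ N, ∀ m ≥ N, ∀ n ≥ N, testNorm k (fun x => φ m x - φ n x) < ε) ∧
  Tendsto (fun n => ∫⁻ x : ℝ, ENNReal.ofReal ((φ n x - f x) ^ 2 * Real.cosh (2 * x)))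
    atTop (𝓝 0)

/-- `f` represents an element of the weighted Sobolev space, the completion of the smooth
compactly supported functions for `testNorm k`, realised inside the weighted `L²` space. -/
def MemHt (k : ℕ) (f : ℝ → ℝ) : Prop := ∃ φ, IsApprox k f φ

open Classical in
/-- The norm of the completion: the limit of the norms along an approximating sequence
(the limit does not depend on the sequence; the value is `0` outside of the space). -/
def htNorm (k : ℕ) (f : ℝ → ℝ) : ℝ :=
  if h : MemHt k f then limUnder atTop (fun n => testNorm k (h.choose n)) else 0

/-- The weighted Sobolev distance at time `t` of `(W, q)` to the background `(W_b, 0)`. -/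
def Mtilde (W₀ W₁ : ℝ) (k : ℕ) (W q : ℝ → ℝ → ℝ) (t : ℝ) : ℝ :=
  htNorm k (fun x => W t x - Wb W₀ W₁ t x)
    + htNorm (k - 1) (fun x => dt (fun s y => W s y - Wb W₀ W₁ s y) t x)
    + htNorm k (fun x => q t x) + htNorm (k - 1) (fun x => dt q t x)

/-- Polarized initial data near the double cusp: `R - R_b` and its time derivative lie in
`C_0^k × C_0^{k-1}`, `W - W_b` and its time derivative in the weighted Sobolev spaces of
orders `k` and `k - 1` (continuous representatives), and `q = q_t = 0`. -/
structure IsPolarizedData (R₀ W₀ W₁ : ℝ) (k : ℕ) (D : InitialData) : Prop where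
  mem_R : MemC0 k (fun x => D.R x - Rb R₀ 0 x)
  mem_Rt : MemC0 (k - 1) (fun x => D.Rt x - dt (Rb R₀) 0 x)
  mem_W : MemHt k (fun x => D.W x - Wb W₀ W₁ 0 x)
  mem_Wt : MemHt (k - 1) (fun x => D.Wt x - dt (Wb W₀ W₁) 0 x)
  cont_W : Continuous D.W
  cont_Wt : Continuous D.Wt
  q_zero : ∀ x, D.q x = 0
  qt_zero : ∀ x, D.qt x = 0

end

end DoubleCusp

/-! Polarization persists because, for given R and W, the q-equation is linear and homogeneous in
the first derivatives of q. Uniqueness on backward characteristic triangles (`future_eq_zero`) gives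
q = 0, and the same principle then gives uniqueness of R and W. What remains is linear: R = R_b + ρ
with ρ given by d'Alembert's formula, and a wave equation with first-order terms for w = W - W_b.

The first-order terms are removed by a rescaling. Write R = R₀ e^{2t} cosh(2x) (1 + σ) and w = A u
with A = R^{-1/2}. Because R itself solves the wave equation, u_tt - u_xx = -((R_t² - R_x²)/(4R²)) u
+ G (`wave_identity`). On the background the potential is sech²(2x), which is nonnegative and
independent of time. Since ρ grows at most linearly in t while R_b grows like e^{2t}, the correction
Q to the potential is O((1+t) e^{-t} sech(2x)). The source G, present because W_b does not solve the
equation with the perturbed R, has the same rate in time, further decay in x, and a factor m_k(0)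
(`exists_coeffBound`). The condition m_0(0) < 2R₀/3 enters only here: it keeps 1 + σ ≥ 1/10. A time
cutoff extends σ to negative times, so that everything is defined on the whole plane and the
ordinary derivative can be used.

The energy of u is the integral of u_t² + u_x² + sech²(2x) u². Commuting with ∂_t does not touch the
main potential, so the energies of ∂_t^j u for j ≤ k-1 obey the same inequality, and Gronwall with
the integrable rate (1+t) e^{-t} keeps them bounded for all time (`EnergyHyp.energy_le`). They
control u in L² only with the weight sech, but a bounded u_t in L² makes the L² norm of u grow at
most linearly (`EnergyHyp.integral_sq_le`): this is the factor t + 1. The remaining derivatives come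
from the equation (`jet_le_of_wave`). Finally A² cosh(2x) is comparable to e^{-2t}, so the plain
Sobolev norms of u become the weighted norms of w with a gain of e^{-t}
(`exists_weighted_estimate`).

These estimates are proved for compactly supported data and source, where finite speed of
propagation makes every integral harmless. Even then ∂_t^{k-1} u is merely C¹, so the energy
identity is obtained by differentiating along characteristics (`hasDerivAt_char_iterate`,
`exists_energy`). Classical solutions come from a contraction argument for the Duhamel formula
(`exists_wave_solution`). For general data one takes smooth approximations and truncates the source:
the approximate solutions are Cauchy in the weighted norms, converge pointwise by the triangle
estimate, and closability of the norm identifies the limit as an element of the completion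
(`memHt_of_pointwise`, `exists_weighted_solution`). -/

namespace DoubleCusp

/-! ### Directional derivatives and jets on the plane -/

noncomputable section

/-- Directional derivative on the plane of points `(t, x)`. -/
def pd (v : ℝ × ℝ) (f : ℝ × ℝ → ℝ) : ℝ × ℝ → ℝ := fun p => fderiv ℝ f p v

/-- The time direction. -/
abbrev et : ℝ × ℝ := (1, 0)

/-- The space direction. -/
abbrev ex : ℝ × ℝ := (0, 1)

theorem contDiff_pd {n : ℕ} {f : ℝ × ℝ → ℝ} (hf : ContDiff ℝ (n + 1 : ℕ) f) (v : ℝ × ℝ) :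
    ContDiff ℝ n (pd v f) :=
  (hf.fderiv_right (by norm_cast)).clm_apply contDiff_const

theorem contDiff_le {m n : ℕ} {f : ℝ × ℝ → ℝ} (hf : ContDiff ℝ n f) (h : m ≤ n) :
    ContDiff ℝ m f := hf.of_le (by exact_mod_cast h)

theorem contDiff_of_succ {n : ℕ} {f : ℝ × ℝ → ℝ} (hf : ContDiff ℝ (n + 1 : ℕ) f) :
    ContDiff ℝ n f := contDiff_le hf n.le_succ

theorem differentiable_of_succ {n : ℕ} {f : ℝ × ℝ → ℝ} (hf : ContDiff ℝ (n + 1 : ℕ) f) :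
    Differentiable ℝ f := hf.differentiable (by norm_cast)

theorem pd_add {f g : ℝ × ℝ → ℝ} (v : ℝ × ℝ) (hf : Differentiable ℝ f)
    (hg : Differentiable ℝ g) : pd v (fun p => f p + g p) = fun p => pd v f p + pd v g p := by
  funext p
  simp only [pd]
  rw [fderiv_fun_add (hf p) (hg p)]; rfl

theorem pd_sub {f g : ℝ × ℝ → ℝ} (v : ℝ × ℝ) (hf : Differentiable ℝ f)
    (hg : Differentiable ℝ g) : pd v (fun p => f p - g p) = fun p => pd v f p - pd v g p := by
  funext p
  simp only [pd]
  rw [fderiv_fun_sub (hf p) (hg p)]; rfl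

theorem pd_neg {f : ℝ × ℝ → ℝ} (v : ℝ × ℝ) :
    pd v (fun p => - f p) = fun p => - pd v f p := by
  funext p
  simp only [pd]
  rw [fderiv_fun_neg]; rfl

theorem pd_mul {f g : ℝ × ℝ → ℝ} (v : ℝ × ℝ) (hf : Differentiable ℝ f)
    (hg : Differentiable ℝ g) :
    pd v (fun p => f p * g p) = fun p => pd v f p * g p + f p * pd v g p := by
  funext p
  simp only [pd]
  rw [fderiv_fun_mul (hf p) (hg p)]
  simp; ring

theorem pd_const (v : ℝ × ℝ) (c : ℝ) : pd v (fun _ => c) = fun _ => 0 := by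
  funext p
  simp [pd]

theorem differentiableAt_pd {f : ℝ × ℝ → ℝ} {p : ℝ × ℝ} (hf : ContDiffAt ℝ 2 f p)
    (v : ℝ × ℝ) : DifferentiableAt ℝ (pd v f) p :=
  ((hf.fderiv_right (m := 1) (by norm_num)).differentiableAt (by norm_num)).clm_apply
    (differentiableAt_const v)

theorem pd_comm_at {f : ℝ × ℝ → ℝ} {p : ℝ × ℝ} (hf : ContDiffAt ℝ 2 f p) (v w : ℝ × ℝ) :
    pd v (pd w f) p = pd w (pd v f) p := by
  have hd : DifferentiableAt ℝ (fderiv ℝ f) p :=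
    (hf.fderiv_right (m := 1) (by norm_num)).differentiableAt (by norm_num)
  have h : ∀ a b : ℝ × ℝ, fderiv ℝ (fun q => fderiv ℝ f q b) p a
      = fderiv ℝ (fderiv ℝ f) p a b := by
    intro a b
    rw [fderiv_clm_apply hd (differentiableAt_const b)]
    simp
  change fderiv ℝ (fun q => fderiv ℝ f q w) p v = fderiv ℝ (fun q => fderiv ℝ f q v) p w
  rw [h, h]
  exact (hf.isSymmSndFDerivAt (by simp)) v w

theorem pd_comm {f : ℝ × ℝ → ℝ} (hf : ContDiff ℝ 2 f) (v w : ℝ × ℝ) :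
    pd v (pd w f) = pd w (pd v f) :=
  funext fun _ => pd_comm_at hf.contDiffAt v w

theorem hasDerivAt_comp_pd {f : ℝ × ℝ → ℝ} {g : ℝ → ℝ × ℝ} {v : ℝ × ℝ} {s : ℝ}
    (hf : DifferentiableAt ℝ f (g s)) (hg : HasDerivAt g v s) :
    HasDerivAt (fun r => f (g r)) (pd v f (g s)) s :=
  hf.hasFDerivAt.comp_hasDerivAt s hg

theorem hasDerivAt_pt {f : ℝ × ℝ → ℝ} {t x : ℝ} (hf : DifferentiableAt ℝ f (t, x)) :
    HasDerivAt (fun s => f (s, x)) (pd et f (t, x)) t :=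
  hasDerivAt_comp_pd (g := fun s => (s, x)) hf ((hasDerivAt_id t).prodMk (hasDerivAt_const t x))

theorem hasDerivAt_px {f : ℝ × ℝ → ℝ} {t x : ℝ} (hf : DifferentiableAt ℝ f (t, x)) :
    HasDerivAt (fun y => f (t, y)) (pd ex f (t, x)) x :=
  hasDerivAt_comp_pd (g := fun y => (t, y)) hf ((hasDerivAt_const x t).prodMk (hasDerivAt_id x))

/-- Continuous partial derivatives give strict differentiability. With the next two lemmas, this is
how functions defined by integrals acquire regularity: from explicit formulas for their two partial
derivatives. -/
theorem hasFDerivAt_of_partial {f a b : ℝ × ℝ → ℝ} (ha : Continuous a) (hb : Continuous b)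
    (h1 : ∀ t x, HasDerivAt (fun s => f (s, x)) (a (t, x)) t)
    (h2 : ∀ t x, HasDerivAt (fun y => f (t, y)) (b (t, x)) x) (p : ℝ × ℝ) :
    HasFDerivAt f ((ContinuousLinearMap.toSpanSingleton ℝ (a p)).coprod
      (ContinuousLinearMap.toSpanSingleton ℝ (b p))) p := by
  have := hasStrictFDerivAt_uncurry_coprod (𝕜 := ℝ) (u := p) (f := fun s y => f (s, y))
    (f₁ := fun s y => ContinuousLinearMap.toSpanSingleton ℝ (a (s, y)))
    (f₂ := fun s y => ContinuousLinearMap.toSpanSingleton ℝ (b (s, y)))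
    (Eventually.of_forall fun q => (h1 q.1 q.2).hasFDerivAt)
    (Eventually.of_forall fun q => (h2 q.1 q.2).hasFDerivAt)
    (((ContinuousLinearMap.toSpanSingletonCLE (𝕜 := ℝ) (E := ℝ)).continuous.comp ha).continuousAt)
    (((ContinuousLinearMap.toSpanSingletonCLE (𝕜 := ℝ) (E := ℝ)).continuous.comp hb).continuousAt)
  exact this.hasFDerivAt

theorem pd_eq_of_partial {f a b : ℝ × ℝ → ℝ} (ha : Continuous a) (hb : Continuous b)
    (h1 : ∀ t x, HasDerivAt (fun s => f (s, x)) (a (t, x)) t)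
    (h2 : ∀ t x, HasDerivAt (fun y => f (t, y)) (b (t, x)) x) :
    pd et f = a ∧ pd ex f = b := by
  constructor <;> funext p <;> simp only [pd] <;>
    rw [(hasFDerivAt_of_partial ha hb h1 h2 p).fderiv] <;> simp

theorem contDiff_succ_of_partial {n : ℕ} {f a b : ℝ × ℝ → ℝ} (ha : ContDiff ℝ n a)
    (hb : ContDiff ℝ n b)
    (h1 : ∀ t x, HasDerivAt (fun s => f (s, x)) (a (t, x)) t)
    (h2 : ∀ t x, HasDerivAt (fun y => f (t, y)) (b (t, x)) x) :
    ContDiff ℝ (n + 1 : ℕ) f := by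
  have h := hasFDerivAt_of_partial ha.continuous hb.continuous h1 h2
  have : ContDiff ℝ ((n : WithTop ℕ∞) + 1) f := by
    rw [contDiff_succ_iff_fderiv]
    refine ⟨fun p => (h p).differentiableAt, fun hn => by simp at hn, ?_⟩
    have he : fderiv ℝ f = fun p => (ContinuousLinearMap.toSpanSingleton ℝ (a p)).coprod
      (ContinuousLinearMap.toSpanSingleton ℝ (b p)) := funext fun p => (h p).fderiv
    rw [he]
    refine contDiff_clm_apply_iff.2 fun y => ?_
    simp only [ContinuousLinearMap.coprod_apply, ContinuousLinearMap.toSpanSingleton_apply,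
      smul_eq_mul]
    exact (contDiff_const.mul ha).add (contDiff_const.mul hb)
  exact_mod_cast this

/-- The sum of the absolute values of all iterated derivatives of order at most `n` in
directions from `S`. -/
def jet (S : Finset (ℝ × ℝ)) : ℕ → (ℝ × ℝ → ℝ) → ℝ × ℝ → ℝ
  | 0, f, p => |f p|
  | n + 1, f, p => |f p| + ∑ v ∈ S, jet S n (pd v f) p

variable {S S' : Finset (ℝ × ℝ)} {n m : ℕ} {f g : ℝ × ℝ → ℝ} {p : ℝ × ℝ}

theorem jet_nonneg : ∀ (n : ℕ) (f : ℝ × ℝ → ℝ), 0 ≤ jet S n f p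
  | 0, _ => abs_nonneg _
  | n + 1, _ => add_nonneg (abs_nonneg _) (Finset.sum_nonneg fun _ _ => jet_nonneg n _)

theorem abs_le_jet (n : ℕ) (f : ℝ × ℝ → ℝ) : |f p| ≤ jet S n f p := by
  cases n with
  | zero => exact le_rfl
  | succ n => exact le_add_of_nonneg_right (Finset.sum_nonneg fun v _ => jet_nonneg n _)

theorem jet_le_succ (n : ℕ) : ∀ f : ℝ × ℝ → ℝ, jet S n f p ≤ jet S (n + 1) f p := by
  induction n with
  | zero => exact abs_le_jet 1
  | succ n ih =>
    intro f
    rw [jet, jet]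
    gcongr
    exact ih _

theorem jet_mono_order (h : n ≤ m) (f : ℝ × ℝ → ℝ) : jet S n f p ≤ jet S m f p :=
  monotone_nat_of_le_succ (fun n => jet_le_succ n f) h

theorem jet_mono_set (h : S ⊆ S') (n : ℕ) : ∀ f : ℝ × ℝ → ℝ, jet S n f p ≤ jet S' n f p := by
  induction n with
  | zero => exact fun _ => le_rfl
  | succ n ih =>
    intro f
    rw [jet, jet]
    gcongr
    exact (Finset.sum_le_sum fun v _ => ih _).trans
      (Finset.sum_le_sum_of_subset_of_nonneg h fun _ _ _ => jet_nonneg n _)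

theorem jet_pd_le {v : ℝ × ℝ} (hv : v ∈ S) (n : ℕ) (f : ℝ × ℝ → ℝ) :
    jet S n (pd v f) p ≤ jet S (n + 1) f p :=
  (Finset.single_le_sum (f := fun v => jet S n (pd v f) p)
    (fun _ _ => jet_nonneg n _) hv).trans (le_add_of_nonneg_left (abs_nonneg _))

theorem sum_jet_pd_le (n : ℕ) (f : ℝ × ℝ → ℝ) :
    ∑ v ∈ S, jet S n (pd v f) p ≤ jet S (n + 1) f p :=
  le_add_of_nonneg_left (abs_nonneg _)

theorem jet_congr (n : ℕ) : ∀ {f g : ℝ × ℝ → ℝ}, f =ᶠ[𝓝 p] g → jet S n f p = jet S n g p := by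
  induction n with
  | zero => intro f g h; simp [jet, h.self_of_nhds]
  | succ n ih =>
    intro f g h
    rw [jet, jet, h.self_of_nhds]
    congr 1
    refine Finset.sum_congr rfl fun _ _ => ih ?_
    filter_upwards [h.fderiv (𝕜 := ℝ)] with q hq
    simp [pd, hq]

theorem jet_neg (n : ℕ) : ∀ f : ℝ × ℝ → ℝ, jet S n (fun q => - f q) p = jet S n f p := by
  induction n with
  | zero => intro f; simp [jet]
  | succ n ih => intro f; simp [jet, pd_neg, ih]

theorem jet_const (n : ℕ) : ∀ c : ℝ, jet S n (fun _ => c) p = |c| := by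
  induction n with
  | zero => intro f; simp [jet]
  | succ n ih => intro f; simp [jet, pd_const, ih]

theorem jet_add_le (n : ℕ) : ∀ {f g : ℝ × ℝ → ℝ}, ContDiff ℝ n f → ContDiff ℝ n g →
    jet S n (fun q => f q + g q) p ≤ jet S n f p + jet S n g p := by
  induction n with
  | zero => intro f g _ _; exact abs_add_le _ _
  | succ n ih =>
    intro f g hf hg
    simp only [jet]
    have h1 := abs_add_le (f p) (g p)
    have h2 : ∑ v ∈ S, jet S n (pd v fun q => f q + g q) p
        ≤ ∑ v ∈ S, jet S n (pd v f) p + ∑ v ∈ S, jet S n (pd v g) p := by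
      rw [← Finset.sum_add_distrib]
      refine Finset.sum_le_sum fun v _ => ?_
      rw [pd_add v (differentiable_of_succ hf) (differentiable_of_succ hg)]
      exact ih (contDiff_pd hf v) (contDiff_pd hg v)
    linarith

theorem jet_sub_le (n : ℕ) {f g : ℝ × ℝ → ℝ} (hf : ContDiff ℝ n f) (hg : ContDiff ℝ n g) :
    jet S n (fun q => f q - g q) p ≤ jet S n f p + jet S n g p := by
  simp only [sub_eq_add_neg]
  exact (jet_add_le n hf hg.neg).trans_eq (by rw [jet_neg])

/-- At each order the Leibniz rule yields two products and the undifferentiated product is a third,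
whence one factor 3 per order. -/
theorem jet_mul_le (n : ℕ) : ∀ {f g : ℝ × ℝ → ℝ}, ContDiff ℝ n f → ContDiff ℝ n g →
    jet S n (fun q => f q * g q) p ≤ 3 ^ n * (jet S n f p * jet S n g p) := by
  induction n with
  | zero => intro f g _ _; simp [jet, abs_mul]
  | succ n ih =>
    intro f g hf hg
    have hfn : ContDiff ℝ n f := contDiff_of_succ hf
    have hgn : ContDiff ℝ n g := contDiff_of_succ hg
    set F := jet S (n + 1) f p
    set G := jet S (n + 1) g p
    have hF0 : 0 ≤ F := jet_nonneg _ _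
    have hG0 : 0 ≤ G := jet_nonneg _ _
    have key : ∑ v ∈ S, jet S n (pd v fun q => f q * g q) p ≤ 3 ^ n * (F * G) + 3 ^ n * (F * G) := by
      calc _ ≤ ∑ v ∈ S, (3 ^ n * (jet S n (pd v f) p * G) + 3 ^ n * (F * jet S n (pd v g) p)) := by
            refine Finset.sum_le_sum fun v _ => ?_
            rw [pd_mul v (differentiable_of_succ hf) (differentiable_of_succ hg)]
            have hfv := contDiff_pd hf v
            have hgv := contDiff_pd hg v
            refine (jet_add_le n (hfv.mul hgn) (hfn.mul hgv)).trans (add_le_add ?_ ?_)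
            · refine (ih hfv hgn).trans ?_
              gcongr
              · exact jet_nonneg _ _
              · exact jet_le_succ n g
            · refine (ih hfn hgv).trans ?_
              gcongr
              · exact jet_nonneg _ _
              · exact jet_le_succ n f
        _ = 3 ^ n * ((∑ v ∈ S, jet S n (pd v f) p) * G)
            + 3 ^ n * (F * ∑ v ∈ S, jet S n (pd v g) p) := by
            rw [Finset.sum_add_distrib, ← Finset.mul_sum, ← Finset.mul_sum, ← Finset.sum_mul,
              ← Finset.mul_sum]
        _ ≤ _ := by
            gcongr
            · exact sum_jet_pd_le n f
            · exact sum_jet_pd_le n g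
    have h0 : |f p * g p| ≤ 3 ^ n * (F * G) := by
      rw [abs_mul]
      have : |f p| * |g p| ≤ F * G :=
        mul_le_mul (abs_le_jet _ _) (abs_le_jet _ _) (abs_nonneg _) hF0
      have h3 : (1 : ℝ) ≤ 3 ^ n := one_le_pow₀ (by norm_num)
      nlinarith [mul_nonneg hF0 hG0]
    rw [jet, pow_succ]
    linarith

theorem jet_const_mul (n : ℕ) (c : ℝ) : ∀ {f : ℝ × ℝ → ℝ}, ContDiff ℝ n f →
    jet S n (fun q => c * f q) p = |c| * jet S n f p := by
  induction n with
  | zero => intro f _; simp [jet, abs_mul]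
  | succ n ih =>
    intro f hf
    simp only [jet, abs_mul, mul_add, Finset.mul_sum]
    congr 1
    refine Finset.sum_congr rfl fun v _ => ?_
    rw [pd_mul v (differentiable_const c) (differentiable_of_succ hf), ← ih (contDiff_pd hf v)]
    simp [pd_const]

theorem continuous_jet (n : ℕ) : ∀ {f : ℝ × ℝ → ℝ}, ContDiff ℝ n f → Continuous (jet S n f) := by
  induction n with
  | zero => intro f hf; exact hf.continuous.abs
  | succ n ih =>
    intro f hf
    exact hf.continuous.abs.add (continuous_finsetSum _ fun v _ => ih (contDiff_pd hf v))

end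

/-! ### Eliminating derivatives by means of a wave equation -/

noncomputable section

theorem contDiff_two_of_le {n : ℕ} {f : ℝ × ℝ → ℝ} (hf : ContDiff ℝ n f) (hn : 2 ≤ n) :
    ContDiff ℝ 2 f := hf.of_le (by exact_mod_cast hn)

/-- For a solution of a wave equation, all derivatives are controlled by the pure
`v`-derivatives of the function and of its first `w`-derivative. -/
theorem jet_le_of_wave {v w : ℝ × ℝ} (hvw : v ≠ w) (K : ℝ) (n : ℕ) :
    ∃ C, 0 ≤ C ∧ ∀ u a H : ℝ × ℝ → ℝ, ∀ p, ContDiff ℝ n u → ContDiff ℝ (n - 1 : ℕ) a →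
      ContDiff ℝ (n - 1 : ℕ) H → jet {v, w} (n - 1) a p ≤ K →
      (2 ≤ n → ∀ q, pd w (pd w u) q = pd v (pd v u) q + a q * u q + H q) →
      jet {v, w} n u p ≤ C * (jet {v} n u p + jet {v} (n - 1) (pd w u) p
        + jet {v, w} (n - 1) H p) := by
  induction n with
  | zero =>
    refine ⟨1, zero_le_one, fun u a H p _ _ _ _ _ => ?_⟩
    have h1 : 0 ≤ jet {v} (0 - 1) (pd w u) p := jet_nonneg _ _
    have h2 : 0 ≤ jet {v, w} (0 - 1) H p := jet_nonneg _ _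
    simp only [jet] at h1 h2 ⊢
    linarith
  | succ n ih =>
    rcases Nat.eq_zero_or_pos n with rfl | hn
    · clear ih
      refine ⟨1, zero_le_one, fun u a H p _ _ _ _ _ => ?_⟩
      have h2 : 0 ≤ jet {v, w} (0 + 1 - 1) H p := jet_nonneg _ _
      simp only [zero_add, Nat.sub_self, jet, Finset.sum_pair hvw, Finset.sum_singleton] at h2 ⊢
      linarith
    obtain ⟨n, rfl⟩ : ∃ k, n = k + 1 := ⟨n - 1, by omega⟩
    obtain ⟨C, hC, ih⟩ := ih
    simp only [Nat.add_sub_cancel] at ih ⊢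
    -- A generous constant. With P = 3^n |K| the jets of ∂_v u and ∂_w u are bounded below by C (3X
    -- + P C X) and C (4X + 2 P C X), and |u| by X.
    refine ⟨1 + C * (2 + 1 + 1 + 1) * (2 + 3 ^ n * |K| * 3 * (1 + C)), by positivity, ?_⟩
    intro u a H p hu ha hH hK heq
    have heq' := heq (by omega)
    have hu1 : ContDiff ℝ (n + 1 : ℕ) u := contDiff_le hu (by omega)
    have hun : ContDiff ℝ n u := contDiff_le hu (by omega)
    have han : ContDiff ℝ n a := contDiff_le ha (by omega)
    have hHn : ContDiff ℝ n H := contDiff_le hH (by omega)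
    have hud := differentiable_of_succ hu
    have had := differentiable_of_succ ha
    have hHd := differentiable_of_succ hH
    have hu2 := contDiff_two_of_le hu (by omega)
    have hmv : v ∈ ({v, w} : Finset (ℝ × ℝ)) := by simp
    have hmw : w ∈ ({v, w} : Finset (ℝ × ℝ)) := by simp
    have hsv : ({v} : Finset (ℝ × ℝ)) ⊆ {v, w} := by simp
    set X := jet {v} (n + 1 + 1) u p + jet {v} (n + 1) (pd w u) p + jet {v, w} (n + 1) H p with hX
    have X1 : 0 ≤ jet {v} (n + 1 + 1) u p := jet_nonneg _ _
    have X2 : 0 ≤ jet {v} (n + 1) (pd w u) p := jet_nonneg _ _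
    have X3 : 0 ≤ jet {v, w} (n + 1) H p := jet_nonneg _ _
    have hX0 : 0 ≤ X := by positivity
    have hKn : jet {v, w} n a p ≤ |K| := (jet_le_succ _ _).trans (hK.trans (le_abs_self K))
    have hn1 : jet {v, w} (n + 1) u p ≤ C * X := by
      refine (ih u a H p hu1 han hHn ((jet_le_succ _ _).trans hK) fun _ => heq').trans ?_
      gcongr
      rw [hX]
      gcongr
      · exact jet_le_succ _ _
      · exact jet_le_succ _ _
      · exact jet_le_succ _ _
    have hnu : jet {v, w} n u p ≤ C * X := (jet_le_succ _ _).trans hn1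
    -- A derivative ∂_z u solves an equation of the same form, with the same potential a and the
    -- source ∂_z a · u + ∂_z H. That source involves only u itself, so the induction hypothesis
    -- applies to ∂_z u.
    have hderiv : ∀ z ∈ ({v, w} : Finset (ℝ × ℝ)), 2 ≤ n + 1 → ∀ q,
        pd w (pd w (pd z u)) q = pd v (pd v (pd z u)) q + a q * pd z u q
          + (pd z a q * u q + pd z H q) := by
      intro z _ h2 q
      have hvv : Differentiable ℝ (pd v (pd v u)) := by
        obtain ⟨l, rfl⟩ : ∃ l, n = l + 1 := ⟨n - 1, by omega⟩
        exact differentiable_of_succ (contDiff_pd (contDiff_pd hu v) v)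
      have hw2 : ContDiff ℝ 2 (pd w u) := contDiff_two_of_le (contDiff_pd hu w) h2
      have hv2 : ContDiff ℝ 2 (pd v u) := contDiff_two_of_le (contDiff_pd hu v) h2
      rw [pd_comm hu2 w z, pd_comm hw2 w z, pd_comm hu2 v z, pd_comm hv2 v z,
        show pd w (pd w u) = fun q => pd v (pd v u) q + a q * u q + H q from funext heq',
        pd_add z (hvv.fun_add (had.fun_mul hud)) hHd, pd_add z hvv (had.fun_mul hud), pd_mul z had hud]
      ring
    have hsrc : ∀ z ∈ ({v, w} : Finset (ℝ × ℝ)),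
        jet {v, w} n (fun q => pd z a q * u q + pd z H q) p ≤ 3 ^ n * |K| * (C * X) + X := by
      intro z hz
      refine (jet_add_le n ((contDiff_pd ha z).mul hun) (contDiff_pd hH z)).trans (add_le_add ?_ ?_)
      · refine (jet_mul_le n (contDiff_pd ha z) hun).trans ?_
        rw [mul_assoc]
        gcongr
        · exact jet_nonneg _ _
        · exact (jet_pd_le hz n a).trans (hK.trans (le_abs_self K))
      · exact (jet_pd_le hz n H).trans (by rw [hX]; linarith)
    have hz : ∀ z ∈ ({v, w} : Finset (ℝ × ℝ)), jet {v, w} (n + 1) (pd z u) p ≤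
        C * (jet {v} (n + 1) (pd z u) p + jet {v} n (pd w (pd z u)) p
          + (3 ^ n * |K| * (C * X) + X)) := by
      intro z hz
      refine (ih (pd z u) a (fun q => pd z a q * u q + pd z H q) p (contDiff_pd hu z) han
        (((contDiff_pd ha z).mul hun).add (contDiff_pd hH z)) ((jet_le_succ _ _).trans hK)
        (hderiv z hz)).trans ?_
      gcongr
      exact hsrc z hz
    have hv1 : jet {v} (n + 1) (pd v u) p ≤ X :=
      (jet_pd_le (Finset.mem_singleton_self v) _ _).trans (by rw [hX]; linarith)
    have hv2 : jet {v} n (pd w (pd v u)) p ≤ X := by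
      rw [pd_comm hu2 w v]
      exact (jet_pd_le (Finset.mem_singleton_self v) _ _).trans (by rw [hX]; linarith)
    have hw1 : jet {v} (n + 1) (pd w u) p ≤ X := by rw [hX]; linarith
    -- The only quantity not already on the right-hand side, ∂_w² u, is eliminated by the equation.
    have hw2 : jet {v} n (pd w (pd w u)) p ≤ X + 3 ^ n * |K| * (C * X) + X := by
      rw [show pd w (pd w u) = fun q => pd v (pd v u) q + a q * u q + H q from funext heq']
      have c1 : ContDiff ℝ n (pd v (pd v u)) := contDiff_pd (contDiff_pd hu v) v
      refine (jet_add_le n (c1.add (han.mul hun)) hHn).trans (add_le_add ((jet_add_le n c1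
        (han.mul hun)).trans (add_le_add ?_ ?_)) ?_)
      · exact (jet_pd_le (Finset.mem_singleton_self v) _ _).trans
          ((jet_pd_le (Finset.mem_singleton_self v) _ _).trans (by rw [hX]; linarith))
      · refine (jet_mono_set hsv n _).trans ((jet_mul_le n han hun).trans ?_)
        rw [mul_assoc]
        gcongr
        exact jet_nonneg _ _
      · exact (jet_mono_set hsv n _).trans ((jet_le_succ _ _).trans (by rw [hX]; linarith))
    have e1 := hz v hmv
    have e2 := hz w hmw
    have e0 : |u p| ≤ X := (abs_le_jet _ _).trans (show jet {v} (n + 1 + 1) u p ≤ X by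
      rw [hX]; linarith)
    rw [jet, Finset.sum_pair hvw]
    have hP : 0 ≤ 3 ^ n * |K| := by positivity
    set P := (3 : ℝ) ^ n * |K|
    have e1' : jet {v, w} (n + 1) (pd v u) p ≤ C * (3 * X + P * (C * X)) :=
      e1.trans (mul_le_mul_of_nonneg_left (by linarith) hC)
    have e2' : jet {v, w} (n + 1) (pd w u) p ≤ C * (4 * X + 2 * (P * (C * X))) :=
      e2.trans (mul_le_mul_of_nonneg_left (by linarith) hC)
    have : 0 ≤ C * X * P := by positivity
    have : 0 ≤ C * X * P * C := by positivity
    have : 0 ≤ C * X := by positivity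
    nlinarith

end

/-! ### Primitives along characteristics and the Duhamel integral -/

noncomputable section

theorem hasDerivAt_integral_param {F F' : ℝ × ℝ → ℝ} (hF : Continuous F) (hF' : Continuous F')
    (h : ∀ s y, HasDerivAt (fun z => F (s, z)) (F' (s, y)) y) (a b y : ℝ) :
    HasDerivAt (fun z => ∫ s in a..b, F (s, z)) (∫ s in a..b, F' (s, y)) y := by
  obtain ⟨M, hM⟩ := ((isCompact_uIcc (a := a) (b := b)).prod
    (isCompact_Icc (a := y - 1) (b := y + 1))).exists_bound_of_continuousOn hF'.continuousOn
  refine (intervalIntegral.hasDerivAt_integral_of_dominated_loc_of_deriv_le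
    (F := fun z s => F (s, z)) (F' := fun z s => F' (s, z)) (bound := fun _ => M)
    (s := Set.Icc (y - 1) (y + 1)) (Icc_mem_nhds (by linarith) (by linarith)) ?_ ?_ ?_ ?_ ?_ ?_).2
  · exact Eventually.of_forall fun z => (by fun_prop : Continuous fun s => F (s, z)).aestronglyMeasurable
  · exact (by fun_prop : Continuous fun s => F (s, y)).intervalIntegrable _ _
  · exact (by fun_prop : Continuous fun s => F' (s, y)).aestronglyMeasurable
  · exact Eventually.of_forall fun s hs z hz => hM (s, z) ⟨Set.uIoc_subset_uIcc hs, hz⟩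
  · exact intervalIntegrable_const
  · exact Eventually.of_forall fun s _ z _ => h s z

/-- The primitive in the first variable, vanishing at `0`. -/
def prim (h : ℝ × ℝ → ℝ) (p : ℝ × ℝ) : ℝ := ∫ s in (0 : ℝ)..p.1, h (s, p.2)

theorem continuous_prim {h : ℝ × ℝ → ℝ} (hh : Continuous h) : Continuous (prim h) :=
  intervalIntegral.continuous_parametric_intervalIntegral_of_continuous
    (f := fun p : ℝ × ℝ => fun s => h (s, p.2)) (by fun_prop) continuous_fst

theorem hasDerivAt_prim_fst {h : ℝ × ℝ → ℝ} (hh : Continuous h) (t x : ℝ) :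
    HasDerivAt (fun s => prim h (s, x)) (h (t, x)) t :=
  intervalIntegral.integral_hasDerivAt_right ((by fun_prop : Continuous fun s => h (s, x)).intervalIntegrable _ _)
    ((by fun_prop : Continuous fun s => h (s, x)).stronglyMeasurableAtFilter _ _)
    (by fun_prop : Continuous fun s => h (s, x)).continuousAt

/-- The time derivative of the primitive is h itself, so its regularity rests on the space
derivative, which is the primitive of h'. -/
theorem contDiff_prim_succ {n : ℕ} {h h' : ℝ × ℝ → ℝ} (hh : ContDiff ℝ n h)
    (hh' : Continuous h') (hp : ContDiff ℝ n (prim h'))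
    (hd : ∀ s y, HasDerivAt (fun z => h (s, z)) (h' (s, y)) y) :
    ContDiff ℝ (n + 1 : ℕ) (prim h) ∧ pd et (prim h) = h ∧ pd ex (prim h) = prim h' := by
  have h1 := hasDerivAt_prim_fst hh.continuous
  have h2 : ∀ t x, HasDerivAt (fun y => prim h (t, y)) (prim h' (t, x)) x :=
    fun t x => hasDerivAt_integral_param hh.continuous hh' hd 0 t x
  exact ⟨contDiff_succ_of_partial hh hp h1 h2,
    pd_eq_of_partial hh.continuous hp.continuous h1 h2⟩

theorem contDiff_prim (n : ℕ) : ∀ {h : ℝ × ℝ → ℝ}, ContDiff ℝ n h → ContDiff ℝ n (prim h) := by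
  induction n with
  | zero => intro h hh; exact contDiff_zero.2 (continuous_prim hh.continuous)
  | succ n ih =>
    intro h hh
    exact (contDiff_prim_succ (contDiff_of_succ hh) (contDiff_pd hh ex).continuous
      (ih (contDiff_pd hh ex)) fun s y => hasDerivAt_px (differentiable_of_succ hh _)).1

theorem prim_sub {f g : ℝ × ℝ → ℝ} (hf : Continuous f) (hg : Continuous g) (p : ℝ × ℝ) :
    prim (fun q => f q - g q) p = prim f p - prim g p :=
  intervalIntegral.integral_sub ((by fun_prop : Continuous fun s => f (s, p.2)).intervalIntegrable _ _)
    ((by fun_prop : Continuous fun s => g (s, p.2)).intervalIntegrable _ _)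

theorem norm_integral_exp_le {g : ℝ → ℝ} {M l t : ℝ} (hl : 0 < l) (hM : 0 ≤ M)
    (ht : 0 ≤ t) (h : ∀ s, |g s| ≤ M * Real.exp (l * |s|)) :
    |∫ s in (0 : ℝ)..t, g s| ≤ M / l * Real.exp (l * t) := by
  have h1 : ‖∫ s in (0 : ℝ)..t, g s‖ ≤ ∫ s in (0 : ℝ)..t, M * Real.exp (l * s) := by
    refine intervalIntegral.norm_integral_le_of_norm_le ht (Eventually.of_forall fun s hs => ?_)
      ((by fun_prop : Continuous fun s => M * Real.exp (l * s)).intervalIntegrable _ _)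
    simpa [abs_of_pos hs.1] using h s
  have h2 : ∫ s in (0 : ℝ)..t, M * Real.exp (l * s) = M / l * Real.exp (l * t) - M / l := by
    have : ∀ s ∈ Set.uIcc 0 t, HasDerivAt (fun s => M / l * Real.exp (l * s)) (M * Real.exp (l * s)) s := by
      intro s _
      have := (((hasDerivAt_id s).const_mul l).exp).const_mul (M / l)
      refine this.congr_deriv ?_
      simp only [id]; field_simp
    rw [intervalIntegral.integral_eq_sub_of_hasDerivAt this
      ((by fun_prop : Continuous fun s => M * Real.exp (l * s)).intervalIntegrable _ _)]
    simp
  rw [h2] at h1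
  have : 0 ≤ M / l := by positivity
  rw [Real.norm_eq_abs] at h1
  linarith

/-- Integration in time gains 1/l against the weight e^{l|t|}, which for large l turns the Duhamel
operator into a contraction. Negative times are reflected to positive ones. -/
theorem abs_prim_le {g : ℝ × ℝ → ℝ} {M l : ℝ} (hl : 0 < l) (hM : 0 ≤ M)
    (h : ∀ p, |g p| ≤ M * Real.exp (l * |p.1|)) (p : ℝ × ℝ) :
    |prim g p| ≤ M / l * Real.exp (l * |p.1|) := by
  rcases le_total 0 p.1 with ht | ht
  · rw [abs_of_nonneg ht]
    exact norm_integral_exp_le hl hM ht fun s => h (s, p.2)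
  · rw [abs_of_nonpos ht]
    have := norm_integral_exp_le (g := fun s => g (-s, p.2)) hl hM (neg_nonneg.2 ht)
      fun s => by simpa using h (-s, p.2)
    rw [intervalIntegral.integral_comp_neg (fun s => g (s, p.2)), neg_neg, neg_zero,
      intervalIntegral.integral_symm, abs_neg] at this
    exact this

/-- The backward characteristic primitives. -/
def charPlus (h : ℝ × ℝ → ℝ) (p : ℝ × ℝ) : ℝ := prim (fun q => h (q.1, q.2 - q.1)) (p.1, p.2 + p.1)

/-- The path here is s ↦ (s, x - t + s), whereas `charPlus` follows s ↦ (s, x + t - s). Both end at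
(t, x). -/
def charMinus (h : ℝ × ℝ → ℝ) (p : ℝ × ℝ) : ℝ := prim (fun q => h (q.1, q.2 + q.1)) (p.1, p.2 - p.1)

/-- The primitive in the second variable, vanishing at `0`. -/
def primSnd (h : ℝ × ℝ → ℝ) (p : ℝ × ℝ) : ℝ := prim (fun q => h (q.2, q.1)) (p.2, p.1)

/-- The solution of the inhomogeneous wave equation with zero data. -/
def duhamel (h : ℝ × ℝ → ℝ) (p : ℝ × ℝ) : ℝ :=
  (charPlus (primSnd h) p - charMinus (primSnd h) p) / 2

theorem contDiff_primSnd {n : ℕ} {h : ℝ × ℝ → ℝ} (hh : ContDiff ℝ n h) :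
    ContDiff ℝ n (primSnd h) :=
  (contDiff_prim n (h := fun q => h (q.2, q.1)) (by fun_prop)).comp
    (contDiff_snd.prodMk contDiff_fst)

theorem hasDerivAt_primSnd {h : ℝ × ℝ → ℝ} (hh : Continuous h) (s y : ℝ) :
    HasDerivAt (fun z => primSnd h (s, z)) (h (s, y)) y :=
  hasDerivAt_prim_fst (h := fun q => h (q.2, q.1)) (by fun_prop) y s

theorem contDiff_charPlus {n : ℕ} {h : ℝ × ℝ → ℝ} (hh : ContDiff ℝ n h) :
    ContDiff ℝ n (charPlus h) :=
  (contDiff_prim n (h := fun q => h (q.1, q.2 - q.1)) (by fun_prop)).comp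
    (contDiff_fst.prodMk (contDiff_snd.add contDiff_fst))

theorem contDiff_charMinus {n : ℕ} {h : ℝ × ℝ → ℝ} (hh : ContDiff ℝ n h) :
    ContDiff ℝ n (charMinus h) :=
  (contDiff_prim n (h := fun q => h (q.1, q.2 + q.1)) (by fun_prop)).comp
    (contDiff_fst.prodMk (contDiff_snd.sub contDiff_fst))

theorem hasDerivAt_charPlus {h h' : ℝ × ℝ → ℝ} (hh : Continuous h) (hh' : Continuous h')
    (hd : ∀ s y, HasDerivAt (fun z => h (s, z)) (h' (s, y)) y) (t x : ℝ) :
    HasDerivAt (fun s => charPlus h (s, x)) (h (t, x) + charPlus h' (t, x)) t ∧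
      HasDerivAt (fun y => charPlus h (t, y)) (charPlus h' (t, x)) x := by
  obtain ⟨h1, h2, h3⟩ := contDiff_prim_succ (n := 0) (h := fun q => h (q.1, q.2 - q.1))
    (h' := fun q => h' (q.1, q.2 - q.1)) (contDiff_zero.2 (by fun_prop)) (by fun_prop)
    (contDiff_zero.2 (continuous_prim (by fun_prop)))
    (fun s y => (hd s (y - s)).comp_sub_const y s)
  have hdiff := differentiable_of_succ h1 (t, x + t)
  constructor
  · have := hasDerivAt_comp_pd (g := fun s => (s, x + s)) hdiff
      ((hasDerivAt_id t).prodMk ((hasDerivAt_id t).const_add x))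
    refine this.congr_deriv ?_
    have e : ((1 : ℝ), (1 : ℝ)) = et + ex := by simp
    have h2' := congrFun h2 (t, x + t)
    have h3' := congrFun h3 (t, x + t)
    simp only [pd] at h2' h3' ⊢
    rw [e, map_add, h2', h3']
    simp [charPlus]
  · have := hasDerivAt_comp_pd (g := fun y => (t, y + t)) hdiff
      ((hasDerivAt_const x t).prodMk ((hasDerivAt_id x).add_const t))
    rw [h3] at this
    exact this

theorem hasDerivAt_charMinus {h h' : ℝ × ℝ → ℝ} (hh : Continuous h) (hh' : Continuous h')
    (hd : ∀ s y, HasDerivAt (fun z => h (s, z)) (h' (s, y)) y) (t x : ℝ) :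
    HasDerivAt (fun s => charMinus h (s, x)) (h (t, x) - charMinus h' (t, x)) t ∧
      HasDerivAt (fun y => charMinus h (t, y)) (charMinus h' (t, x)) x := by
  obtain ⟨h1, h2, h3⟩ := contDiff_prim_succ (n := 0) (h := fun q => h (q.1, q.2 + q.1))
    (h' := fun q => h' (q.1, q.2 + q.1)) (contDiff_zero.2 (by fun_prop)) (by fun_prop)
    (contDiff_zero.2 (continuous_prim (by fun_prop)))
    (fun s y => (hd s (y + s)).comp_add_const y s)
  have hdiff := differentiable_of_succ h1 (t, x - t)
  constructor
  · have := hasDerivAt_comp_pd (g := fun s => (s, x - s)) hdiff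
      ((hasDerivAt_id t).prodMk ((hasDerivAt_id t).const_sub x))
    refine this.congr_deriv ?_
    have e : ((1 : ℝ), (-1 : ℝ)) = et - ex := by simp
    have h2' := congrFun h2 (t, x - t)
    have h3' := congrFun h3 (t, x - t)
    simp only [pd] at h2' h3' ⊢
    rw [e, map_sub, h2', h3']
    simp [charMinus]
  · have := hasDerivAt_comp_pd (g := fun y => (t, y - t)) hdiff
      ((hasDerivAt_const x t).prodMk ((hasDerivAt_id x).sub_const t))
    rw [h3] at this
    exact this

/-- The space primitive inside `duhamel` turns the integral over the characteristic triangle into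
line integrals. In ∂_t the boundary terms of the two families cancel, so first derivatives are line
integrals of h itself: one derivative is gained and none falls on h. -/
theorem duhamel_spec {n : ℕ} {h : ℝ × ℝ → ℝ} (hh : ContDiff ℝ n h) :
    ContDiff ℝ (n + 1 : ℕ) (duhamel h) ∧
      pd et (duhamel h) = (fun p => (charPlus h p + charMinus h p) / 2) ∧
      pd ex (duhamel h) = (fun p => (charPlus h p - charMinus h p) / 2) := by
  have hK := contDiff_primSnd hh
  have hP := hasDerivAt_charPlus hK.continuous hh.continuous (hasDerivAt_primSnd hh.continuous)
  have hM := hasDerivAt_charMinus hK.continuous hh.continuous (hasDerivAt_primSnd hh.continuous)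
  have c1 := contDiff_charPlus hh
  have c2 := contDiff_charMinus hh
  have ha : ContDiff ℝ n (fun p => (charPlus h p + charMinus h p) / 2) := (c1.add c2).div_const 2
  have hb : ContDiff ℝ n (fun p => (charPlus h p - charMinus h p) / 2) := (c1.sub c2).div_const 2
  have h1 : ∀ t x, HasDerivAt (fun s => duhamel h (s, x))
      ((charPlus h (t, x) + charMinus h (t, x)) / 2) t := fun t x => by
    refine (((hP t x).1.sub (hM t x).1).div_const 2).congr_deriv ?_
    ring
  have h2 : ∀ t x, HasDerivAt (fun y => duhamel h (t, y))
      ((charPlus h (t, x) - charMinus h (t, x)) / 2) x := fun t x =>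
    ((hP t x).2.sub (hM t x).2).div_const 2
  exact ⟨contDiff_succ_of_partial ha hb h1 h2,
    pd_eq_of_partial ha.continuous hb.continuous h1 h2⟩

theorem duhamel_wave {h : ℝ × ℝ → ℝ} (hh : ContDiff ℝ 1 h) (p : ℝ × ℝ) :
    pd et (pd et (duhamel h)) p - pd ex (pd ex (duhamel h)) p = h p := by
  have hh' : ContDiff ℝ ((0 + 1 : ℕ) : WithTop ℕ∞) h := by simpa using hh
  obtain ⟨-, e1, e2⟩ := duhamel_spec hh'
  have hd : ∀ s y, HasDerivAt (fun z => h (s, z)) (pd ex h (s, y)) y :=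
    fun s y => hasDerivAt_px (differentiable_of_succ hh' _)
  have hc := (contDiff_pd hh' ex).continuous
  have c1 := (contDiff_charPlus (n := 0) (contDiff_zero.2 hc)).continuous
  have c2 := (contDiff_charMinus (n := 0) (contDiff_zero.2 hc)).continuous
  have hP := hasDerivAt_charPlus hh.continuous hc hd
  have hM := hasDerivAt_charMinus hh.continuous hc hd
  have a1 : pd et (pd et (duhamel h)) p
      = (h p + charPlus (pd ex h) p + (h p - charMinus (pd ex h) p)) / 2 := by
    have := hasDerivAt_pt (t := p.1) (x := p.2) (differentiable_of_succ
      (((contDiff_charPlus hh').add (contDiff_charMinus hh')).div_const 2) p)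
    rw [e1]
    exact this.unique (((hP p.1 p.2).1.add (hM p.1 p.2).1).div_const 2)
  have a2 : pd ex (pd ex (duhamel h)) p
      = (charPlus (pd ex h) p - charMinus (pd ex h) p) / 2 := by
    have := hasDerivAt_px (t := p.1) (x := p.2) (differentiable_of_succ
      (((contDiff_charPlus hh').sub (contDiff_charMinus hh')).div_const 2) p)
    rw [e2]
    exact this.unique (((hP p.1 p.2).2.sub (hM p.1 p.2).2).div_const 2)
  rw [a1, a2]; ring

theorem duhamel_zero_time (h : ℝ × ℝ → ℝ) (x : ℝ) : duhamel h (0, x) = 0 := by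
  simp [duhamel, charPlus, charMinus, prim]

/-- Exhibits two successive time integrations, each of which gains a factor 1/l in the weighted
bound. -/
theorem duhamel_eq_prim {h : ℝ × ℝ → ℝ} (hh : Continuous h) (p : ℝ × ℝ) :
    duhamel h p = prim (fun q => (charPlus h q + charMinus h q) / 2) p := by
  obtain ⟨c, e1, -⟩ := duhamel_spec (n := 0) (contDiff_zero.2 hh)
  have hc := (contDiff_pd c et).continuous
  rw [← e1, prim, intervalIntegral.integral_eq_sub_of_hasDerivAt
    (f := fun s => duhamel h (s, p.2)) (fun s _ => hasDerivAt_pt (differentiable_of_succ c _))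
    ((by fun_prop : Continuous fun s => pd et (duhamel h) (s, p.2)).intervalIntegrable _ _),
    duhamel_zero_time, sub_zero]

theorem abs_duhamel_le {h : ℝ × ℝ → ℝ} {M l : ℝ} (hh : Continuous h) (hl : 0 < l) (hM : 0 ≤ M)
    (hb : ∀ p, |h p| ≤ M * Real.exp (l * |p.1|)) (p : ℝ × ℝ) :
    |duhamel h p| ≤ M / l / l * Real.exp (l * |p.1|) := by
  rw [duhamel_eq_prim hh]
  refine abs_prim_le hl (by positivity) (fun q => ?_) p
  have h1 : |charPlus h q| ≤ M / l * Real.exp (l * |q.1|) :=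
    abs_prim_le (g := fun q => h (q.1, q.2 - q.1)) hl hM (fun q => hb _) _
  have h2 : |charMinus h q| ≤ M / l * Real.exp (l * |q.1|) :=
    abs_prim_le (g := fun q => h (q.1, q.2 + q.1)) hl hM (fun q => hb _) _
  rw [abs_div, abs_two]
  have := abs_add_le (charPlus h q) (charMinus h q)
  linarith

theorem duhamel_sub {f g : ℝ × ℝ → ℝ} (hf : Continuous f) (hg : Continuous g) (p : ℝ × ℝ) :
    duhamel (fun q => f q - g q) p = duhamel f p - duhamel g p := by
  have hs : primSnd (fun q => f q - g q) = fun q => primSnd f q - primSnd g q := by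
    funext q
    exact prim_sub (f := fun q => f (q.2, q.1)) (g := fun q => g (q.2, q.1)) (by fun_prop)
      (by fun_prop) _
  have c1 := (contDiff_primSnd (n := 0) (contDiff_zero.2 hf)).continuous
  have c2 := (contDiff_primSnd (n := 0) (contDiff_zero.2 hg)).continuous
  simp only [duhamel, hs, charPlus, charMinus]
  rw [prim_sub (f := fun q => primSnd f (q.1, q.2 - q.1))
      (g := fun q => primSnd g (q.1, q.2 - q.1)) (by fun_prop) (by fun_prop),
    prim_sub (f := fun q => primSnd f (q.1, q.2 + q.1))
      (g := fun q => primSnd g (q.1, q.2 + q.1)) (by fun_prop) (by fun_prop)]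
  ring

end

/-! ### D'Alembert's formula and existence for wave equations with a potential -/

noncomputable section

/-- A travelling profile. -/
def trav (e : ℝ) (f : ℝ → ℝ) (p : ℝ × ℝ) : ℝ := f (p.2 + e * p.1)

theorem contDiff_trav {n : ℕ} {f : ℝ → ℝ} (e : ℝ) (hf : ContDiff ℝ n f) :
    ContDiff ℝ n (trav e f) :=
  hf.comp (contDiff_snd.add (contDiff_const.mul contDiff_fst))

theorem pd_trav {f : ℝ → ℝ} (e : ℝ) (hf : Differentiable ℝ f) (v : ℝ × ℝ) :
    pd v (trav e f) = fun p => (v.2 + e * v.1) * trav e (deriv f) p := by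
  funext p
  have h1 : HasFDerivAt (fun q : ℝ × ℝ => q.2 + e * q.1)
      (ContinuousLinearMap.snd ℝ ℝ ℝ + e • ContinuousLinearMap.fst ℝ ℝ ℝ) p :=
    hasFDerivAt_snd.add (hasFDerivAt_fst.const_mul e)
  have h2 := (hf (p.2 + e * p.1)).hasDerivAt.comp_hasFDerivAt p h1
  change fderiv ℝ (f ∘ fun q : ℝ × ℝ => q.2 + e * q.1) p v = _
  rw [h2.fderiv]
  simp [trav]; ring

theorem deriv_primitive {g : ℝ → ℝ} (hg : Continuous g) :
    (∀ y, HasDerivAt (fun y => ∫ z in (0 : ℝ)..y, g z) (g y) y) := fun _ =>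
  intervalIntegral.integral_hasDerivAt_right (hg.intervalIntegrable _ _)
    (hg.stronglyMeasurableAtFilter _ _) hg.continuousAt

theorem contDiff_primitive {n : ℕ} {g : ℝ → ℝ} (hg : ContDiff ℝ n g) :
    ContDiff ℝ (n + 1 : ℕ) (fun y => ∫ z in (0 : ℝ)..y, g z) := by
  have h := deriv_primitive hg.continuous
  push_cast
  rw [contDiff_succ_iff_deriv]
  exact ⟨fun y => (h y).differentiableAt, fun hn => by simp at hn,
    by rwa [show deriv (fun y => ∫ z in (0 : ℝ)..y, g z) = g from funext fun y => (h y).deriv]⟩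

/-- D'Alembert's solution of the homogeneous wave equation. -/
def dalembert (f g : ℝ → ℝ) (p : ℝ × ℝ) : ℝ :=
  (trav 1 (fun y => f y + ∫ z in (0 : ℝ)..y, g z) p
    + trav (-1) (fun y => f y - ∫ z in (0 : ℝ)..y, g z) p) / 2

theorem dalembert_spec {n : ℕ} {f g : ℝ → ℝ} (hf : ContDiff ℝ (n + 1 : ℕ) f)
    (hg : ContDiff ℝ n g) :
    ContDiff ℝ (n + 1 : ℕ) (dalembert f g) ∧
      pd et (dalembert f g) = (fun p => (trav 1 (deriv f) p + trav 1 g p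
        - trav (-1) (deriv f) p + trav (-1) g p) / 2) ∧
      pd ex (dalembert f g) = (fun p => (trav 1 (deriv f) p + trav 1 g p
        + trav (-1) (deriv f) p - trav (-1) g p) / 2) := by
  have hG := contDiff_primitive hg
  have c1 := hf.add hG
  have c2 := hf.sub hG
  have hfd : Differentiable ℝ f := hf.differentiable (by norm_cast)
  have hGd := deriv_primitive hg.continuous
  have d1 : Differentiable ℝ (fun y => f y + ∫ z in (0 : ℝ)..y, g z) :=
    fun y => (hfd y).fun_add (hGd y).differentiableAt
  have d2 : Differentiable ℝ (fun y => f y - ∫ z in (0 : ℝ)..y, g z) :=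
    fun y => (hfd y).fun_sub (hGd y).differentiableAt
  have e1 : deriv (fun y => f y + ∫ z in (0 : ℝ)..y, g z) = fun y => deriv f y + g y :=
    funext fun y => ((hfd y).hasDerivAt.fun_add (hGd y)).deriv
  have e2 : deriv (fun y => f y - ∫ z in (0 : ℝ)..y, g z) = fun y => deriv f y - g y :=
    funext fun y => ((hfd y).hasDerivAt.fun_sub (hGd y)).deriv
  have t1 := contDiff_trav 1 c1
  have t2 := contDiff_trav (-1) c2
  have key : ∀ v : ℝ × ℝ, pd v (dalembert f g) = fun p =>
      ((v.2 + 1 * v.1) * trav 1 (fun y => deriv f y + g y) p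
        + (v.2 + (-1) * v.1) * trav (-1) (fun y => deriv f y - g y) p) / 2 := by
    intro v
    have : dalembert f g = fun p => (1 / 2) * (trav 1 (fun y => f y + ∫ z in (0 : ℝ)..y, g z) p
        + trav (-1) (fun y => f y - ∫ z in (0 : ℝ)..y, g z) p) := by
      funext p; simp only [dalembert]; ring
    have dt1 := differentiable_of_succ t1
    have dt2 := differentiable_of_succ t2
    rw [this, pd_mul v (differentiable_const _) (dt1.fun_add dt2), pd_const,
      pd_add v dt1 dt2, pd_trav 1 d1, pd_trav (-1) d2, e1, e2]
    funext p; ring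
  refine ⟨(t1.add t2).div_const 2, ?_, ?_⟩ <;> rw [key] <;> funext p <;> simp only [trav] <;> ring

theorem dalembert_zero (f g : ℝ → ℝ) (x : ℝ) : dalembert f g (0, x) = f x := by
  simp [dalembert, trav]

theorem dalembert_wave {f g : ℝ → ℝ} (hf : ContDiff ℝ 2 f) (hg : ContDiff ℝ 1 g) (p : ℝ × ℝ) :
    pd et (pd et (dalembert f g)) p = pd ex (pd ex (dalembert f g)) p := by
  have hf' : ContDiff ℝ ((1 + 1 : ℕ) : WithTop ℕ∞) f := by exact_mod_cast hf
  have hg' : ContDiff ℝ ((1 : ℕ) : WithTop ℕ∞) g := by exact_mod_cast hg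
  obtain ⟨-, e1, e2⟩ := dalembert_spec hf' hg'
  have hdf : ContDiff ℝ ((0 + 1 : ℕ) : WithTop ℕ∞) (deriv f) := by
    have := (contDiff_succ_iff_deriv (n := 1)).1 (by norm_num; exact hf)
    simpa using this.2.2
  have df : Differentiable ℝ (deriv f) := hdf.differentiable (by norm_cast)
  have dg : Differentiable ℝ g := hg.differentiable (by norm_num)
  have key : ∀ v : ℝ × ℝ, ∀ a b c d : ℝ, pd v (fun p => (a * trav 1 (deriv f) p + b * trav 1 g p
        + c * trav (-1) (deriv f) p + d * trav (-1) g p) / 2) p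
      = (a * ((v.2 + 1 * v.1) * trav 1 (deriv (deriv f)) p) + b * ((v.2 + 1 * v.1) * trav 1 (deriv g) p)
        + c * ((v.2 + (-1) * v.1) * trav (-1) (deriv (deriv f)) p)
        + d * ((v.2 + (-1) * v.1) * trav (-1) (deriv g) p)) / 2 := by
    intro v a b c d
    have m1 : ∀ e : ℝ, Differentiable ℝ (trav e (deriv f)) :=
      fun e => differentiable_of_succ (contDiff_trav e hdf)
    have m2 : ∀ e : ℝ, Differentiable ℝ (trav e g) :=
      fun e => differentiable_of_succ (n := 0) (contDiff_trav e (by simpa using hg'))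
    have h : ∀ e, HasFDerivAt (trav e (deriv f)) (fderiv ℝ (trav e (deriv f)) p) p :=
      fun e => (m1 e p).hasFDerivAt
    have h' : ∀ e, HasFDerivAt (trav e g) (fderiv ℝ (trav e g) p) p :=
      fun e => (m2 e p).hasFDerivAt
    have H := ((((h 1).const_mul a).fun_add ((h' 1).const_mul b)).fun_add
      ((h (-1)).const_mul c)).fun_add ((h' (-1)).const_mul d)
    have H2 := H.mul_const (1 / 2)
    have q1 := fun e => congrFun (pd_trav e df v) p
    have q2 := fun e => congrFun (pd_trav e dg v) p
    simp only [pd] at q1 q2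
    rw [show (fun p => (a * trav 1 (deriv f) p + b * trav 1 g p + c * trav (-1) (deriv f) p
        + d * trav (-1) g p) / 2) = fun p => (a * trav 1 (deriv f) p + b * trav 1 g p
        + c * trav (-1) (deriv f) p + d * trav (-1) g p) * (1 / 2) by funext p; ring,
      pd, H2.fderiv]
    simp only [smul_eq_mul, smul_apply, add_apply]
    rw [← q1, ← q1, ← q2, ← q2]
    ring
  have k1 := key et 1 1 (-1) 1
  have k2 := key ex 1 1 1 (-1)
  rw [e1, e2]
  have r1 : (fun p => (trav 1 (deriv f) p + trav 1 g p - trav (-1) (deriv f) p + trav (-1) g p) / 2)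
      = fun p => (1 * trav 1 (deriv f) p + 1 * trav 1 g p + (-1) * trav (-1) (deriv f) p
        + 1 * trav (-1) g p) / 2 := by funext p; ring
  have r2 : (fun p => (trav 1 (deriv f) p + trav 1 g p + trav (-1) (deriv f) p - trav (-1) g p) / 2)
      = fun p => (1 * trav 1 (deriv f) p + 1 * trav 1 g p + 1 * trav (-1) (deriv f) p
        + (-1) * trav (-1) g p) / 2 := by funext p; ring
  rw [r1, r2, k1, k2]
  ring

/-- The two boundary values average to at most M, and g is integrated over an interval of length
2|t|. Only sup norms of order zero enter, which is why smallness of m_0(0) is enough to keep R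
positive. -/
theorem abs_dalembert_le {f g : ℝ → ℝ} {M N : ℝ} (hf : ∀ x, |f x| ≤ M) (hg : ∀ x, |g x| ≤ N)
    (hgc : Continuous g) (p : ℝ × ℝ) : |dalembert f g p| ≤ M + N * |p.1| := by
  have h1 : (∫ z in (0 : ℝ)..(p.2 + 1 * p.1), g z) - ∫ z in (0 : ℝ)..(p.2 + (-1) * p.1), g z
      = ∫ z in (p.2 + (-1) * p.1)..(p.2 + 1 * p.1), g z :=
    intervalIntegral.integral_interval_sub_left (hgc.intervalIntegrable _ _)
      (hgc.intervalIntegrable _ _)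
  have h2 := intervalIntegral.norm_integral_le_of_norm_le_const (a := p.2 + (-1) * p.1)
    (b := p.2 + 1 * p.1) (f := g) (C := N) fun x _ => hg x
  rw [show p.2 + 1 * p.1 - (p.2 + (-1) * p.1) = 2 * p.1 by ring, abs_mul, abs_two,
    Real.norm_eq_abs] at h2
  have h3 : dalembert f g p = (f (p.2 + 1 * p.1) + f (p.2 + (-1) * p.1)
      + ∫ z in (p.2 + (-1) * p.1)..(p.2 + 1 * p.1), g z) / 2 := by
    rw [← h1]; simp only [dalembert, trav]; ring
  rw [h3, abs_div, abs_two]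
  have a1 := hf (p.2 + 1 * p.1)
  have a2 := hf (p.2 + (-1) * p.1)
  have a3 := abs_add_three (f (p.2 + 1 * p.1)) (f (p.2 + (-1) * p.1))
    (∫ z in (p.2 + (-1) * p.1)..(p.2 + 1 * p.1), g z)
  linarith

-- Writing u = e^{l|t|} f with f bounded and continuous, the map defined by the right-hand side has
-- Lipschitz constant A/l². A single contraction thus solves the equation for all times in both
-- directions.
open BoundedContinuousFunction in
theorem exists_integral_solution {V F : ℝ × ℝ → ℝ} {A M : ℝ} (hV : Continuous V)
    (hF : Continuous F) (hA : ∀ p, |V p| ≤ A) (hFb : ∀ p, |F p| ≤ M * Real.exp |p.1|) :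
    ∃ u : ℝ × ℝ → ℝ, Continuous u ∧ ∀ p, u p = F p - duhamel (fun q => V q * u q) p := by
  have hA0 : 0 ≤ A := (abs_nonneg _).trans (hA 0)
  have hM0 : 0 ≤ M := by simpa using (abs_nonneg _).trans (hFb 0)
  -- Large enough for A/l² ≤ 1/2. Moreover l ≥ 1 lets the weight absorb the growth e^{|t|} of F.
  set l : ℝ := 2 * (A + 1) with hl
  have hl0 : 0 < l := by positivity
  have hl1 : 1 ≤ l := by linarith
  have hAl : A / l / l ≤ 1 / 2 := by
    rw [div_div, div_le_iff₀ (by positivity)]; nlinarith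
  have hexp : ∀ t : ℝ, Real.exp (-(l * |t|)) * Real.exp (l * |t|) = 1 := fun t => by
    rw [← Real.exp_add]; simp
  have hc : ∀ f : (ℝ × ℝ) →ᵇ ℝ, Continuous fun q : ℝ × ℝ => V q * (Real.exp (l * |q.1|) * f q) :=
    fun f => by fun_prop
  have hdc : ∀ {h : ℝ × ℝ → ℝ}, Continuous h → Continuous (duhamel h) := fun hh =>
    (duhamel_spec (n := 0) (contDiff_zero.2 hh)).1.continuous
  have hVb : ∀ f : (ℝ × ℝ) →ᵇ ℝ, ∀ q : ℝ × ℝ,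
      |V q * (Real.exp (l * |q.1|) * f q)| ≤ A * ‖f‖ * Real.exp (l * |q.1|) := fun f q => by
    rw [abs_mul, abs_mul, abs_of_pos (Real.exp_pos _)]
    have h1 := hA q
    have h2 : |f q| ≤ ‖f‖ := f.norm_coe_le_norm q
    calc |V q| * (Real.exp (l * |q.1|) * |f q|) ≤ A * (Real.exp (l * |q.1|) * ‖f‖) := by gcongr
      _ = _ := by ring
  let Φ : ((ℝ × ℝ) →ᵇ ℝ) → ((ℝ × ℝ) →ᵇ ℝ) := fun f =>
    BoundedContinuousFunction.ofNormedAddCommGroup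
      (fun p => Real.exp (-(l * |p.1|)) *
        (F p - duhamel (fun q => V q * (Real.exp (l * |q.1|) * f q)) p))
      (by have := hdc (hc f); fun_prop) (M + A * ‖f‖ / l / l) (fun p => by
        have h1 := hFb p
        have h2 := abs_duhamel_le (hc f) hl0 (by positivity) (hVb f) p
        have h3 : Real.exp |p.1| ≤ Real.exp (l * |p.1|) := by
          gcongr; nlinarith [abs_nonneg p.1]
        rw [norm_mul, Real.norm_eq_abs, abs_of_pos (Real.exp_pos _), Real.norm_eq_abs]
        have h4 := abs_sub (F p) (duhamel (fun q => V q * (Real.exp (l * |q.1|) * f q)) p)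
        have h5 : |F p - duhamel (fun q => V q * (Real.exp (l * |q.1|) * f q)) p|
            ≤ (M + A * ‖f‖ / l / l) * Real.exp (l * |p.1|) := by nlinarith
        calc _ ≤ Real.exp (-(l * |p.1|)) * ((M + A * ‖f‖ / l / l) * Real.exp (l * |p.1|)) := by
              gcongr
          _ = (M + A * ‖f‖ / l / l) * (Real.exp (-(l * |p.1|)) * Real.exp (l * |p.1|)) := by ring
          _ = _ := by rw [hexp, mul_one])
  have hΦ : ContractingWith (1 / 2) Φ := by
    refine ⟨by norm_num, LipschitzWith.of_dist_le_mul fun f g => ?_⟩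
    rw [BoundedContinuousFunction.dist_le (by positivity)]
    intro p
    have e1 : Φ f p - Φ g p = - (Real.exp (-(l * |p.1|)) *
        duhamel (fun q => V q * (Real.exp (l * |q.1|) * (f - g) q)) p) := by
      have : (fun q => V q * (Real.exp (l * |q.1|) * (f - g) q)) = fun q =>
          V q * (Real.exp (l * |q.1|) * f q) - V q * (Real.exp (l * |q.1|) * g q) := by
        funext q; simp; ring
      rw [this, duhamel_sub (hc f) (hc g)]
      change Real.exp _ * _ - Real.exp _ * _ = _
      ring
    rw [Real.dist_eq, e1, abs_neg, abs_mul, abs_of_pos (Real.exp_pos _)]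
    have h2 := abs_duhamel_le (hc (f - g)) hl0 (by positivity) (hVb (f - g)) p
    calc _ ≤ Real.exp (-(l * |p.1|)) * (A * ‖f - g‖ / l / l * Real.exp (l * |p.1|)) := by gcongr
      _ = (A / l / l) * ‖f - g‖ * (Real.exp (-(l * |p.1|)) * Real.exp (l * |p.1|)) := by ring
      _ = (A / l / l) * ‖f - g‖ := by rw [hexp, mul_one]
      _ ≤ _ := by
        rw [dist_eq_norm]
        simp only [NNReal.coe_div, NNReal.coe_one, NNReal.coe_ofNat]
        gcongr
  obtain ⟨f, hf⟩ : ∃ f, Φ f = f := ⟨_, hΦ.fixedPoint_isFixedPt⟩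
  refine ⟨fun p => Real.exp (l * |p.1|) * f p, by fun_prop, fun p => ?_⟩
  have h1 : f p = Real.exp (-(l * |p.1|)) *
      (F p - duhamel (fun q => V q * (Real.exp (l * |q.1|) * f q)) p) := by
    conv_lhs => rw [← hf]
    rfl
  change Real.exp (l * |p.1|) * f p = _
  rw [h1, ← mul_assoc, mul_comm (Real.exp _) (Real.exp _), hexp, one_mul]

/-- Global existence for the linear wave equation with a bounded potential. -/
theorem exists_wave_solution {n : ℕ} (hn : 1 ≤ n) {V G : ℝ × ℝ → ℝ} {f g : ℝ → ℝ} {A M : ℝ}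
    (hV : ContDiff ℝ n V) (hG : ContDiff ℝ n G) (hf : ContDiff ℝ (n + 1 : ℕ) f)
    (hg : ContDiff ℝ n g) (hA : ∀ p, |V p| ≤ A) (hGM : ∀ p, |G p| ≤ M) (hfM : ∀ x, |f x| ≤ M)
    (hgM : ∀ x, |g x| ≤ M) :
    ∃ u : ℝ × ℝ → ℝ, ContDiff ℝ (n + 1 : ℕ) u ∧ (∀ x, u (0, x) = f x) ∧
      (∀ x, pd et u (0, x) = g x) ∧
      ∀ p, pd et (pd et u) p - pd ex (pd ex u) p = - (V p * u p) + G p := by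
  obtain ⟨d1, d2, -⟩ := dalembert_spec hf hg
  obtain ⟨s1, s2, -⟩ := duhamel_spec hG
  have hM0 : 0 ≤ M := (abs_nonneg _).trans (hfM 0)
  obtain ⟨u, huc, hu⟩ := exists_integral_solution (F := fun p => dalembert f g p + duhamel G p)
    (M := 3 * M) hV.continuous (d1.continuous.add s1.continuous) hA (fun p => by
      have h1 := abs_dalembert_le hfM hgM hg.continuous p
      have h2 := abs_duhamel_le (l := 1) hG.continuous one_pos hM0 (fun q => (hGM q).trans
        (le_mul_of_one_le_right hM0 (Real.one_le_exp (by positivity)))) p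
      have h3 := Real.add_one_le_exp |p.1|
      have h4 := abs_add_le (dalembert f g p) (duhamel G p)
      simp only [one_mul, div_one] at h2
      nlinarith [abs_nonneg p.1])
  have hu' : u = fun p => dalembert f g p + duhamel G p - duhamel (fun q => V q * u q) p :=
    funext hu
  -- Bootstrap: the Duhamel term is one derivative smoother than V u, so regularity climbs until it
  -- meets that of the data and of V.
  have boot : ∀ j ≤ n + 1, ContDiff ℝ j u := by
    intro j
    induction j with
    | zero => intro _; exact contDiff_zero.2 huc
    | succ j ih =>
      intro hj
      have := (duhamel_spec (n := j) ((contDiff_le hV (by omega)).mul (ih (by omega)))).1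
      rw [hu']
      exact ((contDiff_le d1 hj).add (contDiff_le s1 hj)).sub this
  have hVu : ContDiff ℝ n (fun q => V q * u q) := hV.mul (boot n (by omega))
  obtain ⟨w1, w2, -⟩ := duhamel_spec hVu
  have hpd : ∀ v, pd v u = fun p => pd v (dalembert f g) p + pd v (duhamel G) p
      - pd v (duhamel (fun q => V q * u q)) p := fun v => by
    conv_lhs => rw [hu']
    rw [pd_sub v ((differentiable_of_succ d1).fun_add (differentiable_of_succ s1))
      (differentiable_of_succ w1), pd_add v (differentiable_of_succ d1) (differentiable_of_succ s1)]
  refine ⟨u, boot _ le_rfl, fun x => ?_, fun x => ?_, fun p => ?_⟩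
  · rw [hu, dalembert_zero, duhamel_zero_time, duhamel_zero_time]; simp
  · rw [hpd, d2, s2, w2]
    simp [trav, charPlus, charMinus, prim]
  · obtain ⟨n, rfl⟩ : ∃ k, n = k + 1 := ⟨n - 1, by omega⟩
    have hpd2 : ∀ v, pd v (pd v u) = fun p => pd v (pd v (dalembert f g)) p
        + pd v (pd v (duhamel G)) p - pd v (pd v (duhamel (fun q => V q * u q))) p := fun v => by
      have a1 := differentiable_of_succ (contDiff_pd d1 v)
      have a2 := differentiable_of_succ (contDiff_pd s1 v)
      have a3 := differentiable_of_succ (contDiff_pd w1 v)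
      rw [hpd, pd_sub v (a1.fun_add a2) a3, pd_add v a1 a2]
    have hone : ∀ {h : ℝ × ℝ → ℝ}, ContDiff ℝ (n + 1 : ℕ) h → ContDiff ℝ 1 h := fun hh => by
      simpa using contDiff_le (m := 1) hh (by omega)
    have b1 := dalembert_wave (f := f) (g := g) (hf.of_le (by norm_cast; omega))
      (hg.of_le (by norm_cast)) p
    have b2 := duhamel_wave (hone hG) p
    have b3 := duhamel_wave (hone hVu) p
    rw [hpd2, hpd2]
    linarith

end

/-! ### A priori bound on backward characteristic triangles -/

noncomputable section

/-- Comparison with the explicit primitive d s + (a/l) e^{ls}. Differentiability is asked only in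
the open interval, because for functions on the half-plane the two-sided time derivative exists only
for t > 0. -/
theorem abs_le_of_deriv_exp_bound {g g' : ℝ → ℝ} {s₀ a l d : ℝ} (hs : 0 ≤ s₀) (hl : 0 < l)
    (ha : 0 ≤ a) (hc : ContinuousOn g (Set.Icc 0 s₀))
    (hd : ∀ s ∈ Set.Ioo 0 s₀, HasDerivAt g (g' s) s)
    (hb : ∀ s ∈ Set.Ioo 0 s₀, |g' s| ≤ a * Real.exp (l * s) + d) (h0 : |g 0| ≤ d) :
    |g s₀| ≤ d + d * s₀ + a / l * Real.exp (l * s₀) := by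
  have hB : ∀ s, HasDerivAt (fun s => d * s + a / l * Real.exp (l * s))
      (a * Real.exp (l * s) + d) s := fun s => by
    have := ((hasDerivAt_id s).const_mul d).add
      ((((hasDerivAt_id s).const_mul l).exp).const_mul (a / l))
    refine this.congr_deriv ?_
    simp only [id]; field_simp; ring
  have key : ∀ k k' : ℝ → ℝ, ContinuousOn k (Set.Icc 0 s₀) →
      (∀ s ∈ Set.Ioo 0 s₀, HasDerivAt k (k' s) s) →
      (∀ s ∈ Set.Ioo 0 s₀, k' s ≤ a * Real.exp (l * s) + d) →
      k s₀ ≤ k 0 + d * s₀ + a / l * Real.exp (l * s₀) := by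
    intro k k' hkc hkd hkb
    have hm : MonotoneOn (fun s => d * s + a / l * Real.exp (l * s) - k s) (Set.Icc 0 s₀) := by
      refine monotoneOn_of_hasDerivWithinAt_nonneg (convex_Icc 0 s₀)
        (f' := fun s => a * Real.exp (l * s) + d - k' s) ?_ ?_ ?_
      · exact ContinuousOn.sub (by fun_prop) hkc
      · intro s hs'
        rw [interior_Icc] at hs' ⊢
        exact ((hB s).sub (hkd s hs')).hasDerivWithinAt
      · intro s hs'
        rw [interior_Icc] at hs'
        have := hkb s hs'
        linarith
    have := hm (Set.left_mem_Icc.2 hs) (Set.right_mem_Icc.2 hs) hs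
    simp only [mul_zero, Real.exp_zero] at this
    have : 0 ≤ a / l := by positivity
    linarith
  have k1 := key g g' hc hd fun s hs' => (le_abs_self _).trans (hb s hs')
  have k2 := key (fun s => - g s) (fun s => - g' s) hc.neg (fun s hs' => (hd s hs').neg)
    fun s hs' => (neg_le_abs _).trans (hb s hs')
  have := abs_le.1 h0
  rw [abs_le]
  constructor <;> linarith

/-- The backward characteristic triangle below the point `(T, x₀)`. -/
def triangle (T x₀ : ℝ) : Set (ℝ × ℝ) := {q | 0 ≤ q.1 ∧ |q.2 - x₀| ≤ T - q.1}

theorem isCompact_triangle (T x₀ : ℝ) : IsCompact (triangle T x₀) := by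
  refine (isCompact_Icc.prod isCompact_Icc : IsCompact (Set.Icc (0 : ℝ) T ×ˢ
    Set.Icc (x₀ - T) (x₀ + T))).of_isClosed_subset ?_ ?_
  · exact (isClosed_le continuous_const continuous_fst).inter
      (isClosed_le (f := fun q : ℝ × ℝ => |q.2 - x₀|) (g := fun q => T - q.1) (by fun_prop)
        (by fun_prop))
  · rintro ⟨s, y⟩ ⟨h1, h2⟩
    simp only at h1 h2
    have h3 := abs_le.1 h2
    have := abs_nonneg (y - x₀)
    exact ⟨⟨h1, by simp only; linarith⟩, ⟨by simp only; linarith, by simp only; linarith⟩⟩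

/-- Gronwall in the form of a maximum: let M be the maximum of e^{-lt}(|f| + |p| + |m|) over the
compact triangle and integrate up to the maximising point, vertically for f and along the two
characteristics for p and m. These paths stay in the triangle, and their integral terms contribute
only M/2, which is absorbed. -/
theorem triangle_estimate {T x₀ A d : ℝ} (hA : 0 ≤ A) (hd : 0 ≤ d) {f p m h : ℝ × ℝ → ℝ}
    (hf : ContinuousOn f (triangle T x₀)) (hp : ContinuousOn p (triangle T x₀))
    (hm : ContinuousOn m (triangle T x₀))
    (df : ∀ s y, 0 < s → HasDerivAt (fun r => f (r, y)) ((p (s, y) + m (s, y)) / 2) s)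
    (dp : ∀ s c, 0 < s → HasDerivAt (fun r => p (r, c - r)) (h (s, c - s)) s)
    (dm : ∀ s c, 0 < s → HasDerivAt (fun r => m (r, c + r)) (h (s, c + s)) s)
    (hb : ∀ q ∈ triangle T x₀, |h q| ≤ A * (|f q| + |p q| + |m q|) + d)
    (h0 : ∀ x, |x - x₀| ≤ T → |f (0, x)| ≤ d ∧ |p (0, x)| ≤ d ∧ |m (0, x)| ≤ d) :
    ∀ q ∈ triangle T x₀, |f q| + |p q| + |m q|
      ≤ 2 * (3 + 3 * T) * d * Real.exp (2 * (1 + 2 * A) * T) := by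
  intro q₁ hq₁
  -- The vertical integration costs M/l and each characteristic one A M/l; with this l the total is
  -- exactly M/2.
  set l : ℝ := 2 * (1 + 2 * A)
  have hl : 0 < l := by positivity
  have hT : 0 ≤ T := by linarith [abs_nonneg (q₁.2 - x₀), hq₁.1, hq₁.2]
  obtain ⟨⟨s₀, y₀⟩, hq₀, hmax⟩ := (isCompact_triangle T x₀).exists_isMaxOn ⟨q₁, hq₁⟩
    (f := fun q => Real.exp (-(l * q.1)) * (|f q| + |p q| + |m q|))
    ((by fun_prop : Continuous fun q : ℝ × ℝ => Real.exp (-(l * q.1))).continuousOn.mul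
      ((hf.abs.add hp.abs).add hm.abs))
  set M := Real.exp (-(l * s₀)) * (|f (s₀, y₀)| + |p (s₀, y₀)| + |m (s₀, y₀)|) with hM
  have hM0 : 0 ≤ M := by positivity
  have hexp : ∀ t : ℝ, Real.exp (l * t) * Real.exp (-(l * t)) = 1 := fun t => by
    rw [← Real.exp_add]; simp
  have hbd : ∀ q ∈ triangle T x₀, |f q| + |p q| + |m q| ≤ M * Real.exp (l * q.1) := by
    intro q hq
    have := hmax hq
    simp only [Set.mem_ofPred_eq] at this
    calc |f q| + |p q| + |m q| = Real.exp (l * q.1) * (Real.exp (-(l * q.1)) * (|f q| + |p q| + |m q|)) := by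
          rw [← mul_assoc, hexp, one_mul]
      _ ≤ Real.exp (l * q.1) * M := by gcongr
      _ = _ := mul_comm _ _
  obtain ⟨hs0, hy0⟩ := hq₀
  simp only at hs0 hy0
  have hy := abs_le.1 hy0
  have mem : ∀ s ∈ Set.Icc 0 s₀, ∀ y, |y - y₀| ≤ s₀ - s → (s, y) ∈ triangle T x₀ := by
    intro s hs y hy'
    refine ⟨hs.1, ?_⟩
    have := abs_sub_le y y₀ x₀
    simp only
    linarith
  have hh : ∀ s ∈ Set.Ioo 0 s₀, ∀ y, |y - y₀| ≤ s₀ - s →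
      |h (s, y)| ≤ A * M * Real.exp (l * s) + d := by
    intro s hs y hy'
    have hK := mem s ⟨hs.1.le, hs.2.le⟩ y hy'
    have h1 := hb _ hK
    have h2 := mul_le_mul_of_nonneg_left (hbd _ hK) hA
    simp only at h2
    linarith
  have a1 : ∀ s ∈ Set.Icc 0 s₀, |y₀ + s₀ - s - y₀| ≤ s₀ - s := fun s hs => by
    rw [show y₀ + s₀ - s - y₀ = s₀ - s by ring, abs_of_nonneg (by linarith [hs.2])]
  have a2 : ∀ s ∈ Set.Icc 0 s₀, |y₀ - s₀ + s - y₀| ≤ s₀ - s := fun s hs => by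
    rw [show y₀ - s₀ + s - y₀ = -(s₀ - s) by ring, abs_neg, abs_of_nonneg (by linarith [hs.2])]
  have a3 : ∀ s ∈ Set.Icc 0 s₀, |y₀ - y₀| ≤ s₀ - s := fun s hs => by
    simpa using hs.2
  have i0 : (0 : ℝ) ∈ Set.Icc 0 s₀ := ⟨le_rfl, hs0⟩
  have hI : ∀ {s}, s ∈ Set.Ioo 0 s₀ → s ∈ Set.Icc 0 s₀ := fun hs => ⟨hs.1.le, hs.2.le⟩
  have hin : ∀ y, |y - y₀| ≤ s₀ - 0 → |y - x₀| ≤ T := fun y hy => by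
    simpa using (mem 0 i0 y hy).2
  have bp : |p (s₀, y₀)| ≤ d + d * s₀ + A * M / l * Real.exp (l * s₀) := by
    have := abs_le_of_deriv_exp_bound (g := fun s => p (s, y₀ + s₀ - s))
      (g' := fun s => h (s, y₀ + s₀ - s)) (d := d) hs0 hl (by positivity : 0 ≤ A * M)
      (hp.comp (by fun_prop) fun s hs => mem s hs _ (a1 s hs))
      (fun s hs => dp s _ hs.1) (fun s hs => hh s hs _ (a1 s (hI hs)))
      (h0 _ (hin _ (a1 0 i0))).2.1
    simpa using this
  have bm : |m (s₀, y₀)| ≤ d + d * s₀ + A * M / l * Real.exp (l * s₀) := by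
    have := abs_le_of_deriv_exp_bound (g := fun s => m (s, y₀ - s₀ + s))
      (g' := fun s => h (s, y₀ - s₀ + s)) (d := d) hs0 hl (by positivity : 0 ≤ A * M)
      (hm.comp (by fun_prop) fun s hs => mem s hs _ (a2 s hs))
      (fun s hs => dm s _ hs.1) (fun s hs => hh s hs _ (a2 s (hI hs)))
      (h0 _ (hin _ (a2 0 i0))).2.2
    simpa using this
  have bf : |f (s₀, y₀)| ≤ d + d * s₀ + M / l * Real.exp (l * s₀) := by
    refine abs_le_of_deriv_exp_bound (g := fun s => f (s, y₀)) (d := d) hs0 hl hM0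
      (hf.comp (by fun_prop) fun s hs => mem s hs _ (a3 s hs))
      (fun s hs => df s _ hs.1) (fun s hs => ?_) (h0 _ (hin _ (a3 0 i0))).1
    have h1 := hbd _ (mem s (hI hs) y₀ (a3 s (hI hs)))
    simp only at h1
    rw [abs_div, abs_two]
    have := abs_add_le (p (s, y₀)) (m (s, y₀))
    have := abs_nonneg (f (s, y₀))
    have := abs_nonneg (p (s, y₀))
    have := abs_nonneg (m (s, y₀))
    linarith
  have hs0T : s₀ ≤ T := by linarith [abs_nonneg (y₀ - x₀)]
  have hMle : M ≤ 2 * (3 + 3 * T) * d := by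
    have h1 : |f (s₀, y₀)| + |p (s₀, y₀)| + |m (s₀, y₀)|
        ≤ (3 + 3 * T) * d + M / 2 * Real.exp (l * s₀) := by
      have : A * M / l + A * M / l + M / l = M / 2 := by
        simp only [l]; field_simp; ring
      have h2 : d * s₀ ≤ d * T := by gcongr
      calc _ ≤ 3 * d + 3 * (d * s₀) + (A * M / l + A * M / l + M / l) * Real.exp (l * s₀) := by
            linarith
        _ ≤ _ := by rw [this]; linarith
    have h2 : M ≤ Real.exp (-(l * s₀)) * ((3 + 3 * T) * d + M / 2 * Real.exp (l * s₀)) := by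
      rw [hM]; gcongr
    have h3 : Real.exp (-(l * s₀)) ≤ 1 := Real.exp_le_one_iff.2 (by
      have := mul_nonneg hl.le hs0
      linarith)
    have h4 : 0 ≤ (3 + 3 * T) * d := by positivity
    nlinarith [hexp s₀]
  have hq1T : q₁.1 ≤ T := by linarith [abs_nonneg (q₁.2 - x₀), hq₁.2]
  calc _ ≤ M * Real.exp (l * q₁.1) := hbd _ hq₁
    _ ≤ _ := by gcongr

end

/-! ### One-sided derivatives on the closed half-plane -/

noncomputable section

variable {F : ℝ → ℝ → ℝ}

theorem uniqueDiffOn_future : UniqueDiffOn ℝ (Set.Ici (0 : ℝ) ×ˢ (Set.univ : Set ℝ)) :=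
  (uniqueDiffOn_Ici 0).prod uniqueDiffOn_univ

theorem hasDerivWithinAt_dt (hF : SmoothOnFuture 1 F) {t : ℝ} (ht : 0 ≤ t) (x : ℝ) :
    HasDerivWithinAt (fun s => F s x) (fderivWithin ℝ (fun p : ℝ × ℝ => F p.1 p.2)
      (Set.Ici 0 ×ˢ Set.univ) (t, x) et) (Set.Ici 0) t := by
  have h := ((hF.differentiableOn (by norm_num)) (t, x) ⟨ht, trivial⟩).hasFDerivWithinAt
  exact h.comp_hasDerivWithinAt (f := fun s : ℝ => (s, x)) t
    ((hasDerivAt_id t).prodMk (hasDerivAt_const t x)).hasDerivWithinAt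
    fun s hs => ⟨hs, trivial⟩

theorem hasDerivAt_dx' (hF : SmoothOnFuture 1 F) {t : ℝ} (ht : 0 ≤ t) (x : ℝ) :
    HasDerivAt (fun y => F t y) (fderivWithin ℝ (fun p : ℝ × ℝ => F p.1 p.2)
      (Set.Ici 0 ×ˢ Set.univ) (t, x) ex) x := by
  have h := ((hF.differentiableOn (by norm_num)) (t, x) ⟨ht, trivial⟩).hasFDerivWithinAt
  rw [← hasDerivWithinAt_univ]
  exact h.comp_hasDerivWithinAt (f := fun y : ℝ => (t, y)) x
    ((hasDerivAt_const x t).prodMk (hasDerivAt_id x)).hasDerivWithinAt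
    fun s _ => ⟨ht, trivial⟩

/-- The half-plane is a set of unique differentiability up to its boundary, so the one-sided `dt` is
a component of the derivative within it. Continuity of `dt F` up to t = 0 follows from this. -/
theorem dt_eq_fderivWithin (hF : SmoothOnFuture 1 F) {t : ℝ} (ht : 0 ≤ t) (x : ℝ) :
    dt F t x = fderivWithin ℝ (fun p : ℝ × ℝ => F p.1 p.2) (Set.Ici 0 ×ˢ Set.univ) (t, x) et :=
  (hasDerivWithinAt_dt hF ht x).derivWithin (uniqueDiffOn_Ici 0 t ht)

theorem dx_eq_fderivWithin (hF : SmoothOnFuture 1 F) {t : ℝ} (ht : 0 ≤ t) (x : ℝ) :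
    dx F t x = fderivWithin ℝ (fun p : ℝ × ℝ => F p.1 p.2) (Set.Ici 0 ×ˢ Set.univ) (t, x) ex :=
  (hasDerivAt_dx' hF ht x).deriv

theorem hasDerivAt_dx (hF : SmoothOnFuture 1 F) {t : ℝ} (ht : 0 ≤ t) (x : ℝ) :
    HasDerivAt (fun y => F t y) (dx F t x) x := by
  rw [dx_eq_fderivWithin hF ht]; exact hasDerivAt_dx' hF ht x

theorem hasDerivAt_dt (hF : SmoothOnFuture 1 F) {t : ℝ} (ht : 0 < t) (x : ℝ) :
    HasDerivAt (fun s => F s x) (dt F t x) t := by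
  rw [dt_eq_fderivWithin hF ht.le]
  exact (hasDerivWithinAt_dt hF ht.le x).hasDerivAt (Ici_mem_nhds ht)

theorem continuousOn_dt (hF : SmoothOnFuture 1 F) :
    ContinuousOn (fun q : ℝ × ℝ => dt F q.1 q.2) (Set.Ici 0 ×ˢ Set.univ) :=
  ((hF.continuousOn_fderivWithin uniqueDiffOn_future (by norm_num)).clm_apply
    (continuousOn_const (c := et))).congr fun q hq => dt_eq_fderivWithin hF hq.1 q.2

theorem continuousOn_dx (hF : SmoothOnFuture 1 F) :
    ContinuousOn (fun q : ℝ × ℝ => dx F q.1 q.2) (Set.Ici 0 ×ˢ Set.univ) :=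
  ((hF.continuousOn_fderivWithin uniqueDiffOn_future (by norm_num)).clm_apply
    (continuousOn_const (c := ex))).congr fun q hq => dx_eq_fderivWithin hF hq.1 q.2

theorem SmoothOnFuture.of_le {m n : ℕ} (hF : SmoothOnFuture n F) (h : m ≤ n) :
    SmoothOnFuture m F := ContDiffOn.of_le hF (by exact_mod_cast h)

theorem future_mem_nhds {t : ℝ} (ht : 0 < t) (x : ℝ) :
    Set.Ici (0 : ℝ) ×ˢ (Set.univ : Set ℝ) ∈ 𝓝 (t, x) :=
  prod_mem_nhds (Ici_mem_nhds ht) univ_mem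

theorem eventually_pos_time {t : ℝ} (ht : 0 < t) (x : ℝ) : ∀ᶠ q : ℝ × ℝ in 𝓝 (t, x), 0 < q.1 :=
  (isOpen_lt continuous_const continuous_fst).mem_nhds ht

theorem dt_eventuallyEq (hF : SmoothOnFuture 1 F) {t : ℝ} (ht : 0 < t) (x : ℝ) :
    (fun q : ℝ × ℝ => dt F q.1 q.2) =ᶠ[𝓝 (t, x)] pd et (fun p => F p.1 p.2) := by
  filter_upwards [eventually_pos_time ht x] with q hq
  rw [dt_eq_fderivWithin hF hq.le, pd, fderivWithin_of_mem_nhds (future_mem_nhds hq _)]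

theorem dx_eventuallyEq (hF : SmoothOnFuture 1 F) {t : ℝ} (ht : 0 < t) (x : ℝ) :
    (fun q : ℝ × ℝ => dx F q.1 q.2) =ᶠ[𝓝 (t, x)] pd ex (fun p => F p.1 p.2) := by
  filter_upwards [eventually_pos_time ht x] with q hq
  rw [dx_eq_fderivWithin hF hq.le, pd, fderivWithin_of_mem_nhds (future_mem_nhds hq _)]

theorem dt_dt_eq (hF : SmoothOnFuture 2 F) {t : ℝ} (ht : 0 < t) (x : ℝ) :
    dt (dt F) t x = pd et (pd et (fun p => F p.1 p.2)) (t, x) := by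
  have hc : ContDiffAt ℝ 2 (fun p : ℝ × ℝ => F p.1 p.2) (t, x) :=
    hF.contDiffAt (future_mem_nhds ht x)
  have h1 := dt_eventuallyEq (hF.of_le one_le_two) ht x
  have h2 := hasDerivAt_pt ((differentiableAt_pd hc et).congr_of_eventuallyEq h1)
  rw [show pd et (fun q : ℝ × ℝ => dt F q.1 q.2) (t, x)
    = pd et (pd et (fun p => F p.1 p.2)) (t, x) by simp only [pd]; rw [h1.fderiv_eq]] at h2
  exact h2.hasDerivWithinAt.derivWithin (uniqueDiffOn_Ici 0 t ht.le)

theorem dx_dx_eq (hF : SmoothOnFuture 2 F) {t : ℝ} (ht : 0 < t) (x : ℝ) :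
    dx (dx F) t x = pd ex (pd ex (fun p => F p.1 p.2)) (t, x) := by
  have hc : ContDiffAt ℝ 2 (fun p : ℝ × ℝ => F p.1 p.2) (t, x) :=
    hF.contDiffAt (future_mem_nhds ht x)
  have h1 := dx_eventuallyEq (hF.of_le one_le_two) ht x
  have h2 := hasDerivAt_px ((differentiableAt_pd hc ex).congr_of_eventuallyEq h1)
  rw [show pd ex (fun q : ℝ × ℝ => dx F q.1 q.2) (t, x)
    = pd ex (pd ex (fun p => F p.1 p.2)) (t, x) by simp only [pd]; rw [h1.fderiv_eq]] at h2
  exact h2.deriv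

/-- The factorisation (∂_t - e ∂_x)(∂_t + e ∂_x) = ∂_t² - ∂_x² for e = ±1, read along the line x = c
- e t; the mixed terms cancel by symmetry of second derivatives. -/
theorem hasDerivAt_char (hF : SmoothOnFuture 2 F) {e : ℝ} (he : e * e = 1) {s : ℝ} (hs : 0 < s)
    (c : ℝ) :
    HasDerivAt (fun r => dt F r (c - e * r) + e * dx F r (c - e * r))
      (dt (dt F) s (c - e * s) - dx (dx F) s (c - e * s)) s := by
  have hc : ContDiffAt ℝ 2 (fun p : ℝ × ℝ => F p.1 p.2) (s, c - e * s) :=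
    hF.contDiffAt (future_mem_nhds hs _)
  have d1 := differentiableAt_pd hc et
  have d2 := differentiableAt_pd hc ex
  have h1 := dt_eventuallyEq (hF.of_le one_le_two) hs (c - e * s)
  have h2 := dx_eventuallyEq (hF.of_le one_le_two) hs (c - e * s)
  have hg : HasDerivAt (fun r : ℝ => (r, c - e * r)) (1, -e) s := by
    have := (hasDerivAt_id s).prodMk (((hasDerivAt_id s).const_mul e).const_sub c)
    simpa using this
  have D1 := hasDerivAt_comp_pd (g := fun r : ℝ => (r, c - e * r)) d1 hg
  have D2 := hasDerivAt_comp_pd (g := fun r : ℝ => (r, c - e * r)) d2 hg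
  have D := D1.fun_add (D2.const_mul e)
  have hev := hg.continuousAt.eventually (h1.and h2)
  have ev : (1, -e) = et - e • ex := by simp
  have e1 : ∀ g : ℝ × ℝ → ℝ, pd (1, -e) g (s, c - e * s)
      = pd et g (s, c - e * s) - e * pd ex g (s, c - e * s) := fun g => by
    simp only [pd]; rw [ev, map_sub, map_smul]; rfl
  rw [e1, e1, pd_comm_at hc et ex] at D
  refine (D.congr_of_eventuallyEq ?_).congr_deriv ?_
  · filter_upwards [hev] with r hr
    rw [← hr.1, ← hr.2]
  · rw [dt_dt_eq hF hs, dx_dx_eq hF hs]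
    linear_combination -pd ex (pd ex fun p => F p.1 p.2) (s, c - e * s) * he

/-- The amplification factor in the estimate on backward characteristic triangles. -/
def triConst (A T : ℝ) : ℝ := 2 * (3 + 3 * T) * 2 * Real.exp (2 * (1 + 2 * A) * T)

theorem future_triangle (hF : SmoothOnFuture 2 F) {T x₀ A d : ℝ} (hA : 0 ≤ A) (hd : 0 ≤ d)
    (hb : ∀ q ∈ triangle T x₀, |dt (dt F) q.1 q.2 - dx (dx F) q.1 q.2|
      ≤ A * (|F q.1 q.2| + |dt F q.1 q.2| + |dx F q.1 q.2|) + d)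
    (h0 : ∀ x, |x - x₀| ≤ T → |F 0 x| ≤ d ∧ |dt F 0 x| ≤ d ∧ |dx F 0 x| ≤ d) :
    ∀ q ∈ triangle T x₀, |F q.1 q.2| + |dt F q.1 q.2| + |dx F q.1 q.2| ≤ triConst A T * d := by
  intro q hq
  have hF1 := hF.of_le one_le_two
  have hsub : triangle T x₀ ⊆ Set.Ici 0 ×ˢ Set.univ := fun q hq => ⟨hq.1, trivial⟩
  have c0 : ContinuousOn (fun q : ℝ × ℝ => F q.1 q.2) (triangle T x₀) := hF.continuousOn.mono hsub
  have c1 := (continuousOn_dt hF1).mono hsub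
  have c2 := (continuousOn_dx hF1).mono hsub
  -- Returns from the characteristic derivatives ∂_t F ± ∂_x F to ∂_t F and ∂_x F. In the other
  -- direction data of size d become data of size 2d, which is the second factor 2 in `triConst`.
  have pm : ∀ a b : ℝ, |a| + |b| ≤ |a + b| + |a - b| := fun a b => by
    have h1 := abs_add_le (a + b) (a - b)
    have h2 := abs_sub (a + b) (a - b)
    rw [show a + b + (a - b) = 2 * a by ring, abs_mul, abs_two] at h1
    rw [show a + b - (a - b) = 2 * b by ring, abs_mul, abs_two] at h2
    linarith
  have := triangle_estimate (T := T) (x₀ := x₀) (A := A) (d := 2 * d) hA (by linarith)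
    (f := fun q => F q.1 q.2)
    (p := fun q => dt F q.1 q.2 + dx F q.1 q.2) (m := fun q => dt F q.1 q.2 - dx F q.1 q.2)
    (h := fun q => dt (dt F) q.1 q.2 - dx (dx F) q.1 q.2)
    c0 (c1.add c2) (c1.sub c2)
    (fun s y hs => (hasDerivAt_dt hF1 hs y).congr_deriv (by ring))
    (fun s c hs => by
      simpa using hasDerivAt_char hF (e := 1) (by norm_num) hs c)
    (fun s c hs => by
      simpa [sub_eq_add_neg] using hasDerivAt_char hF (e := -1) (by norm_num) hs c)
    (fun q hq => (hb q hq).trans (add_le_add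
      (mul_le_mul_of_nonneg_left (by have := pm (dt F q.1 q.2) (dx F q.1 q.2); linarith) hA)
      (by linarith)))
    (fun x hx => by
      obtain ⟨h1, h2, h3⟩ := h0 x hx
      have h4 := abs_add_le (dt F 0 x) (dx F 0 x)
      have h5 := abs_sub (dt F 0 x) (dx F 0 x)
      exact ⟨by simp only; linarith, by simp only; linarith, by simp only; linarith⟩)
    q hq
  have h6 := pm (dt F q.1 q.2) (dx F q.1 q.2)
  rw [triConst]
  linarith

/-- Uniqueness for scalar wave equations with zero data. -/
theorem future_eq_zero (hF : SmoothOnFuture 2 F) {a : ℝ × ℝ → ℝ}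
    (ha : ContinuousOn a (Set.Ici 0 ×ˢ Set.univ))
    (hb : ∀ t x, 0 ≤ t → |dt (dt F) t x - dx (dx F) t x|
      ≤ a (t, x) * (|F t x| + |dt F t x| + |dx F t x|))
    (h0 : ∀ x, F 0 x = 0) (h1 : ∀ x, dt F 0 x = 0) : ∀ t x, 0 ≤ t → F t x = 0 := by
  intro t x ht
  have hsub : triangle t x ⊆ Set.Ici 0 ×ˢ Set.univ := fun q hq => ⟨hq.1, trivial⟩
  -- Only a local bound is needed: the coefficient is continuous and the triangle below the given
  -- point is compact. The conclusion then comes from taking d = 0.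
  obtain ⟨A, hA⟩ := (isCompact_triangle t x).exists_bound_of_continuousOn (ha.mono hsub)
  have h2 : ∀ x, dx F 0 x = 0 := fun x => by
    rw [dx, show (fun y => F 0 y) = fun _ => 0 from funext h0]; simp
  have := future_triangle hF (T := t) (x₀ := x) (A := |A|) (d := 0) (abs_nonneg _) le_rfl
    (fun q hq => by
      rw [add_zero]
      refine (hb q.1 q.2 hq.1).trans (mul_le_mul_of_nonneg_right ?_ (by positivity))
      exact (le_abs_self _).trans ((hA q hq).trans (le_abs_self _)))
    (fun y _ => by simp [h0, h1, h2]) (t, x) ⟨ht, by simp⟩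
  rw [mul_zero] at this
  have h3 := abs_nonneg (dt F t x)
  have h4 := abs_nonneg (dx F t x)
  exact abs_nonpos_iff.1 (by simp only at this; linarith)

end

/-! ### Uniqueness and persistence of polarization -/

noncomputable section

variable {F G : ℝ → ℝ → ℝ}

theorem SmoothOnFuture.dt {n : ℕ} (hF : SmoothOnFuture (n + 1) F) : SmoothOnFuture n (dt F) :=
  ((ContDiffOn.fderivWithin hF uniqueDiffOn_future (by norm_cast)).clm_apply
    (contDiffOn_const (c := et))).congr fun q hq => dt_eq_fderivWithin (hF.of_le (by omega)) hq.1 q.2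

theorem SmoothOnFuture.dx {n : ℕ} (hF : SmoothOnFuture (n + 1) F) : SmoothOnFuture n (dx F) :=
  ((ContDiffOn.fderivWithin hF uniqueDiffOn_future (by norm_cast)).clm_apply
    (contDiffOn_const (c := ex))).congr fun q hq => dx_eq_fderivWithin (hF.of_le (by omega)) hq.1 q.2

theorem SmoothOnFuture.sub {n : ℕ} (hF : SmoothOnFuture n F) (hG : SmoothOnFuture n G) :
    SmoothOnFuture n (fun t x => F t x - G t x) := ContDiffOn.sub hF hG

theorem dt_congr (h : ∀ t x, 0 ≤ t → F t x = G t x) {t : ℝ} (ht : 0 ≤ t) (x : ℝ) :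
    dt F t x = dt G t x :=
  derivWithin_congr (fun s hs => h s x hs) (h t x ht)

theorem dx_congr (h : ∀ t x, 0 ≤ t → F t x = G t x) {t : ℝ} (ht : 0 ≤ t) (x : ℝ) :
    dx F t x = dx G t x := by
  rw [dx, dx, show (fun y => F t y) = fun y => G t y from funext fun y => h t y ht]

theorem dt_sub (hF : SmoothOnFuture 1 F) (hG : SmoothOnFuture 1 G) {t : ℝ} (ht : 0 ≤ t) (x : ℝ) :
    dt (fun t x => F t x - G t x) t x = dt F t x - dt G t x :=
  derivWithin_fun_sub (hasDerivWithinAt_dt hF ht x).differentiableWithinAt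
    (hasDerivWithinAt_dt hG ht x).differentiableWithinAt

theorem dx_sub (hF : SmoothOnFuture 1 F) (hG : SmoothOnFuture 1 G) {t : ℝ} (ht : 0 ≤ t) (x : ℝ) :
    dx (fun t x => F t x - G t x) t x = dx F t x - dx G t x :=
  ((hasDerivAt_dx hF ht x).sub (hasDerivAt_dx hG ht x)).deriv

theorem dt_dt_sub (hF : SmoothOnFuture 2 F) (hG : SmoothOnFuture 2 G) {t : ℝ} (ht : 0 ≤ t)
    (x : ℝ) : dt (dt (fun t x => F t x - G t x)) t x = dt (dt F) t x - dt (dt G) t x := by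
  rw [dt_congr (fun t x ht => dt_sub (hF.of_le one_le_two) (hG.of_le one_le_two) ht x) ht x]
  exact dt_sub (SmoothOnFuture.dt (n := 1) hF) (SmoothOnFuture.dt (n := 1) hG) ht x

theorem dx_dx_sub (hF : SmoothOnFuture 2 F) (hG : SmoothOnFuture 2 G) {t : ℝ} (ht : 0 ≤ t)
    (x : ℝ) : dx (dx (fun t x => F t x - G t x)) t x = dx (dx F) t x - dx (dx G) t x := by
  rw [dx_congr (fun t x ht => dx_sub (hF.of_le one_le_two) (hG.of_le one_le_two) ht x) ht x]
  exact dx_sub (SmoothOnFuture.dx (n := 1) hF) (SmoothOnFuture.dx (n := 1) hG) ht x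

theorem IsSolution.mono {m n : ℕ} {D : InitialData} {R W q : ℝ → ℝ → ℝ}
    (h : IsSolution n D R W q) (hmn : m ≤ n) : IsSolution m D R W q :=
  { h with
    smooth_R := h.smooth_R.of_le hmn
    smooth_W := h.smooth_W.of_le hmn
    smooth_q := h.smooth_q.of_le hmn }

theorem IsSolution.R_unique {D : InitialData} {R W q R' W' q' : ℝ → ℝ → ℝ}
    (h : IsSolution 2 D R W q) (h' : IsSolution 2 D R' W' q') :
    ∀ t x, 0 ≤ t → R' t x = R t x := by
  intro t x ht
  have := future_eq_zero (h'.smooth_R.sub h.smooth_R) (a := fun _ => 0) continuousOn_const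
    (fun t x ht => by
      rw [dt_dt_sub h'.smooth_R h.smooth_R ht, dx_dx_sub h'.smooth_R h.smooth_R ht, zero_mul,
        abs_nonpos_iff]
      linarith [h.eq_R t x ht, h'.eq_R t x ht])
    (fun x => by rw [h'.init_R, h.init_R, sub_self])
    (fun x => by
      rw [dt_sub (h'.smooth_R.of_le one_le_two) (h.smooth_R.of_le one_le_two) le_rfl,
        h'.init_Rt, h.init_Rt, sub_self]) t x ht
  linarith

theorem continuousOn_dt_div {R : ℝ → ℝ → ℝ} (hR : SmoothOnFuture 1 R)
    (h0 : ∀ t x, 0 ≤ t → R t x ≠ 0) :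
    ContinuousOn (fun q : ℝ × ℝ => |dt R q.1 q.2 / R q.1 q.2| + |dx R q.1 q.2 / R q.1 q.2|)
      (Set.Ici 0 ×ˢ Set.univ) := by
  have hc : ContinuousOn (fun q : ℝ × ℝ => R q.1 q.2) (Set.Ici 0 ×ˢ Set.univ) := hR.continuousOn
  exact (((continuousOn_dt hR).div hc fun q hq => h0 _ _ hq.1).abs).add
    (((continuousOn_dx hR).div hc fun q hq => h0 _ _ hq.1).abs)

/-- For fixed R and W the equation is linear and homogeneous in the first derivatives of q, with
coefficients continuous on the closed half-plane, so zero data stay zero. -/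
theorem IsSolution.q_eq_zero {D : InitialData} {R W q : ℝ → ℝ → ℝ} (h : IsSolution 2 D R W q)
    (hq : ∀ x, D.q x = 0) (hqt : ∀ x, D.qt x = 0) : ∀ t x, 0 ≤ t → q t x = 0 := by
  have hW1 := h.smooth_W.of_le one_le_two
  refine future_eq_zero h.smooth_q
    (((continuousOn_dt_div (h.smooth_R.of_le one_le_two) h.R_ne_zero)).add
      ((continuousOn_const (c := (4 : ℝ))).mul
        ((continuousOn_dt hW1).abs.add (continuousOn_dx hW1).abs))) (fun t x ht => ?_)
    (fun x => by rw [h.init_q, hq]) (fun x => by rw [h.init_qt, hqt])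
  have e := h.eq_q t x ht
  set α := dt R t x / R t x
  set η := dx R t x / R t x
  have : dt (dt q) t x - dx (dx q) t x = (-α * dt q t x + η * dx q t x)
      + (4 * dt W t x * dt q t x - 4 * dx W t x * dx q t x) := by linear_combination e
  rw [this]
  have h1 := abs_add_le (-α * dt q t x + η * dx q t x)
    (4 * dt W t x * dt q t x - 4 * dx W t x * dx q t x)
  have h2 := abs_add_le (-α * dt q t x) (η * dx q t x)
  have h3 := abs_sub (4 * dt W t x * dt q t x) (4 * dx W t x * dx q t x)
  simp only [abs_mul, abs_neg] at h1 h2 h3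
  norm_num at h3
  have a0 := abs_nonneg (q t x)
  have a1 := abs_nonneg (dt q t x)
  have a2 := abs_nonneg (dx q t x)
  have a3 := abs_nonneg (dt W t x)
  have a4 := abs_nonneg (dx W t x)
  have a5 := abs_nonneg α
  have a6 := abs_nonneg η
  change _ ≤ (|α| + |η| + 4 * (|dt W t x| + |dx W t x|)) * (|q t x| + |dt q t x| + |dx q t x|)
  nlinarith [mul_nonneg a5 a0, mul_nonneg a6 a0, mul_nonneg a3 a0, mul_nonneg a4 a0,
    mul_nonneg a5 a2, mul_nonneg a6 a1, mul_nonneg a3 a2, mul_nonneg a4 a1]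

theorem dt_zero_of_zero (h : ∀ t x, 0 ≤ t → F t x = 0) {t : ℝ} (ht : 0 ≤ t) (x : ℝ) :
    dt F t x = 0 := by
  rw [dt_congr (G := fun _ _ => 0) h ht]; simp [dt]

theorem dx_zero_of_zero (h : ∀ t x, 0 ≤ t → F t x = 0) {t : ℝ} (ht : 0 ≤ t) (x : ℝ) :
    dx F t x = 0 := by
  rw [dx_congr (G := fun _ _ => 0) h ht]; simp [dx]

/-- Both q's vanish and both R's agree, so the nonlinear term disappears and the difference of the
W's satisfies a linear homogeneous equation. -/
theorem IsSolution.W_unique {D : InitialData} {R W q R' W' q' : ℝ → ℝ → ℝ}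
    (h : IsSolution 2 D R W q) (h' : IsSolution 2 D R' W' q')
    (hq : ∀ x, D.q x = 0) (hqt : ∀ x, D.qt x = 0) :
    ∀ t x, 0 ≤ t → W' t x = W t x := by
  intro t x ht
  have hR := h.R_unique h'
  have hq0 := h.q_eq_zero hq hqt
  have hq0' := h'.q_eq_zero hq hqt
  have s := h.smooth_W.of_le one_le_two
  have s' := h'.smooth_W.of_le one_le_two
  have := future_eq_zero (h'.smooth_W.sub h.smooth_W)
    (continuousOn_dt_div (h.smooth_R.of_le one_le_two) h.R_ne_zero)
    (fun t x ht => by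
      rw [dt_dt_sub h'.smooth_W h.smooth_W ht, dx_dx_sub h'.smooth_W h.smooth_W ht,
        dt_sub s' s ht, dx_sub s' s ht]
      have e := h.eq_W t x ht
      have e' := h'.eq_W t x ht
      rw [dt_zero_of_zero hq0 ht, dx_zero_of_zero hq0 ht] at e
      rw [dt_zero_of_zero hq0' ht, dx_zero_of_zero hq0' ht, hR t x ht, dt_congr hR ht,
        dx_congr hR ht] at e'
      set α := dt R t x / R t x
      set η := dx R t x / R t x
      have : dt (dt W') t x - dt (dt W) t x - (dx (dx W') t x - dx (dx W) t x)
          = -α * (dt W' t x - dt W t x) + η * (dx W' t x - dx W t x) := by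
        linear_combination e' - e
      rw [this]
      have h2 := abs_add_le (-α * (dt W' t x - dt W t x)) (η * (dx W' t x - dx W t x))
      simp only [abs_mul, abs_neg] at h2
      have a0 := abs_nonneg (W' t x - W t x)
      have a1 := abs_nonneg (dt W' t x - dt W t x)
      have a2 := abs_nonneg (dx W' t x - dx W t x)
      have a5 := abs_nonneg α
      have a6 := abs_nonneg η
      nlinarith [mul_nonneg a5 a0, mul_nonneg a6 a0, mul_nonneg a5 a2, mul_nonneg a6 a1])
    (fun x => by rw [h'.init_W, h.init_W, sub_self])
    (fun x => by rw [dt_sub s' s le_rfl, h'.init_Wt, h.init_Wt, sub_self]) t x ht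
  linarith

end

/-! ### Weighted Sobolev norms of compactly supported functions -/

noncomputable section

/-- `f` is of class `C^k` with compact support. -/
def CompactCk (k : ℕ) (f : ℝ → ℝ) : Prop := ContDiff ℝ k f ∧ HasCompactSupport f

theorem hasCompactSupport_iteratedDeriv {f : ℝ → ℝ} (hf : HasCompactSupport f) (i : ℕ) :
    HasCompactSupport (iteratedDeriv i f) := by
  induction i with
  | zero => simpa using hf
  | succ i ih => rw [iteratedDeriv_succ]; exact ih.deriv

theorem contDiff_iteratedDeriv {f : ℝ → ℝ} {i j k : ℕ} (hf : ContDiff ℝ k f) (h : i + j ≤ k) :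
    ContDiff ℝ j (iteratedDeriv i f) := by
  refine contDiff_nat_iff_iteratedDeriv.2 ⟨fun m hm => ?_, fun m hm => ?_⟩
  · rw [iteratedDeriv_eq_iterate, iteratedDeriv_eq_iterate, ← Function.iterate_add_apply,
      ← iteratedDeriv_eq_iterate]
    exact hf.continuous_iteratedDeriv _ (by norm_cast; omega)
  · rw [iteratedDeriv_eq_iterate, iteratedDeriv_eq_iterate, ← Function.iterate_add_apply,
      ← iteratedDeriv_eq_iterate]
    exact hf.differentiable_iteratedDeriv _ (by norm_cast; omega)

theorem CompactCk.iteratedDeriv {f : ℝ → ℝ} {i j k : ℕ} (hf : CompactCk k f) (h : i + j ≤ k) :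
    CompactCk j (iteratedDeriv i f) :=
  ⟨contDiff_iteratedDeriv hf.1 h, hasCompactSupport_iteratedDeriv hf.2 i⟩

theorem CompactCk.sub {f g : ℝ → ℝ} {k : ℕ} (hf : CompactCk k f) (hg : CompactCk k g) :
    CompactCk k (fun x => f x - g x) := ⟨hf.1.sub hg.1, hf.2.sub hg.2⟩

theorem iteratedDeriv_sub_of_le {f g : ℝ → ℝ} {i k : ℕ} (hf : ContDiff ℝ k f)
    (hg : ContDiff ℝ k g) (h : i ≤ k) : iteratedDeriv i (fun x => f x - g x)
      = fun x => iteratedDeriv i f x - iteratedDeriv i g x := funext fun _ =>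
  iteratedDeriv_sub (hf.of_le (by exact_mod_cast h)).contDiffAt
    (hg.of_le (by exact_mod_cast h)).contDiffAt

theorem iteratedDeriv_add_of_le {f g : ℝ → ℝ} {i k : ℕ} (hf : ContDiff ℝ k f)
    (hg : ContDiff ℝ k g) (h : i ≤ k) : iteratedDeriv i (fun x => f x + g x)
      = fun x => iteratedDeriv i f x + iteratedDeriv i g x := funext fun _ =>
  iteratedDeriv_add (hf.of_le (by exact_mod_cast h)).contDiffAt
    (hg.of_le (by exact_mod_cast h)).contDiffAt

theorem integrable_weight {a b : ℝ → ℝ} (ha : Continuous a) (hb : Continuous b)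
    (hs : HasCompactSupport a) : Integrable fun x => a x * b x * Real.cosh (2 * x) := by
  refine Continuous.integrable_of_hasCompactSupport (by fun_prop) ?_
  have : (fun x => a x * b x * Real.cosh (2 * x)) = fun x => a x * (b x * Real.cosh (2 * x)) := by
    funext x; ring
  rw [this]
  exact hs.mul_right

section Family
variable {I : Finset ℕ} {a b : ℕ → ℝ → ℝ}

/-- The squared norm of a + s b as a quadratic polynomial in s. Nonpositivity of its discriminant is
Cauchy–Schwarz and s = 1 gives the triangle inequality, for all orders of derivatives at once. -/
theorem sum_weight_expand (ha : ∀ i ∈ I, Continuous (a i) ∧ HasCompactSupport (a i))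
    (hb : ∀ i ∈ I, Continuous (b i) ∧ HasCompactSupport (b i)) (s : ℝ) :
    ∑ i ∈ I, ∫ x, (a i x + s * b i x) ^ 2 * Real.cosh (2 * x)
      = (∑ i ∈ I, ∫ x, a i x ^ 2 * Real.cosh (2 * x))
        + 2 * s * (∑ i ∈ I, ∫ x, a i x * b i x * Real.cosh (2 * x))
        + s ^ 2 * ∑ i ∈ I, ∫ x, b i x ^ 2 * Real.cosh (2 * x) := by
  rw [Finset.mul_sum, Finset.mul_sum, ← Finset.sum_add_distrib, ← Finset.sum_add_distrib]
  refine Finset.sum_congr rfl fun i hi => ?_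
  have h1 := integrable_weight (ha i hi).1 (ha i hi).1 (ha i hi).2
  have h2 := integrable_weight (ha i hi).1 (hb i hi).1 (ha i hi).2
  have h3 := integrable_weight (hb i hi).1 (hb i hi).1 (hb i hi).2
  rw [← integral_const_mul, ← integral_const_mul]
  simp only [pow_two] at *
  rw [← integral_add h1 (h2.const_mul _), ← integral_add (h1.fun_add (h2.const_mul _)) (h3.const_mul _)]
  refine integral_congr_ae (Eventually.of_forall fun x => ?_)
  simp only; ring

theorem sum_weight_nonneg (a : ℕ → ℝ → ℝ) :
    0 ≤ ∑ i ∈ I, ∫ x, a i x ^ 2 * Real.cosh (2 * x) :=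
  Finset.sum_nonneg fun _ _ => integral_nonneg fun _ =>
    mul_nonneg (sq_nonneg _) (Real.cosh_pos _).le

theorem abs_sum_weight_le (ha : ∀ i ∈ I, Continuous (a i) ∧ HasCompactSupport (a i))
    (hb : ∀ i ∈ I, Continuous (b i) ∧ HasCompactSupport (b i)) :
    |∑ i ∈ I, ∫ x, a i x * b i x * Real.cosh (2 * x)|
      ≤ √(∑ i ∈ I, ∫ x, a i x ^ 2 * Real.cosh (2 * x))
        * √(∑ i ∈ I, ∫ x, b i x ^ 2 * Real.cosh (2 * x)) := by
  rw [← Real.sqrt_mul (sum_weight_nonneg a)]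
  refine Real.abs_le_sqrt ?_
  have := discrim_le_zero (a := ∑ i ∈ I, ∫ x, b i x ^ 2 * Real.cosh (2 * x))
    (b := 2 * ∑ i ∈ I, ∫ x, a i x * b i x * Real.cosh (2 * x))
    (c := ∑ i ∈ I, ∫ x, a i x ^ 2 * Real.cosh (2 * x)) fun s => by
      have h := sum_weight_nonneg (I := I) fun i x => a i x + s * b i x
      rw [sum_weight_expand ha hb] at h
      linarith
  rw [discrim] at this
  linarith

theorem sqrt_sum_weight_add_le (ha : ∀ i ∈ I, Continuous (a i) ∧ HasCompactSupport (a i))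
    (hb : ∀ i ∈ I, Continuous (b i) ∧ HasCompactSupport (b i)) :
    √(∑ i ∈ I, ∫ x, (a i x + b i x) ^ 2 * Real.cosh (2 * x))
      ≤ √(∑ i ∈ I, ∫ x, a i x ^ 2 * Real.cosh (2 * x))
        + √(∑ i ∈ I, ∫ x, b i x ^ 2 * Real.cosh (2 * x)) := by
  refine Real.sqrt_le_iff.2 ⟨by positivity, ?_⟩
  have h := sum_weight_expand ha hb 1
  simp only [one_mul] at h
  rw [h, add_sq, Real.sq_sqrt (sum_weight_nonneg a), Real.sq_sqrt (sum_weight_nonneg b)]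
  have := (le_abs_self _).trans (abs_sum_weight_le ha hb)
  linarith

end Family

theorem CompactCk.cont {f : ℝ → ℝ} {k : ℕ} (hf : CompactCk k f) :
    ∀ i ∈ Finset.range (k + 1), Continuous (_root_.iteratedDeriv i f) ∧
      HasCompactSupport (_root_.iteratedDeriv i f) := fun i hi => by
  have := hf.iteratedDeriv (i := i) (j := 0) (by have := Finset.mem_range.1 hi; omega)
  exact ⟨this.1.continuous, this.2⟩

theorem testNorm_nonneg (k : ℕ) (f : ℝ → ℝ) : 0 ≤ testNorm k f := Real.sqrt_nonneg _

theorem testNorm_sq (k : ℕ) (f : ℝ → ℝ) : testNorm k f ^ 2 =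
    ∑ i ∈ Finset.range (k + 1), ∫ x : ℝ, (iteratedDeriv i f x) ^ 2 * Real.cosh (2 * x) :=
  Real.sq_sqrt (sum_weight_nonneg _)

theorem testNorm_add_le {k : ℕ} {f g : ℝ → ℝ} (hf : CompactCk k f) (hg : CompactCk k g) :
    testNorm k (fun x => f x + g x) ≤ testNorm k f + testNorm k g := by
  have := sqrt_sum_weight_add_le hf.cont hg.cont
  refine le_trans (le_of_eq ?_) this
  rw [testNorm]
  congr 1
  refine Finset.sum_congr rfl fun i hi => ?_
  rw [iteratedDeriv_add_of_le hf.1 hg.1 (by have := Finset.mem_range.1 hi; omega)]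

theorem testNorm_sub_comm (k : ℕ) (f g : ℝ → ℝ) :
    testNorm k (fun x => f x - g x) = testNorm k (fun x => g x - f x) := by
  have : (fun x => f x - g x) = fun x => -(g x - f x) := by funext x; ring
  rw [this]
  simp only [testNorm, iteratedDeriv_fun_neg, neg_sq]

theorem testNorm_triangle {k : ℕ} {f g h : ℝ → ℝ} (hf : CompactCk k f) (hg : CompactCk k g)
    (hh : CompactCk k h) : testNorm k (fun x => f x - h x)
      ≤ testNorm k (fun x => f x - g x) + testNorm k (fun x => g x - h x) := by
  refine le_trans (le_of_eq ?_) (testNorm_add_le (hf.sub hg) (hg.sub hh))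
  congr 1; funext x; ring

theorem abs_testNorm_sub_le {k : ℕ} {f g : ℝ → ℝ} (hf : CompactCk k f) (hg : CompactCk k g) :
    |testNorm k f - testNorm k g| ≤ testNorm k (fun x => f x - g x) := by
  have h1 : testNorm k f ≤ testNorm k (fun x => f x - g x) + testNorm k g := by
    refine le_trans (le_of_eq ?_) (testNorm_add_le (hf.sub hg) hg)
    congr 1; funext x; ring
  have h2 : testNorm k g ≤ testNorm k (fun x => g x - f x) + testNorm k f := by
    refine le_trans (le_of_eq ?_) (testNorm_add_le (hg.sub hf) hf)
    congr 1; funext x; ring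
  rw [testNorm_sub_comm] at h2
  rw [abs_le]; constructor <;> linarith

theorem integral_iteratedDeriv_le (k : ℕ) (f : ℝ → ℝ) {i : ℕ} (hi : i ≤ k) :
    ∫ x : ℝ, (iteratedDeriv i f x) ^ 2 * Real.cosh (2 * x) ≤ testNorm k f ^ 2 := by
  rw [testNorm_sq]
  exact Finset.single_le_sum (f := fun i => ∫ x : ℝ, (iteratedDeriv i f x) ^ 2 * Real.cosh (2 * x))
    (fun j _ => integral_nonneg fun _ => mul_nonneg (sq_nonneg _) (Real.cosh_pos _).le)
    (Finset.mem_range.2 (by omega))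

/-- Weighted Sobolev inequality. -/
theorem sobolev_weight {f : ℝ → ℝ} (hf : CompactCk 1 f) (x : ℝ) :
    f x ^ 2 * Real.cosh (2 * x) ≤ 3 * ((∫ y, f y ^ 2 * Real.cosh (2 * y))
      + ∫ y, deriv f y ^ 2 * Real.cosh (2 * y)) := by
  have hf1 : ContDiff ℝ 1 f := by simpa using hf.1
  have hd : ∀ y, HasDerivAt f (deriv f y) y :=
    fun y => (hf1.differentiable (by norm_num) y).hasDerivAt
  have hdc : Continuous (deriv f) := hf1.continuous_deriv (by norm_num)
  have hF : ContDiff ℝ 1 (fun y => f y ^ 2 * Real.cosh (2 * y)) := by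
    have : ContDiff ℝ 1 fun y : ℝ => Real.cosh (2 * y) := Real.contDiff_cosh.comp (by fun_prop)
    fun_prop
  have hFd : ∀ y, HasDerivAt (fun y => f y ^ 2 * Real.cosh (2 * y))
      (2 * f y * deriv f y * Real.cosh (2 * y) + f y ^ 2 * (2 * Real.sinh (2 * y))) y := fun y => by
    have h1 := ((hd y).fun_pow 2).fun_mul ((((hasDerivAt_id y).const_mul 2)).cosh)
    refine h1.congr_deriv ?_
    simp only [id]; push_cast; ring
  have hFs : HasCompactSupport (fun y => f y ^ 2 * Real.cosh (2 * y)) := by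
    have : (fun y => f y ^ 2 * Real.cosh (2 * y)) = fun y => f y * (f y * Real.cosh (2 * y)) := by
      funext y; ring
    rw [this]
    exact hf.2.mul_right
  have h1 := hFs.integral_Iic_deriv_eq hF x
  rw [← h1]
  have i1 := integrable_weight hf.1.continuous hf.1.continuous hf.2
  have i2 := integrable_weight hdc hdc hf.2.deriv
  simp only [← pow_two] at i1 i2
  rw [← integral_add i1 i2, ← integral_const_mul]
  have i3 := (i1.add i2).const_mul 3
  refine le_trans ?_ (setIntegral_le_integral (s := Set.Iic x) i3
    (Eventually.of_forall fun y => ?_))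
  -- Since |sinh| < cosh, the weight dominates half its own derivative: (f² cosh(2y))' = 2 f f'
  -- cosh(2y) + 2 f² sinh(2y) ≤ (3 f² + f'²) cosh(2y).
  · refine setIntegral_mono_on ?_ i3.integrableOn measurableSet_Iic fun y _ => ?_
    · exact ((hF.continuous_deriv (by norm_num)).integrable_of_hasCompactSupport
        hFs.deriv).integrableOn
    · rw [(hFd y).deriv]
      have c1 : Real.sinh (2 * y) ≤ Real.cosh (2 * y) := (Real.sinh_lt_cosh _).le
      have c2 := (Real.cosh_pos (2 * y))
      nlinarith [mul_nonneg (sq_nonneg (f y - deriv f y)) c2.le,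
        mul_nonneg (sq_nonneg (f y)) (sub_nonneg.2 c1),
        mul_nonneg (sq_nonneg (deriv f y)) c2.le]
  · have c2 := (Real.cosh_pos (2 * y))
    simp only [Pi.zero_apply]
    positivity

theorem iteratedDeriv_sq_le_testNorm {k i : ℕ} {f : ℝ → ℝ} (hf : CompactCk k f) (hi : i + 1 ≤ k)
    (x : ℝ) : (iteratedDeriv i f x) ^ 2 * Real.cosh (2 * x) ≤ 6 * testNorm k f ^ 2 := by
  have h1 := sobolev_weight (hf.iteratedDeriv hi) x
  have h2 := integral_iteratedDeriv_le k f (i := i) (by omega)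
  have h3 := integral_iteratedDeriv_le k f hi
  rw [iteratedDeriv_succ] at h3
  linarith

theorem abs_iteratedDeriv_le_testNorm {k i : ℕ} {f : ℝ → ℝ} (hf : CompactCk k f) (hi : i + 1 ≤ k)
    (x : ℝ) : |iteratedDeriv i f x| * √(Real.cosh (2 * x)) ≤ 3 * testNorm k f := by
  have h := iteratedDeriv_sq_le_testNorm hf hi x
  refine abs_le_of_sq_le_sq' (a := |iteratedDeriv i f x| * √(Real.cosh (2 * x))) ?_
    (by have := testNorm_nonneg k f; positivity) |>.2
  rw [mul_pow, mul_pow, sq_abs, Real.sq_sqrt (Real.cosh_pos _).le]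
  nlinarith [sq_nonneg (testNorm k f)]

theorem abs_iteratedDeriv_le_testNorm' {k i : ℕ} {f : ℝ → ℝ} (hf : CompactCk k f) (hi : i + 1 ≤ k)
    (x : ℝ) : |iteratedDeriv i f x| ≤ 3 * testNorm k f :=
  (le_mul_of_one_le_right (abs_nonneg _) (Real.one_le_sqrt.2 (Real.one_le_cosh _))).trans
    (abs_iteratedDeriv_le_testNorm hf hi x)

end

/-! ### Mollification and closability -/

noncomputable section

theorem HasCompactSupport.exists_bound_support {f : ℝ → ℝ} (hf : HasCompactSupport f) :
    ∃ L, 0 ≤ L ∧ ∀ x, L ≤ |x| → f x = 0 := by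
  obtain ⟨L, hL⟩ := hf.isCompact.isBounded.subset_closedBall 0
  refine ⟨|L| + 1, by positivity, fun x hx => ?_⟩
  by_contra h
  have := hL (subset_tsupport f (Function.mem_support.2 h))
  rw [Metric.mem_closedBall, dist_zero_right, Real.norm_eq_abs] at this
  linarith [le_abs_self L]

theorem hasCompactSupport_of_bound {f : ℝ → ℝ} {L : ℝ} (h : ∀ x, L ≤ |x| → f x = 0) :
    HasCompactSupport f := by
  refine HasCompactSupport.intro (isCompact_closedBall (0 : ℝ) L) fun x hx => h x ?_
  rw [Metric.mem_closedBall, dist_zero_right, Real.norm_eq_abs, not_le] at hx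
  exact hx.le

-- Convolution with a narrow bump commutes with the derivatives, and uniform continuity makes each
-- of the finitely many of them uniformly close. All supports lie in one fixed interval, on which
-- the weight is bounded. This is needed because time slices of solutions are only C^k, while the
-- completion is defined through smooth functions.
open scoped Convolution in
theorem exists_smooth_testNorm_lt {k : ℕ} {f : ℝ → ℝ} (hf : CompactCk k f) {ε : ℝ} (hε : 0 < ε) :
    ∃ φ : ℝ → ℝ, ContDiff ℝ ((⊤ : ℕ∞) : WithTop ℕ∞) φ ∧ HasCompactSupport φ ∧
      testNorm k (fun x => φ x - f x) < ε := by
  obtain ⟨L, hL0, hL⟩ := HasCompactSupport.exists_bound_support hf.2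
  -- The number of derivatives, times the length of [-(L+2), L+2], times the maximum of the weight
  -- there; δ² K then bounds the squared norm of the error.
  set K : ℝ := (k + 1) * (2 * (L + 2)) * Real.cosh (2 * (L + 2)) with hK
  have hK0 : 0 < K := by positivity
  obtain ⟨δ, hδ, hδK⟩ : ∃ δ : ℝ, 0 < δ ∧ δ ^ 2 * K < ε ^ 2 := by
    refine ⟨ε / √(2 * K), by positivity, ?_⟩
    rw [div_pow, Real.sq_sqrt (by positivity)]
    have : ε ^ 2 / (2 * K) * K = ε ^ 2 / 2 := by field_simp
    rw [this]
    have : 0 < ε ^ 2 := by positivity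
    linarith
  have hu : ∀ᶠ r : ℝ in 𝓝[>] 0, ∀ i ∈ Finset.range (k + 1), ∀ x y, |x - y| < r →
      |iteratedDeriv i f x - iteratedDeriv i f y| ≤ δ := by
    rw [Filter.eventually_all_finset]
    intro i hi
    have huc := (hf.cont i hi).2.uniformContinuous_of_continuous (hf.cont i hi).1
    obtain ⟨r, hr, h⟩ := Metric.uniformContinuous_iff.1 huc δ hδ
    filter_upwards [Ioo_mem_nhdsGT hr] with s hs x y hxy
    exact (h (hxy.trans hs.2)).le
  obtain ⟨r, hr, hr0, hr1⟩ := (hu.and (Ioo_mem_nhdsGT (zero_lt_one' ℝ))).exists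
  let b : ContDiffBump (0 : ℝ) := ⟨r / 2, r, by linarith, by linarith⟩
  have hbc : Continuous (b.normed volume) := b.continuous_normed
  have hconv : ∀ i ≤ k, iteratedDeriv i (b.normed volume ⋆[ContinuousLinearMap.lsmul ℝ ℝ, volume] f)
      = b.normed volume ⋆[ContinuousLinearMap.lsmul ℝ ℝ, volume] iteratedDeriv i f := by
    intro i
    induction i with
    | zero => intro _; simp
    | succ i ih =>
      intro hi
      rw [iteratedDeriv_succ, ih (by omega), iteratedDeriv_succ]
      have hg := hf.iteratedDeriv (i := i) (j := 1) hi
      exact funext fun x => (hg.2.hasDerivAt_convolution_right _ hbc.locallyIntegrable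
        (by simpa using hg.1) x).deriv
  set φ := b.normed volume ⋆[ContinuousLinearMap.lsmul ℝ ℝ, volume] f
  have hφ : ContDiff ℝ ((⊤ : ℕ∞) : WithTop ℕ∞) φ :=
    b.hasCompactSupport_normed.contDiff_convolution_left _ b.contDiff_normed
      hf.1.continuous.locallyIntegrable
  have hφs : HasCompactSupport φ := b.hasCompactSupport_normed.convolution _ hf.2
  have hclose : ∀ i ∈ Finset.range (k + 1), ∀ x,
      |iteratedDeriv i φ x - iteratedDeriv i f x| ≤ δ := by
    intro i hi x
    rw [hconv i (by have := Finset.mem_range.1 hi; omega)]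
    refine b.dist_normed_convolution_le (hf.cont i hi).1.aestronglyMeasurable fun y hy => ?_
    exact hr i hi y x hy
  have hout : ∀ i ∈ Finset.range (k + 1), ∀ x, L + 2 ≤ |x| →
      |iteratedDeriv i φ x - iteratedDeriv i f x| ≤ 0 := by
    intro i hi x hx
    rw [hconv i (by have := Finset.mem_range.1 hi; omega)]
    have hz : ∀ y, L < |y| → iteratedDeriv i f y = 0 := by
      intro y hy
      have : f =ᶠ[𝓝 y] fun _ => 0 := by
        filter_upwards [(isOpen_lt continuous_const continuous_abs).mem_nhds hy] with z hz
        exact hL z (le_of_lt hz)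
      rw [this.iteratedDeriv_eq i]
      cases i <;> simp
    refine b.dist_normed_convolution_le (hf.cont i hi).1.aestronglyMeasurable fun y hy => ?_
    have hy' : |y - x| < r := hy
    have : |x| ≤ |y| + |y - x| := by
      have := abs_sub_abs_le_abs_sub x y
      rw [abs_sub_comm] at this; linarith
    rw [hz y (by linarith), hz x (by linarith), dist_self]
  refine ⟨φ, hφ, hφs, ?_⟩
  have hφk : ContDiff ℝ k φ := hφ.of_le (by exact_mod_cast le_top)
  have hsq : testNorm k (fun x => φ x - f x) ^ 2 ≤ δ ^ 2 * K := by
    rw [testNorm_sq]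
    calc _ ≤ ∑ i ∈ Finset.range (k + 1), δ ^ 2 * (2 * (L + 2)) * Real.cosh (2 * (L + 2)) := by
          refine Finset.sum_le_sum fun i hi => ?_
          have hik : i ≤ k := by have := Finset.mem_range.1 hi; omega
          rw [iteratedDeriv_sub_of_le hφk hf.1 hik]
          have hz : ∀ x ∉ Set.Icc (-(L + 2)) (L + 2),
              (iteratedDeriv i φ x - iteratedDeriv i f x) ^ 2 * Real.cosh (2 * x) = 0 := by
            intro x hx
            have : L + 2 ≤ |x| := by
              by_contra h
              push Not at h
              exact hx ⟨(abs_lt.1 h).1.le, (abs_lt.1 h).2.le⟩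
            rw [abs_nonpos_iff.1 (hout i hi x this)]; simp
          rw [← setIntegral_eq_integral_of_forall_compl_eq_zero hz]
          have hb : ∀ x ∈ Set.Icc (-(L + 2)) (L + 2),
              ‖(iteratedDeriv i φ x - iteratedDeriv i f x) ^ 2 * Real.cosh (2 * x)‖
                ≤ δ ^ 2 * Real.cosh (2 * (L + 2)) := by
            intro x hx
            rw [Real.norm_eq_abs, abs_of_nonneg (by positivity), ← sq_abs]
            gcongr
            · exact hclose i hi x
            · have := abs_le.2 hx
              rw [Real.cosh_le_cosh, abs_mul, abs_mul, abs_two,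
                abs_of_nonneg (by linarith : 0 ≤ L + 2)]
              linarith
          refine (le_abs_self _).trans ((norm_setIntegral_le_of_norm_le_const
            (by rw [Real.volume_Icc]; exact ENNReal.ofReal_lt_top) hb).trans (le_of_eq ?_))
          rw [measureReal_def, Real.volume_Icc, ENNReal.toReal_ofReal (by linarith)]
          ring
      _ = δ ^ 2 * K := by
          rw [Finset.sum_const, Finset.card_range, hK, nsmul_eq_mul]; push_cast; ring
  exact lt_of_pow_lt_pow_left₀ 2 hε.le (hsq.trans_lt hδK)

theorem CompactCk.of_smooth {k : ℕ} {φ : ℝ → ℝ}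
    (h : ContDiff ℝ ((⊤ : ℕ∞) : WithTop ℕ∞) φ ∧ HasCompactSupport φ) : CompactCk k φ :=
  ⟨h.1.of_le (by exact_mod_cast le_top), h.2⟩

/-- Integration by parts moves all the derivatives onto a. What is left is weighted L² convergence
tested, by Cauchy–Schwarz, against a / cosh(2x). -/
theorem tendsto_integral_mul_iteratedDeriv {χ : ℕ → ℝ → ℝ}
    (hχ : ∀ n, ContDiff ℝ ((⊤ : ℕ∞) : WithTop ℕ∞) (χ n) ∧ HasCompactSupport (χ n))
    (h0 : Tendsto (fun n => ∫ x, χ n x ^ 2 * Real.cosh (2 * x)) atTop (𝓝 0)) (i : ℕ) :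
    ∀ a : ℝ → ℝ, ContDiff ℝ ((⊤ : ℕ∞) : WithTop ℕ∞) a → HasCompactSupport a →
      Tendsto (fun n => ∫ x, a x * iteratedDeriv i (χ n) x) atTop (𝓝 0) := by
  induction i with
  | zero =>
    intro a ha has
    have hc : Continuous fun x => a x / Real.cosh (2 * x) :=
      ha.continuous.div (by fun_prop) fun x => (Real.cosh_pos _).ne'
    have hcs : HasCompactSupport fun x => a x / Real.cosh (2 * x) := by
      simp only [div_eq_mul_inv]; exact has.mul_right
    have hle : ∀ n, |∫ x, a x * iteratedDeriv 0 (χ n) x|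
        ≤ √(∫ x, (a x / Real.cosh (2 * x)) ^ 2 * Real.cosh (2 * x))
          * √(∫ x, χ n x ^ 2 * Real.cosh (2 * x)) := by
      intro n
      have := abs_sum_weight_le (I := {0}) (a := fun _ x => a x / Real.cosh (2 * x))
        (b := fun _ => χ n) (fun _ _ => ⟨hc, hcs⟩) (fun _ _ => ⟨(hχ n).1.continuous, (hχ n).2⟩)
      simp only [Finset.sum_singleton] at this
      refine le_trans (le_of_eq ?_) this
      congr 1
      refine integral_congr_ae (Eventually.of_forall fun x => ?_)
      have := (Real.cosh_pos (2 * x)).ne'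
      simp only [iteratedDeriv_zero]; field_simp
    refine squeeze_zero_norm hle ?_
    have := (h0.sqrt).const_mul (√(∫ x, (a x / Real.cosh (2 * x)) ^ 2 * Real.cosh (2 * x)))
    simpa using this
  | succ i ih =>
    intro a ha has
    have ha1 : ContDiff ℝ 1 a := ha.of_le (by exact_mod_cast le_top)
    have had : ContDiff ℝ ((⊤ : ℕ∞) : WithTop ℕ∞) (deriv a) := by
      have := (contDiff_infty_iff_deriv.1 ha).2
      exact this
    have hk := (ih (deriv a) had has.deriv).neg
    rw [neg_zero] at hk
    refine hk.congr fun n => ?_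
    have hC : CompactCk (i + 1) (χ n) := CompactCk.of_smooth (hχ n)
    have hg := hC.iteratedDeriv (i := i) (j := 1) le_rfl
    have hg1 : ContDiff ℝ 1 (iteratedDeriv i (χ n)) := by simpa using hg.1
    have hgd : Continuous (deriv (iteratedDeriv i (χ n))) := hg1.continuous_deriv (by norm_num)
    rw [iteratedDeriv_succ]
    refine (integral_mul_deriv_eq_deriv_mul_of_integrable
      (fun x _ => (ha1.differentiable (by norm_num) x).hasDerivAt)
      (fun x _ => (hg1.differentiable (by norm_num) x).hasDerivAt) ?_ ?_ ?_).symm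
    · exact (ha1.continuous.mul hgd).integrable_of_hasCompactSupport has.mul_right
    · exact (had.continuous.mul hg1.continuous).integrable_of_hasCompactSupport has.deriv.mul_right
    · exact (ha1.continuous.mul hg1.continuous).integrable_of_hasCompactSupport has.mul_right

theorem contDiff_cosh_two : ContDiff ℝ ((⊤ : ℕ∞) : WithTop ℕ∞) fun x : ℝ => Real.cosh (2 * x) :=
  Real.contDiff_cosh.comp (by fun_prop)

/-- Closability of the weighted Sobolev norm. -/
theorem testNorm_tendsto_zero {k : ℕ} {χ : ℕ → ℝ → ℝ}
    (hχ : ∀ n, ContDiff ℝ ((⊤ : ℕ∞) : WithTop ℕ∞) (χ n) ∧ HasCompactSupport (χ n))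
    (hcau : ∀ ε > 0, ∃ N, ∀ m ≥ N, ∀ n ≥ N, testNorm k (fun x => χ m x - χ n x) < ε)
    (h0 : Tendsto (fun n => ∫ x, χ n x ^ 2 * Real.cosh (2 * x)) atTop (𝓝 0)) :
    Tendsto (fun n => testNorm k (χ n)) atTop (𝓝 0) := by
  rw [Metric.tendsto_atTop]
  intro ε hε
  obtain ⟨N, hN⟩ := hcau (ε / 2) (by positivity)
  refine ⟨N, fun n hn => ?_⟩
  rw [Real.dist_eq, sub_zero, abs_of_nonneg (testNorm_nonneg _ _)]
  have hC : ∀ n, CompactCk k (χ n) := fun n => CompactCk.of_smooth (hχ n)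
  have hlim : Tendsto (fun m => ∑ i ∈ Finset.range (k + 1),
      ∫ x, iteratedDeriv i (χ n) x * iteratedDeriv i (χ m) x * Real.cosh (2 * x)) atTop (𝓝 0) := by
    rw [show (0 : ℝ) = ∑ i ∈ Finset.range (k + 1), 0 by simp]
    refine tendsto_finsetSum _ fun i _ => ?_
    have hs : ContDiff ℝ ((⊤ : ℕ∞) : WithTop ℕ∞) (iteratedDeriv i (χ n)) := by
      rw [contDiff_infty]
      intro j
      exact contDiff_iteratedDeriv (k := i + j) ((hχ n).1.of_le (by exact_mod_cast le_top)) le_rfl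
    have := tendsto_integral_mul_iteratedDeriv hχ h0 i
      (fun x => iteratedDeriv i (χ n) x * Real.cosh (2 * x)) (hs.mul contDiff_cosh_two)
      (hasCompactSupport_iteratedDeriv (hχ n).2 i).mul_right
    refine this.congr fun m => integral_congr_ae (Eventually.of_forall fun x => ?_)
    simp only; ring
  -- ‖χ_n‖² = ⟨χ_n, χ_n - χ_m⟩ + ⟨χ_n, χ_m⟩. The Cauchy property bounds the first term by (ε/2)
  -- ‖χ_n‖, and the second tends to 0 as m → ∞ with n fixed.
  have hle : ∀ m ≥ N, testNorm k (χ n) ^ 2 ≤ testNorm k (χ n) * (ε / 2)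
      + ∑ i ∈ Finset.range (k + 1),
        ∫ x, iteratedDeriv i (χ n) x * iteratedDeriv i (χ m) x * Real.cosh (2 * x) := by
    intro m hm
    have hd := (hC n).sub (hC m)
    have h1 := (le_abs_self _).trans (abs_sum_weight_le (hC n).cont hd.cont)
    have h2 : (∑ i ∈ Finset.range (k + 1), ∫ x, iteratedDeriv i (χ n) x
        * iteratedDeriv i (fun x => χ n x - χ m x) x * Real.cosh (2 * x))
        = testNorm k (χ n) ^ 2 - ∑ i ∈ Finset.range (k + 1),
        ∫ x, iteratedDeriv i (χ n) x * iteratedDeriv i (χ m) x * Real.cosh (2 * x) := by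
      rw [testNorm_sq, ← Finset.sum_sub_distrib]
      refine Finset.sum_congr rfl fun i hi => ?_
      have c1 := (hC n).cont i hi
      have c2 := (hC m).cont i hi
      rw [iteratedDeriv_sub_of_le (hC n).1 (hC m).1 (by have := Finset.mem_range.1 hi; omega)]
      simp only [pow_two]
      rw [← integral_sub (integrable_weight c1.1 c1.1 c1.2) (integrable_weight c1.1 c2.1 c1.2)]
      refine integral_congr_ae (Eventually.of_forall fun x => ?_)
      simp only; ring
    rw [h2] at h1
    have h3 : testNorm k (χ n) * testNorm k (fun x => χ n x - χ m x)
        ≤ testNorm k (χ n) * (ε / 2) :=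
      mul_le_mul_of_nonneg_left (hN n hn m hm).le (testNorm_nonneg _ _)
    change _ ≤ testNorm k (χ n) * testNorm k (fun x => χ n x - χ m x) at h1
    linarith
  have h4 : testNorm k (χ n) ^ 2 ≤ testNorm k (χ n) * (ε / 2) + 0 :=
    ge_of_tendsto (hlim.const_add _) (by filter_upwards [eventually_ge_atTop N] with m hm using hle m hm)
  by_contra hcon
  push Not at hcon
  nlinarith [testNorm_nonneg k (χ n)]

end

/-! ### The completion: its norm, membership and regularity -/

noncomputable section

theorem lintegral_sq_weight {χ : ℝ → ℝ} (hc : Continuous χ) (hs : HasCompactSupport χ) :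
    ∫⁻ x, ENNReal.ofReal (χ x ^ 2 * Real.cosh (2 * x))
      = ENNReal.ofReal (∫ x, χ x ^ 2 * Real.cosh (2 * x)) := by
  have := integrable_weight hc hc hs
  simp only [← pow_two] at this
  exact (ofReal_integral_eq_lintegral_ofReal this (Eventually.of_forall fun x =>
    mul_nonneg (sq_nonneg _) (Real.cosh_pos _).le)).symm

/-- The difference of two approximating sequences is Cauchy in the Sobolev norm and null in weighted
L², hence null in the Sobolev norm by closability. So the sequence selected by choice in `htNorm` is
immaterial. -/
theorem IsApprox.tendsto_sub {k : ℕ} {f : ℝ → ℝ} {φ ψ : ℕ → ℝ → ℝ} (hf : Continuous f)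
    (hφ : IsApprox k f φ) (hψ : IsApprox k f ψ) :
    Tendsto (fun n => testNorm k (fun x => φ n x - ψ n x)) atTop (𝓝 0) := by
  have hCφ : ∀ n, CompactCk k (φ n) := fun n => CompactCk.of_smooth (hφ.1 n)
  have hCψ : ∀ n, CompactCk k (ψ n) := fun n => CompactCk.of_smooth (hψ.1 n)
  refine testNorm_tendsto_zero (fun n => ⟨(hφ.1 n).1.sub (hψ.1 n).1, (hφ.1 n).2.sub (hψ.1 n).2⟩)
    (fun ε hε => ?_) ?_
  · obtain ⟨N₁, h₁⟩ := hφ.2.1 (ε / 2) (by positivity)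
    obtain ⟨N₂, h₂⟩ := hψ.2.1 (ε / 2) (by positivity)
    refine ⟨max N₁ N₂, fun m hm n hn => ?_⟩
    have a1 := h₁ m (le_of_max_le_left hm) n (le_of_max_le_left hn)
    have a2 := h₂ n (le_of_max_le_right hn) m (le_of_max_le_right hm)
    have := testNorm_add_le ((hCφ m).sub (hCφ n)) ((hCψ n).sub (hCψ m))
    have e : (fun x => φ m x - ψ m x - (φ n x - ψ n x))
        = fun x => φ m x - φ n x + (ψ n x - ψ m x) := by funext x; ring
    rw [e]
    linarith
  · have hle : ∀ n, ∫⁻ x, ENNReal.ofReal ((φ n x - ψ n x) ^ 2 * Real.cosh (2 * x))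
        ≤ 2 * (∫⁻ x, ENNReal.ofReal ((φ n x - f x) ^ 2 * Real.cosh (2 * x)))
          + 2 * (∫⁻ x, ENNReal.ofReal ((ψ n x - f x) ^ 2 * Real.cosh (2 * x))) := by
      intro n
      have c1 := (hφ.1 n).1.continuous
      have c2 := (hψ.1 n).1.continuous
      rw [← lintegral_const_mul _ (by fun_prop), ← lintegral_const_mul _ (by fun_prop),
        ← lintegral_add_left (by fun_prop)]
      refine lintegral_mono fun x => ?_
      have h2 : (2 : ENNReal) = ENNReal.ofReal 2 := by simp
      rw [h2, ← ENNReal.ofReal_mul (by norm_num), ← ENNReal.ofReal_mul (by norm_num),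
        ← ENNReal.ofReal_add (by positivity) (by positivity)]
      refine ENNReal.ofReal_le_ofReal ?_
      nlinarith [mul_nonneg (sq_nonneg (φ n x - f x + (ψ n x - f x))) (Real.cosh_pos (2 * x)).le]
    have hz : Tendsto (fun n => ∫⁻ x, ENNReal.ofReal ((φ n x - ψ n x) ^ 2 * Real.cosh (2 * x)))
        atTop (𝓝 0) := by
      have h1 := ENNReal.Tendsto.const_mul hφ.2.2 (a := 2) (Or.inr (by simp))
      have h2 := ENNReal.Tendsto.const_mul hψ.2.2 (a := 2) (Or.inr (by simp))
      have h3 := h1.add h2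
      simp only [mul_zero, add_zero] at h3
      exact tendsto_of_tendsto_of_tendsto_of_le_of_le tendsto_const_nhds h3 (fun _ => zero_le) hle
    have hz' : Tendsto (fun n => ENNReal.ofReal (∫ x, (φ n x - ψ n x) ^ 2 * Real.cosh (2 * x)))
        atTop (𝓝 0) := by
      refine hz.congr fun n => lintegral_sq_weight ((hφ.1 n).1.continuous.sub (hψ.1 n).1.continuous)
        ((hφ.1 n).2.sub (hψ.1 n).2)
    have := (ENNReal.tendsto_toReal ENNReal.zero_ne_top).comp hz'
    simp only [ENNReal.toReal_zero] at this
    refine this.congr fun n => ?_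
    exact ENNReal.toReal_ofReal (integral_nonneg fun x =>
      mul_nonneg (sq_nonneg _) (Real.cosh_pos _).le)

theorem IsApprox.tendsto_htNorm {k : ℕ} {f : ℝ → ℝ} {φ : ℕ → ℝ → ℝ} (hf : Continuous f)
    (hφ : IsApprox k f φ) : Tendsto (fun n => testNorm k (φ n)) atTop (𝓝 (htNorm k f)) := by
  have hM : MemHt k f := ⟨φ, hφ⟩
  rw [htNorm, dif_pos hM]
  have hψ := hM.choose_spec
  set ψ := hM.choose
  have hCφ : ∀ n, CompactCk k (φ n) := fun n => CompactCk.of_smooth (hφ.1 n)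
  have hCψ : ∀ n, CompactCk k (ψ n) := fun n => CompactCk.of_smooth (hψ.1 n)
  have hcau : CauchySeq fun n => testNorm k (ψ n) := by
    rw [Metric.cauchySeq_iff]
    intro ε hε
    obtain ⟨N, hN⟩ := hψ.2.1 ε hε
    exact ⟨N, fun m hm n hn => (abs_testNorm_sub_le (hCψ m) (hCψ n)).trans_lt (hN m hm n hn)⟩
  have h1 := tendsto_nhds_limUnder (cauchySeq_tendsto_of_complete hcau)
  have h2 := IsApprox.tendsto_sub hf hφ hψ
  have h3 : Tendsto (fun n => testNorm k (φ n) - testNorm k (ψ n)) atTop (𝓝 0) :=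
    squeeze_zero_norm (fun n => abs_testNorm_sub_le (hCφ n) (hCψ n)) h2
  have := h3.add h1
  simpa using this

theorem htNorm_nonneg {k : ℕ} {f : ℝ → ℝ} (hf : Continuous f) : 0 ≤ htNorm k f := by
  by_cases h : MemHt k f
  · obtain ⟨φ, hφ⟩ := h
    exact ge_of_tendsto' (hφ.tendsto_htNorm hf) fun n => testNorm_nonneg _ _
  · rw [htNorm, dif_neg h]

/-- A pointwise limit of a Cauchy sequence of compactly supported functions belongs to the
weighted Sobolev space, and its norm is the limit of the norms. -/
theorem memHt_of_pointwise {k : ℕ} (hk : 1 ≤ k) {f : ℝ → ℝ} {g : ℕ → ℝ → ℝ} (hf : Continuous f)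
    (hg : ∀ n, CompactCk k (g n))
    (hcau : ∀ ε > 0, ∃ N, ∀ m ≥ N, ∀ n ≥ N, testNorm k (fun x => g m x - g n x) < ε)
    (hlim : ∀ x, Tendsto (fun n => g n x) atTop (𝓝 (f x))) :
    MemHt k f ∧ Tendsto (fun n => testNorm k (g n)) atTop (𝓝 (htNorm k f)) := by
  -- The g n are only C^k; each is replaced by a smooth function at distance less than 1/(n+1).
  choose φ hφ1 hφ2 hφ3 using fun n : ℕ =>
    exists_smooth_testNorm_lt (hg n) (ε := 1 / ((n : ℝ) + 1)) (by positivity)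
  have hC : ∀ n, CompactCk k (φ n) := fun n => CompactCk.of_smooth ⟨hφ1 n, hφ2 n⟩
  have hsmall : Tendsto (fun n => testNorm k (fun x => φ n x - g n x)) atTop (𝓝 0) :=
    squeeze_zero (fun n => testNorm_nonneg _ _) (fun n => (hφ3 n).le)
      tendsto_one_div_add_atTop_nhds_zero_nat
  have hcφ : ∀ ε > 0, ∃ N, ∀ m ≥ N, ∀ n ≥ N, testNorm k (fun x => φ m x - φ n x) < ε := by
    intro ε hε
    obtain ⟨N₁, h₁⟩ := hcau (ε / 3) (by positivity)
    obtain ⟨N₂, h₂⟩ := eventually_atTop.1 (hsmall.eventually_lt_const (by positivity : 0 < ε / 3))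
    refine ⟨max N₁ N₂, fun m hm n hn => ?_⟩
    have a1 := h₁ m (le_of_max_le_left hm) n (le_of_max_le_left hn)
    have a2 := h₂ m (le_of_max_le_right hm)
    have a3 := h₂ n (le_of_max_le_right hn)
    rw [testNorm_sub_comm] at a3
    have b1 := testNorm_triangle (hC m) (hg m) (hC n)
    have b2 := testNorm_triangle (hg m) (hg n) (hC n)
    linarith
  have hlimφ : ∀ x, Tendsto (fun n => φ n x) atTop (𝓝 (f x)) := by
    intro x
    have : Tendsto (fun n => φ n x - g n x) atTop (𝓝 0) := by
      refine squeeze_zero_norm (fun n => ?_) (by simpa using hsmall.const_mul 3)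
      have := abs_iteratedDeriv_le_testNorm' ((hC n).sub (hg n)) (i := 0) hk x
      simpa using this
    simpa using this.add (hlim x)
  have happ : IsApprox k f φ := by
    refine ⟨fun n => ⟨hφ1 n, hφ2 n⟩, hcφ, ?_⟩
    -- Weighted L² convergence follows from the Cauchy property and pointwise convergence by Fatou's
    -- lemma.
    rw [ENNReal.tendsto_atTop_zero]
    intro ε hε
    obtain ⟨δ, hδ0, hδ⟩ : ∃ δ : ℝ, 0 < δ ∧ ENNReal.ofReal (δ ^ 2) ≤ ε := by
      rcases eq_or_ne ε ⊤ with rfl | htop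
      · exact ⟨1, one_pos, le_top⟩
      · refine ⟨√ε.toReal, Real.sqrt_pos.2 (ENNReal.toReal_pos hε.ne' htop), ?_⟩
        rw [Real.sq_sqrt ENNReal.toReal_nonneg, ENNReal.ofReal_toReal htop]
    obtain ⟨N, hN⟩ := hcφ δ hδ0
    refine ⟨N, fun n hn => ?_⟩
    have hp : ∀ x, Tendsto (fun m => ENNReal.ofReal ((φ n x - φ m x) ^ 2 * Real.cosh (2 * x))) atTop
        (𝓝 (ENNReal.ofReal ((φ n x - f x) ^ 2 * Real.cosh (2 * x)))) := fun x =>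
      (ENNReal.continuous_ofReal.tendsto _).comp ((((hlimφ x).const_sub _).pow 2).mul_const _)
    calc ∫⁻ x, ENNReal.ofReal ((φ n x - f x) ^ 2 * Real.cosh (2 * x))
        = ∫⁻ x, liminf (fun m => ENNReal.ofReal ((φ n x - φ m x) ^ 2 * Real.cosh (2 * x))) atTop :=
          lintegral_congr fun x => (hp x).liminf_eq.symm
      _ ≤ liminf (fun m => ∫⁻ x, ENNReal.ofReal ((φ n x - φ m x) ^ 2 * Real.cosh (2 * x))) atTop := by
          refine lintegral_liminf_le fun m => ?_
          have c1 := (hφ1 n).continuous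
          have c2 := (hφ1 m).continuous
          exact (ENNReal.continuous_ofReal.comp (by fun_prop : Continuous fun x =>
            (φ n x - φ m x) ^ 2 * Real.cosh (2 * x))).measurable
      _ ≤ ε := by
          refine liminf_le_of_frequently_le' (Eventually.frequently ?_)
          filter_upwards [eventually_ge_atTop N] with m hm
          refine le_trans ?_ hδ
          rw [lintegral_sq_weight (χ := fun x => φ n x - φ m x)
            ((hφ1 n).continuous.sub (hφ1 m).continuous) ((hφ2 n).sub (hφ2 m))]
          refine ENNReal.ofReal_le_ofReal ?_
          have h1 := integral_iteratedDeriv_le k (fun x => φ n x - φ m x) (i := 0) (by omega)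
          have h2 := hN n hn m hm
          simp only [iteratedDeriv_zero] at h1
          exact h1.trans (pow_le_pow_left₀ (testNorm_nonneg _ _) h2.le 2)
  refine ⟨⟨φ, happ⟩, ?_⟩
  have h1 : Tendsto (fun n => testNorm k (g n) - testNorm k (φ n)) atTop (𝓝 0) :=
    squeeze_zero_norm (fun n => (abs_testNorm_sub_le (hg n) (hC n)).trans_eq
      (testNorm_sub_comm _ _ _)) hsmall
  simpa using h1.add (happ.tendsto_htNorm hf)

theorem htNorm_zero {k : ℕ} (hk : 1 ≤ k) : htNorm k (fun _ => 0) = 0 := by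
  have h := (memHt_of_pointwise hk (f := fun _ => 0) (g := fun _ _ => 0) continuous_const
    (fun _ => ⟨contDiff_const, HasCompactSupport.zero⟩) (fun ε hε => ⟨0, fun m _ n _ => by
      simpa [testNorm, iteratedDeriv_const] using hε⟩) fun x => tendsto_const_nhds).2
  refine tendsto_nhds_unique h ?_
  simp [testNorm]

/-- The weighted Sobolev inequality makes the derivatives of order below k converge uniformly, so
the pointwise limit is C^{k-1}. It agrees with f almost everywhere by Fatou, hence everywhere since
both are continuous. The weighted pointwise bound passes to the limit too and will keep the data of
the rescaled unknown bounded. -/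
theorem IsApprox.regular {k : ℕ} (hk : 1 ≤ k) {f : ℝ → ℝ} {φ : ℕ → ℝ → ℝ} (hf : Continuous f)
    (hφ : IsApprox k f φ) : ContDiff ℝ (k - 1 : ℕ) f ∧
      (∀ i < k, TendstoUniformly (fun n => iteratedDeriv i (φ n)) (iteratedDeriv i f) atTop) ∧
      ∃ M, ∀ i < k, ∀ x, |iteratedDeriv i f x| * √(Real.cosh (2 * x)) ≤ M := by
  have hC : ∀ n, CompactCk k (φ n) := fun n => CompactCk.of_smooth (hφ.1 n)
  have hd : ∀ i < k, ∀ m n x, |iteratedDeriv i (φ m) x - iteratedDeriv i (φ n) x|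
      ≤ 3 * testNorm k (fun x => φ m x - φ n x) := by
    intro i hi m n x
    have := abs_iteratedDeriv_le_testNorm' ((hC m).sub (hC n)) (i := i) hi x
    rwa [iteratedDeriv_sub_of_le (hC m).1 (hC n).1 hi.le] at this
  have hpc : ∀ i < k, ∀ x, ∃ y, Tendsto (fun n => iteratedDeriv i (φ n) x) atTop (𝓝 y) := by
    intro i hi x
    refine cauchySeq_tendsto_of_complete (Metric.cauchySeq_iff.2 fun ε hε => ?_)
    obtain ⟨N, hN⟩ := hφ.2.1 (ε / 3) (by positivity)
    refine ⟨N, fun m hm n hn => (hd i hi m n x).trans_lt ?_⟩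
    linarith [hN m hm n hn]
  have hex : ∀ i x, ∃ y, i < k → Tendsto (fun n => iteratedDeriv i (φ n) x) atTop (𝓝 y) := by
    intro i x
    by_cases hi : i < k
    · exact (hpc i hi x).imp fun y hy _ => hy
    · exact ⟨0, fun h => absurd h hi⟩
  choose g hg using hex
  have hunif : ∀ i < k, TendstoUniformly (fun n => iteratedDeriv i (φ n)) (g i) atTop := by
    intro i hi
    rw [Metric.tendstoUniformly_iff]
    intro ε hε
    obtain ⟨N, hN⟩ := hφ.2.1 (ε / 6) (by positivity)
    filter_upwards [eventually_ge_atTop N] with n hn x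
    have h1 : Tendsto (fun m => |iteratedDeriv i (φ m) x - iteratedDeriv i (φ n) x|) atTop
        (𝓝 |g i x - iteratedDeriv i (φ n) x|) := ((hg i x hi).sub_const _).abs
    have h2 : |g i x - iteratedDeriv i (φ n) x| ≤ ε / 2 := by
      refine le_of_tendsto h1 ?_
      filter_upwards [eventually_ge_atTop N] with m hm
      linarith [hd i hi m n x, hN m hm n hn]
    rw [Real.dist_eq]; linarith
  have hgc : ∀ i < k, Continuous (g i) := fun i hi =>
    (hunif i hi).continuous (Frequently.of_forall fun n =>
      ((hC n).iteratedDeriv (i := i) (j := 0) (by omega)).1.continuous)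
  have hgd : ∀ i, i + 1 < k → ∀ x, HasDerivAt (g i) (g (i + 1) x) x := by
    intro i hi x
    refine hasDerivAt_of_tendstoUniformly (hunif (i + 1) hi) (Eventually.of_forall fun n x => ?_)
      (fun x => hg i x (by omega)) x
    have := ((hC n).iteratedDeriv (i := i) (j := 1) (by omega)).1
    rw [iteratedDeriv_succ]
    exact (this.differentiable (by norm_num) x).hasDerivAt
  have hg0 : g 0 = f := by
    have hp : ∀ x, Tendsto (fun n => ENNReal.ofReal ((φ n x - f x) ^ 2 * Real.cosh (2 * x))) atTop
        (𝓝 (ENNReal.ofReal ((g 0 x - f x) ^ 2 * Real.cosh (2 * x)))) := fun x => by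
      have := hg 0 x (by omega)
      simp only [iteratedDeriv_zero] at this
      exact (ENNReal.continuous_ofReal.tendsto _).comp (((this.sub_const _).pow 2).mul_const _)
    have hc0 := hgc 0 (by omega)
    have hle : ∫⁻ x, ENNReal.ofReal ((g 0 x - f x) ^ 2 * Real.cosh (2 * x)) ≤ 0 := by
      calc _ = ∫⁻ x, liminf (fun n => ENNReal.ofReal ((φ n x - f x) ^ 2 * Real.cosh (2 * x))) atTop :=
            lintegral_congr fun x => (hp x).liminf_eq.symm
        _ ≤ liminf (fun n => ∫⁻ x, ENNReal.ofReal ((φ n x - f x) ^ 2 * Real.cosh (2 * x))) atTop := by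
            refine lintegral_liminf_le fun n => ?_
            have c1 := (hφ.1 n).1.continuous
            exact (ENNReal.continuous_ofReal.comp (by fun_prop : Continuous fun x =>
              (φ n x - f x) ^ 2 * Real.cosh (2 * x))).measurable
        _ = 0 := hφ.2.2.liminf_eq
    have hcont : Continuous fun x => ENNReal.ofReal ((g 0 x - f x) ^ 2 * Real.cosh (2 * x)) :=
      ENNReal.continuous_ofReal.comp (by fun_prop)
    have h0 := (lintegral_eq_zero_iff hcont.measurable).1 (le_antisymm hle zero_le)
    have h1 := (hcont.ae_eq_iff_eq volume continuous_const).1 h0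
    funext x
    have h2 : ENNReal.ofReal ((g 0 x - f x) ^ 2 * Real.cosh (2 * x)) = 0 := congrFun h1 x
    rw [ENNReal.ofReal_eq_zero] at h2
    have h3 := Real.cosh_pos (2 * x)
    have h4 : (g 0 x - f x) ^ 2 ≤ 0 := by
      by_contra hcon
      push Not at hcon
      linarith [mul_pos hcon h3]
    have := pow_eq_zero_iff (two_ne_zero) |>.1 (le_antisymm h4 (sq_nonneg _))
    linarith
  have hit : ∀ i < k, iteratedDeriv i f = g i := by
    intro i
    induction i with
    | zero => intro _; rw [iteratedDeriv_zero, hg0]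
    | succ i ih =>
      intro hi
      rw [iteratedDeriv_succ, ih (by omega)]
      exact funext fun x => (hgd i hi x).deriv
  refine ⟨?_, fun i hi => by rw [hit i hi]; exact hunif i hi, ?_⟩
  · refine contDiff_nat_iff_iteratedDeriv.2 ⟨fun m hm => ?_, fun m hm => ?_⟩
    · rw [hit m (by omega)]; exact hgc m (by omega)
    · rw [hit m (by omega)]
      exact fun x => (hgd m (by omega) x).differentiableAt
  · refine ⟨3 * htNorm k f, fun i hi x => ?_⟩
    rw [hit i hi]
    exact le_of_tendsto_of_tendsto' ((hg i x hi).abs.mul_const _)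
      ((hφ.tendsto_htNorm hf).const_mul 3) fun n => abs_iteratedDeriv_le_testNorm (hC n) hi x

end

/-! ### Jet bounds and the weights e^{at} cosh(2x)^b -/

noncomputable section

/-- `f` is of class `C^n`, and its jet of order `n` is bounded by the weight `w`. -/
def JetLE (n : ℕ) (f w : ℝ × ℝ → ℝ) : Prop :=
  ContDiff ℝ n f ∧ ∀ p, jet {et, ex} n f p ≤ w p

theorem et_ne_ex : et ≠ ex := by simp [et, ex]

theorem jet_pair_succ (n : ℕ) (f : ℝ × ℝ → ℝ) (p : ℝ × ℝ) :
    jet {et, ex} (n + 1) f p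
      = |f p| + (jet {et, ex} n (pd et f) p + jet {et, ex} n (pd ex f) p) := by
  rw [jet, Finset.sum_pair et_ne_ex]

namespace JetLE

variable {n m : ℕ} {f g w w' : ℝ × ℝ → ℝ}

theorem nonneg (h : JetLE n f w) (p : ℝ × ℝ) : 0 ≤ w p := (jet_nonneg n f).trans (h.2 p)

theorem abs_le (h : JetLE n f w) (p : ℝ × ℝ) : |f p| ≤ w p := (abs_le_jet n f).trans (h.2 p)

theorem mono (h : JetLE n f w) (hw : ∀ p, w p ≤ w' p) : JetLE n f w' :=
  ⟨h.1, fun p => (h.2 p).trans (hw p)⟩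

theorem of_le (h : JetLE n f w) (hm : m ≤ n) : JetLE m f w :=
  ⟨contDiff_le h.1 hm, fun p => (jet_mono_order hm f).trans (h.2 p)⟩

theorem mul (hf : JetLE n f w) (hg : JetLE n g w') :
    JetLE n (fun p => f p * g p) (fun p => 3 ^ n * (w p * w' p)) := by
  refine ⟨hf.1.mul hg.1, fun p => (jet_mul_le n hf.1 hg.1).trans ?_⟩
  have := hf.nonneg p
  change _ ≤ 3 ^ n * (w p * w' p)
  gcongr
  · exact jet_nonneg _ _
  · exact hf.2 p
  · exact hg.2 p

theorem add (hf : JetLE n f w) (hg : JetLE n g w') :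
    JetLE n (fun p => f p + g p) (fun p => w p + w' p) :=
  ⟨hf.1.add hg.1, fun p => (jet_add_le n hf.1 hg.1).trans (add_le_add (hf.2 p) (hg.2 p))⟩

theorem sub (hf : JetLE n f w) (hg : JetLE n g w') :
    JetLE n (fun p => f p - g p) (fun p => w p + w' p) :=
  ⟨hf.1.sub hg.1, fun p => (jet_sub_le n hf.1 hg.1).trans (add_le_add (hf.2 p) (hg.2 p))⟩

theorem const_mul (c : ℝ) (hf : JetLE n f w) :
    JetLE n (fun p => c * f p) (fun p => |c| * w p) :=
  ⟨contDiff_const.mul hf.1, fun p => (jet_const_mul n c hf.1).trans_le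
    (mul_le_mul_of_nonneg_left (hf.2 p) (abs_nonneg c))⟩

theorem const (n : ℕ) (c : ℝ) : JetLE n (fun _ => c) (fun _ => |c|) :=
  ⟨contDiff_const, fun _ => (jet_const n c).le⟩

theorem pd_et (hf : JetLE (n + 1) f w) : JetLE n (pd et f) w :=
  ⟨contDiff_pd hf.1 _, fun p => (jet_pd_le (by simp) n f).trans (hf.2 p)⟩

theorem pd_ex (hf : JetLE (n + 1) f w) : JetLE n (pd ex f) w :=
  ⟨contDiff_pd hf.1 _, fun p => (jet_pd_le (by simp) n f).trans (hf.2 p)⟩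

theorem congr (hf : JetLE n f w) (h : ∀ p, w p = w' p) : JetLE n f w' :=
  hf.mono fun p => (h p).le

end JetLE

/-- Functions whose logarithmic derivatives have bounded jets. -/
theorem jet_le_of_log_deriv (K : ℝ) (n : ℕ) : ∃ C, 1 ≤ C ∧ ∀ (f a b : ℝ × ℝ → ℝ) (p : ℝ × ℝ),
    ContDiff ℝ n f → ContDiff ℝ n a → ContDiff ℝ n b →
    jet {et, ex} n a p ≤ K → jet {et, ex} n b p ≤ K →
    (∀ q, pd et f q = a q * f q) → (∀ q, pd ex f q = b q * f q) →
    jet {et, ex} n f p ≤ C * |f p| := by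
  induction n with
  | zero => exact ⟨1, le_rfl, fun f a b p _ _ _ _ _ _ _ => by simp [jet]⟩
  | succ n ih =>
    obtain ⟨C, hC, ih⟩ := ih
    refine ⟨1 + 2 * (3 ^ n * (|K| * C)), le_add_of_nonneg_right (by positivity),
      fun f a b p hf ha hb haK hbK hft hfx => ?_⟩
    have h1 := ih f a b p (contDiff_of_succ hf) (contDiff_of_succ ha) (contDiff_of_succ hb)
      ((jet_le_succ n a).trans haK) ((jet_le_succ n b).trans hbK) hft hfx
    have key : ∀ d : ℝ × ℝ → ℝ, ContDiff ℝ (n + 1 : ℕ) d → jet {et, ex} (n + 1) d p ≤ K →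
        jet {et, ex} n (fun q => d q * f q) p ≤ 3 ^ n * (|K| * C) * |f p| := by
      intro d hd hdK
      refine (jet_mul_le n (contDiff_of_succ hd) (contDiff_of_succ hf)).trans ?_
      calc _ ≤ 3 ^ n * (|K| * (C * |f p|)) := by
            gcongr
            · exact jet_nonneg _ _
            · exact ((jet_le_succ n d).trans hdK).trans (le_abs_self K)
        _ = _ := by ring
    rw [jet_pair_succ, funext hft, funext hfx]
    have := key a ha haK
    have := key b hb hbK
    linarith

theorem contDiff_fst' {n : WithTop ℕ∞} {f : ℝ → ℝ} (hf : ContDiff ℝ n f) :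
    ContDiff ℝ n fun p : ℝ × ℝ => f p.1 := hf.comp contDiff_fst

theorem contDiff_snd' {n : WithTop ℕ∞} {f : ℝ → ℝ} (hf : ContDiff ℝ n f) :
    ContDiff ℝ n fun p : ℝ × ℝ => f p.2 := hf.comp contDiff_snd

/-- Jets of functions of a linear form. -/
theorem jet_linear_le {a b : ℝ} (hab : |a| + |b| ≤ 2) (n : ℕ) : ∀ {f : ℝ → ℝ}, ContDiff ℝ n f →
    ∀ p : ℝ × ℝ, jet {et, ex} n (fun q => f (a * q.1 + b * q.2)) p
      ≤ 2 ^ n * ∑ i ∈ Finset.range (n + 1), |iteratedDeriv i f (a * p.1 + b * p.2)| := by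
  induction n with
  | zero => intro f _ p; simp [jet]
  | succ n ih =>
    intro f hf p
    have hf' : ContDiff ℝ n (deriv f) := by
      have : ContDiff ℝ ((n : WithTop ℕ∞) + 1) f := by exact_mod_cast hf
      exact (contDiff_succ_iff_deriv.1 this).2.2
    have hd : Differentiable ℝ f := hf.differentiable (by norm_cast)
    obtain ⟨h1, h2⟩ := pd_eq_of_partial (f := fun q : ℝ × ℝ => f (a * q.1 + b * q.2))
      (a := fun q => a * deriv f (a * q.1 + b * q.2))
      (b := fun q => b * deriv f (a * q.1 + b * q.2))
      (by have := hf'.continuous; fun_prop) (by have := hf'.continuous; fun_prop)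
      (fun t x => by
        have h := ((hasDerivAt_id t).const_mul a).add_const (b * x)
        have := (hd (a * t + b * x)).hasDerivAt.comp t h
        exact this.congr_deriv (by ring))
      (fun t x => by
        have h := ((hasDerivAt_id x).const_mul b).const_add (a * t)
        have := (hd (a * t + b * x)).hasDerivAt.comp x h
        exact this.congr_deriv (by ring))
    have hc : ContDiff ℝ n fun q : ℝ × ℝ => deriv f (a * q.1 + b * q.2) :=
      hf'.comp ((contDiff_const.mul contDiff_fst).add (contDiff_const.mul contDiff_snd))
    rw [jet_pair_succ, h1, h2, jet_const_mul n a hc, jet_const_mul n b hc, Finset.sum_range_succ',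
      ← add_mul]
    have h3 := ih hf' p
    have h4 := jet_nonneg (S := {et, ex}) (p := p) n fun q : ℝ × ℝ => deriv f (a * q.1 + b * q.2)
    simp only [iteratedDeriv_succ', iteratedDeriv_zero]
    set T := ∑ i ∈ Finset.range (n + 1), |iteratedDeriv i (deriv f) (a * p.1 + b * p.2)|
    have h5 : (1 : ℝ) ≤ 2 ^ (n + 1) := one_le_pow₀ (by norm_num)
    have h6 := mul_le_mul hab h3 h4 (by norm_num)
    have h7 := mul_le_mul_of_nonneg_right h5 (abs_nonneg (f (a * p.1 + b * p.2)))
    rw [pow_succ] at *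
    linarith

/-- The function `tanh (2x)` on the plane. -/
def th (p : ℝ × ℝ) : ℝ := Real.tanh (2 * p.2)

/-- The weights `e^{a t} cosh (2x)^b`. -/
def wt (a b : ℝ) (p : ℝ × ℝ) : ℝ := Real.exp (a * p.1) * Real.cosh (2 * p.2) ^ b

theorem contDiff_cosh2 {n : WithTop ℕ∞} : ContDiff ℝ n fun x : ℝ => Real.cosh (2 * x) :=
  Real.contDiff_cosh.comp (contDiff_const.mul contDiff_id)

theorem contDiff_th {n : WithTop ℕ∞} : ContDiff ℝ n th := by
  have : ContDiff ℝ n fun x : ℝ => Real.tanh (2 * x) := by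
    simp only [Real.tanh_eq_sinh_div_cosh]
    exact (Real.contDiff_sinh.comp (contDiff_const.mul contDiff_id)).div contDiff_cosh2
      fun x => (Real.cosh_pos _).ne'
  exact contDiff_snd' this

theorem contDiff_wt {n : WithTop ℕ∞} (a b : ℝ) : ContDiff ℝ n (wt a b) := by
  have h1 : ContDiff ℝ n fun p : ℝ × ℝ => Real.exp (a * p.1) :=
    Real.contDiff_exp.comp (contDiff_const.mul contDiff_fst)
  have h2 : ContDiff ℝ n fun p : ℝ × ℝ => Real.cosh (2 * p.2) ^ b :=
    contDiff_snd' (contDiff_cosh2.rpow_const_of_ne fun x => (Real.cosh_pos _).ne')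
  exact h1.mul h2

theorem wt_pos (a b : ℝ) (p : ℝ × ℝ) : 0 < wt a b p :=
  mul_pos (Real.exp_pos _) (Real.rpow_pos_of_pos (Real.cosh_pos _) _)

theorem wt_mul (a b a' b' : ℝ) (p : ℝ × ℝ) : wt a b p * wt a' b' p = wt (a + a') (b + b') p := by
  simp only [wt]
  rw [Real.rpow_add (Real.cosh_pos _), add_mul, Real.exp_add]
  ring

theorem wt_zero (p : ℝ × ℝ) : wt 0 0 p = 1 := by simp [wt]

theorem th_sq (p : ℝ × ℝ) : 1 - th p ^ 2 = wt 0 (-1) p ^ 2 := by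
  simp only [th, wt, zero_mul, Real.exp_zero, one_mul, Real.tanh_eq_sinh_div_cosh]
  rw [Real.rpow_neg_one]
  have h := (Real.cosh_pos (2 * p.2)).ne'
  have := Real.cosh_sq (2 * p.2)
  field_simp
  linarith

theorem abs_th_le (p : ℝ × ℝ) : |th p| ≤ 1 := by
  have := th_sq p
  exact abs_le_one_iff_mul_self_le_one.2 (by nlinarith [sq_nonneg (wt 0 (-1) p)])

theorem hasDerivAt_cosh2 (x : ℝ) :
    HasDerivAt (fun y => Real.cosh (2 * y)) (Real.sinh (2 * x) * 2) x := by
  have := (Real.hasDerivAt_cosh (2 * x)).comp x ((hasDerivAt_id x).const_mul 2)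
  exact this.congr_deriv (by ring)

theorem pd_th : pd et th = (fun _ => 0) ∧ pd ex th = fun p => 2 * (1 - th p * th p) := by
  refine pd_eq_of_partial continuous_const
    (by have := (contDiff_th (n := 1)).continuous; fun_prop) (fun t x => hasDerivAt_const t (Real.tanh (2 * x)))
    fun t x => ?_
  have h1 := (Real.hasDerivAt_sinh (2 * x)).comp x ((hasDerivAt_id x).const_mul 2)
  have hc := (Real.cosh_pos (2 * x)).ne'
  have := h1.div (hasDerivAt_cosh2 x) hc
  refine (this.congr_of_eventuallyEq (Eventually.of_forall fun y => ?_)).congr_deriv ?_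
  · simp [th, Real.tanh_eq_sinh_div_cosh]
  · simp only [th, Real.tanh_eq_sinh_div_cosh, Function.comp]
    field_simp

theorem pd_wt (a b : ℝ) :
    pd et (wt a b) = (fun p => a * wt a b p) ∧ pd ex (wt a b) = fun p => 2 * b * th p * wt a b p := by
  have hw := (contDiff_wt (n := 1) a b).continuous
  have ht := (contDiff_th (n := 1)).continuous
  refine pd_eq_of_partial (by fun_prop) (by fun_prop) (fun t x => ?_) fun t x => ?_
  · have h := ((hasDerivAt_id t).const_mul a).exp.mul_const (Real.cosh (2 * x) ^ b)
    exact h.congr_deriv (by simp [wt]; ring)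
  · have hc := Real.cosh_pos (2 * x)
    have h := ((hasDerivAt_cosh2 x).rpow_const (p := b) (Or.inl hc.ne')).const_mul (Real.exp (a * t))
    refine h.congr_deriv ?_
    simp only [wt, th, Real.tanh_eq_sinh_div_cosh]
    rw [Real.rpow_sub hc, Real.rpow_one]
    field_simp

/-- The identity ∂_x tanh(2x) = 2 (1 - tanh²(2x)) expresses the derivative through the function
itself and closes the induction. -/
theorem jetLE_th (n : ℕ) : ∃ C, 0 ≤ C ∧ JetLE n th fun _ => C := by
  induction n with
  | zero => exact ⟨1, zero_le_one, contDiff_th, fun p => abs_th_le p⟩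
  | succ n ih =>
    obtain ⟨C, hC, h⟩ := ih
    have h1 := ((JetLE.const n 1).sub (h.mul h)).const_mul 2
    refine ⟨1 + (0 + |2| * (|1| + 3 ^ n * (C * C))), by positivity, contDiff_th, fun p => ?_⟩
    rw [jet_pair_succ, pd_th.1, pd_th.2, jet_const, abs_zero]
    exact add_le_add (abs_th_le p) (add_le_add_right (h1.2 p) _)

/-- The logarithmic derivatives of the weight are the constant a and 2b tanh(2x), both with bounded
jets. -/
theorem jetLE_wt (a b : ℝ) (n : ℕ) : ∃ C, 1 ≤ C ∧ JetLE n (wt a b) fun p => C * wt a b p := by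
  obtain ⟨T, hT, h⟩ := jetLE_th n
  obtain ⟨C, hC, H⟩ := jet_le_of_log_deriv (max |a| (|2 * b| * T)) n
  have hb := h.const_mul (2 * b)
  refine ⟨C, hC, contDiff_wt a b, fun p => ?_⟩
  refine (H (wt a b) (fun _ => a) (fun p => 2 * b * th p) p (contDiff_wt a b) contDiff_const hb.1
    ((jet_const n a).trans_le (le_max_left _ _)) ((hb.2 p).trans (le_max_right _ _))
    (fun q => by rw [(pd_wt a b).1]) (fun q => by rw [(pd_wt a b).2])).trans_eq ?_
  rw [abs_of_pos (wt_pos a b p)]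

end

/-! ### The time cutoff and the jets of d'Alembert's solution -/

noncomputable section

/-- A smooth function equal to `e^{-2t}` for `t ≥ -1/32` and to `0` for `t ≤ -1/16`. -/
def theta (t : ℝ) : ℝ := Real.smoothTransition (2 + 32 * t) * Real.exp (-2 * t)

theorem contDiff_theta {n : ℕ} : ContDiff ℝ n theta :=
  (Real.smoothTransition.contDiff.comp (contDiff_const.add (contDiff_const.mul contDiff_id))).mul
    (Real.contDiff_exp.comp (contDiff_const.mul contDiff_id))

theorem theta_eq {t : ℝ} (ht : -1 / 32 ≤ t) : theta t = Real.exp (-2 * t) := by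
  rw [theta, Real.smoothTransition.one_of_one_le (by linarith), one_mul]

theorem theta_eq_zero {t : ℝ} (ht : t ≤ -1 / 16) : theta t = 0 := by
  rw [theta, Real.smoothTransition.zero_of_nonpos (by linarith), zero_mul]

theorem theta_nonneg (t : ℝ) : 0 ≤ theta t :=
  mul_nonneg (Real.smoothTransition.nonneg _) (Real.exp_pos _).le

theorem theta_le (t : ℝ) : theta t ≤ Real.exp (-2 * t) :=
  mul_le_of_le_one_left (Real.exp_pos _).le (Real.smoothTransition.le_one _)

/-- The bound 27/20 is what makes (2/3)(27/20) = 9/10 against |ρ| ≤ (2R₀/3)(1 + |t|). For t ≥ 0 the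
product is at most 1; the extension down to t = -1/16 costs at most e^{1/8} · 17/16, with e^{1/8} ≤
8/7. -/
theorem theta_mul_le (t : ℝ) : theta t * (1 + |t|) ≤ 27 / 20 := by
  rcases le_total t (-1 / 16) with h | h
  · rw [theta_eq_zero h]; norm_num
  rcases le_total 0 t with h0 | h0
  · rw [abs_of_nonneg h0]
    have h1 := theta_le t
    have h2 : Real.exp (-2 * t) * (1 + t) ≤ 1 := by
      have h3 := Real.add_one_le_exp t
      have h4 := Real.exp_pos (-2 * t)
      calc _ ≤ Real.exp (-2 * t) * Real.exp t := by nlinarith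
        _ = Real.exp (-t) := by rw [← Real.exp_add]; ring_nf
        _ ≤ 1 := Real.exp_le_one_iff.2 (by linarith)
    nlinarith
  · rw [abs_of_nonpos h0]
    have h1 : Real.exp (-2 * t) ≤ 8 / 7 := by
      calc _ ≤ Real.exp (1 / 8) := Real.exp_le_exp.2 (by linarith)
        _ ≤ 1 / (1 - 1 / 8) := Real.exp_bound_div_one_sub_of_interval (by norm_num) (by norm_num)
        _ = 8 / 7 := by norm_num
    have h2 := theta_nonneg t
    have h3 := theta_le t
    nlinarith

/-- For t > 1 the function is an explicit exponential, for t < -1 it vanishes, and in between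
compactness gives the bound. -/
theorem abs_iteratedDeriv_theta_le (i : ℕ) :
    ∃ C, 0 ≤ C ∧ ∀ t, |iteratedDeriv i theta t| ≤ C * Real.exp (-2 * |t|) := by
  have hc : Continuous fun t => |iteratedDeriv i theta t| * Real.exp (2 * |t|) := by
    have := (contDiff_theta (n := i)).continuous_iteratedDeriv' i
    fun_prop
  obtain ⟨M, hM⟩ := (isCompact_Icc (a := (-1 : ℝ)) (b := 1)).exists_bound_of_continuousOn
    hc.continuousOn
  refine ⟨max M (2 ^ i), le_max_of_le_right (by positivity), fun t => ?_⟩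
  have hE := Real.exp_pos (-2 * |t|)
  rcases lt_or_ge 1 t with h | h
  · have h1 : theta =ᶠ[𝓝 t] fun t => Real.exp (-2 * t) := by
      filter_upwards [lt_mem_nhds h] with s hs using theta_eq (by linarith)
    rw [h1.iteratedDeriv_eq, iteratedDeriv_exp_const_mul, abs_mul, abs_pow, Real.abs_exp,
      abs_of_pos (by linarith : 0 < t)]
    gcongr
    exact (by norm_num : |(-2 : ℝ)| ^ i = 2 ^ i).trans_le (le_max_right _ _)
  rcases lt_or_ge t (-1) with h' | h'
  · have h1 : theta =ᶠ[𝓝 t] fun _ => 0 := by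
      filter_upwards [gt_mem_nhds h'] with s hs using theta_eq_zero (by linarith)
    rw [h1.iteratedDeriv_eq]
    have : iteratedDeriv i (fun _ : ℝ => (0 : ℝ)) t = 0 := by
      simp
    rw [this, abs_zero]
    exact mul_nonneg (le_max_of_le_right (by positivity)) hE.le
  · have h1 := hM t ⟨h', h⟩
    rw [Real.norm_eq_abs, abs_of_nonneg (by positivity)] at h1
    calc _ = |iteratedDeriv i theta t| * Real.exp (2 * |t|) * Real.exp (-2 * |t|) := by
          rw [mul_assoc, ← Real.exp_add]; simp
      _ ≤ M * Real.exp (-2 * |t|) := by gcongr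
      _ ≤ _ := by gcongr; exact le_max_left _ _

theorem jetLE_theta (n : ℕ) : ∃ C, 0 ≤ C ∧
    JetLE n (fun p => theta p.1) fun p => C * Real.exp (-2 * |p.1|) := by
  choose C hC H using abs_iteratedDeriv_theta_le
  refine ⟨2 ^ n * ∑ i ∈ Finset.range (n + 1), C i,
    mul_nonneg (by positivity) (Finset.sum_nonneg fun i _ => hC i), contDiff_fst' contDiff_theta,
    fun p => ?_⟩
  have h := jet_linear_le (a := 1) (b := 0) (by norm_num) n (contDiff_theta (n := n)) p
  simp only [one_mul, zero_mul, add_zero] at h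
  refine h.trans ?_
  change _ ≤ (2 ^ n * ∑ i ∈ Finset.range (n + 1), C i) * Real.exp (-2 * |p.1|)
  rw [mul_assoc, Finset.sum_mul]
  gcongr with i
  exact H i _

/-- The jets of d'Alembert's solution grow at most linearly in time. -/
theorem jetLE_dalembert {N : ℕ} {f g : ℝ → ℝ} {m : ℝ} (hf : ContDiff ℝ (N + 1 : ℕ) f)
    (hg : ContDiff ℝ N g) (hfm : ∀ i ≤ N + 1, ∀ x, |iteratedDeriv i f x| ≤ m)
    (hgm : ∀ i ≤ N, ∀ x, |iteratedDeriv i g x| ≤ m) :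
    JetLE (N + 1) (dalembert f g) fun p => (1 + 4 * (2 ^ N * (N + 1))) * m * (1 + |p.1|) := by
  have hf' : ContDiff ℝ N (deriv f) := by
    have : ContDiff ℝ ((N : WithTop ℕ∞) + 1) f := by exact_mod_cast hf
    exact (contDiff_succ_iff_deriv.1 this).2.2
  obtain ⟨h1, h2, h3⟩ := dalembert_spec hf hg
  have key : ∀ (e : ℝ) (h : ℝ → ℝ), |e| ≤ 1 → ContDiff ℝ N h →
      (∀ i ≤ N, ∀ x, |iteratedDeriv i h x| ≤ m) →
      JetLE N (trav e h) fun _ => 2 ^ N * ((N + 1) * m) := by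
    intro e h he hh hm
    refine ⟨contDiff_trav e hh, fun p => ?_⟩
    have h4 := jet_linear_le (a := e) (b := 1) (by rw [abs_one]; linarith) N hh p
    have h5 : (fun q : ℝ × ℝ => h (e * q.1 + 1 * q.2)) = trav e h := by
      funext q; simp only [trav]; ring_nf
    rw [h5] at h4
    refine h4.trans ?_
    change _ ≤ 2 ^ N * ((N + 1) * m)
    gcongr
    calc _ ≤ ∑ _i ∈ Finset.range (N + 1), m :=
          Finset.sum_le_sum fun i hi => hm i (by simp at hi; omega) _
      _ = _ := by simp
  have kf := fun (e : ℝ) (he : |e| ≤ 1) => key e (deriv f) he hf' fun i hi x => by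
    rw [← iteratedDeriv_succ']; exact hfm (i + 1) (by omega) x
  have kg := fun (e : ℝ) (he : |e| ≤ 1) => key e g he hg hgm
  have a1 : |(1 : ℝ)| ≤ 1 := by simp
  have a2 : |(-1 : ℝ)| ≤ 1 := by simp
  have k1 := ((((kf 1 a1).add (kg 1 a1)).sub (kf (-1) a2)).add (kg (-1) a2)).const_mul (1 / 2)
  have k2 := ((((kf 1 a1).add (kg 1 a1)).add (kf (-1) a2)).sub (kg (-1) a2)).const_mul (1 / 2)
  have m0 : 0 ≤ m := (abs_nonneg _).trans (hfm 0 (by omega) 0)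
  refine ⟨h1, fun p => ?_⟩
  have b1 := k1.2 p
  have b2 := k2.2 p
  have b3 := abs_dalembert_le (f := f) (g := g) (M := m) (N := m)
    (fun x => by simpa using hfm 0 (by omega) x) (fun x => by simpa using hgm 0 (by omega) x)
    hg.continuous p
  rw [jet_pair_succ, h2, h3]
  simp only [div_eq_inv_mul] at *
  rw [abs_of_pos (by norm_num : (0 : ℝ) < 2⁻¹ * 1)] at b1 b2
  simp only [mul_one] at *
  have b4 : 0 ≤ 2 ^ N * ((N + 1) * m) := by positivity
  have b5 : 0 ≤ 2 ^ N * ((N + 1) * m) * |p.1| := by positivity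
  linarith

/-- For y = (1 + σ)^{-1/2} the identity ∂y = -y³ ∂σ / 2 closes an induction which uses only a
pointwise bound for y and the jet of σ. -/
theorem jet_inv_sqrt (K : ℝ) (n : ℕ) : ∃ C, 0 ≤ C ∧ ∀ (σ y : ℝ × ℝ → ℝ) (p : ℝ × ℝ),
    ContDiff ℝ n σ → ContDiff ℝ n y → |y p| ≤ 4 → jet {et, ex} n σ p ≤ K →
    (1 ≤ n → ∀ v q, pd v y q = -(1 / 2) * (y q * (y q * (y q * pd v σ q)))) →
    jet {et, ex} n y p ≤ C := by
  induction n with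
  | zero => exact ⟨4, by norm_num, fun σ y p _ _ h _ _ => h⟩
  | succ n ih =>
    obtain ⟨C, hC, ih⟩ := ih
    set D := 1 / 2 * (3 ^ n * (C * (3 ^ n * (C * (3 ^ n * (C * |K|))))))
    have hD : 0 ≤ D := by positivity
    refine ⟨4 + 2 * D, by positivity, fun σ y p hσ hy hy4 hK hd => ?_⟩
    have h1 := ih σ y p (contDiff_of_succ hσ) (contDiff_of_succ hy) hy4
      ((jet_le_succ n σ).trans hK) (fun _ => hd (by omega))
    have hyn := contDiff_of_succ hy
    have key : ∀ v ∈ ({et, ex} : Finset (ℝ × ℝ)), jet {et, ex} n (pd v y) p ≤ D := by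
      intro v hv
      have hs := contDiff_pd hσ v
      rw [funext (hd (by omega) v), jet_const_mul n _ (hyn.mul (hyn.mul (hyn.mul hs)))]
      have hj := jet_nonneg (S := {et, ex}) (p := p) n y
      have i1 := (jet_mul_le (S := {et, ex}) (p := p) n hyn hs).trans
        (mul_le_mul_of_nonneg_left (mul_le_mul h1 (((jet_pd_le hv n σ).trans hK).trans (le_abs_self K))
          (jet_nonneg _ _) hC) (by positivity))
      have i2 := (jet_mul_le (S := {et, ex}) (p := p) n hyn (hyn.mul hs)).trans
        (mul_le_mul_of_nonneg_left (mul_le_mul h1 i1 (jet_nonneg _ _) hC) (by positivity))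
      have i3 := (jet_mul_le (S := {et, ex}) (p := p) n hyn (hyn.mul (hyn.mul hs))).trans
        (mul_le_mul_of_nonneg_left (mul_le_mul h1 i2 (jet_nonneg _ _) hC) (by positivity))
      rw [show |(-(1 / 2) : ℝ)| = 1 / 2 by norm_num]
      exact mul_le_mul_of_nonneg_left i3 (by norm_num)
    rw [jet_pair_succ]
    have := key et (by simp)
    have := key ex (by simp)
    linarith

end

/-! ### Coefficients of the rescaled equation -/

noncomputable section

/-- The decay rate `(1 + |t|) e^{-|t|}`. -/
def bet (t : ℝ) : ℝ := (1 + |t|) * Real.exp (-|t|)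

theorem bet_pos (t : ℝ) : 0 < bet t := mul_pos (by positivity) (Real.exp_pos _)

theorem bet_le_one (t : ℝ) : bet t ≤ 1 := by
  have h1 := Real.add_one_le_exp |t|
  calc _ ≤ Real.exp |t| * Real.exp (-|t|) := by
        unfold bet; gcongr; linarith
    _ = 1 := by rw [← Real.exp_add]; simp

/-- The relative perturbation of the area function, cut off in the past. -/
def sig (R₀ : ℝ) (ρ : ℝ × ℝ → ℝ) (p : ℝ × ℝ) : ℝ := R₀⁻¹ * (theta p.1 * (ρ p * wt 0 (-1) p))

/-- The function `(1 + σ)^{-1/2}`. -/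
def invSqrt (σ : ℝ × ℝ → ℝ) (p : ℝ × ℝ) : ℝ := (√(1 + σ p))⁻¹

/-- The perturbation of the potential. -/
def potQ (σ : ℝ × ℝ → ℝ) (p : ℝ × ℝ) : ℝ :=
  pd et σ p * (invSqrt σ p * invSqrt σ p) - th p * (pd ex σ p * (invSqrt σ p * invSqrt σ p))
    + 1 / 4 * ((pd et σ p * pd et σ p - pd ex σ p * pd ex σ p)
      * ((invSqrt σ p * invSqrt σ p) * (invSqrt σ p * invSqrt σ p)))

/-- The source term of the rescaled equation. -/
def srcG (R₀ W₀ : ℝ) (σ : ℝ × ℝ → ℝ) (p : ℝ × ℝ) : ℝ :=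
  W₀ * √R₀ * (wt 1 (-1 / 2) p * (invSqrt σ p * pd ex σ p))

/-- The rescaling factor `R^{-1/2}`. -/
def resc (R₀ : ℝ) (σ : ℝ × ℝ → ℝ) (p : ℝ × ℝ) : ℝ :=
  (√R₀)⁻¹ * (wt (-1) (-1 / 2) p * invSqrt σ p)

/-- The inverse rescaling factor `R^{1/2}`. -/
def rescInv (R₀ : ℝ) (σ : ℝ × ℝ → ℝ) (p : ℝ × ℝ) : ℝ :=
  √R₀ * (wt 1 (1 / 2) p * ((1 + σ p) * invSqrt σ p))

variable {σ : ℝ × ℝ → ℝ} {n : ℕ}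

theorem invSqrt_mul_self {p : ℝ × ℝ} (h : 1 / 10 ≤ 1 + σ p) :
    invSqrt σ p * invSqrt σ p * (1 + σ p) = 1 := by
  have h0 : 0 < 1 + σ p := by linarith
  have h1 : √(1 + σ p) ≠ 0 := (Real.sqrt_pos.2 h0).ne'
  unfold invSqrt
  nth_rewrite 3 [← Real.mul_self_sqrt h0.le]
  field_simp

theorem contDiff_invSqrt (hσ : ContDiff ℝ n σ) (h : ∀ p, 1 / 10 ≤ 1 + σ p) :
    ContDiff ℝ n (invSqrt σ) :=
  ((contDiff_const.add hσ).sqrt fun p => by linarith [h p]).inv fun p =>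
    (Real.sqrt_pos.2 (by linarith [h p])).ne'

theorem pd_invSqrt (hσ : Differentiable ℝ σ) (h : ∀ p, 1 / 10 ≤ 1 + σ p) (v q : ℝ × ℝ) :
    pd v (invSqrt σ) q
      = -(1 / 2) * (invSqrt σ q * (invSqrt σ q * (invSqrt σ q * pd v σ q))) := by
  have h0 : 0 < 1 + σ q := by linarith [h q]
  have h1 : √(1 + σ q) ≠ 0 := (Real.sqrt_pos.2 h0).ne'
  have hd : HasDerivAt (fun s : ℝ => q + s • v) v 0 := by
    simpa using ((hasDerivAt_id (0 : ℝ)).smul_const v).const_add q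
  have e0 : q + (0 : ℝ) • v = q := by simp
  have hs := hasDerivAt_comp_pd (f := σ) (hσ _) hd
  rw [e0] at hs
  have h2 : HasDerivAt (fun s : ℝ => invSqrt σ (q + s • v))
      (-(1 / 2) * (invSqrt σ q * (invSqrt σ q * (invSqrt σ q * pd v σ q)))) 0 := by
    have h3 := ((hs.const_add 1).sqrt (by rw [e0]; exact h0.ne')).inv (by rw [e0]; exact h1)
    refine h3.congr_deriv ?_
    simp only [e0, invSqrt]
    field_simp
  have hy : DifferentiableAt ℝ (invSqrt σ) (q + (0 : ℝ) • v) := by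
    rw [e0]
    exact (((hσ q).const_add 1).sqrt h0.ne').inv h1
  have h4 := hasDerivAt_comp_pd (f := invSqrt σ) (g := fun s : ℝ => q + s • v) hy hd
  rw [e0] at h4
  exact h4.unique h2

theorem jetLE_invSqrt (K : ℝ) (n : ℕ) : ∃ C, 0 ≤ C ∧ ∀ σ : ℝ × ℝ → ℝ,
    JetLE n σ (fun _ => K) → (∀ p, 1 / 10 ≤ 1 + σ p) → JetLE n (invSqrt σ) fun _ => C := by
  obtain ⟨C, hC, H⟩ := jet_inv_sqrt K n
  refine ⟨C, hC, fun σ hσ h => ?_⟩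
  have hy := contDiff_invSqrt hσ.1 h
  refine ⟨hy, fun p => H σ _ p hσ.1 hy ?_ (hσ.2 p) fun hn v q =>
    pd_invSqrt (hσ.1.differentiable (by norm_cast; omega)) h v q⟩
  have h1 := invSqrt_mul_self (h p)
  have h2 := h p
  -- From 1 + σ ≥ 1/10 one has y² ≤ 10 < 16.
  refine abs_le_of_sq_le_sq ?_ (by norm_num)
  nlinarith [sq_nonneg (invSqrt σ p)]

theorem resc_mul_rescInv {R₀ : ℝ} (hR : 0 < R₀) (h : ∀ p, 1 / 10 ≤ 1 + σ p) (p : ℝ × ℝ) :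
    resc R₀ σ p * rescInv R₀ σ p = 1 := by
  have h1 := invSqrt_mul_self (h p)
  have h2 := wt_mul (-1) (-1 / 2) 1 (1 / 2) p
  norm_num [wt_zero] at h2
  have h3 : (√R₀)⁻¹ * √R₀ = 1 := inv_mul_cancel₀ (Real.sqrt_pos.2 hR).ne'
  calc _ = ((√R₀)⁻¹ * √R₀) * (wt (-1) (-1 / 2) p * wt 1 (1 / 2) p)
        * (invSqrt σ p * invSqrt σ p * (1 + σ p)) := by unfold resc rescInv; ring
    _ = 1 := by rw [h1, h3]; norm_num [h2]

theorem wt_neg_one_le_one {b : ℝ} (hb : b ≤ 0) (p : ℝ × ℝ) : wt 0 b p ≤ 1 := by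
  simp only [wt, zero_mul, Real.exp_zero, one_mul]
  exact Real.rpow_le_one_of_one_le_of_nonpos (Real.one_le_cosh _) hb

theorem exp_two_abs (t : ℝ) :
    (1 + |t|) * Real.exp (-2 * |t|) = bet t * Real.exp (-|t|) := by
  rw [bet, mul_assoc, ← Real.exp_add]; ring_nf

/-- Bounds for the relative perturbation. -/
theorem sig_bounds {R₀ : ℝ} (hR : 0 < R₀) (K : ℝ) (hK : 0 ≤ K) (n : ℕ) :
    ∃ C, 0 ≤ C ∧ ∀ (ρ : ℝ × ℝ → ℝ) (m m₀ : ℝ), 0 ≤ m → m₀ < 2 * R₀ / 3 →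
      JetLE n ρ (fun p => K * m * (1 + |p.1|)) → (∀ p, |ρ p| ≤ m₀ * (1 + |p.1|)) →
      (∀ p, 1 / 10 ≤ 1 + sig R₀ ρ p) ∧
      JetLE n (sig R₀ ρ) fun p => C * m * (bet p.1 * Real.exp (-|p.1|) * wt 0 (-1) p) := by
  obtain ⟨C1, h1, H1⟩ := jetLE_theta n
  obtain ⟨C2, h2, H2⟩ := jetLE_wt 0 (-1) n
  refine ⟨R₀⁻¹ * (3 ^ n * (C1 * (3 ^ n * (K * C2)))), by positivity,
    fun ρ m m₀ hm hm₀ hρ hρ₀ => ⟨fun p => ?_, ?_⟩⟩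
  · have hw := wt_pos 0 (-1) p
    have hw1 := wt_neg_one_le_one (b := -1) (by norm_num) p
    have ht := theta_nonneg p.1
    have ht1 := theta_mul_le p.1
    -- This is where m₀ < 2R₀/3 is used: the cutoff exponential beats the linear growth of ρ,
    -- leaving (2/3)(27/20) = 9/10.
    have h3 : |sig R₀ ρ p| ≤ 9 / 10 := by
      unfold sig
      rw [abs_mul, abs_mul, abs_mul, abs_of_pos hw, abs_of_nonneg ht, abs_of_pos (inv_pos.2 hR)]
      calc _ ≤ R₀⁻¹ * (theta p.1 * ((2 * R₀ / 3 * (1 + |p.1|)) * 1)) := by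
            gcongr
            exact (hρ₀ p).trans (by gcongr)
        _ = 2 / 3 * (theta p.1 * (1 + |p.1|)) := by field_simp
        _ ≤ 9 / 10 := by linarith
    linarith [neg_abs_le (sig R₀ ρ p)]
  · refine ((H1.mul (hρ.mul H2)).const_mul R₀⁻¹).congr fun p => ?_
    rw [abs_of_pos (inv_pos.2 hR), ← exp_two_abs]
    ring

/-- The inverse factor uses √(1 + σ) = (1 + σ) (1 + σ)^{-1/2}, so the jets of (1 + σ)^{-1/2} serve
for both. -/
theorem jetLE_resc {R₀ : ℝ} (K : ℝ) (n : ℕ) : ∃ C, 0 ≤ C ∧ ∀ σ : ℝ × ℝ → ℝ,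
    JetLE n σ (fun _ => K) → (∀ p, 1 / 10 ≤ 1 + σ p) →
    JetLE n (resc R₀ σ) (fun p => C * wt (-1) (-1 / 2) p) ∧
    JetLE n (rescInv R₀ σ) (fun p => C * wt 1 (1 / 2) p) := by
  obtain ⟨C1, h1, H1⟩ := jetLE_invSqrt K n
  obtain ⟨C2, h2, H2⟩ := jetLE_wt (-1) (-1 / 2) n
  obtain ⟨C3, h3, H3⟩ := jetLE_wt 1 (1 / 2) n
  refine ⟨max (|(√R₀)⁻¹| * (3 ^ n * (C2 * C1)))
    (|√R₀| * (3 ^ n * (C3 * (3 ^ n * ((|1| + K) * C1))))), le_max_of_le_left (by positivity),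
    fun σ hσ h => ⟨?_, ?_⟩⟩
  · refine ((H2.mul (H1 σ hσ h)).const_mul _).mono fun p => ?_
    refine le_of_eq_of_le ?_ (mul_le_mul_of_nonneg_right (le_max_left _ _) (wt_pos _ _ p).le)
    ring
  · refine ((H3.mul (((JetLE.const n 1).add hσ).mul (H1 σ hσ h))).const_mul _).mono fun p => ?_
    refine le_of_eq_of_le ?_ (mul_le_mul_of_nonneg_right (le_max_right _ _) (wt_pos _ _ p).le)
    ring

theorem exp_mul_exp_neg_abs_le (t : ℝ) : Real.exp t * Real.exp (-|t|) ≤ 1 := by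
  rw [← Real.exp_add]
  exact Real.exp_le_one_iff.2 (by linarith [le_abs_self t])

/-- Bounds for the potential and the source. -/
theorem pot_src_bounds (R₀ W₀ K B : ℝ) (hK : 0 ≤ K) (hB : 0 ≤ B) (n : ℕ) :
    ∃ C, 0 ≤ C ∧ ∀ (σ : ℝ × ℝ → ℝ) (m : ℝ), 0 ≤ m → m ≤ B →
      JetLE (n + 1) σ (fun p => K * m * (bet p.1 * Real.exp (-|p.1|) * wt 0 (-1) p)) →
      (∀ p, 1 / 10 ≤ 1 + σ p) →
      JetLE n (potQ σ) (fun p => C * (bet p.1 * wt 0 (-1) p)) ∧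
      JetLE n (srcG R₀ W₀ σ) fun p => C * m * (bet p.1 * (wt 0 (-1 / 2) p * wt 0 (-1) p)) := by
  obtain ⟨C1, h1, H1⟩ := jetLE_invSqrt (K * B) n
  obtain ⟨T, hT, HT⟩ := jetLE_th n
  obtain ⟨C2, h2, H2⟩ := jetLE_wt 1 (-1 / 2) n
  set CQ := 3 ^ n * (K * B * (3 ^ n * (C1 * C1)))
    + 3 ^ n * (T * (3 ^ n * (K * B * (3 ^ n * (C1 * C1)))))
    + |1 / 4| * (3 ^ n * ((3 ^ n * (K * B * (K * B)) + 3 ^ n * (K * B * (K * B)))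
      * (3 ^ n * (3 ^ n * (C1 * C1) * (3 ^ n * (C1 * C1)))))) with hCQ
  set CG := |W₀ * √R₀| * (3 ^ n * (C2 * (3 ^ n * (C1 * K)))) with hCG
  have hCQ0 : 0 ≤ CQ := by positivity
  have hCG0 : 0 ≤ CG := by positivity
  refine ⟨max CQ CG, le_max_of_le_left hCQ0, fun σ m hm hmB hσ h => ?_⟩
  have hb : ∀ p : ℝ × ℝ, 0 ≤ bet p.1 * wt 0 (-1) p := fun p =>
    mul_nonneg (bet_pos _).le (wt_pos _ _ _).le
  have hb1 : ∀ p : ℝ × ℝ, bet p.1 * wt 0 (-1) p ≤ 1 := fun p =>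
    mul_le_one₀ (bet_le_one _) (wt_pos _ _ _).le (wt_neg_one_le_one (by norm_num) p)
  have hE : ∀ p : ℝ × ℝ, Real.exp (-|p.1|) ≤ 1 := fun p =>
    Real.exp_le_one_iff.2 (by linarith [abs_nonneg p.1])
  -- For the potential the factor m is replaced by its bound B and the surplus e^{-|t|} is
  -- discarded. The source keeps both: the exponential compensates the e^t in `srcG`, and m makes
  -- the final estimate linear in the perturbation of R.
  have hσ1 : JetLE (n + 1) σ fun p => K * B * (bet p.1 * wt 0 (-1) p) := hσ.mono fun p => by
    have := hb p
    calc _ = K * m * (bet p.1 * wt 0 (-1) p) * Real.exp (-|p.1|) := by ring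
      _ ≤ K * m * (bet p.1 * wt 0 (-1) p) * 1 := by gcongr; exact hE p
      _ ≤ _ := by rw [mul_one]; gcongr
  have hσ2 : JetLE (n + 1) σ fun _ => K * B := hσ1.mono fun p =>
    mul_le_of_le_one_right (by positivity) (hb1 p)
  have hy := H1 σ (hσ2.of_le n.le_succ) h
  have st := hσ1.pd_et
  have sx := hσ1.pd_ex
  constructor
  · have y2 := hy.mul hy
    refine (((st.mul y2).sub (HT.mul (sx.mul y2))).add ((((st.mul st).sub (sx.mul sx)).mul
      (y2.mul y2)).const_mul (1 / 4))).mono fun p => ?_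
    have e1 := hb p
    have e2 := hb1 p
    set b := bet p.1 * wt 0 (-1) p
    -- The part of the potential quadratic in the derivatives of σ is no larger than the linear
    -- part, since b ≤ 1.
    have e3 : b * b ≤ b := mul_le_of_le_one_left e1 e2
    have e4 : CQ * b ≤ max CQ CG * b := mul_le_mul_of_nonneg_right (le_max_left _ _) e1
    have e5 := mul_le_mul_of_nonneg_left e3 (a := |1 / 4| * (3 ^ n * ((3 ^ n * (K * B * (K * B))
      + 3 ^ n * (K * B * (K * B))) * (3 ^ n * (3 ^ n * (C1 * C1) * (3 ^ n * (C1 * C1))))))) (by positivity)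
    refine le_trans ?_ e4
    rw [hCQ]
    linarith
  · refine ((H2.mul (hy.mul hσ.pd_ex)).const_mul (W₀ * √R₀)).mono fun p => ?_
    have e0 : wt 1 (-1 / 2) p = Real.exp p.1 * wt 0 (-1 / 2) p := by simp [wt]
    have e1 := hb p
    have e2 := exp_mul_exp_neg_abs_le p.1
    have e3 := (wt_pos 0 (-1 / 2) p).le
    calc _ = CG * m * (wt 0 (-1 / 2) p * (bet p.1 * wt 0 (-1) p))
          * (Real.exp p.1 * Real.exp (-|p.1|)) := by rw [e0, hCG]; ring
      _ ≤ CG * m * (wt 0 (-1 / 2) p * (bet p.1 * wt 0 (-1) p)) * 1 := by gcongr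
      _ ≤ max CQ CG * m * (wt 0 (-1 / 2) p * (bet p.1 * wt 0 (-1) p)) := by
          rw [mul_one]; gcongr; exact le_max_right _ _
      _ = _ := by ring

end

/-! ### The rescaling identity -/

noncomputable section

variable {a A u : ℝ × ℝ → ℝ} {v : ℝ × ℝ}

theorem pd_log_mul (hA : Differentiable ℝ A) (hu : Differentiable ℝ u)
    (h : pd v A = fun q => a q * A q) :
    pd v (fun q => A q * u q) = fun q => A q * (pd v u q + a q * u q) := by
  rw [pd_mul v hA hu, h]
  funext q; ring

theorem pd_pd_log_mul (hA : ContDiff ℝ 1 A) (ha : ContDiff ℝ 1 a) (hu : ContDiff ℝ 2 u)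
    (h : pd v A = fun q => a q * A q) :
    pd v (pd v fun q => A q * u q) = fun q => A q * (pd v (pd v u) q + 2 * a q * pd v u q
      + (pd v a q + a q ^ 2) * u q) := by
  have dA := hA.differentiable one_ne_zero
  have da := ha.differentiable one_ne_zero
  have du := hu.differentiable two_ne_zero
  have du' : Differentiable ℝ (pd v u) := fun q => differentiableAt_pd hu.contDiffAt v
  rw [pd_log_mul dA du h, pd_log_mul dA (du'.fun_add (da.fun_mul du)) h,
    pd_add v du' (da.fun_mul du), pd_mul v da du]
  funext q; ring

theorem pd_eventuallyEq {f g : ℝ × ℝ → ℝ} {p : ℝ × ℝ} (h : f =ᶠ[𝓝 p] g) (v : ℝ × ℝ) :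
    pd v f =ᶠ[𝓝 p] pd v g := by
  filter_upwards [h.fderiv (𝕜 := ℝ)] with q hq
  simp [pd, hq]

/-- The background function `W_b` on the plane. -/
def planeWb (W₀ W₁ : ℝ) (p : ℝ × ℝ) : ℝ := Wb W₀ W₁ p.1 p.2

/-- The background area function on the plane. -/
def planeRb (R₀ : ℝ) (p : ℝ × ℝ) : ℝ := Rb R₀ p.1 p.2

theorem planeRb_eq (R₀ : ℝ) : planeRb R₀ = fun p => R₀ * wt 2 1 p := by
  funext p; simp [planeRb, Rb, wt]; ring

theorem contDiff_planeRb {n : ℕ} (R₀ : ℝ) : ContDiff ℝ n (planeRb R₀) := by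
  rw [planeRb_eq]; exact contDiff_const.mul (contDiff_wt 2 1)

theorem contDiff_planeWb {n : ℕ} (W₀ W₁ : ℝ) : ContDiff ℝ n (planeWb W₀ W₁) := by
  have : ContDiff ℝ n fun p : ℝ × ℝ => Real.arctan (Real.exp (2 * p.2)) :=
    Real.contDiff_arctan.comp (Real.contDiff_exp.comp (contDiff_const.mul contDiff_snd))
  exact contDiff_const.add (contDiff_const.mul this)

theorem pd_planeWb (W₀ W₁ : ℝ) : pd et (planeWb W₀ W₁) = (fun _ => 0) ∧
    pd ex (planeWb W₀ W₁) = fun p => W₀ * wt 0 (-1) p := by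
  have hw := (contDiff_wt (n := 1) 0 (-1)).continuous
  refine pd_eq_of_partial continuous_const (by fun_prop)
    (fun t x => hasDerivAt_const t (Wb W₀ W₁ 0 x)) fun t x => ?_
  have h := ((((hasDerivAt_id x).const_mul 2).exp).arctan.const_mul W₀).const_add W₁
  refine h.congr_deriv ?_
  simp only [wt, id, mul_one, Real.rpow_neg_one, Real.cosh_eq, zero_mul, Real.exp_zero, one_mul,
    Real.exp_neg]
  have := Real.exp_pos (2 * x)
  field_simp
  ring

theorem pd_pd_planeWb (W₀ W₁ : ℝ) : pd et (pd et (planeWb W₀ W₁)) = (fun _ => 0) ∧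
    pd ex (pd ex (planeWb W₀ W₁)) = fun p => -2 * W₀ * th p * wt 0 (-1) p := by
  constructor
  · rw [(pd_planeWb W₀ W₁).1, pd_const]
  · rw [(pd_planeWb W₀ W₁).2, pd_mul ex (differentiable_const _)
      ((contDiff_wt (n := 1) 0 (-1)).differentiable one_ne_zero), pd_const, (pd_wt 0 (-1)).2]
    funext p; ring

theorem pd_planeRb (R₀ : ℝ) : pd et (planeRb R₀) = (fun p => 2 * planeRb R₀ p) ∧
    pd ex (planeRb R₀) = fun p => 2 * th p * planeRb R₀ p := by
  have hw := (contDiff_wt (n := 1) 2 1).differentiable one_ne_zero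
  constructor <;> rw [planeRb_eq, pd_mul _ (differentiable_const _) hw, pd_const]
  · rw [(pd_wt 2 1).1]; funext p; ring
  · rw [(pd_wt 2 1).2]; funext p; ring

theorem pd_pd_planeRb (R₀ : ℝ) (p : ℝ × ℝ) :
    pd ex (pd ex (planeRb R₀)) p = pd et (pd et (planeRb R₀)) p := by
  have hR := (contDiff_planeRb (n := 1) R₀).differentiable one_ne_zero
  have ht := (contDiff_th (n := 1)).differentiable one_ne_zero
  rw [(pd_planeRb R₀).1, (pd_planeRb R₀).2, pd_mul et (differentiable_const _) hR,
    pd_mul ex ((differentiable_const _).fun_mul ht) hR, pd_mul ex (differentiable_const _) ht,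
    pd_const, pd_const, pd_th.2, (pd_planeRb R₀).1, (pd_planeRb R₀).2]
  ring

section

variable {R₀ : ℝ} {ρ : ℝ × ℝ → ℝ}

/-- The cutoff is inactive for t > -1/32, an open set containing the half-plane t ≥ 0. The
factorisation of R may therefore be differentiated at t = 0 as well. -/
theorem planeR_eventuallyEq (hR : 0 < R₀) (p : ℝ × ℝ) (hp : -1 / 32 < p.1) :
    (fun q => planeRb R₀ q + ρ q) =ᶠ[𝓝 p] fun q => R₀ * (wt 2 1 q * (1 + sig R₀ ρ q)) := by
  have h : ∀ᶠ q : ℝ × ℝ in 𝓝 p, -1 / 32 < q.1 := continuous_fst.tendsto p (lt_mem_nhds hp)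
  filter_upwards [h] with q hq
  have h1 := wt_mul 2 1 0 (-1) q
  have h2 : wt (2 + 0) (1 + -1) q = Real.exp (2 * q.1) := by simp [wt]
  have h3 : Real.exp (2 * q.1) * Real.exp (-2 * q.1) = 1 := by rw [← Real.exp_add]; simp
  rw [planeRb_eq, sig, theta_eq hq.le]
  have : R₀ * (wt 2 1 q * (1 + R₀⁻¹ * (Real.exp (-2 * q.1) * (ρ q * wt 0 (-1) q))))
      = R₀ * wt 2 1 q + (R₀ * R₀⁻¹) * ((wt 2 1 q * wt 0 (-1) q) * Real.exp (-2 * q.1)) * ρ q := by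
    ring
  rw [this, h1, h2, h3, mul_inv_cancel₀ hR.ne']
  ring

theorem planeR_pos (hR : 0 < R₀) (hσ : ∀ p, 1 / 10 ≤ 1 + sig R₀ ρ p) (p : ℝ × ℝ) (hp : -1 / 32 < p.1) : 0 < planeRb R₀ p + ρ p := by
  have h := (planeR_eventuallyEq (ρ := ρ) hR p hp).self_of_nhds
  change planeRb R₀ p + ρ p = R₀ * (wt 2 1 p * (1 + sig R₀ ρ p)) at h
  rw [h]
  have := wt_pos 2 1 p
  have := hσ p
  have h3 : 0 < 1 + sig R₀ ρ p := by linarith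
  positivity

/-- The rescaled unknown satisfies a wave equation with potential and source exactly when the
original unknown satisfies the wave map equation. -/
theorem wave_identity (hR : 0 < R₀) (hρ : ContDiff ℝ 2 ρ)
    (hσ : ∀ p, 1 / 10 ≤ 1 + sig R₀ ρ p) (W₀ W₁ : ℝ) (hw : ∀ p, pd et (pd et ρ) p = pd ex (pd ex ρ) p)
    (hu : ContDiff ℝ 2 u) (p : ℝ × ℝ) (hp : -1 / 32 < p.1)
    (h : pd et (pd et u) p - pd ex (pd ex u) p
      = -((wt 0 (-1) p ^ 2 + potQ (sig R₀ ρ) p) * u p) + srcG R₀ W₀ (sig R₀ ρ) p) :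
    let w := fun q => planeWb W₀ W₁ q + resc R₀ (sig R₀ ρ) q * u q
    let R := fun q => planeRb R₀ q + ρ q
    pd et (pd et w) p - pd ex (pd ex w) p + pd et R p / R p * pd et w p
      - pd ex R p / R p * pd ex w p = 0 := by
  intro w R
  set σ := sig R₀ ρ with hσd
  have cσ : ContDiff ℝ 2 σ :=
    contDiff_const.mul ((contDiff_fst' (contDiff_theta (n := 2))).mul (hρ.mul (contDiff_wt 0 (-1))))
  have cσ1 : ∀ v, ContDiff ℝ 1 (pd v σ) := fun v => contDiff_pd (n := 1) cσ v
  have dσ := cσ.differentiable two_ne_zero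
  have cy : ContDiff ℝ 2 (invSqrt σ) := contDiff_invSqrt (n := 2) cσ hσ
  have cy1 := cy.of_le (m := 1) (by norm_num)
  have dy := cy.differentiable two_ne_zero
  have cth := contDiff_th (n := 1)
  set y := invSqrt σ with hy
  -- The logarithmic derivatives of A in t and x are a and b; where the cutoff is inactive they
  -- equal -R_t/(2R) and -R_x/(2R).
  set a : ℝ × ℝ → ℝ := fun q => -1 - 1 / 2 * (pd et σ q * (y q * y q)) with ha
  set b : ℝ × ℝ → ℝ := fun q => -th q - 1 / 2 * (pd ex σ q * (y q * y q)) with hb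
  have ca : ContDiff ℝ 1 a :=
    contDiff_const.sub (contDiff_const.mul ((cσ1 et).mul (cy1.mul cy1)))
  have cb : ContDiff ℝ 1 b :=
    cth.neg.sub (contDiff_const.mul ((cσ1 ex).mul (cy1.mul cy1)))
  have dA0 := (contDiff_wt (n := 1) (-1) (-1 / 2)).differentiable one_ne_zero
  have hA : ∀ v, pd v (resc R₀ σ) = fun q => (√R₀)⁻¹ * (pd v (wt (-1) (-1 / 2)) q * y q
      + wt (-1) (-1 / 2) q * (-(1 / 2) * (y q * (y q * (y q * pd v σ q))))) := by
    intro v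
    have : resc R₀ σ = fun q => (√R₀)⁻¹ * (wt (-1) (-1 / 2) q * y q) := rfl
    rw [this, pd_mul v (differentiable_const _) (dA0.fun_mul dy), pd_const, pd_mul v dA0 dy]
    funext q
    simp only [hy, pd_invSqrt dσ hσ v q]
    ring
  have hAt : pd et (resc R₀ σ) = fun q => a q * resc R₀ σ q := by
    rw [hA, (pd_wt (-1) (-1 / 2)).1]; funext q; simp only [resc, ha]; ring
  have hAx : pd ex (resc R₀ σ) = fun q => b q * resc R₀ σ q := by
    rw [hA, (pd_wt (-1) (-1 / 2)).2]; funext q; simp only [resc, hb]; ring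
  have cA : ContDiff ℝ 1 (resc R₀ σ) :=
    contDiff_const.mul ((contDiff_wt _ _).mul cy1)
  -- the area function
  set R' : ℝ × ℝ → ℝ := fun q => R₀ * (wt 2 1 q * (1 + σ q)) with hR'
  have dw := (contDiff_wt (n := 1) 2 1).differentiable one_ne_zero
  have dR' : Differentiable ℝ R' := (differentiable_const _).fun_mul
    (dw.fun_mul ((differentiable_const _).fun_add dσ))
  have hy1 : ∀ q, y q * y q * (1 + σ q) = 1 := fun q => invSqrt_mul_self (hσ q)
  have hRv : ∀ v, pd v R' = fun q => R₀ * (pd v (wt 2 1) q * (1 + σ q) + wt 2 1 q * pd v σ q) := by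
    intro v
    rw [hR', pd_mul v (differentiable_const _) (dw.fun_mul ((differentiable_const _).fun_add dσ)),
      pd_const, pd_mul v dw ((differentiable_const _).fun_add dσ),
      pd_add v (differentiable_const _) dσ, pd_const]
    funext q; ring
  have hRt : pd et R' = fun q => -2 * a q * R' q := by
    rw [hRv, (pd_wt 2 1).1]; funext q
    simp only [ha, hR']
    linear_combination (-(R₀ * wt 2 1 q * pd et σ q)) * hy1 q
  have hRx : pd ex R' = fun q => -2 * b q * R' q := by
    rw [hRv, (pd_wt 2 1).2]; funext q
    simp only [hb, hR']
    linear_combination (-(R₀ * wt 2 1 q * pd ex σ q)) * hy1 q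
  have hev : R =ᶠ[𝓝 p] R' := planeR_eventuallyEq hR p hp
  have dρ := hρ.differentiable two_ne_zero
  have dRb := (contDiff_planeRb (n := 1) R₀).differentiable one_ne_zero
  have hRR : ∀ v, pd v (pd v R) p = pd v (pd v (planeRb R₀)) p + pd v (pd v ρ) p := by
    intro v
    have d1 : Differentiable ℝ (pd v (planeRb R₀)) := fun q =>
      differentiableAt_pd (contDiff_planeRb (n := 2) R₀).contDiffAt v
    have d2 : Differentiable ℝ (pd v ρ) := fun q => differentiableAt_pd hρ.contDiffAt v
    rw [pd_add v dRb dρ, pd_add v d1 d2]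
  have hRw : pd et (pd et R') p = pd ex (pd ex R') p := by
    rw [← (pd_eventuallyEq (pd_eventuallyEq hev et) et).self_of_nhds,
      ← (pd_eventuallyEq (pd_eventuallyEq hev ex) ex).self_of_nhds, hRR, hRR, hw, pd_pd_planeRb]
  have da := ca.differentiable one_ne_zero
  have db := cb.differentiable one_ne_zero
  have hRpos : R' p ≠ 0 := by
    rw [← hev.self_of_nhds]; exact (planeR_pos hR hσ p hp).ne'
  -- The wave equation for R in terms of its logarithmic derivatives, using R_tt / R = -2 a_t + 4 a²
  -- and R_xx / R = -2 b_x + 4 b².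
  have key : pd et a p - 2 * a p ^ 2 = pd ex b p - 2 * b p ^ 2 := by
    rw [hRt, hRx, pd_mul et ((differentiable_const _).fun_mul da) dR',
      pd_mul ex ((differentiable_const _).fun_mul db) dR', pd_mul et (differentiable_const _) da,
      pd_mul ex (differentiable_const _) db, pd_const, pd_const, hRt, hRx] at hRw
    refine mul_right_cancel₀ hRpos ?_
    linear_combination (-1 / 2) * hRw
  have q1 : pd et R p / R p = -2 * a p := by
    rw [(pd_eventuallyEq hev et).self_of_nhds, hev.self_of_nhds, hRt]
    field_simp
  have q2 : pd ex R p / R p = -2 * b p := by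
    rw [(pd_eventuallyEq hev ex).self_of_nhds, hev.self_of_nhds, hRx]
    field_simp
  -- the unknown
  have du := hu.differentiable two_ne_zero
  have dA := cA.differentiable one_ne_zero
  have dWb := (contDiff_planeWb (n := 1) W₀ W₁).differentiable one_ne_zero
  have cA2 : ContDiff ℝ 2 (resc R₀ σ) := contDiff_const.mul ((contDiff_wt _ _).mul cy)
  have cAu : ContDiff ℝ 2 fun q => resc R₀ σ q * u q := cA2.mul hu
  have hwv : ∀ v, pd v w = fun q => pd v (planeWb W₀ W₁) q + pd v (fun q => resc R₀ σ q * u q) q :=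
    fun v => pd_add v dWb (dA.fun_mul du)
  have hwvv : ∀ v, pd v (pd v w) = fun q => pd v (pd v (planeWb W₀ W₁)) q
      + pd v (pd v fun q => resc R₀ σ q * u q) q := by
    intro v
    rw [hwv, pd_add v (fun q => differentiableAt_pd (contDiff_planeWb (n := 2) W₀ W₁).contDiffAt v)
      (fun q => differentiableAt_pd cAu.contDiffAt v)]
  -- W_b leaves the residual -(R_x/R - 2 tanh(2x)) ∂_x W_b in the perturbed equation; G is defined
  -- so that A G cancels it.
  have hAG : resc R₀ σ p * srcG R₀ W₀ σ p = W₀ * wt 0 (-1) p * pd ex σ p * (y p * y p) := by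
    have h2 : wt (-1) (-1 / 2) p * wt 1 (-1 / 2) p = wt 0 (-1) p := by rw [wt_mul]; norm_num
    have h3 : (√R₀)⁻¹ * √R₀ = 1 := inv_mul_cancel₀ (Real.sqrt_pos.2 hR).ne'
    calc _ = ((√R₀)⁻¹ * √R₀) * (wt (-1) (-1 / 2) p * wt 1 (-1 / 2) p) * W₀ * pd ex σ p
          * (y p * y p) := by unfold resc srcG; ring
      _ = _ := by rw [h3, h2]; ring
  have hs := th_sq p
  rw [q1, q2, hwvv, hwvv, hwv, hwv, (pd_pd_planeWb W₀ W₁).1, (pd_pd_planeWb W₀ W₁).2,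
    (pd_planeWb W₀ W₁).1, (pd_planeWb W₀ W₁).2, pd_pd_log_mul cA ca hu hAt,
    pd_pd_log_mul cA cb hu hAx, pd_log_mul dA du hAt, pd_log_mul dA du hAx]
  simp only [potQ] at h
  rw [← hy] at h
  -- The potential (R_t² - R_x²)/(4R²): its background part is 1 - tanh² = sech² and the remainder
  -- is `potQ`.
  have hV : a p ^ 2 - b p ^ 2 = wt 0 (-1) p ^ 2 + (pd et σ p * (y p * y p)
      - th p * (pd ex σ p * (y p * y p)) + 1 / 4 * ((pd et σ p * pd et σ p - pd ex σ p * pd ex σ p)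
      * ((y p * y p) * (y p * y p)))) := by
    rw [← hs]; simp only [ha, hb]; ring
  have hbp : b p = -th p - 1 / 2 * (pd ex σ p * (y p * y p)) := rfl
  rw [← hV] at h
  linear_combination (resc R₀ σ p) * h + (resc R₀ σ p * u p) * key + hAG
    + 2 * W₀ * wt 0 (-1) p * hbp

end

end

/-! ### Coefficient bounds from the norms of the data -/

noncomputable section

theorem MemC0.of_le {j k : ℕ} {f : ℝ → ℝ} (hf : MemC0 k f) (h : j ≤ k) : MemC0 j f :=
  ⟨hf.1.of_le (by exact_mod_cast h), fun i hi => hf.2 i (hi.trans h)⟩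

theorem MemC0.bddAbove {k i : ℕ} {f : ℝ → ℝ} (hf : MemC0 k f) (hi : i ≤ k) :
    BddAbove (Set.range fun x => |iteratedDeriv i f x|) := by
  have hc : Continuous (iteratedDeriv i f) :=
    hf.1.continuous_iteratedDeriv i (by exact_mod_cast hi)
  have h1 := (hf.2 i hi).eventually (Metric.ball_mem_nhds (0 : ℝ) one_pos)
  obtain ⟨K, hK, hKs⟩ := mem_cocompact.1 h1
  obtain ⟨M, hM⟩ := hK.exists_bound_of_continuousOn hc.continuousOn
  refine ⟨max M 1, ?_⟩
  rintro _ ⟨x, rfl⟩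
  by_cases hx : x ∈ K
  · exact (hM x hx).trans (le_max_left _ _)
  · have := hKs hx
    simp only [dist_zero_right, Real.norm_eq_abs, Set.mem_ofPred_eq] at this
    exact this.le.trans (le_max_right _ _)

theorem ckNorm_nonneg (k : ℕ) (f : ℝ → ℝ) : 0 ≤ ckNorm k f :=
  Finset.sum_nonneg fun _ _ => Real.iSup_nonneg fun _ => abs_nonneg _

theorem MemC0.abs_le_ckNorm {k i : ℕ} {f : ℝ → ℝ} (hf : MemC0 k f) (hi : i ≤ k) (x : ℝ) :
    |iteratedDeriv i f x| ≤ ckNorm k f :=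
  (le_ciSup (hf.bddAbove hi) x).trans
    (Finset.single_le_sum (f := fun i => ⨆ x : ℝ, |iteratedDeriv i f x|)
      (fun _ _ => Real.iSup_nonneg fun _ => abs_nonneg _) (Finset.mem_range.2 (by omega)))

/-- Uniform bounds for the coefficients of the rescaled equation `□u = -(s² + Q) u + G`, for the
rescaling factor `A` and for its inverse `Ai`. -/
structure CoeffBound (n : ℕ) (C m : ℝ) (A Ai Q G : ℝ × ℝ → ℝ) : Prop where
  jetA : JetLE (n + 1) A fun p => C * wt (-1) (-1 / 2) p
  jetAi : JetLE (n + 1) Ai fun p => C * wt 1 (1 / 2) p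
  mul_eq : ∀ p, A p * Ai p = 1
  jetQ : JetLE n Q fun p => C * (bet p.1 * wt 0 (-1) p)
  jetG : JetLE n G fun p => C * m * (bet p.1 * (wt 0 (-1 / 2) p * wt 0 (-1) p))

/-- Two sizes play separate roles: M + M', from sup norms alone, keeps 1 + σ away from zero, while m
controls all derivatives and enters the source linearly. The constant is fixed before the data are
chosen. -/
theorem exists_coeffBound {R₀ : ℝ} (hR : 0 < R₀) (W₀ B : ℝ) (hB : 0 ≤ B) (N : ℕ) :
    ∃ C, 0 ≤ C ∧ ∀ (f g : ℝ → ℝ) (m M M' : ℝ), ContDiff ℝ (N + 1 : ℕ) f → ContDiff ℝ N g →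
      (∀ i ≤ N + 1, ∀ x, |iteratedDeriv i f x| ≤ m) → (∀ i ≤ N, ∀ x, |iteratedDeriv i g x| ≤ m) →
      (∀ x, |f x| ≤ M) → (∀ x, |g x| ≤ M') → M + M' < 2 * R₀ / 3 → m ≤ B →
      (∀ p, 1 / 10 ≤ 1 + sig R₀ (dalembert f g) p) ∧
      CoeffBound N C m (resc R₀ (sig R₀ (dalembert f g))) (rescInv R₀ (sig R₀ (dalembert f g)))
        (potQ (sig R₀ (dalembert f g))) (srcG R₀ W₀ (sig R₀ (dalembert f g))) := by
  obtain ⟨C1, h1, H1⟩ := sig_bounds hR (1 + 4 * (2 ^ N * (N + 1))) (by positivity) (N + 1)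
  obtain ⟨C2, h2, H2⟩ := jetLE_resc (R₀ := R₀) (C1 * B) (N + 1)
  obtain ⟨C3, h3, H3⟩ := pot_src_bounds R₀ W₀ C1 B h1 hB N
  refine ⟨max C2 C3, le_max_of_le_left h2, fun f g m M M' hf hg hfm hgm hfM hgM hM hm => ?_⟩
  have m0 : 0 ≤ m := (abs_nonneg _).trans (hfm 0 (by omega) 0)
  have M0 : 0 ≤ M := (abs_nonneg _).trans (hfM 0)
  have M0' : 0 ≤ M' := (abs_nonneg _).trans (hgM 0)
  obtain ⟨hσ, jσ⟩ := H1 (dalembert f g) m (M + M') m0 hM (jetLE_dalembert hf hg hfm hgm)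
    fun p => (abs_dalembert_le hfM hgM hg.continuous p).trans (by
      nlinarith [abs_nonneg p.1, mul_nonneg M0 (abs_nonneg p.1)])
  have jK : JetLE (N + 1) (sig R₀ (dalembert f g)) fun _ => C1 * B := jσ.mono fun p => by
    have e1 : Real.exp (-|p.1|) ≤ 1 := Real.exp_le_one_iff.2 (by linarith [abs_nonneg p.1])
    have e2 := wt_neg_one_le_one (b := -1) (by norm_num) p
    have e3 : bet p.1 * Real.exp (-|p.1|) * wt 0 (-1) p ≤ 1 :=
      mul_le_one₀ (mul_le_one₀ (bet_le_one _) (Real.exp_pos _).le e1) (wt_pos _ _ _).le e2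
    calc _ ≤ C1 * m * 1 := by gcongr
      _ ≤ C1 * B := by rw [mul_one]; gcongr
  obtain ⟨jA, jAi⟩ := H2 _ jK hσ
  obtain ⟨jQ, jG⟩ := H3 _ m m0 hm jσ hσ
  refine ⟨hσ, ?_, ?_, resc_mul_rescInv hR hσ, ?_, ?_⟩
  · exact jA.mono fun p => mul_le_mul_of_nonneg_right (le_max_left _ _) (wt_pos _ _ _).le
  · exact jAi.mono fun p => mul_le_mul_of_nonneg_right (le_max_left _ _) (wt_pos _ _ _).le
  · exact jQ.mono fun p => mul_le_mul_of_nonneg_right (le_max_right _ _)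
      (mul_nonneg (bet_pos _).le (wt_pos _ _ _).le)
  · refine jG.mono fun p => mul_le_mul_of_nonneg_right
      (mul_le_mul_of_nonneg_right (le_max_right _ _) m0)
      (mul_nonneg (bet_pos _).le (mul_nonneg (wt_pos _ _ _).le (wt_pos _ _ _).le))

end

/-! ### Finite speed of propagation and differentiation along characteristics -/

noncomputable section

variable {u : ℝ × ℝ → ℝ}

theorem dt_plane (hu : Differentiable ℝ u) {t : ℝ} (ht : 0 ≤ t) (x : ℝ) :
    dt (fun s y => u (s, y)) t x = pd et u (t, x) :=
  (hasDerivAt_pt (hu (t, x))).hasDerivWithinAt.derivWithin (uniqueDiffOn_Ici 0 t ht)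

theorem dx_plane (hu : Differentiable ℝ u) (t x : ℝ) :
    dx (fun s y => u (s, y)) t x = pd ex u (t, x) := (hasDerivAt_px (hu (t, x))).deriv

theorem dt_dt_plane (hu : ContDiff ℝ 2 u) {t : ℝ} (ht : 0 ≤ t) (x : ℝ) :
    dt (dt fun s y => u (s, y)) t x = pd et (pd et u) (t, x) := by
  rw [← dt_plane (fun q => differentiableAt_pd hu.contDiffAt et) ht]
  exact derivWithin_congr (fun s hs => dt_plane (hu.differentiable two_ne_zero) hs x)
    (dt_plane (hu.differentiable two_ne_zero) ht x)

theorem dx_dx_plane (hu : ContDiff ℝ 2 u) (t x : ℝ) :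
    dx (dx fun s y => u (s, y)) t x = pd ex (pd ex u) (t, x) := by
  rw [← dx_plane (fun q => differentiableAt_pd hu.contDiffAt ex)]
  exact congrFun (congrFun (congrArg dx (funext fun s => funext fun y =>
    dx_plane (hu.differentiable two_ne_zero) s y)) t) x

/-- Estimate on backward characteristic triangles for functions on the plane. -/
theorem plane_triangle (hu : ContDiff ℝ 2 u) {T x₀ A d : ℝ} (hA : 0 ≤ A) (hd : 0 ≤ d)
    (hb : ∀ q ∈ triangle T x₀, |pd et (pd et u) q - pd ex (pd ex u) q|
      ≤ A * (|u q| + |pd et u q| + |pd ex u q|) + d)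
    (h0 : ∀ x, |x - x₀| ≤ T → |u (0, x)| ≤ d ∧ |pd et u (0, x)| ≤ d ∧ |pd ex u (0, x)| ≤ d) :
    ∀ q ∈ triangle T x₀, |u q| + |pd et u q| + |pd ex u q| ≤ triConst A T * d := by
  have du := hu.differentiable two_ne_zero
  have h := future_triangle (F := fun s y => u (s, y)) (T := T) (x₀ := x₀) (A := A) (d := d)
    (show SmoothOnFuture 2 _ from hu.contDiffOn) hA hd
    (fun q hq => by
      rw [dt_dt_plane hu hq.1, dx_dx_plane hu, dt_plane du hq.1, dx_plane du]; exact hb q hq)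
    (fun x hx => by rw [dt_plane du le_rfl, dx_plane du]; exact h0 x hx)
  intro q hq
  have := h q hq
  rwa [dt_plane du hq.1, dx_plane du] at this

theorem pd_zero_of_space_zero {f : ℝ × ℝ → ℝ} (hf : Differentiable ℝ f) {t x : ℝ}
    (h : ∀ᶠ y in 𝓝 x, f (t, y) = 0) : pd ex f (t, x) = 0 := by
  have h1 := hasDerivAt_px (hf (t, x))
  have h2 : HasDerivAt (fun y => f (t, y)) 0 x :=
    (hasDerivAt_const x (0 : ℝ)).congr_of_eventuallyEq h
  exact h1.unique h2

/-- Finite speed of propagation: all the derivatives vanish outside of the domain of influence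
of the support of the data and of the source. -/
theorem jet_eq_zero_of_support {n : ℕ} (hn : 2 ≤ n) (hu : ContDiff ℝ n u) {V G : ℝ × ℝ → ℝ}
    {A L : ℝ} (hV : ∀ p, |V p| ≤ A)
    (heq : ∀ p, pd et (pd et u) p - pd ex (pd ex u) p = -(V p * u p) + G p)
    (hG : ∀ p : ℝ × ℝ, L ≤ |p.2| → G p = 0) (h0 : ∀ x, L ≤ |x| → u (0, x) = 0)
    (h1 : ∀ x, L ≤ |x| → pd et u (0, x) = 0) {t x : ℝ} (ht : 0 ≤ t) (hx : L + 1 + t ≤ |x|) :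
    jet {et, ex} n u (t, x) = 0 := by
  have hu2 := contDiff_two_of_le hu hn
  have du := hu2.differentiable two_ne_zero
  have A0 : 0 ≤ A := (abs_nonneg _).trans (hV 0)
  have hz : ∀ s y : ℝ, 0 ≤ s → L + s < |y| → u (s, y) = 0 := by
    intro s y hs hy
    have hL : ∀ z, |z - y| ≤ s → L < |z| := fun z hz => by
      have := abs_sub_abs_le_abs_sub y z
      rw [abs_sub_comm] at this
      linarith
    have := plane_triangle hu2 (T := s) (x₀ := y) (A := A) (d := 0) A0 le_rfl
      (fun q hq => by
        rw [heq, hG q (hL _ (hq.2.trans (by linarith [hq.1]))).le, add_zero, add_zero, abs_neg, abs_mul]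
        have := hV q
        gcongr
        linarith [abs_nonneg (pd et u q), abs_nonneg (pd ex u q)])
      (fun z hz => by
        have h3 := hL z hz
        rw [h0 z h3.le, h1 z h3.le, pd_zero_of_space_zero du]
        · simp
        · filter_upwards [continuous_abs.tendsto z (lt_mem_nhds h3)] with y hy using h0 y (le_of_lt hy))
      (s, y) ⟨hs, by simp⟩
    rw [mul_zero] at this
    exact abs_nonpos_iff.1 (by linarith [abs_nonneg (pd et u (s, y)), abs_nonneg (pd ex u (s, y))])
  have hj : ∀ s : ℝ, 0 < s → L + s < |x| → jet {et, ex} n u (s, x) = 0 := by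
    intro s hs hxs
    have hev : u =ᶠ[𝓝 (s, x)] fun _ => 0 := by
      have c1 : ∀ᶠ q : ℝ × ℝ in 𝓝 (s, x), 0 < q.1 := continuous_fst.tendsto (s, x) (lt_mem_nhds hs)
      have c2 : ∀ᶠ q : ℝ × ℝ in 𝓝 (s, x), 0 < |q.2| - (L + q.1) :=
        (by fun_prop : Continuous fun q : ℝ × ℝ => |q.2| - (L + q.1)).tendsto (s, x)
          (lt_mem_nhds (by simp only; linarith))
      filter_upwards [c1, c2] with q h1 h2 using hz q.1 q.2 h1.le (by linarith)
    rw [jet_congr n hev, jet_const, abs_zero]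
  -- Vanishing in a full neighbourhood is available only at positive times, so the jet at t,
  -- possibly 0, is obtained as a limit from later times. The margin 1 in L + 1 + t leaves room for
  -- them.
  have hc : ContinuousWithinAt (fun s => jet {et, ex} n u (s, x)) (Set.Ioi t) t :=
    ((continuous_jet n hu).comp (by fun_prop : Continuous fun s : ℝ => (s, x))).continuousWithinAt
  refine tendsto_nhds_unique hc ((tendsto_const_nhds (x := (0 : ℝ))).congr' ?_)
  filter_upwards [Ioo_mem_nhdsGT (lt_add_one t)] with s hs
  exact (hj s (ht.trans_lt hs.1) (by linarith [hs.2])).symm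

/-- If `f` and `D_v f` are of class `C^1`, then `D_w f` is differentiable along `v`. -/
theorem hasDerivAt_pd_along {f : ℝ × ℝ → ℝ} {v : ℝ × ℝ} (hf : ContDiff ℝ 1 f)
    (hv : ContDiff ℝ 1 (pd v f)) (w q : ℝ × ℝ) (s : ℝ) :
    HasDerivAt (fun r : ℝ => pd w f (q + r • v)) (pd w (pd v f) (q + s • v)) s := by
  have df := hf.differentiable one_ne_zero
  have dv := hv.differentiable one_ne_zero
  have cw : Continuous (pd w (pd v f)) := (contDiff_pd (n := 0) hv w).continuous
  have line : ∀ (q v : ℝ × ℝ) (r : ℝ), HasDerivAt (fun s : ℝ => q + s • v) v r := fun q v r => by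
    simpa using ((hasDerivAt_id r).smul_const v).const_add q
  -- Write f(q + r v + z w) - f(q + z w) as the integral of ∂_v f along v and differentiate in z
  -- under the integral. Only the C¹ regularity of ∂_v f is used, and f need not be C².
  have hint : ∀ r : ℝ, pd w f (q + r • v)
      = pd w f q + ∫ σ in (0 : ℝ)..r, pd w (pd v f) (q + σ • v) := by
    intro r
    have e1 : ∀ z : ℝ, f (q + r • v + z • w)
        = f (q + z • w) + ∫ σ in (0 : ℝ)..r, pd v f (q + σ • v + z • w) := by
      intro z
      have h := intervalIntegral.integral_eq_sub_of_hasDerivAt (a := 0) (b := r)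
        (f := fun σ : ℝ => f (q + z • w + σ • v)) (f' := fun σ => pd v f (q + z • w + σ • v))
        (fun σ _ => hasDerivAt_comp_pd (g := fun σ : ℝ => q + z • w + σ • v) (df _) (line _ _ _))
        ((hv.continuous.comp (by fun_prop)).intervalIntegrable _ _)
      simp only [zero_smul, add_zero] at h
      have e : ∀ σ : ℝ, q + σ • v + z • w = q + z • w + σ • v := fun σ => by abel
      simp only [e]
      linarith
    have d1 : HasDerivAt (fun z : ℝ => f (q + r • v + z • w)) (pd w f (q + r • v)) 0 := by
      have := hasDerivAt_comp_pd (g := fun z : ℝ => q + r • v + z • w) (df _) (line (q + r • v) w 0)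
      simpa using this
    have d2 : HasDerivAt (fun z : ℝ => f (q + z • w)) (pd w f q) 0 := by
      have := hasDerivAt_comp_pd (g := fun z : ℝ => q + z • w) (df _) (line q w 0)
      simpa using this
    have d3 := hasDerivAt_integral_param (F := fun p : ℝ × ℝ => pd v f (q + p.1 • v + p.2 • w))
      (F' := fun p : ℝ × ℝ => pd w (pd v f) (q + p.1 • v + p.2 • w))
      (hv.continuous.comp (by fun_prop)) (cw.comp (by fun_prop))
      (fun σ z => hasDerivAt_comp_pd (g := fun z : ℝ => q + σ • v + z • w) (dv _) (line _ w z)) 0 r 0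
    have d4 := (d2.add d3).congr_of_eventuallyEq (Eventually.of_forall e1)
    simpa using d1.unique d4
  have hI := intervalIntegral.integral_hasDerivAt_right (a := 0) (b := s)
    (f := fun σ : ℝ => pd w (pd v f) (q + σ • v))
    ((cw.comp (by fun_prop)).intervalIntegrable _ _)
    (Continuous.stronglyMeasurableAtFilter (cw.comp (by fun_prop)) _ _)
    (cw.comp (by fun_prop)).continuousAt
  exact (hI.const_add (pd w f q)).congr_of_eventuallyEq (Eventually.of_forall hint)

theorem contDiff_iterate_pd {n i j : ℕ} (hu : ContDiff ℝ n u) (h : j + i ≤ n) (v : ℝ × ℝ) :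
    ContDiff ℝ i ((pd v)^[j] u) := by
  induction j generalizing i with
  | zero => exact contDiff_le hu (by omega)
  | succ j ih =>
    rw [Function.iterate_succ_apply']
    exact contDiff_pd (ih (by omega)) v

theorem pd_iterate_comm {n j : ℕ} (hu : ContDiff ℝ n u) (h : j + 1 ≤ n) (v w : ℝ × ℝ) :
    (pd v)^[j] (pd w u) = pd w ((pd v)^[j] u) := by
  induction j with
  | zero => rfl
  | succ j ih =>
    rw [Function.iterate_succ_apply', Function.iterate_succ_apply', ih (by omega)]
    exact pd_comm (contDiff_two_of_le (contDiff_iterate_pd (i := 2) hu (by omega) v) le_rfl) v w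

theorem pd_combination (f : ℝ × ℝ → ℝ) (e : ℝ) (p : ℝ × ℝ) :
    pd (1, e) f p = pd et f p + e * pd ex f p := by
  have : ((1, e) : ℝ × ℝ) = et + e • ex := by simp [et, ex]
  rw [pd, this, map_add, map_smul]; rfl

theorem pd_combination_comm (hu : ContDiff ℝ 2 u) {e : ℝ} (he : e * e = 1) (p : ℝ × ℝ) :
    pd (1, -e) (pd (1, e) u) p = pd et (pd et u) p - pd ex (pd ex u) p := by
  have d1 : ∀ v, Differentiable ℝ (pd v u) := fun v q => differentiableAt_pd hu.contDiffAt v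
  have h : pd (1, e) u = fun p => pd et u p + e * pd ex u p := funext (pd_combination u e)
  rw [h, pd_combination, pd_add et (d1 et) ((differentiable_const e).fun_mul (d1 ex)),
    pd_add ex (d1 et) ((differentiable_const e).fun_mul (d1 ex)),
    pd_mul et (differentiable_const e) (d1 ex), pd_mul ex (differentiable_const e) (d1 ex),
    pd_const, pd_const]
  have hc := congrFun (pd_comm hu et ex) p
  linear_combination (-pd ex (pd ex u) p) * he + e * hc

/-- The time derivatives of a solution of the wave equation satisfy the differentiated equation
along characteristics. -/
theorem hasDerivAt_char_iterate {N : ℕ} (hN : 1 ≤ N) (hu : ContDiff ℝ (N + 1 : ℕ) u)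
    {h : ℝ × ℝ → ℝ} (hh : ContDiff ℝ N h)
    (heq : ∀ p, pd et (pd et u) p - pd ex (pd ex u) p = h p) {e : ℝ} (he : e * e = 1) :
    ∀ j ≤ N, ∀ (q : ℝ × ℝ) (s : ℝ),
      HasDerivAt (fun r : ℝ => pd (1, e) ((pd et)^[j] u) (q + r • (1, -e)))
        ((pd et)^[j] h (q + s • (1, -e))) s := by
  have line : ∀ (q v : ℝ × ℝ) (r : ℝ), HasDerivAt (fun s : ℝ => q + s • v) v r := fun q v r => by
    simpa using ((hasDerivAt_id r).smul_const v).const_add q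
  intro j
  induction j with
  | zero =>
    intro _ q s
    have hu2 := contDiff_two_of_le hu (by omega)
    have := hasDerivAt_comp_pd (f := pd (1, e) u) (g := fun s : ℝ => q + s • ((1, -e) : ℝ × ℝ))
      (differentiableAt_pd hu2.contDiffAt (1, e)) (line q (1, -e) s)
    rw [pd_combination_comm hu2 he, heq] at this
    exact this
  | succ j ih =>
    intro hj q s
    have ih := ih (by omega)
    have cZ : ContDiff ℝ (1 + 1 : ℕ) ((pd et)^[j] u) := contDiff_iterate_pd hu (by omega) et
    have cf : ContDiff ℝ (1 : ℕ) (pd (1, e) ((pd et)^[j] u)) := contDiff_pd cZ _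
    have ch : ContDiff ℝ (1 : ℕ) ((pd et)^[j] h) := contDiff_iterate_pd hh (by omega) et
    -- The induction hypothesis as an identity of functions. Since (∂_t + e ∂_x) ∂_t^j u and its
    -- characteristic derivative ∂_t^j h are both C¹, one more ∂_t can be taken along the
    -- characteristic although ∂_t^{j+1} u may be merely C¹.
    have hv : pd (1, -e) (pd (1, e) ((pd et)^[j] u)) = (pd et)^[j] h := by
      funext p
      have h1 := ih p 0
      have h2 := hasDerivAt_comp_pd (f := pd (1, e) ((pd et)^[j] u))
        (g := fun s : ℝ => p + s • ((1, -e) : ℝ × ℝ))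
        ((cf.differentiable (by norm_num)) _) (line p (1, -e) 0)
      simpa using h2.unique h1
    have h3 := hasDerivAt_pd_along (v := (1, -e)) (by exact_mod_cast cf)
      (by rw [hv]; exact_mod_cast ch) et q s
    rw [hv, pd_comm (by exact_mod_cast cZ) et (1, e)] at h3
    rw [Function.iterate_succ_apply', Function.iterate_succ_apply']
    exact h3

end

/-! ### Energy identity, Gronwall inequality and growth of the L² norm -/

noncomputable section

theorem integrable_of_vanish {φ : ℝ → ℝ} {M : ℝ} (hc : Continuous φ)
    (h : ∀ x, M ≤ |x| → φ x = 0) : Integrable φ :=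
  hc.integrable_of_hasCompactSupport (hasCompactSupport_of_bound h)

theorem intervalIntegral_shift {φ : ℝ → ℝ} {M M' d : ℝ} (h : ∀ x, M ≤ |x| → φ x = 0)
    (hM : M + |d| < M') : ∫ c in (-M')..M', φ (c + d) = ∫ x, φ x := by
  rw [← integral_add_right_eq_self φ d]
  refine intervalIntegral.integral_eq_integral_of_support_subset fun c hc => ?_
  by_contra hcon
  refine hc (h _ ?_)
  have h1 : M' ≤ |c| := by
    by_contra hlt
    push Not at hlt
    exact hcon ⟨(abs_lt.1 hlt).1, (abs_lt.1 hlt).2.le⟩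
  have := abs_sub_abs_le_abs_sub c (-d)
  rw [abs_neg, sub_neg_eq_add] at this
  linarith

variable {Z f : ℝ × ℝ → ℝ}

/-- The derivative of the space integral of a function with controlled support. -/
theorem hasDerivAt_integral_plane (hZ : ContDiff ℝ 1 Z) {M t : ℝ}
    (h0 : ∀ x, M ≤ |x| → Z (t, x) = 0) :
    HasDerivAt (fun s => ∫ x in (-(M + 1))..(M + 1), Z (s, x) ^ 2)
      (∫ x, 2 * (Z (t, x) * pd et Z (t, x))) t := by
  have dZ := hZ.differentiable one_ne_zero
  have cZ := hZ.continuous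
  have cZt : Continuous (pd et Z) := (contDiff_pd (n := 0) hZ et).continuous
  have h := hasDerivAt_integral_param (F := fun p : ℝ × ℝ => Z (p.2, p.1) ^ 2)
    (F' := fun p : ℝ × ℝ => 2 * (Z (p.2, p.1) * pd et Z (p.2, p.1))) (by fun_prop) (by fun_prop)
    (fun s y => ((hasDerivAt_pt (dZ (y, s))).pow 2).congr_deriv (by norm_num; ring))
    (-(M + 1)) (M + 1) t
  refine h.congr_deriv ?_
  have := intervalIntegral_shift (φ := fun x => 2 * (Z (t, x) * pd et Z (t, x))) (M := M)
    (M' := M + 1) (d := 0) (fun x hx => by simp [h0 x hx]) (by simp)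
  simpa using this

/-- The energy identity for one function. -/
theorem exists_energy (hZ : ContDiff ℝ 1 Z) (hf : Continuous f)
    (hp : ∀ e : ℝ, e * e = 1 → ∀ (q : ℝ × ℝ) (s : ℝ),
      HasDerivAt (fun r : ℝ => pd (1, e) Z (q + r • (1, -e)))
        (-(wt 0 (-1) (q + s • (1, -e)) ^ 2 * Z (q + s • (1, -e))) + f (q + s • (1, -e))) s)
    {T M : ℝ}
    (h0 : ∀ t x, 0 ≤ t → t ≤ T → M ≤ |x| → Z (t, x) = 0 ∧ pd et Z (t, x) = 0 ∧ pd ex Z (t, x) = 0) :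
    ∃ E : ℝ → ℝ, ∀ t, 0 ≤ t → t ≤ T →
      E t = (∫ x, (pd et Z (t, x) ^ 2 + pd ex Z (t, x) ^ 2 + wt 0 (-1) (t, x) ^ 2 * Z (t, x) ^ 2)) ∧
      HasDerivAt E (∫ x, 2 * (pd et Z (t, x) * f (t, x))) t := by
  have cZ := hZ.continuous
  have dZ := hZ.differentiable one_ne_zero
  have cZt : Continuous (pd et Z) := (contDiff_pd (n := 0) hZ et).continuous
  have cZx : Continuous (pd ex Z) := (contDiff_pd (n := 0) hZ ex).continuous
  have cs : Continuous (wt 0 (-1)) := (contDiff_wt (n := 0) 0 (-1)).continuous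
  have cD : ∀ e : ℝ, Continuous (pd (1, e) Z) := fun e =>
    (contDiff_pd (n := 0) hZ (1, e)).continuous
  set h : ℝ × ℝ → ℝ := fun p => -(wt 0 (-1) p ^ 2 * Z p) + f p with hh
  have ch : Continuous h := by fun_prop
  -- Wide enough for the labels c of all characteristics that meet the support up to time T.
  set M' := M + T + 1 with hM'
  -- characteristic integrals
  have key : ∀ e : ℝ, e * e = 1 → ∀ t, 0 ≤ t → t ≤ T →
      (∫ c in (-M')..M', pd (1, e) Z (t, c + -e * t) ^ 2) = (∫ x, pd (1, e) Z (t, x) ^ 2) ∧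
      HasDerivAt (fun s => ∫ c in (-M')..M', pd (1, e) Z (s, c + -e * s) ^ 2)
        (∫ x, 2 * (pd (1, e) Z (t, x) * h (t, x))) t := by
    intro e he t ht htT
    have hae : |e| = 1 := by
      have := abs_mul_abs_self e
      nlinarith [abs_nonneg e]
    have hMt : M + |-e * t| < M' := by
      rw [abs_mul, abs_neg, hae, abs_of_nonneg ht]; linarith
    have hz : ∀ x, M ≤ |x| → pd (1, e) Z (t, x) = 0 := fun x hx => by
      obtain ⟨-, h1, h2⟩ := h0 t x ht htT hx
      rw [pd_combination, h1, h2]; ring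
    refine ⟨intervalIntegral_shift (φ := fun x => pd (1, e) Z (t, x) ^ 2) (M := M)
      (fun x hx => by simp [hz x hx]) hMt, ?_⟩
    have hd := hasDerivAt_integral_param
      (F := fun p : ℝ × ℝ => pd (1, e) Z (p.2, p.1 + -e * p.2) ^ 2)
      (F' := fun p : ℝ × ℝ => 2 * (pd (1, e) Z (p.2, p.1 + -e * p.2) * h (p.2, p.1 + -e * p.2)))
      (by have := cD e; fun_prop) (by have := cD e; fun_prop)
      (fun c s => by
        have h1 := hp e he (0, c) s
        have h2 : ∀ r : ℝ, ((0, c) : ℝ × ℝ) + r • ((1, -e) : ℝ × ℝ) = (r, c + -e * r) := by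
          intro r; simp [mul_comm]
        simp only [h2] at h1
        exact (h1.pow 2).congr_deriv (by simp only [hh]; norm_num; ring)) (-M') M' t
    refine hd.congr_deriv ?_
    exact intervalIntegral_shift (φ := fun x => 2 * (pd (1, e) Z (t, x) * h (t, x))) (M := M)
      (fun x hx => by simp [hz x hx]) hMt
  have hW : ∀ t, 0 ≤ t → t ≤ T →
      HasDerivAt (fun s => ∫ x in (-(M + 1))..(M + 1), (wt 0 (-1) (s, x) * Z (s, x)) ^ 2)
      (∫ x, 2 * (wt 0 (-1) (t, x) * Z (t, x) * (wt 0 (-1) (t, x) * pd et Z (t, x)))) t := by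
    intro t ht htT
    have c1 := contDiff_wt (n := 1) 0 (-1)
    have := hasDerivAt_integral_plane (Z := fun p => wt 0 (-1) p * Z p) (c1.mul hZ) (M := M) (t := t)
      (fun x hx => by simp [(h0 t x ht htT hx).1])
    rw [pd_mul et (c1.differentiable one_ne_zero) dZ, (pd_wt 0 (-1)).1] at this
    simpa using this
  -- As Z is only C¹, Z_t² + Z_x² cannot be differentiated in time at fixed x. It is half the sum of
  -- (Z_t + Z_x)² and (Z_t - Z_x)², each integrated over the labels of the family of characteristics
  -- along which it is differentiable.
  refine ⟨fun t => (1 / 2) * ((∫ c in (-M')..M', pd (1, 1) Z (t, c + -1 * t) ^ 2)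
    + ∫ c in (-M')..M', pd (1, -1) Z (t, c + -(-1) * t) ^ 2)
    + ∫ x in (-(M + 1))..(M + 1), (wt 0 (-1) (t, x) * Z (t, x)) ^ 2, fun t ht htT => ?_⟩
  have z0 := fun x hx => (h0 t x ht htT hx).1
  have z1 := fun x hx => (h0 t x ht htT hx).2.1
  have z2 := fun x hx => (h0 t x ht htT hx).2.2
  obtain ⟨a1, b1⟩ := key 1 (by norm_num) t ht htT
  obtain ⟨a2, b2⟩ := key (-1) (by norm_num) t ht htT
  have a3 := intervalIntegral_shift (φ := fun x => (wt 0 (-1) (t, x) * Z (t, x)) ^ 2) (M := M)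
    (M' := M + 1) (d := 0) (fun x hx => by simp [z0 x hx]) (by simp)
  have iz : ∀ {φ : ℝ → ℝ}, Continuous φ → (∀ x, M ≤ |x| → φ x = 0) → Integrable φ :=
    fun h1 h2 => integrable_of_vanish h1 h2
  simp only [pd_combination Z 1, pd_combination Z (-1)] at a1 a2 b1 b2 ⊢
  have i1 : Integrable fun x => (pd et Z (t, x) + 1 * pd ex Z (t, x)) ^ 2 :=
    iz (by fun_prop) fun x hx => by simp [z1 x hx, z2 x hx]
  have i2 : Integrable fun x => (pd et Z (t, x) + -1 * pd ex Z (t, x)) ^ 2 :=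
    iz (by fun_prop) fun x hx => by simp [z1 x hx, z2 x hx]
  have i3 : Integrable fun x => (wt 0 (-1) (t, x) * Z (t, x)) ^ 2 :=
    iz (by fun_prop) fun x hx => by simp [z0 x hx]
  have i4 : Integrable fun x => 2 * ((pd et Z (t, x) + 1 * pd ex Z (t, x)) * h (t, x)) :=
    iz (by fun_prop) fun x hx => by simp [z1 x hx, z2 x hx]
  have i5 : Integrable fun x => 2 * ((pd et Z (t, x) + -1 * pd ex Z (t, x)) * h (t, x)) :=
    iz (by fun_prop) fun x hx => by simp [z1 x hx, z2 x hx]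
  have i6 : Integrable fun x =>
      2 * (wt 0 (-1) (t, x) * Z (t, x) * (wt 0 (-1) (t, x) * pd et Z (t, x))) :=
    iz (by fun_prop) fun x hx => by simp [z0 x hx]
  constructor
  · simp only [add_zero] at a3
    rw [a1, a2, a3, ← integral_add i1 i2, ← integral_const_mul,
      ← integral_add ((i1.fun_add i2).const_mul _) i3]
    exact integral_congr_ae (Eventually.of_forall fun x => by simp only; ring)
  · refine (((b1.add b2).const_mul (1 / 2)).add (hW t ht htT)).congr_deriv ?_
    rw [← integral_add i4 i5, ← integral_const_mul, ← integral_add ((i4.fun_add i5).const_mul _) i6]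
    exact integral_congr_ae (Eventually.of_forall fun x => by simp only [hh]; ring)

/-- A Gronwall inequality with the integrable rate `(1 + t) e^{-t}`. -/
theorem gronwall_bet {E E' : ℝ → ℝ} {C g T : ℝ} (hC : 0 ≤ C)
    (hE : ∀ t, 0 ≤ t → t ≤ T → HasDerivAt E (E' t) t)
    (h0 : ∀ t, 0 ≤ t → t ≤ T → 0 ≤ E t) (hg : 0 ≤ g)
    (h : ∀ t, 0 ≤ t → t ≤ T → E' t ≤ C * bet t * (E t + g)) {t : ℝ} (ht : 0 ≤ t) (htT : t ≤ T) :
    E t ≤ Real.exp (2 * C) * (E 0 + g) := by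
  -- A primitive of `bet` on t ≥ 0, zero at 0 and bounded by 2, which gives the factor e^{2C}.
  set b : ℝ → ℝ := fun t => 2 - (2 + t) * Real.exp (-t) with hb
  have hbd : ∀ t, 0 ≤ t → HasDerivAt b (bet t) t := by
    intro t ht
    have h1 := (((hasDerivAt_id t).const_add 2).mul (hasDerivAt_neg t).exp).const_sub 2
    refine h1.congr_deriv ?_
    simp only [bet, abs_of_nonneg ht, id]
    ring
  have hF : ∀ t, 0 ≤ t → t ≤ T → HasDerivAt (fun t => (E t + g) * Real.exp (-C * b t))
      ((E' t - C * bet t * (E t + g)) * Real.exp (-C * b t)) t := by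
    intro t ht htT
    refine (((hE t ht htT).add_const g).mul (((hbd t ht).const_mul (-C)).exp)).congr_deriv ?_
    ring
  have hanti : AntitoneOn (fun t => (E t + g) * Real.exp (-C * b t)) (Set.Icc 0 T) := by
    refine antitoneOn_of_deriv_nonpos (convex_Icc 0 T)
      (fun s hs => (hF s hs.1 hs.2).continuousAt.continuousWithinAt) (fun s hs => ?_) fun s hs => ?_
    · rw [interior_Icc] at hs
      exact (hF s hs.1.le hs.2.le).differentiableAt.differentiableWithinAt
    · rw [interior_Icc] at hs
      rw [(hF s hs.1.le hs.2.le).deriv]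
      exact mul_nonpos_of_nonpos_of_nonneg (by linarith [h s hs.1.le hs.2.le]) (Real.exp_pos _).le
  have h1 := hanti ⟨le_rfl, ht.trans htT⟩ ⟨ht, htT⟩ ht
  simp only [hb, add_zero, neg_zero, Real.exp_zero, mul_one, sub_self, mul_zero] at h1
  have h2 : Real.exp (-(2 * C)) ≤ Real.exp (-C * (2 - (2 + t) * Real.exp (-t))) := by
    refine Real.exp_le_exp.2 ?_
    have : 0 ≤ C * ((2 + t) * Real.exp (-t)) := by positivity
    linarith
  have h3 := h0 t ht htT
  have h4 : (E t + g) * Real.exp (-(2 * C)) ≤ E 0 + g :=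
    (mul_le_mul_of_nonneg_left h2 (by linarith)).trans h1
  rw [Real.exp_neg, ← div_eq_mul_inv, div_le_iff₀ (Real.exp_pos _)] at h4
  linarith

/-- Quadratic growth from a bounded energy. -/
theorem quadratic_growth {Y Y' : ℝ → ℝ} {E T : ℝ}
    (hY : ∀ t, 0 ≤ t → t ≤ T → HasDerivAt Y (Y' t) t)
    (h : ∀ t, 0 ≤ t → t ≤ T → Y' t ≤ Y t / (1 + t) + (1 + t) * E) {t : ℝ} (ht : 0 ≤ t)
    (htT : t ≤ T) : Y t ≤ (1 + t) * (Y 0 + t * E) := by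
  -- The differential inequality says precisely that Y/(1+t) - tE is nonincreasing.
  have hF : ∀ t, 0 ≤ t → t ≤ T → HasDerivAt (fun t => Y t / (1 + t) - t * E)
      ((Y' t * (1 + t) - Y t) / (1 + t) ^ 2 - E) t := by
    intro t ht htT
    have hne : 1 + t ≠ 0 := by positivity
    refine (((hY t ht htT).div ((hasDerivAt_id t).const_add 1) hne).sub
      ((hasDerivAt_id t).mul_const E)).congr_deriv ?_
    simp
  have hanti : AntitoneOn (fun t => Y t / (1 + t) - t * E) (Set.Icc 0 T) := by
    refine antitoneOn_of_deriv_nonpos (convex_Icc 0 T)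
      (fun s hs => (hF s hs.1 hs.2).continuousAt.continuousWithinAt) (fun s hs => ?_) fun s hs => ?_
    · rw [interior_Icc] at hs
      exact (hF s hs.1.le hs.2.le).differentiableAt.differentiableWithinAt
    · rw [interior_Icc] at hs
      rw [(hF s hs.1.le hs.2.le).deriv]
      have hpos : 0 < 1 + s := by linarith [hs.1]
      have := h s hs.1.le hs.2.le
      rw [sub_nonpos, div_le_iff₀ (by positivity)]
      have h2 : Y s / (1 + s) * (1 + s) = Y s := by field_simp
      nlinarith
  have h1 := hanti ⟨le_rfl, ht.trans htT⟩ ⟨ht, htT⟩ ht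
  simp only [add_zero, div_one, zero_mul, sub_zero] at h1
  have h2 : Y t / (1 + t) ≤ Y 0 + t * E := by linarith
  rw [div_le_iff₀ (by positivity)] at h2
  linarith

end

/-! ### Higher-order energies stay bounded -/

noncomputable section

variable {u : ℝ × ℝ → ℝ}

theorem jet_singleton (v : ℝ × ℝ) (n : ℕ) (f : ℝ × ℝ → ℝ) (p : ℝ × ℝ) :
    jet {v} n f p = ∑ i ∈ Finset.range (n + 1), |(pd v)^[i] f p| := by
  induction n generalizing f with
  | zero => simp [jet]
  | succ n ih =>
    rw [jet, Finset.sum_singleton, ih, Finset.sum_range_succ' _ (n + 1), add_comm]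
    rfl

theorem abs_iterate_pd_le {S : Finset (ℝ × ℝ)} {v : ℝ × ℝ} (hv : v ∈ S) {j n : ℕ} (h : j ≤ n)
    (f : ℝ × ℝ → ℝ) (p : ℝ × ℝ) : |(pd v)^[j] f p| ≤ jet S n f p := by
  refine le_trans ?_ (jet_mono_set (Finset.singleton_subset_iff.2 hv) n f)
  rw [jet_singleton]
  exact Finset.single_le_sum (f := fun i => |(pd v)^[i] f p|) (fun _ _ => abs_nonneg _)
    (Finset.mem_range.2 (by omega))

theorem abs_pd_iterate_pd_le {S : Finset (ℝ × ℝ)} {v w : ℝ × ℝ} (hv : v ∈ S) (hw : w ∈ S)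
    {j n : ℕ} (h : j ≤ n) (hu : ContDiff ℝ (n + 1 : ℕ) u) (p : ℝ × ℝ) :
    |pd w ((pd v)^[j] u) p| ≤ jet S (n + 1) u p := by
  rw [← pd_iterate_comm hu (by omega)]
  exact (abs_iterate_pd_le hv h _ p).trans (jet_pd_le hw n u)

theorem iterate_pd_add {n j : ℕ} {f g : ℝ × ℝ → ℝ} (hf : ContDiff ℝ n f) (hg : ContDiff ℝ n g)
    (h : j ≤ n) (v : ℝ × ℝ) :
    (pd v)^[j] (fun p => f p + g p) = fun p => (pd v)^[j] f p + (pd v)^[j] g p := by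
  induction j with
  | zero => rfl
  | succ j ih =>
    simp only [Function.iterate_succ_apply']
    have d := fun {f : ℝ × ℝ → ℝ} (hf : ContDiff ℝ n f) =>
      (contDiff_iterate_pd (i := 1) hf h v).differentiable (by norm_num)
    rw [ih (by omega), pd_add v (d hf) (d hg)]

theorem iterate_pd_mul_left {n j : ℕ} {a f : ℝ × ℝ → ℝ} {v : ℝ × ℝ} (hd : Differentiable ℝ a)
    (ha : pd v a = fun _ => 0) (hf : ContDiff ℝ n f) (h : j ≤ n) :
    (pd v)^[j] (fun p => a p * f p) = fun p => a p * (pd v)^[j] f p := by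
  induction j with
  | zero => rfl
  | succ j ih =>
    simp only [Function.iterate_succ_apply']
    rw [ih (by omega), pd_mul v hd
      ((contDiff_iterate_pd (i := 1) hf h v).differentiable (by norm_num)), ha]
    simp

/-- The energy density of order `N`. -/
def energyDensity (N : ℕ) (u : ℝ × ℝ → ℝ) (p : ℝ × ℝ) : ℝ :=
  ∑ j ∈ Finset.range (N + 1), (pd et ((pd et)^[j] u) p ^ 2 + pd ex ((pd et)^[j] u) p ^ 2
    + wt 0 (-1) p ^ 2 * (pd et)^[j] u p ^ 2)

/-- A crude polynomial bound, sufficient for the integrability of sech² and for cosh → ∞. -/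
theorem one_add_sq_le_cosh (x : ℝ) : 1 + x ^ 2 ≤ Real.cosh (2 * x) := by
  have h3 := Real.cosh_two_mul x
  have h4 := Real.cosh_sq x
  have h5 : x ^ 2 ≤ Real.sinh x ^ 2 := by
    rcases le_total 0 x with h | h
    · exact pow_le_pow_left₀ h (Real.self_le_sinh_iff.2 h) 2
    · have := Real.sinh_le_self_iff.2 h
      nlinarith
  nlinarith [sq_nonneg (Real.sinh x)]

theorem wt_neg_one_sq_le (t x : ℝ) : wt 0 (-1) (t, x) ^ 2 ≤ (1 + x ^ 2)⁻¹ := by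
  have h1 : wt 0 (-1) (t, x) = (Real.cosh (2 * x))⁻¹ := by simp [wt, Real.rpow_neg_one]
  have h3 : wt 0 (-1) (t, x) ≤ 1 := wt_neg_one_le_one (by norm_num) _
  have h4 := wt_pos 0 (-1) (t, x)
  calc _ ≤ wt 0 (-1) (t, x) := by nlinarith
    _ ≤ _ := by rw [h1]; exact inv_anti₀ (by positivity) (one_add_sq_le_cosh x)

theorem continuous_wt (a b : ℝ) : Continuous (wt a b) := (contDiff_wt (n := 0) a b).continuous

theorem integrable_wt_sq (t : ℝ) : Integrable fun x => wt 0 (-1) (t, x) ^ 2 := by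
  have := continuous_wt 0 (-1)
  refine integrable_inv_one_add_sq.mono' (by fun_prop) (Eventually.of_forall fun x => ?_)
  rw [Real.norm_of_nonneg (sq_nonneg _)]
  exact wt_neg_one_sq_le t x

/-- The integral of the squared weight. -/
def wtMass : ℝ := ∫ x, wt 0 (-1) (0, x) ^ 2

theorem wtMass_nonneg : 0 ≤ wtMass := integral_nonneg fun _ => sq_nonneg _

theorem integral_wt_sq (t : ℝ) : ∫ x, wt 0 (-1) (t, x) ^ 2 = wtMass := by simp [wtMass, wt]

theorem sq_sum_abs_le (n : ℕ) (a : ℕ → ℝ) :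
    (∑ i ∈ Finset.range n, |a i|) ^ 2 ≤ n * ∑ i ∈ Finset.range n, a i ^ 2 := by
  have := sq_sum_le_card_mul_sum_sq (s := Finset.range n) (f := fun i => |a i|)
  simpa using this

section

variable {N : ℕ} {K g L : ℝ} {Q G : ℝ × ℝ → ℝ}

/-- The hypotheses of the energy estimate: a solution of the rescaled equation with compactly
supported data and source. -/
structure EnergyHyp (N : ℕ) (K g L : ℝ) (Q G u : ℝ × ℝ → ℝ) : Prop where
  one_le : 1 ≤ N
  K_nonneg : 0 ≤ K
  g_nonneg : 0 ≤ g
  smooth : ContDiff ℝ (N + 1 : ℕ) u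
  jetQ : JetLE N Q fun p => K * (bet p.1 * wt 0 (-1) p)
  jetG : JetLE N G fun p => g * (bet p.1 * wt 0 (-1) p)
  eqn : ∀ p, pd et (pd et u) p - pd ex (pd ex u) p = -((wt 0 (-1) p ^ 2 + Q p) * u p) + G p
  support_G : ∀ p : ℝ × ℝ, L ≤ |p.2| → G p = 0
  support_u : ∀ x, L ≤ |x| → u (0, x) = 0
  support_ut : ∀ x, L ≤ |x| → pd et u (0, x) = 0

theorem bet_wt_le_one (p : ℝ × ℝ) : bet p.1 * wt 0 (-1) p ≤ 1 :=
  mul_le_one₀ (bet_le_one _) (wt_pos _ _ _).le (wt_neg_one_le_one (by norm_num) p)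

theorem EnergyHyp.jet_zero (H : EnergyHyp N K g L Q G u) {t x : ℝ} (ht : 0 ≤ t)
    (hx : L + 1 + t ≤ |x|) : jet {et, ex} (N + 1) u (t, x) = 0 := by
  have hN := H.one_le
  refine jet_eq_zero_of_support (A := 1 + K) (by omega) H.smooth (fun p => ?_) H.eqn H.support_G
    H.support_u H.support_ut ht hx
  have h1 := wt_neg_one_le_one (b := -1) (by norm_num) p
  have h2 := wt_pos 0 (-1) p
  refine (abs_add_le _ _).trans (add_le_add ?_ ?_)
  · rw [abs_of_nonneg (sq_nonneg _)]; nlinarith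
  · exact (H.jetQ.abs_le p).trans (mul_le_of_le_one_right H.K_nonneg (bet_wt_le_one p))

/-- The differentiated right-hand side, apart from the main potential. -/
theorem EnergyHyp.abs_iterate_source_le (H : EnergyHyp N K g L Q G u) {j : ℕ} (hj : j ≤ N)
    (p : ℝ × ℝ) : |(pd et)^[j] (fun q => -(Q q * u q) + G q) p|
      ≤ bet p.1 * (3 ^ N * K * (wt 0 (-1) p * ∑ i ∈ Finset.range (N + 1), |(pd et)^[i] u p|)
        + g * wt 0 (-1) p) := by
  have hu := contDiff_of_succ H.smooth
  have hQ := H.jetQ.1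
  have hG := H.jetG.1
  have hsub : ({et} : Finset (ℝ × ℝ)) ⊆ {et, ex} := by simp
  refine (abs_iterate_pd_le (S := {et}) (by simp) hj _ p).trans ?_
  refine (jet_add_le N (hQ.mul hu).neg hG).trans ?_
  rw [jet_neg, mul_add]
  refine add_le_add ((jet_mul_le N hQ hu).trans ?_) ?_
  · rw [jet_singleton et N u]
    have h1 : jet {et} N Q p ≤ K * (bet p.1 * wt 0 (-1) p) :=
      (jet_mono_set hsub N Q).trans (H.jetQ.2 p)
    calc _ ≤ 3 ^ N * (K * (bet p.1 * wt 0 (-1) p)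
          * ∑ i ∈ Finset.range (N + 1), |(pd et)^[i] u p|) := by gcongr
      _ = _ := by ring
  · exact (jet_mono_set hsub N G).trans ((H.jetG.2 p).trans_eq (by ring))

/-- Q carries a factor sech(2x), so it meets u only through sech · ∂_t^i u, which the energy
controls. The plain L² norm of u, which may grow in time, never appears. The rest is Young's
inequality. -/
theorem EnergyHyp.density_ineq (H : EnergyHyp N K g L Q G u) (p : ℝ × ℝ) :
    ∑ j ∈ Finset.range (N + 1), 2 * (pd et ((pd et)^[j] u) p
        * (pd et)^[j] (fun q => -(Q q * u q) + G q) p)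
      ≤ bet p.1 * ((3 ^ N * K + 1 + 3 ^ N * K * (N + 1) ^ 2) * energyDensity N u p
        + (N + 1) * g ^ 2 * wt 0 (-1) p ^ 2) := by
  set s := wt 0 (-1) p
  set K' := 3 ^ N * K
  have hK' : 0 ≤ K' := mul_nonneg (by positivity) H.K_nonneg
  set S := ∑ i ∈ Finset.range (N + 1), |(pd et)^[i] u p|
  have hS : S ^ 2 ≤ (N + 1) * ∑ i ∈ Finset.range (N + 1), (pd et)^[i] u p ^ 2 := by
    exact_mod_cast sq_sum_abs_le (N + 1) fun i => (pd et)^[i] u p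
  have hb := (bet_pos p.1).le
  have hs : 0 < s := wt_pos _ _ _
  have hS0 : 0 ≤ S := Finset.sum_nonneg fun _ _ => abs_nonneg _
  have step : ∀ j ∈ Finset.range (N + 1), 2 * (pd et ((pd et)^[j] u) p
        * (pd et)^[j] (fun q => -(Q q * u q) + G q) p)
      ≤ bet p.1 * ((K' + 1) * pd et ((pd et)^[j] u) p ^ 2 + (K' * (s ^ 2 * S ^ 2)
        + g ^ 2 * s ^ 2)) := by
    intro j hj
    have h1 := H.abs_iterate_source_le (Nat.lt_succ_iff.1 (Finset.mem_range.1 hj)) p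
    set a := pd et ((pd et)^[j] u) p
    calc 2 * (a * _) ≤ 2 * (|a| * |(pd et)^[j] (fun q => -(Q q * u q) + G q) p|) := by
          rw [← abs_mul]; gcongr; exact le_abs_self _
      _ ≤ 2 * (|a| * (bet p.1 * (K' * (s * S) + g * s))) := by gcongr
      _ = bet p.1 * (K' * (2 * |a| * (s * S)) + 2 * |a| * (g * s)) := by ring
      _ ≤ bet p.1 * (K' * (|a| ^ 2 + (s * S) ^ 2) + (|a| ^ 2 + (g * s) ^ 2)) := by
          gcongr
          · exact two_mul_le_add_sq _ _
          · exact two_mul_le_add_sq _ _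
      _ = _ := by rw [sq_abs]; ring
  refine (Finset.sum_le_sum step).trans ?_
  rw [← Finset.mul_sum, Finset.sum_add_distrib, ← Finset.mul_sum, Finset.sum_const,
    Finset.card_range, nsmul_eq_mul]
  refine mul_le_mul_of_nonneg_left ?_ hb
  have e1 : ∑ j ∈ Finset.range (N + 1), pd et ((pd et)^[j] u) p ^ 2 ≤ energyDensity N u p :=
    Finset.sum_le_sum fun j _ => by
      have : 0 ≤ s ^ 2 * (pd et)^[j] u p ^ 2 := by positivity
      linarith [sq_nonneg (pd ex ((pd et)^[j] u) p)]
  have e2 : s ^ 2 * ∑ j ∈ Finset.range (N + 1), (pd et)^[j] u p ^ 2 ≤ energyDensity N u p := by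
    rw [Finset.mul_sum]
    exact Finset.sum_le_sum fun j _ => by
      linarith [sq_nonneg (pd ex ((pd et)^[j] u) p), sq_nonneg (pd et ((pd et)^[j] u) p)]
  have e3 : s ^ 2 * S ^ 2 ≤ (N + 1) * energyDensity N u p := by
    calc _ ≤ s ^ 2 * ((N + 1) * ∑ i ∈ Finset.range (N + 1), (pd et)^[i] u p ^ 2) := by gcongr
      _ = (N + 1) * (s ^ 2 * ∑ i ∈ Finset.range (N + 1), (pd et)^[i] u p ^ 2) := by ring
      _ ≤ _ := by gcongr
  have e4 := mul_le_mul_of_nonneg_left e1 (a := K' + 1) (by positivity)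
  have e5 := mul_le_mul_of_nonneg_left e3 (a := ((N : ℝ) + 1) * K') (by positivity)
  push_cast
  linarith

theorem EnergyHyp.continuous_iterate (H : EnergyHyp N K g L Q G u) {j : ℕ} (hj : j ≤ N) :
    Continuous ((pd et)^[j] u) ∧ Continuous (pd et ((pd et)^[j] u)) ∧
      Continuous (pd ex ((pd et)^[j] u)) := by
  have h1 : ContDiff ℝ (0 + 1 : ℕ) ((pd et)^[j] u) := contDiff_iterate_pd H.smooth (by omega) et
  exact ⟨h1.continuous, (contDiff_pd h1 et).continuous, (contDiff_pd h1 ex).continuous⟩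

theorem EnergyHyp.iterate_zero (H : EnergyHyp N K g L Q G u) {t x : ℝ} (ht : 0 ≤ t)
    (hx : L + 1 + t ≤ |x|) {j : ℕ} (hj : j ≤ N) :
    (pd et)^[j] u (t, x) = 0 ∧ pd et ((pd et)^[j] u) (t, x) = 0 ∧
      pd ex ((pd et)^[j] u) (t, x) = 0 := by
  have h0 := H.jet_zero ht hx
  refine ⟨abs_nonpos_iff.1 ?_, abs_nonpos_iff.1 ?_, abs_nonpos_iff.1 ?_⟩ <;> rw [← h0]
  · exact abs_iterate_pd_le (by simp) (by omega) u _
  · exact abs_pd_iterate_pd_le (by simp) (by simp) hj H.smooth _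
  · exact abs_pd_iterate_pd_le (by simp) (by simp) hj H.smooth _

theorem EnergyHyp.integrable_density (H : EnergyHyp N K g L Q G u) {t : ℝ} (ht : 0 ≤ t) {j : ℕ}
    (hj : j ≤ N) : Integrable fun x => pd et ((pd et)^[j] u) (t, x) ^ 2
      + pd ex ((pd et)^[j] u) (t, x) ^ 2 + wt 0 (-1) (t, x) ^ 2 * (pd et)^[j] u (t, x) ^ 2 := by
  obtain ⟨c1, c2, c3⟩ := H.continuous_iterate hj
  have c4 := continuous_wt 0 (-1)
  refine integrable_of_vanish (M := L + 1 + t) (by fun_prop) fun x hx => ?_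
  obtain ⟨h1, h2, h3⟩ := H.iterate_zero ht hx hj
  simp [h1, h2, h3]

/-- The energy stays bounded. -/
theorem EnergyHyp.energy_le (H : EnergyHyp N K g L Q G u) {t : ℝ} (ht : 0 ≤ t) :
    ∫ x, energyDensity N u (t, x) ≤ Real.exp (2 * (3 ^ N * K + 1 + 3 ^ N * K * (N + 1) ^ 2
      + (N + 1) * wtMass)) * ((∫ x, energyDensity N u (0, x)) + g ^ 2) := by
  have hu := contDiff_of_succ H.smooth
  set Hs : ℝ × ℝ → ℝ := fun q => -(Q q * u q) + G q with hHs
  have cHs : ContDiff ℝ N Hs := (H.jetQ.1.mul hu).neg.add H.jetG.1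
  have cs : ContDiff ℝ N fun p => -(wt 0 (-1) p ^ 2) := ((contDiff_wt 0 (-1)).pow 2).neg
  have ds : Differentiable ℝ fun p => -(wt 0 (-1) p ^ 2) :=
    (((contDiff_wt (n := 1) 0 (-1)).pow 2).neg).differentiable one_ne_zero
  -- The main potential sech² is independent of time: it commutes with every ∂_t and is kept inside
  -- the energy instead of being estimated.
  have hs0 : pd et (fun p => -(wt 0 (-1) p ^ 2)) = fun _ => 0 := by
    have d := (contDiff_wt (n := 1) 0 (-1)).differentiable one_ne_zero
    simp only [pow_two]
    rw [pd_neg, pd_mul et d d, (pd_wt 0 (-1)).1]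
    funext p; ring
  set h : ℝ × ℝ → ℝ := fun p => -(wt 0 (-1) p ^ 2) * u p + Hs p with hh
  have ch : ContDiff ℝ N h := (cs.mul hu).add cHs
  have hit : ∀ j ≤ N, (pd et)^[j] h = fun p => -(wt 0 (-1) p ^ 2) * (pd et)^[j] u p
      + (pd et)^[j] Hs p := fun j hj => by
    rw [hh, iterate_pd_add (cs.mul hu) cHs hj, iterate_pd_mul_left ds hs0 hu hj]
  have heq : ∀ p, pd et (pd et u) p - pd ex (pd ex u) p = h p := fun p => by
    rw [H.eqn, hh, hHs]; ring
  have cI : ∀ j ≤ N, Continuous ((pd et)^[j] Hs) := fun j hj =>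
    (contDiff_iterate_pd (i := 0) cHs (by omega) et).continuous
  have hex : ∀ j : ℕ, ∃ E : ℝ → ℝ, j ≤ N → ∀ s, 0 ≤ s → s ≤ t →
      E s = (∫ x, (pd et ((pd et)^[j] u) (s, x) ^ 2 + pd ex ((pd et)^[j] u) (s, x) ^ 2
        + wt 0 (-1) (s, x) ^ 2 * (pd et)^[j] u (s, x) ^ 2)) ∧
      HasDerivAt E (∫ x, 2 * (pd et ((pd et)^[j] u) (s, x) * (pd et)^[j] Hs (s, x))) s := by
    intro j
    by_cases hj : j ≤ N
    · obtain ⟨E, hE⟩ := exists_energy (Z := (pd et)^[j] u) (f := (pd et)^[j] Hs)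
        (by exact_mod_cast contDiff_iterate_pd (i := 1) H.smooth (by omega) et) (cI j hj)
        (fun e he q s => by
          have := hasDerivAt_char_iterate H.one_le H.smooth ch heq he j hj q s
          rw [hit j hj] at this
          exact this.congr_deriv (by ring)) (M := L + 1 + t)
        (fun s x hs hst hx => H.iterate_zero hs (by linarith) hj)
      exact ⟨E, fun _ => hE⟩
    · exact ⟨0, fun h => absurd h hj⟩
  choose E hE using hex
  have hEs : ∀ s, 0 ≤ s → s ≤ t →
      ∑ j ∈ Finset.range (N + 1), E j s = ∫ x, energyDensity N u (s, x) := by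
    intro s hs hst
    simp only [energyDensity]
    rw [integral_finsetSum _ fun j hj => H.integrable_density hs (by simp at hj; omega)]
    exact Finset.sum_congr rfl fun j hj => (hE j (by simp at hj; omega) s hs hst).1
  have hint : ∀ s, 0 ≤ s → Integrable fun x => energyDensity N u (s, x) := fun s hs =>
    integrable_finsetSum _ fun j hj => H.integrable_density hs (by simp at hj; omega)
  have hn : ∀ p, 0 ≤ energyDensity N u p := fun p => Finset.sum_nonneg fun j _ => by positivity
  -- The extra (N+1) · `wtMass` in the rate accounts for the source term, proportional to g² sech²,
  -- once integrated in space.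
  have := gronwall_bet (E := fun s => ∑ j ∈ Finset.range (N + 1), E j s)
    (E' := fun s => ∑ j ∈ Finset.range (N + 1),
      ∫ x, 2 * (pd et ((pd et)^[j] u) (s, x) * (pd et)^[j] Hs (s, x)))
    (C := 3 ^ N * K + 1 + 3 ^ N * K * (N + 1) ^ 2 + (N + 1) * wtMass) (g := g ^ 2) (T := t)
    (by have := H.K_nonneg; have := wtMass_nonneg; positivity)
    (fun s hs hst => HasDerivAt.fun_sum fun j hj => (hE j (by simp at hj; omega) s hs hst).2)
    (fun s hs hst => by
      simp only [hEs s hs hst]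
      exact integral_nonneg fun x => hn _)
    (sq_nonneg g)
    (fun s hs hst => by
      simp only [hEs s hs hst]
      have hi : ∀ j ∈ Finset.range (N + 1), Integrable fun x =>
          2 * (pd et ((pd et)^[j] u) (s, x) * (pd et)^[j] Hs (s, x)) := by
        intro j hj
        have hj' : j ≤ N := by simp at hj; omega
        obtain ⟨-, c2, -⟩ := H.continuous_iterate hj'
        have c3 := cI j hj'
        refine integrable_of_vanish (M := L + 1 + s) (by fun_prop) fun x hx => ?_
        rw [(H.iterate_zero hs hx hj').2.1]; ring
      rw [← integral_finsetSum _ hi]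
      have i1 := ((hint s hs).const_mul (3 ^ N * K + 1 + 3 ^ N * K * (N + 1) ^ 2)).fun_add
        ((integrable_wt_sq s).const_mul ((N + 1) * g ^ 2))
      refine (integral_mono (integrable_finsetSum _ hi) (i1.const_mul (bet s))
        fun x => H.density_ineq (s, x)).trans ?_
      rw [integral_const_mul, integral_add ((hint s hs).const_mul _)
        ((integrable_wt_sq s).const_mul _), integral_const_mul, integral_const_mul, integral_wt_sq]
      have hb := (bet_pos s).le
      have e1 : 0 ≤ ∫ x, energyDensity N u (s, x) := integral_nonneg fun x => hn _
      have e2 := wtMass_nonneg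
      have e3 := H.K_nonneg
      rw [mul_comm _ (bet s), mul_assoc (bet s)]
      refine mul_le_mul_of_nonneg_left ?_ hb
      have e4 : 0 ≤ (3 ^ N * K + 1 + 3 ^ N * K * ((N : ℝ) + 1) ^ 2) * g ^ 2 := by positivity
      have e5 : 0 ≤ ((N : ℝ) + 1) * wtMass * ∫ x, energyDensity N u (s, x) := by positivity
      linarith)
    ht le_rfl
  simp only [hEs t ht le_rfl, hEs 0 le_rfl ht] at this
  exact this

end

end

/-! ### Recovery of all derivatives and the energy estimate -/

noncomputable section

variable {N : ℕ} {K g L : ℝ} {Q G u : ℝ × ℝ → ℝ}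

theorem jet_rec_sq {c J a b d : ℝ} (hJ : 0 ≤ J) (h : J ≤ c * (a + b + d)) :
    J ^ 2 ≤ 3 * c ^ 2 * (a ^ 2 + b ^ 2 + d ^ 2) := by
  have h1 := pow_le_pow_left₀ hJ h 2
  have h2 : 0 ≤ c ^ 2 * ((a - b) ^ 2 + (b - d) ^ 2 + (a - d) ^ 2) := by positivity
  nlinarith

theorem EnergyHyp.potential_jet (H : EnergyHyp N K g L Q G u) {C : ℝ}
    (hC : JetLE N (wt 0 (-1)) fun p => C * wt 0 (-1) p) (p : ℝ × ℝ) :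
    jet {et, ex} N (fun q => wt 0 (-1) q ^ 2 + Q q) p ≤ 3 ^ N * C ^ 2 + K := by
  have h1 := (hC.mul hC).add H.jetQ
  simp only [← pow_two] at h1
  refine (h1.2 p).trans (add_le_add ?_ (mul_le_of_le_one_right H.K_nonneg (bet_wt_le_one p)))
  have h2 := hC.nonneg p
  have h3 := wt_neg_one_le_one (b := -1) (by norm_num) p
  have h4 := wt_pos 0 (-1) p
  have h5 : 0 ≤ C := nonneg_of_mul_nonneg_left h2 h4
  gcongr
  exact mul_le_of_le_one_right h5 h3

/-- Recovery of all derivatives from the energy density. -/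
theorem exists_jet_le_density (N : ℕ) (K : ℝ) : ∃ C, 0 ≤ C ∧ ∀ (g L : ℝ) (Q G u : ℝ × ℝ → ℝ),
    EnergyHyp N K g L Q G u → ∀ p, jet {et, ex} (N + 1) u p ^ 2
      ≤ C * (u p ^ 2 + energyDensity N u p + g ^ 2 * wt 0 (-1) p ^ 2) := by
  obtain ⟨C0, hC0, hwt⟩ := jetLE_wt 0 (-1) N
  -- Space is the eliminated direction, u_xx = u_tt + (sech² + Q) u - G: the pure time derivatives
  -- of u and of ∂_x u then suffice, and apart from u itself they are in the energy density.
  obtain ⟨C1, hC1, H1⟩ := jet_le_of_wave et_ne_ex (3 ^ N * C0 ^ 2 + K) (N + 1)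
  refine ⟨3 * C1 ^ 2 * (3 * (N + 2)), by positivity, fun g L Q G u H p => ?_⟩
  have hV : ContDiff ℝ N fun q => wt 0 (-1) q ^ 2 + Q q := ((contDiff_wt 0 (-1)).pow 2).add H.jetQ.1
  have h1 := H1 u (fun q => wt 0 (-1) q ^ 2 + Q q) (fun q => - G q) p H.smooth hV H.jetG.1.neg
    (H.potential_jet hwt p) (fun _ q => by linarith [H.eqn q])
  simp only [Nat.add_sub_cancel] at h1
  rw [jet_neg] at h1
  have h2 := jet_rec_sq (jet_nonneg _ _) h1
  have hg : jet {et, ex} N G p ^ 2 ≤ g ^ 2 * wt 0 (-1) p ^ 2 := by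
    rw [← mul_pow]
    refine pow_le_pow_left₀ (jet_nonneg _ _) ((H.jetG.2 p).trans ?_) 2
    exact mul_le_mul_of_nonneg_left (mul_le_of_le_one_left (wt_pos 0 (-1) p).le (bet_le_one p.1))
      H.g_nonneg
  have ha : jet {et} (N + 1) u p ^ 2 ≤ 2 * (N + 1) * (u p ^ 2 + energyDensity N u p) := by
    rw [jet, Finset.sum_singleton, jet_singleton]
    have e0 : ∀ i, (pd et)^[i] (pd et u) p = pd et ((pd et)^[i] u) p := fun i => by
      rw [← Function.iterate_succ_apply, Function.iterate_succ_apply']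
    have e1 := sq_sum_abs_le (N + 1) fun i => (pd et)^[i] (pd et u) p
    set S := ∑ i ∈ Finset.range (N + 1), |(pd et)^[i] (pd et u) p|
    have e2 : ∑ i ∈ Finset.range (N + 1), (pd et)^[i] (pd et u) p ^ 2 ≤ energyDensity N u p :=
      Finset.sum_le_sum fun j _ => by
        rw [e0]
        have : 0 ≤ wt 0 (-1) p ^ 2 * (pd et)^[j] u p ^ 2 := by positivity
        linarith [sq_nonneg (pd ex ((pd et)^[j] u) p)]
    push_cast at e1
    have e3 := mul_le_mul_of_nonneg_left e2 (a := (N : ℝ) + 1) (by positivity)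
    have e4 : (|u p| + S) ^ 2 ≤ 2 * (u p ^ 2 + S ^ 2) := by
      rw [← sq_abs (u p)]; nlinarith [sq_nonneg (|u p| - S)]
    have e5 : 0 ≤ (N : ℝ) * u p ^ 2 := by positivity
    linarith
  have hb : jet {et} N (pd ex u) p ^ 2 ≤ (N + 1) * energyDensity N u p := by
    rw [jet_singleton]
    have e1 := sq_sum_abs_le (N + 1) fun i => (pd et)^[i] (pd ex u) p
    have e2 : ∑ i ∈ Finset.range (N + 1), (pd et)^[i] (pd ex u) p ^ 2 ≤ energyDensity N u p :=
      Finset.sum_le_sum fun j hj => by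
        rw [pd_iterate_comm H.smooth (by simp at hj; omega)]
        have : 0 ≤ wt 0 (-1) p ^ 2 * (pd et)^[j] u p ^ 2 := by positivity
        linarith [sq_nonneg (pd et ((pd et)^[j] u) p)]
    push_cast at e1
    exact e1.trans (mul_le_mul_of_nonneg_left e2 (by positivity))
  refine h2.trans ?_
  rw [mul_assoc (3 * C1 ^ 2)]
  refine mul_le_mul_of_nonneg_left ?_ (by positivity)
  have hn : 0 ≤ energyDensity N u p := Finset.sum_nonneg fun j _ => by positivity
  have e6 : 0 ≤ (N : ℝ) * energyDensity N u p := by positivity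
  have e7 : 0 ≤ (N : ℝ) * (g ^ 2 * wt 0 (-1) p ^ 2) := by positivity
  have e8 : 0 ≤ g ^ 2 * wt 0 (-1) p ^ 2 := by positivity
  have e9 : 0 ≤ (N : ℝ) * u p ^ 2 := by positivity
  linarith [sq_nonneg (u p)]

/-- Recovery of all derivatives from the initial data. -/
theorem exists_jet_le_data (N : ℕ) (K : ℝ) : ∃ C, 0 ≤ C ∧ ∀ (g L : ℝ) (Q G u : ℝ × ℝ → ℝ),
    EnergyHyp N K g L Q G u → ∀ p, jet {et, ex} (N + 1) u p ^ 2
      ≤ C * ((jet {ex} (N + 1) u p + jet {ex} N (pd et u) p) ^ 2 + g ^ 2 * wt 0 (-1) p ^ 2) := by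
  obtain ⟨C0, hC0, hwt⟩ := jetLE_wt 0 (-1) N
  -- The roles are exchanged: time is eliminated, so space derivatives of u and u_t, known
  -- initially, determine the full jet.
  obtain ⟨C1, hC1, H1⟩ := jet_le_of_wave et_ne_ex.symm (3 ^ N * C0 ^ 2 + K) (N + 1)
  refine ⟨3 * C1 ^ 2, by positivity, fun g L Q G u H p => ?_⟩
  have hV : ContDiff ℝ N fun q => wt 0 (-1) q ^ 2 + Q q := ((contDiff_wt 0 (-1)).pow 2).add H.jetQ.1
  have h1 := H1 u (fun q => -(wt 0 (-1) q ^ 2 + Q q)) G p H.smooth hV.neg H.jetG.1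
    (by
      rw [Finset.pair_comm]
      simp only [Nat.add_sub_cancel]
      rw [jet_neg]; exact H.potential_jet hwt p) (fun _ q => by linarith [H.eqn q])
  simp only [Nat.add_sub_cancel] at h1
  rw [Finset.pair_comm] at h1
  have hg : jet {et, ex} N G p ^ 2 ≤ g ^ 2 * wt 0 (-1) p ^ 2 := by
    rw [← mul_pow]
    refine pow_le_pow_left₀ (jet_nonneg _ _) ((H.jetG.2 p).trans ?_) 2
    exact mul_le_mul_of_nonneg_left (mul_le_of_le_one_left (wt_pos 0 (-1) p).le (bet_le_one p.1))
      H.g_nonneg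
  have h2 := jet_rec_sq (b := jet {et, ex} N G p) (d := 0)
    (a := jet {ex} (N + 1) u p + jet {ex} N (pd et u) p)
    (jet_nonneg _ _) (by rw [add_zero]; exact h1)
  refine h2.trans ?_
  refine mul_le_mul_of_nonneg_left ?_ (by positivity)
  linarith

theorem EnergyHyp.integrable_jet_sq (H : EnergyHyp N K g L Q G u) {t : ℝ} (ht : 0 ≤ t) :
    Integrable fun x => jet {et, ex} (N + 1) u (t, x) ^ 2 := by
  have hc := continuous_jet (S := {et, ex}) (N + 1) H.smooth
  exact integrable_of_vanish (M := L + 1 + t) (by fun_prop) fun x hx => by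
    rw [H.jet_zero ht hx]; norm_num

/-- From 2 u u_t ≤ u²/(1+t) + (1+t) u_t² and the bounded energy, the squared L² norm grows at most
quadratically. This is the origin of the factor t + 1 in the final estimate. -/
theorem EnergyHyp.integral_sq_le (H : EnergyHyp N K g L Q G u) {E : ℝ}
    (hE : ∀ t, 0 ≤ t → ∫ x, energyDensity N u (t, x) ≤ E) {t : ℝ} (ht : 0 ≤ t) :
    ∫ x, u (t, x) ^ 2 ≤ (1 + t) * ((∫ x, u (0, x) ^ 2) + t * E) := by
  have hN := H.one_le
  have h1 : ContDiff ℝ 1 u := by exact_mod_cast contDiff_le H.smooth (by omega : 1 ≤ N + 1)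
  have hz : ∀ s x : ℝ, 0 ≤ s → s ≤ t → L + 1 + t ≤ |x| → u (s, x) = 0 := fun s x hs hst hx =>
    (H.iterate_zero hs (by linarith) (Nat.zero_le N)).1
  have hY : ∀ s, 0 ≤ s → s ≤ t →
      ∫ x in (-(L + 1 + t + 1))..(L + 1 + t + 1), u (s, x) ^ 2 = ∫ x, u (s, x) ^ 2 := by
    intro s hs hst
    have := intervalIntegral_shift (φ := fun x => u (s, x) ^ 2) (M := L + 1 + t)
      (M' := L + 1 + t + 1) (d := 0) (fun x hx => by simp [hz s x hs hst hx]) (by simp)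
    simpa using this
  have := quadratic_growth
    (Y := fun s => ∫ x in (-(L + 1 + t + 1))..(L + 1 + t + 1), u (s, x) ^ 2)
    (Y' := fun s => ∫ x, 2 * (u (s, x) * pd et u (s, x))) (E := E) (T := t)
    (fun s hs hst => hasDerivAt_integral_plane h1 fun x hx => hz s x hs hst hx)
    (fun s hs hst => by
      simp only [hY s hs hst]
      obtain ⟨c1, c2, c3⟩ := H.continuous_iterate (Nat.zero_le N)
      simp only [Function.iterate_zero, id] at c1 c2 c3
      have hpos : 0 < 1 + s := by positivity
      have i1 : Integrable fun x => u (s, x) ^ 2 :=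
        integrable_of_vanish (M := L + 1 + t) (by fun_prop) fun x hx => by simp [hz s x hs hst hx]
      have i2 : Integrable fun x => 2 * (u (s, x) * pd et u (s, x)) :=
        integrable_of_vanish (M := L + 1 + t) (by fun_prop) fun x hx => by simp [hz s x hs hst hx]
      have i3 : Integrable fun x => energyDensity N u (s, x) :=
        integrable_finsetSum _ fun j hj => H.integrable_density hs (by simp at hj; omega)
      have hle := integral_mono i2 ((i1.const_mul (1 + s)⁻¹).fun_add (i3.const_mul (1 + s)))
        fun x => by
          have e1 : pd et u (s, x) ^ 2 ≤ energyDensity N u (s, x) := by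
            have := Finset.single_le_sum (f := fun j => pd et ((pd et)^[j] u) (s, x) ^ 2
              + pd ex ((pd et)^[j] u) (s, x) ^ 2 + wt 0 (-1) (s, x) ^ 2 * (pd et)^[j] u (s, x) ^ 2)
              (fun j _ => by positivity) (Finset.mem_range.2 (Nat.succ_pos N))
            refine le_trans ?_ this
            simp only [Function.iterate_zero, id]
            have e : 0 ≤ wt 0 (-1) (s, x) ^ 2 * u (s, x) ^ 2 := by positivity
            linarith [sq_nonneg (pd ex u (s, x))]
          change 2 * (u (s, x) * pd et u (s, x))
            ≤ (1 + s)⁻¹ * u (s, x) ^ 2 + (1 + s) * energyDensity N u (s, x)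
          have e2 : 0 ≤ (1 + s)⁻¹ * (u (s, x) - (1 + s) * pd et u (s, x)) ^ 2 := by positivity
          have e3 : (1 + s)⁻¹ * (u (s, x) - (1 + s) * pd et u (s, x)) ^ 2
              = (1 + s)⁻¹ * u (s, x) ^ 2 - 2 * (u (s, x) * pd et u (s, x))
                + (1 + s) * pd et u (s, x) ^ 2 := by field_simp; ring
          have e4 := mul_le_mul_of_nonneg_left e1 hpos.le
          linarith
      rw [integral_add (i1.const_mul _) (i3.const_mul _), integral_const_mul (1 + s)⁻¹,
        integral_const_mul (1 + s)] at hle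
      refine hle.trans (add_le_add (le_of_eq ?_) (mul_le_mul_of_nonneg_left (hE s hs) hpos.le))
      rw [div_eq_inv_mul]) ht le_rfl
  simp only [hY t ht le_rfl, hY 0 le_rfl ht] at this
  exact this

/-- The energy estimate. -/
theorem exists_energy_estimate (N : ℕ) (K : ℝ) (hK : 0 ≤ K) :
    ∃ C, 0 ≤ C ∧ ∀ (g L : ℝ) (Q G u : ℝ × ℝ → ℝ),
    EnergyHyp N K g L Q G u → ∀ t, 0 ≤ t → ∫ x, jet {et, ex} (N + 1) u (t, x) ^ 2
      ≤ C * (1 + t) ^ 2 * ((∫ x, (jet {ex} (N + 1) u (0, x) + jet {ex} N (pd et u) (0, x)) ^ 2)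
        + g ^ 2) := by
  obtain ⟨C1, hC1, H1⟩ := exists_jet_le_density N K
  obtain ⟨C2, hC2, H2⟩ := exists_jet_le_data N K
  have hI := wtMass_nonneg
  set X := Real.exp (2 * (3 ^ N * K + 1 + 3 ^ N * K * (N + 1) ^ 2 + (N + 1) * wtMass)) with hX
  have hX1 : 1 ≤ X := Real.one_le_exp (by positivity)
  -- Bounds the initial value of ∫ u² plus the energy in terms of the data and g²: the summands 1
  -- and 3(N+1) count squares of jets, and `wtMass` integrates the source weight.
  set P : ℝ := C2 * (1 + 3 * (N + 1)) * (1 + wtMass) with hP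
  have hP0 : 0 ≤ P := by positivity
  refine ⟨C1 * (P + 2 * X * (P + 1) + wtMass), by positivity, fun g L Q G u H t ht => ?_⟩
  set J0 := ∫ x, (jet {ex} (N + 1) u (0, x) + jet {ex} N (pd et u) (0, x)) ^ 2 with hJ0
  have J0n : 0 ≤ J0 := integral_nonneg fun x => sq_nonneg _
  have hg2 : 0 ≤ g ^ 2 := sq_nonneg g
  have hn : ∀ p, 0 ≤ energyDensity N u p := fun p => Finset.sum_nonneg fun j _ => by positivity
  have iE : ∀ s, 0 ≤ s → Integrable fun x => energyDensity N u (s, x) := fun s hs =>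
    integrable_finsetSum _ fun j hj => H.integrable_density hs (by simp at hj; omega)
  have cu := H.smooth.continuous
  have iu : ∀ s, 0 ≤ s → Integrable fun x => u (s, x) ^ 2 := fun s hs =>
    integrable_of_vanish (M := L + 1 + s) (by fun_prop) fun x hx => by
      rw [show u (s, x) = 0 from (H.iterate_zero hs hx (Nat.zero_le N)).1]; norm_num
  have csub : ({ex} : Finset (ℝ × ℝ)) ⊆ {et, ex} := by simp
  have iJ : Integrable fun x => (jet {ex} (N + 1) u (0, x) + jet {ex} N (pd et u) (0, x)) ^ 2 := by
    have c1 := continuous_jet (S := {ex}) (N + 1) H.smooth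
    have c2 := continuous_jet (S := {ex}) N (contDiff_pd H.smooth et)
    refine integrable_of_vanish (M := L + 1 + 0) (by fun_prop) fun x hx => ?_
    have h0 := H.jet_zero le_rfl hx
    have h1 := jet_mono_set csub (p := (0, x)) (N + 1) u
    have h2 := (jet_mono_set csub (p := (0, x)) N (pd et u)).trans
      (jet_pd_le (by simp : et ∈ ({et, ex} : Finset (ℝ × ℝ))) N u)
    have h3 := jet_nonneg (S := {ex}) (p := (0, x)) (N + 1) u
    have h4 := jet_nonneg (S := {ex}) (p := (0, x)) N (pd et u)
    rw [show jet {ex} (N + 1) u (0, x) = 0 by linarith,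
      show jet {ex} N (pd et u) (0, x) = 0 by linarith]
    norm_num
  -- the initial energy
  have hpt : ∀ x, u (0, x) ^ 2 + energyDensity N u (0, x)
      ≤ (1 + 3 * (N + 1)) * (C2 * ((jet {ex} (N + 1) u (0, x) + jet {ex} N (pd et u) (0, x)) ^ 2
        + g ^ 2 * wt 0 (-1) (0, x) ^ 2)) := by
    intro x
    refine le_trans ?_ (mul_le_mul_of_nonneg_left (H2 g L Q G u H (0, x)) (by positivity))
    set J := jet {et, ex} (N + 1) u (0, x)
    have sqle : ∀ a : ℝ, |a| ≤ J → a ^ 2 ≤ J ^ 2 := fun a ha => sq_le_sq' (abs_le.1 ha).1 (abs_le.1 ha).2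
    have e1 : u (0, x) ^ 2 ≤ J ^ 2 := sqle _ (abs_le_jet _ _)
    have e2 : energyDensity N u (0, x) ≤ ∑ _j ∈ Finset.range (N + 1), 3 * J ^ 2 := by
      refine Finset.sum_le_sum fun j hj => ?_
      have hj' : j ≤ N := by simp at hj; omega
      have f1 := sqle _ (abs_pd_iterate_pd_le (S := {et, ex}) (v := et) (w := et) (by simp) (by simp)
        hj' H.smooth (0, x))
      have f2 := sqle _ (abs_pd_iterate_pd_le (S := {et, ex}) (v := et) (w := ex) (by simp) (by simp)
        hj' H.smooth (0, x))
      have f3 := sqle _ (abs_iterate_pd_le (S := {et, ex}) (v := et) (by simp)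
        (by omega : j ≤ N + 1) u (0, x))
      have f4 : wt 0 (-1) (0, x) ^ 2 * (pd et)^[j] u (0, x) ^ 2 ≤ (pd et)^[j] u (0, x) ^ 2 :=
        mul_le_of_le_one_left (sq_nonneg _) (pow_le_one₀ (wt_pos _ _ _).le
          (wt_neg_one_le_one (by norm_num) _))
      linarith
    rw [Finset.sum_const, Finset.card_range, nsmul_eq_mul] at e2
    push_cast at e2
    linarith
  have h0 : (∫ x, u (0, x) ^ 2) + (∫ x, energyDensity N u (0, x)) ≤ P * (J0 + g ^ 2) := by
    rw [← integral_add (iu 0 le_rfl) (iE 0 le_rfl)]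
    refine (integral_mono ((iu 0 le_rfl).fun_add (iE 0 le_rfl))
      (((iJ.fun_add ((integrable_wt_sq 0).const_mul (g ^ 2))).const_mul C2).const_mul _) hpt).trans ?_
    rw [integral_const_mul, integral_const_mul, integral_add iJ ((integrable_wt_sq 0).const_mul _),
      integral_const_mul, integral_wt_sq, ← hJ0]
    have e1 : 0 ≤ C2 * (1 + 3 * ((N : ℝ) + 1)) := by positivity
    have e2 : J0 + g ^ 2 * wtMass ≤ (1 + wtMass) * (J0 + g ^ 2) := by
      have := mul_nonneg hI J0n
      linarith
    have := mul_le_mul_of_nonneg_left e2 e1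
    rw [hP]
    linarith
  have hu0 : 0 ≤ ∫ x, u (0, x) ^ 2 := integral_nonneg fun x => sq_nonneg _
  have hE0 : 0 ≤ ∫ x, energyDensity N u (0, x) := integral_nonneg fun x => hn _
  set D := J0 + g ^ 2
  have hD : 0 ≤ D := by positivity
  have hE : ∀ s, 0 ≤ s → ∫ x, energyDensity N u (s, x) ≤ X * ((P + 1) * D) := fun s hs =>
    (H.energy_le hs).trans (mul_le_mul_of_nonneg_left (by linarith) (by positivity))
  have hY := H.integral_sq_le hE ht
  have hEt := hE t ht
  have iJt := H.integrable_jet_sq ht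
  refine (integral_mono iJt ((((iu t ht).fun_add (iE t ht)).fun_add
    ((integrable_wt_sq t).const_mul (g ^ 2))).const_mul C1) fun x => H1 g L Q G u H (t, x)).trans ?_
  rw [integral_const_mul, integral_add ((iu t ht).fun_add (iE t ht))
    ((integrable_wt_sq t).const_mul _), integral_add (iu t ht) (iE t ht), integral_const_mul,
    integral_wt_sq, mul_assoc C1, mul_assoc C1]
  refine mul_le_mul_of_nonneg_left ?_ hC1
  have hg3 : g ^ 2 ≤ D := by linarith
  have hXP : 0 ≤ X * ((P + 1) * D) := by positivity
  have t1 : 1 ≤ (1 + t) ^ 2 := by nlinarith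
  have a1 : (1 + t) * ((∫ x, u (0, x) ^ 2) + t * (X * ((P + 1) * D)))
      ≤ (1 + t) ^ 2 * (P * D + X * ((P + 1) * D)) := by
    have f1 : (∫ x, u (0, x) ^ 2) ≤ P * D := by linarith
    have f2 : 0 ≤ P * D := by positivity
    rw [pow_two, mul_assoc]
    refine mul_le_mul_of_nonneg_left ?_ (by positivity)
    have := mul_nonneg ht f2
    linarith
  have a2 : X * ((P + 1) * D) ≤ (1 + t) ^ 2 * (X * ((P + 1) * D)) := le_mul_of_one_le_left hXP t1
  have a3 : g ^ 2 * wtMass ≤ (1 + t) ^ 2 * (wtMass * D) := by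
    have : g ^ 2 * wtMass ≤ wtMass * D := by nlinarith
    exact this.trans (le_mul_of_one_le_left (by positivity) t1)
  linarith

end

/-! ### Transfer to the weighted norms -/

noncomputable section

theorem iteratedDeriv_slice {n : ℕ} {u : ℝ × ℝ → ℝ} (hu : ContDiff ℝ n u) (t : ℝ) {i : ℕ}
    (hi : i ≤ n) (x : ℝ) : iteratedDeriv i (fun y => u (t, y)) x = (pd ex)^[i] u (t, x) := by
  induction i generalizing x with
  | zero => rw [iteratedDeriv_zero]; rfl
  | succ i ih =>
    rw [iteratedDeriv_succ, funext (ih (by omega)), Function.iterate_succ_apply']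
    exact (hasDerivAt_px ((contDiff_iterate_pd (i := 1) hu hi ex).differentiable
      (by norm_num) (t, x))).deriv

theorem jet_ex_eq {n : ℕ} {u : ℝ × ℝ → ℝ} (hu : ContDiff ℝ n u) (t x : ℝ) :
    jet {ex} n u (t, x)
      = ∑ i ∈ Finset.range (n + 1), |iteratedDeriv i (fun y => u (t, y)) x| := by
  rw [jet_singleton]
  exact Finset.sum_congr rfl fun i hi => by
    rw [iteratedDeriv_slice hu t (by simp at hi; omega)]

theorem contDiff_slice {n : ℕ} {u : ℝ × ℝ → ℝ} (hu : ContDiff ℝ n u) (t : ℝ) :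
    ContDiff ℝ n fun x => u (t, x) := hu.comp (contDiff_const.prodMk contDiff_id)

theorem integrable_sum_sq_weight {k : ℕ} {f : ℝ → ℝ} (hf : CompactCk k f) :
    Integrable fun x => (∑ i ∈ Finset.range (k + 1), |iteratedDeriv i f x|) ^ 2
      * Real.cosh (2 * x) := by
  have hc : ∀ i ∈ Finset.range (k + 1), Continuous fun x => |iteratedDeriv i f x| := fun i hi =>
    (hf.cont i hi).1.abs
  have hc' : Continuous fun x => ∑ i ∈ Finset.range (k + 1), |iteratedDeriv i f x| :=
    continuous_finsetSum _ hc
  have hcosh : Continuous fun x : ℝ => Real.cosh (2 * x) := by fun_prop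
  refine ((hc'.pow 2).mul hcosh).integrable_of_hasCompactSupport ?_
  obtain ⟨L, -, hL⟩ := HasCompactSupport.exists_bound_support hf.2
  refine hasCompactSupport_of_bound (L := L + 1) fun x hx => ?_
  have hev : f =ᶠ[𝓝 x] fun _ => 0 := by
    filter_upwards [continuous_abs.tendsto x (lt_mem_nhds (by linarith : L < |x|))] with y hy
      using hL y (le_of_lt hy)
  have : ∀ i, iteratedDeriv i f x = 0 := fun i => by rw [hev.iteratedDeriv_eq]; simp
  simp [this]

theorem testNorm_sq_le {k : ℕ} {f : ℝ → ℝ} (hf : CompactCk k f) :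
    testNorm k f ^ 2 ≤ ∫ x, (∑ i ∈ Finset.range (k + 1), |iteratedDeriv i f x|) ^ 2
      * Real.cosh (2 * x) := by
  have hI := fun i (hi : i ∈ Finset.range (k + 1)) =>
    integrable_weight (hf.cont i hi).1 (hf.cont i hi).1 (hf.cont i hi).2
  simp only [← pow_two] at hI
  rw [testNorm_sq, ← integral_finsetSum _ hI]
  refine integral_mono (integrable_finsetSum _ hI) (integrable_sum_sq_weight hf) fun x => ?_
  simp only
  rw [← Finset.sum_mul]
  refine mul_le_mul_of_nonneg_right ?_ (Real.cosh_pos _).le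
  have := Finset.sum_sq_le_sq_sum_of_nonneg (s := Finset.range (k + 1))
    (f := fun i => |iteratedDeriv i f x|) fun i _ => abs_nonneg _
  simpa using this

theorem sq_sum_le_testNorm {k : ℕ} {f : ℝ → ℝ} (hf : CompactCk k f) :
    ∫ x, (∑ i ∈ Finset.range (k + 1), |iteratedDeriv i f x|) ^ 2 * Real.cosh (2 * x)
      ≤ (k + 1) * testNorm k f ^ 2 := by
  have hI := fun i (hi : i ∈ Finset.range (k + 1)) =>
    integrable_weight (hf.cont i hi).1 (hf.cont i hi).1 (hf.cont i hi).2
  simp only [← pow_two] at hI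
  rw [testNorm_sq, ← integral_finsetSum _ hI, ← integral_const_mul]
  refine integral_mono (integrable_sum_sq_weight hf) ((integrable_finsetSum _ hI).const_mul _) fun x => ?_
  simp only
  rw [← Finset.sum_mul, ← mul_assoc]
  refine mul_le_mul_of_nonneg_right ?_ (Real.cosh_pos _).le
  exact_mod_cast sq_sum_abs_le (k + 1) fun i => iteratedDeriv i f x

variable {N : ℕ} {C₀ m g L : ℝ} {A Ai Q G G' u : ℝ × ℝ → ℝ}

theorem EnergyHyp.compactCk (H : EnergyHyp N C₀ g L Q G u) (hA : ContDiff ℝ (N + 1 : ℕ) A) {t : ℝ}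
    (ht : 0 ≤ t) : CompactCk (N + 1) (fun x => A (t, x) * u (t, x)) ∧
      CompactCk N (fun x => pd et (fun q => A q * u q) (t, x)) := by
  have hw := hA.mul H.smooth
  have dA := differentiable_of_succ hA
  have du := differentiable_of_succ H.smooth
  refine ⟨⟨contDiff_slice hw t, hasCompactSupport_of_bound (L := L + 1 + t) fun x hx => ?_⟩,
    ⟨contDiff_slice (contDiff_pd hw et) t, hasCompactSupport_of_bound (L := L + 1 + t)
      fun x hx => ?_⟩⟩
  · obtain ⟨h1, -, -⟩ := H.iterate_zero ht hx (Nat.zero_le N)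
    simp only [Function.iterate_zero, id] at h1
    rw [h1, mul_zero]
  · obtain ⟨h1, h2, -⟩ := H.iterate_zero ht hx (Nat.zero_le N)
    simp only [Function.iterate_zero, id] at h1 h2
    rw [pd_mul et dA du]
    simp [h1, h2]

/-- The weighted Sobolev norms of `w = A u` at time `t` are controlled by those at time `0`. -/
theorem exists_weighted_estimate (N : ℕ) (C₀ : ℝ) (hC₀ : 0 ≤ C₀) :
    ∃ C, 0 ≤ C ∧ ∀ (m g L : ℝ) (A Ai Q G G' u : ℝ × ℝ → ℝ), CoeffBound N C₀ m A Ai Q G →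
      EnergyHyp N C₀ g L Q G' u → ∀ t, 0 ≤ t →
      testNorm (N + 1) (fun x => A (t, x) * u (t, x)) ^ 2
        + testNorm N (fun x => pd et (fun q => A q * u q) (t, x)) ^ 2
      ≤ C * (Real.exp (-t) * (1 + t)) ^ 2 * (testNorm (N + 1) (fun x => A (0, x) * u (0, x)) ^ 2
        + testNorm N (fun x => pd et (fun q => A q * u q) (0, x)) ^ 2 + g ^ 2) := by
  obtain ⟨C1, hC1, H1⟩ := exists_energy_estimate N C₀ hC₀
  set P : ℝ := (2 * 3 ^ (N + 1) * C₀) ^ 2 * (2 * (N + 2)) with hP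
  have hP0 : 0 ≤ P := by positivity
  refine ⟨2 * (3 ^ (N + 1) * C₀) ^ 2 * C1 * (P + 1), by positivity,
    fun m g L A Ai Q G G' u hc H t ht => ?_⟩
  set w : ℝ × ℝ → ℝ := fun q => A q * u q with hw
  have cA := hc.jetA.1
  have cAi := hc.jetAi.1
  have cw : ContDiff ℝ (N + 1 : ℕ) w := cA.mul H.smooth
  have sub_et : et ∈ ({et, ex} : Finset (ℝ × ℝ)) := by simp
  have sub_ex : ({ex} : Finset (ℝ × ℝ)) ⊆ {et, ex} := by simp
  -- the norms at time `t`
  obtain ⟨k1, k2⟩ := H.compactCk cA ht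
  obtain ⟨l1, l2⟩ := H.compactCk cA (le_refl (0 : ℝ))
  have hwj : ∀ x, jet {et, ex} (N + 1) w (t, x) ^ 2 * Real.cosh (2 * x)
      ≤ (3 ^ (N + 1) * C₀) ^ 2 * Real.exp (-t) ^ 2 * jet {et, ex} (N + 1) u (t, x) ^ 2 := by
    intro x
    have e1 : jet {et, ex} (N + 1) w (t, x)
        ≤ 3 ^ (N + 1) * (C₀ * wt (-1) (-1 / 2) (t, x) * jet {et, ex} (N + 1) u (t, x)) := by
      refine (jet_mul_le (N + 1) cA H.smooth).trans ?_
      have := jet_nonneg (S := {et, ex}) (p := (t, x)) (N + 1) u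
      have := hc.jetA.2 (t, x)
      gcongr
    have e2 := pow_le_pow_left₀ (jet_nonneg _ _) e1 2
    -- The weight cosh(2x) cancels exactly against the square of the size e^{-t} cosh(2x)^{-1/2} of
    -- A. The rate e^{-t} appears here.
    have e3 : wt (-1) (-1 / 2) (t, x) ^ 2 * Real.cosh (2 * x) = Real.exp (-t) ^ 2 := by
      have hcosh := Real.cosh_pos (2 * x)
      have : (Real.cosh (2 * x) ^ (-1 / 2 : ℝ)) ^ 2 = (Real.cosh (2 * x))⁻¹ := by
        rw [← Real.rpow_natCast, ← Real.rpow_mul hcosh.le, ← Real.rpow_neg_one]; norm_num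
      simp only [wt]
      rw [mul_pow, this, mul_assoc, inv_mul_cancel₀ hcosh.ne']
      norm_num
    calc _ ≤ (3 ^ (N + 1) * (C₀ * wt (-1) (-1 / 2) (t, x) * jet {et, ex} (N + 1) u (t, x))) ^ 2
          * Real.cosh (2 * x) := by have := Real.cosh_pos (2 * x); gcongr
      _ = (3 ^ (N + 1) * C₀) ^ 2 * (wt (-1) (-1 / 2) (t, x) ^ 2 * Real.cosh (2 * x))
          * jet {et, ex} (N + 1) u (t, x) ^ 2 := by ring
      _ = _ := by rw [e3]
  have hiu := (H.integrable_jet_sq ht).const_mul ((3 ^ (N + 1) * C₀) ^ 2 * Real.exp (-t) ^ 2)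
  have n1 : testNorm (N + 1) (fun x => w (t, x)) ^ 2 ≤ (3 ^ (N + 1) * C₀) ^ 2 * Real.exp (-t) ^ 2
      * ∫ x, jet {et, ex} (N + 1) u (t, x) ^ 2 := by
    rw [← integral_const_mul]
    refine (testNorm_sq_le k1).trans (integral_mono (integrable_sum_sq_weight k1) hiu fun x => ?_)
    refine le_trans ?_ (hwj x)
    simp only
    rw [← jet_ex_eq cw]
    refine mul_le_mul_of_nonneg_right (pow_le_pow_left₀ (jet_nonneg _ _) ?_ 2) (Real.cosh_pos _).le
    exact jet_mono_set sub_ex _ _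
  have n2 : testNorm N (fun x => pd et w (t, x)) ^ 2 ≤ (3 ^ (N + 1) * C₀) ^ 2 * Real.exp (-t) ^ 2
      * ∫ x, jet {et, ex} (N + 1) u (t, x) ^ 2 := by
    rw [← integral_const_mul]
    refine (testNorm_sq_le k2).trans (integral_mono (integrable_sum_sq_weight k2) hiu fun x => ?_)
    refine le_trans ?_ (hwj x)
    simp only
    rw [← jet_ex_eq (contDiff_pd cw et)]
    refine mul_le_mul_of_nonneg_right (pow_le_pow_left₀ (jet_nonneg _ _) ?_ 2) (Real.cosh_pos _).le
    exact (jet_mono_set sub_ex _ _).trans (jet_pd_le sub_et N w)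
  -- the norms at time `0`
  have huw : u = fun q => Ai q * w q := by
    funext q
    have := hc.mul_eq q
    simp only [hw]
    linear_combination (-u q) * this
  -- Conversely u = A^{-1} w with A^{-1} of size cosh(2x)^{1/2} at t = 0, so unweighted jets of u
  -- are bounded by weighted jets of w.
  have hu0 : ∀ x, jet {ex} (N + 1) u (0, x) + jet {ex} N (pd et u) (0, x)
      ≤ 2 * 3 ^ (N + 1) * C₀ * wt 1 (1 / 2) (0, x)
        * (jet {ex} (N + 1) w (0, x) + jet {ex} N (pd et w) (0, x)) := by
    intro x
    have b0 := hc.jetAi.2 (0, x)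
    have b1 : jet {ex} (N + 1) Ai (0, x) ≤ C₀ * wt 1 (1 / 2) (0, x) :=
      (jet_mono_set sub_ex _ _).trans b0
    have b2 : jet {ex} N Ai (0, x) ≤ C₀ * wt 1 (1 / 2) (0, x) := (jet_le_succ _ _).trans b1
    have b3 : jet {ex} N (pd et Ai) (0, x) ≤ C₀ * wt 1 (1 / 2) (0, x) :=
      ((jet_mono_set sub_ex _ _).trans (jet_pd_le sub_et N Ai)).trans b0
    set c := C₀ * wt 1 (1 / 2) (0, x)
    have hc0 : 0 ≤ c := mul_nonneg hC₀ (wt_pos _ _ _).le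
    set a := jet {ex} (N + 1) w (0, x)
    set b := jet {ex} N (pd et w) (0, x)
    have ha : 0 ≤ a := jet_nonneg _ _
    have hb : 0 ≤ b := jet_nonneg _ _
    have j0 : jet {ex} N w (0, x) ≤ a := jet_le_succ _ _
    have c1 : jet {ex} (N + 1) u (0, x) ≤ 3 ^ (N + 1) * (c * a) := by
      rw [huw]
      refine (jet_mul_le (N + 1) cAi cw).trans ?_
      gcongr
    have cwt : ContDiff ℝ N (pd et w) := contDiff_pd cw et
    have cAt : ContDiff ℝ N (pd et Ai) := contDiff_pd cAi et
    have c2 : jet {ex} N (pd et u) (0, x) ≤ 3 ^ N * (c * a) + 3 ^ N * (c * b) := by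
      rw [huw, pd_mul et (differentiable_of_succ cAi) (differentiable_of_succ cw)]
      refine (jet_add_le N (cAt.mul (contDiff_of_succ cw))
        ((contDiff_of_succ cAi).mul cwt)).trans (add_le_add ?_ ?_)
      · refine (jet_mul_le N cAt (contDiff_of_succ cw)).trans ?_
        have := jet_nonneg (S := {ex}) (p := (0, x)) N w
        gcongr
      · refine (jet_mul_le N (contDiff_of_succ cAi) cwt).trans ?_
        gcongr
    have e1 : 0 ≤ 3 ^ N * (c * a) := by positivity
    have e2 : 0 ≤ 3 ^ N * (c * b) := by positivity
    have e3 : 2 * 3 ^ (N + 1) * C₀ * wt 1 (1 / 2) (0, x) * (a + b)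
        = 6 * (3 ^ N * (c * a)) + 6 * (3 ^ N * (c * b)) := by
      simp only [c, pow_succ]; ring
    have e4 : (3 : ℝ) ^ (N + 1) * (c * a) = 3 * (3 ^ N * (c * a)) := by rw [pow_succ]; ring
    rw [e3]
    linarith
  have n0 : ∫ x, (jet {ex} (N + 1) u (0, x) + jet {ex} N (pd et u) (0, x)) ^ 2
      ≤ P * (testNorm (N + 1) (fun x => w (0, x)) ^ 2
        + testNorm N (fun x => pd et w (0, x)) ^ 2) := by
    have s1 := sq_sum_le_testNorm l1
    have s2 := sq_sum_le_testNorm l2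
    have i1 := (integrable_sum_sq_weight l1)
    have i2 := (integrable_sum_sq_weight l2)
    have hle := integral_mono_of_nonneg (μ := volume)
      (f := fun x => (jet {ex} (N + 1) u (0, x) + jet {ex} N (pd et u) (0, x)) ^ 2)
      (Eventually.of_forall fun x => sq_nonneg _)
      ((i1.fun_add i2).const_mul ((2 * 3 ^ (N + 1) * C₀) ^ 2 * 2)) (Eventually.of_forall fun x => by
        simp only
        rw [← jet_ex_eq cw, ← jet_ex_eq (contDiff_pd cw et)]
        have e1 := pow_le_pow_left₀ (add_nonneg (jet_nonneg _ _) (jet_nonneg _ _)) (hu0 x) 2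
        have e3 : wt 1 (1 / 2) (0, x) ^ 2 = Real.cosh (2 * x) := by
          have hcosh := Real.cosh_pos (2 * x)
          simp only [wt, mul_zero, Real.exp_zero, one_mul]
          rw [← Real.rpow_natCast, ← Real.rpow_mul hcosh.le]; norm_num
        set a := jet {ex} (N + 1) w (0, x)
        set b := jet {ex} N (pd et w) (0, x)
        refine e1.trans ?_
        have e4 : (2 * 3 ^ (N + 1) * C₀ * wt 1 (1 / 2) (0, x) * (a + b)) ^ 2
            = (2 * 3 ^ (N + 1) * C₀) ^ 2 * Real.cosh (2 * x) * (a + b) ^ 2 := by rw [← e3]; ring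
        rw [e4]
        have e5 : 0 ≤ (2 * 3 ^ (N + 1) * C₀) ^ 2 * Real.cosh (2 * x) * (a - b) ^ 2 := by
          have := Real.cosh_pos (2 * x); positivity
        linarith)
    rw [integral_const_mul, integral_add i1 i2] at hle
    refine hle.trans ?_
    have f1 : 0 ≤ testNorm (N + 1) (fun x => w (0, x)) ^ 2 := sq_nonneg _
    have f2 : 0 ≤ testNorm N (fun x => pd et w (0, x)) ^ 2 := sq_nonneg _
    rw [hP, mul_assoc ((2 * 3 ^ (N + 1) * C₀) ^ 2), mul_assoc ((2 * 3 ^ (N + 1) * C₀) ^ 2)]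
    refine mul_le_mul_of_nonneg_left ?_ (sq_nonneg _)
    push_cast at s1 s2
    linarith
  have n3 := H1 g L Q G' u H t ht
  set D := testNorm (N + 1) (fun x => w (0, x)) ^ 2 + testNorm N (fun x => pd et w (0, x)) ^ 2
  have hD : 0 ≤ D := add_nonneg (sq_nonneg _) (sq_nonneg _)
  have n4 : ∫ x, jet {et, ex} (N + 1) u (t, x) ^ 2 ≤ C1 * (1 + t) ^ 2 * ((P + 1) * (D + g ^ 2)) := by
    refine n3.trans (mul_le_mul_of_nonneg_left ?_ (by positivity))
    have := mul_nonneg hP0 (sq_nonneg g)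
    linarith
  have n5 := mul_le_mul_of_nonneg_left n4
    (a := 2 * ((3 ^ (N + 1) * C₀) ^ 2 * Real.exp (-t) ^ 2)) (by positivity)
  calc _ ≤ 2 * ((3 ^ (N + 1) * C₀) ^ 2 * Real.exp (-t) ^ 2)
        * ∫ x, jet {et, ex} (N + 1) u (t, x) ^ 2 := by linarith
    _ ≤ _ := n5
    _ = _ := by ring

end

/-! ### Spatial cutoffs, linear solutions and their limits -/

noncomputable section

theorem abs_iteratedDeriv_smoothTransition_le (i : ℕ) :
    ∃ C, 0 ≤ C ∧ ∀ t, |iteratedDeriv i Real.smoothTransition t| ≤ C := by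
  have hc : Continuous (iteratedDeriv i Real.smoothTransition) :=
    (Real.smoothTransition.contDiff (n := i)).continuous_iteratedDeriv' i
  obtain ⟨M, hM⟩ := (isCompact_Icc (a := (0 : ℝ)) (b := 1)).exists_bound_of_continuousOn
    hc.continuousOn
  have hconst : ∀ (c : ℝ) (t : ℝ), |c| ≤ 1 → Real.smoothTransition =ᶠ[𝓝 t] (fun _ => c) →
      |iteratedDeriv i Real.smoothTransition t| ≤ 1 := by
    intro c t hc h
    rw [h.iteratedDeriv_eq, iteratedDeriv_const]
    split_ifs
    · exact hc
    · simp
  refine ⟨max M 1, le_max_of_le_right zero_le_one, fun t => ?_⟩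
  rcases lt_or_ge t 0 with h | h
  · exact (hconst 0 t (by simp) (by
      filter_upwards [gt_mem_nhds h] with s hs using Real.smoothTransition.zero_of_nonpos hs.le)).trans
      (le_max_right _ _)
  rcases lt_or_ge 1 t with h' | h'
  · exact (hconst 1 t (by simp) (by
      filter_upwards [lt_mem_nhds h'] with s hs using Real.smoothTransition.one_of_one_le hs.le)).trans
      (le_max_right _ _)
  · exact (hM t ⟨h, h'⟩).trans (le_max_left _ _)

/-- A spatial cutoff, equal to `1` for `|x| ≤ n` and to `0` for `|x| ≥ n + 1`. -/
def cut (n : ℕ) (p : ℝ × ℝ) : ℝ :=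
  Real.smoothTransition (n + 1 + p.2) * Real.smoothTransition (n + 1 - p.2)

theorem cut_eq_one {n : ℕ} {p : ℝ × ℝ} (h : |p.2| ≤ n) : cut n p = 1 := by
  obtain ⟨h1, h2⟩ := abs_le.1 h
  rw [cut, Real.smoothTransition.one_of_one_le (by linarith),
    Real.smoothTransition.one_of_one_le (by linarith), one_mul]

theorem cut_eq_zero {n : ℕ} {p : ℝ × ℝ} (h : (n : ℝ) + 1 ≤ |p.2|) : cut n p = 0 := by
  rcases le_abs.1 h with h | h
  · rw [cut, Real.smoothTransition.zero_of_nonpos (x := n + 1 - p.2) (by linarith), mul_zero]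
  · rw [cut, Real.smoothTransition.zero_of_nonpos (x := n + 1 + p.2) (by linarith), zero_mul]

/-- All cutoffs are products of translates of one fixed profile and its reflection, so the bound is
uniform in n. -/
theorem jetLE_cut (N : ℕ) : ∃ C, 0 ≤ C ∧ ∀ n, JetLE N (cut n) fun _ => C := by
  choose c hc0 hc using abs_iteratedDeriv_smoothTransition_le
  set S := 2 ^ N * ∑ i ∈ Finset.range (N + 1), c i with hS
  have hS0 : 0 ≤ S := mul_nonneg (by positivity) (Finset.sum_nonneg fun i _ => hc0 i)
  have key : ∀ (a b : ℝ), |b| ≤ 1 →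
      JetLE N (fun p => Real.smoothTransition (a + b * p.2)) fun _ => S := by
    intro a b hb
    have hcd : ContDiff ℝ N fun y : ℝ => Real.smoothTransition (a + y) :=
      Real.smoothTransition.contDiff.comp (contDiff_const.add contDiff_id)
    refine ⟨Real.smoothTransition.contDiff.comp (contDiff_const.add
      (contDiff_const.mul contDiff_snd)), fun p => ?_⟩
    have := jet_linear_le (a := 0) (b := b) (by rw [abs_zero]; linarith) N hcd p
    simp only [zero_mul, zero_add] at this
    refine this.trans ?_
    simp only [hS]
    gcongr with i
    rw [iteratedDeriv_comp_const_add]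
    exact hc i _
  refine ⟨3 ^ N * (S * S), by positivity, fun n => ?_⟩
  have := (key (n + 1) 1 (by simp)).mul (key (n + 1) (-1) (by simp))
  simp only [one_mul, neg_one_mul, ← sub_eq_add_neg] at this
  exact this

variable {N : ℕ} {C₀ m g L : ℝ} {A Ai Q G G' u : ℝ × ℝ → ℝ}

theorem wt_half_eq (x : ℝ) : wt 1 (1 / 2) (0, x) = √(Real.cosh (2 * x)) := by
  simp [wt, Real.sqrt_eq_rpow]

theorem CoeffBound.abs_le_sqrt (hc : CoeffBound N C₀ m A Ai Q G) (x : ℝ) :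
    |Ai (0, x)| ≤ C₀ * √(Real.cosh (2 * x)) ∧ |pd et Ai (0, x)| ≤ C₀ * √(Real.cosh (2 * x)) ∧
      |pd ex Ai (0, x)| ≤ C₀ * √(Real.cosh (2 * x)) := by
  rw [← wt_half_eq]
  exact ⟨hc.jetAi.abs_le _, hc.jetAi.pd_et.abs_le _, hc.jetAi.pd_ex.abs_le _⟩

theorem CoeffBound.contDiff_pot (hc : CoeffBound N C₀ m A Ai Q G) :
    ContDiff ℝ N fun p => wt 0 (-1) p ^ 2 + Q p := ((contDiff_wt 0 (-1)).pow 2).add hc.jetQ.1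

theorem CoeffBound.abs_pot_le (hC₀ : 0 ≤ C₀) (hc : CoeffBound N C₀ m A Ai Q G) (p : ℝ × ℝ) :
    |wt 0 (-1) p ^ 2 + Q p| ≤ 1 + C₀ := by
  refine (abs_add_le _ _).trans (add_le_add ?_ ?_)
  · rw [abs_of_nonneg (sq_nonneg _)]
    exact pow_le_one₀ (wt_pos _ _ _).le (wt_neg_one_le_one (by norm_num) _)
  · exact (hc.jetQ.abs_le p).trans (mul_le_of_le_one_right hC₀ (bet_wt_le_one p))

/-- Solutions of the rescaled equation with prescribed data for `w = A u`. -/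
theorem CoeffBound.exists_solution (hC₀ : 0 ≤ C₀) (hc : CoeffBound N C₀ m A Ai Q G) {j : ℕ}
    (hj : 1 ≤ j) (hjN : j ≤ N) {M M₀ : ℝ} (hG' : ContDiff ℝ j G') (hG'M : ∀ p, |G' p| ≤ M)
    {w₀ w₁ : ℝ → ℝ} (h0 : ContDiff ℝ (j + 1 : ℕ) w₀) (h1 : ContDiff ℝ j w₁)
    (hM0 : ∀ x, |w₀ x| * √(Real.cosh (2 * x)) ≤ M₀)
    (hM1 : ∀ x, |w₁ x| * √(Real.cosh (2 * x)) ≤ M₀) :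
    ∃ u : ℝ × ℝ → ℝ, ContDiff ℝ (j + 1 : ℕ) u ∧
      (∀ p, pd et (pd et u) p - pd ex (pd ex u) p = -((wt 0 (-1) p ^ 2 + Q p) * u p) + G' p) ∧
      (∀ x, u (0, x) = Ai (0, x) * w₀ x) ∧
      (∀ x, pd et u (0, x) = Ai (0, x) * w₁ x + pd et Ai (0, x) * w₀ x) ∧
      (∀ x, pd ex u (0, x) = pd ex Ai (0, x) * w₀ x + Ai (0, x) * deriv w₀ x) ∧
      (∀ x, A (0, x) * u (0, x) = w₀ x) ∧ ∀ x, pd et (fun q => A q * u q) (0, x) = w₁ x := by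
  have cA : ContDiff ℝ (j + 1 : ℕ) A := contDiff_le hc.jetA.1 (by omega)
  have cAi : ContDiff ℝ (j + 1 : ℕ) Ai := contDiff_le hc.jetAi.1 (by omega)
  -- The growth cosh^{1/2} of A^{-1} is matched by the decay of w₀ that the weighted Sobolev
  -- inequality provides, so the data of u are bounded, as the existence theorem requires.
  have hb : ∀ x, |Ai (0, x) * w₀ x| ≤ C₀ * M₀ := fun x => by
    rw [abs_mul]
    calc _ ≤ C₀ * √(Real.cosh (2 * x)) * |w₀ x| := by gcongr; exact (hc.abs_le_sqrt x).1
      _ = C₀ * (|w₀ x| * √(Real.cosh (2 * x))) := by ring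
      _ ≤ _ := by gcongr; exact hM0 x
  have hb' : ∀ x, |Ai (0, x) * w₁ x + pd et Ai (0, x) * w₀ x| ≤ 2 * (C₀ * M₀) := fun x => by
    have e1 : |Ai (0, x) * w₁ x| ≤ C₀ * M₀ := by
      rw [abs_mul]
      calc _ ≤ C₀ * √(Real.cosh (2 * x)) * |w₁ x| := by gcongr; exact (hc.abs_le_sqrt x).1
        _ = C₀ * (|w₁ x| * √(Real.cosh (2 * x))) := by ring
        _ ≤ _ := by gcongr; exact hM1 x
    have e2 : |pd et Ai (0, x) * w₀ x| ≤ C₀ * M₀ := by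
      rw [abs_mul]
      calc _ ≤ C₀ * √(Real.cosh (2 * x)) * |w₀ x| := by gcongr; exact (hc.abs_le_sqrt x).2.1
        _ = C₀ * (|w₀ x| * √(Real.cosh (2 * x))) := by ring
        _ ≤ _ := by gcongr; exact hM0 x
    exact (abs_add_le _ _).trans (by linarith)
  have hMM : 0 ≤ C₀ * M₀ := (abs_nonneg _).trans (hb 0)
  obtain ⟨u, hu, hu0, hu1, heq⟩ := exists_wave_solution hj (contDiff_le hc.contDiff_pot hjN) hG'
    ((contDiff_slice cAi 0).mul h0)
    (((contDiff_slice (contDiff_le cAi (by omega)) 0).mul h1).add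
      ((contDiff_slice (contDiff_pd cAi et) 0).mul (h0.of_le (by exact_mod_cast j.le_succ))))
    (hc.abs_pot_le hC₀) (M := max M (2 * (C₀ * M₀))) (fun p => (hG'M p).trans (le_max_left _ _))
    (fun x => (hb x).trans (le_max_of_le_right (by linarith)))
    (fun x => (hb' x).trans (le_max_right _ _))
  have du := differentiable_of_succ hu
  have dA := differentiable_of_succ cA
  have dAi := differentiable_of_succ cAi
  have hm := hc.mul_eq
  refine ⟨u, hu, heq, hu0, hu1, fun x => ?_, fun x => ?_, fun x => ?_⟩
  · have e1 := hasDerivAt_px (du (0, x))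
    have e2 := (hasDerivAt_px (dAi (0, x))).mul
      ((h0.differentiable (by norm_cast) x).hasDerivAt)
    exact (e1.congr_of_eventuallyEq (Eventually.of_forall fun y => (hu0 y).symm)).unique e2
  · rw [hu0]; linear_combination w₀ x * hm (0, x)
  · have h2 : pd et (fun q => A q * Ai q) (0, x) = 0 := by
      rw [show (fun q => A q * Ai q) = fun _ => 1 from funext hm, pd_const]
    rw [pd_mul et dA dAi] at h2
    rw [pd_mul et dA du]
    simp only at h2 ⊢
    rw [hu0, hu1]
    linear_combination w₁ x * hm (0, x) + w₀ x * h2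

/-- Convergence of solutions from the convergence of the data, locally in space. -/
theorem tendsto_solution {V : ℝ × ℝ → ℝ} {a : ℝ} (hV : ∀ p, |V p| ≤ a) {un Gn : ℕ → ℝ × ℝ → ℝ}
    (hu : ContDiff ℝ 2 u) (hun : ∀ n, ContDiff ℝ 2 (un n))
    (heq : ∀ p, pd et (pd et u) p - pd ex (pd ex u) p = -(V p * u p) + G p)
    (heqn : ∀ n p, pd et (pd et (un n)) p - pd ex (pd ex (un n)) p = -(V p * un n p) + Gn n p)
    (hG : ∀ r : ℝ, ∀ᶠ n in atTop, ∀ p : ℝ × ℝ, |p.2| ≤ r → Gn n p = G p)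
    (h0 : ∀ r : ℝ, ∀ ε > 0, ∀ᶠ n in atTop, ∀ x, |x| ≤ r → |un n (0, x) - u (0, x)| ≤ ε ∧
      |pd et (un n) (0, x) - pd et u (0, x)| ≤ ε ∧ |pd ex (un n) (0, x) - pd ex u (0, x)| ≤ ε)
    {t : ℝ} (ht : 0 ≤ t) (x : ℝ) :
    Tendsto (fun n => un n (t, x)) atTop (𝓝 (u (t, x))) ∧
      Tendsto (fun n => pd et (un n) (t, x)) atTop (𝓝 (pd et u (t, x))) := by
  have du := hu.differentiable two_ne_zero
  have du1 : ∀ v, Differentiable ℝ (pd v u) := fun v q => differentiableAt_pd hu.contDiffAt v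
  have ha : 0 ≤ a := (abs_nonneg _).trans (hV 0)
  -- The triangle below (t, x) meets only |y| ≤ |x| + t. There the sources eventually coincide and
  -- the data are ε-close, so the difference solves a homogeneous equation with small data.
  have key : ∀ ε > 0, ∀ᶠ n in atTop, |un n (t, x) - u (t, x)|
      + |pd et (un n) (t, x) - pd et u (t, x)| ≤ triConst a t * ε := by
    intro ε hε
    filter_upwards [hG (|x| + t), h0 (|x| + t) ε hε] with n hGn hn
    have dn := (hun n).differentiable two_ne_zero
    have dn1 : ∀ v, Differentiable ℝ (pd v (un n)) := fun v q =>
      differentiableAt_pd (hun n).contDiffAt v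
    have hv : ∀ v, pd v (fun q => un n q - u q) = fun q => pd v (un n) q - pd v u q := fun v =>
      pd_sub v dn du
    have hvv : ∀ v, pd v (pd v (fun q => un n q - u q))
        = fun q => pd v (pd v (un n)) q - pd v (pd v u) q := fun v => by
      rw [hv, pd_sub v (dn1 v) (du1 v)]
    have hr : ∀ y : ℝ, |y - x| ≤ t → |y| ≤ |x| + t := fun y hy => by
      have := abs_sub_abs_le_abs_sub y x; linarith
    have := plane_triangle ((hun n).sub hu) (T := t) (x₀ := x) (A := a) (d := ε) ha hε.le
      (fun q hq => by
        rw [hvv, hvv]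
        have e1 : |q.2| ≤ |x| + t := hr _ (hq.2.trans (by linarith [hq.1]))
        have e2 : pd et (pd et (un n)) q - pd et (pd et u) q
            - (pd ex (pd ex (un n)) q - pd ex (pd ex u) q) = -(V q * (un n q - u q)) := by
          linear_combination heqn n q - heq q + hGn q e1
        rw [e2, abs_neg, abs_mul]
        calc _ ≤ a * |un n q - u q| := by gcongr; exact hV q
          _ ≤ _ := by
            have e3 := mul_nonneg ha (abs_nonneg (pd et (fun q => un n q - u q) q))
            have e4 := mul_nonneg ha (abs_nonneg (pd ex (fun q => un n q - u q) q))
            linarith)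
      (fun y hy => by rw [hv, hv]; exact hn y (hr y hy)) (t, x) ⟨ht, by simp⟩
    rw [hv, hv] at this
    linarith [abs_nonneg (pd ex (un n) (t, x) - pd ex u (t, x))]
  have htri : 0 < triConst a t := by unfold triConst; positivity
  have key' : ∀ ε > 0, ∀ᶠ n in atTop, |un n (t, x) - u (t, x)|
      + |pd et (un n) (t, x) - pd et u (t, x)| < ε := by
    intro ε hε
    filter_upwards [key (ε / (2 * triConst a t)) (by positivity)] with n hn
    refine hn.trans_lt ?_
    rw [show triConst a t * (ε / (2 * triConst a t)) = ε / 2 by field_simp]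
    linarith
  constructor <;> rw [Metric.tendsto_atTop'] <;> intro ε hε <;>
    obtain ⟨n, hn⟩ := eventually_atTop.1 (key' ε hε) <;> refine ⟨n, fun l hl => ?_⟩ <;>
    rw [Real.dist_eq] <;> have := hn l hl.le
  · linarith [abs_nonneg (pd et (un l) (t, x) - pd et u (t, x))]
  · linarith [abs_nonneg (un l (t, x) - u (t, x))]

/-- Linearity keeps the hypotheses of the energy estimate under differences. The source size g is
supplied anew, since the difference of two truncations can be far smaller than either. -/
theorem EnergyHyp.sub {G₁ G₂ u₁ u₂ : ℝ × ℝ → ℝ} {g₁ g₂ L₁ L₂ : ℝ}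
    (H₁ : EnergyHyp N C₀ g₁ L₁ Q G₁ u₁) (H₂ : EnergyHyp N C₀ g₂ L₂ Q G₂ u₂) (hg : 0 ≤ g)
    (hG : JetLE N (fun p => G₁ p - G₂ p) fun p => g * (bet p.1 * wt 0 (-1) p)) :
    EnergyHyp N C₀ g (max L₁ L₂) Q (fun p => G₁ p - G₂ p) fun p => u₁ p - u₂ p := by
  have hN := H₁.one_le
  have c₁ := contDiff_two_of_le H₁.smooth (by omega)
  have c₂ := contDiff_two_of_le H₂.smooth (by omega)
  have hv : ∀ v, pd v (fun q => u₁ q - u₂ q) = fun q => pd v u₁ q - pd v u₂ q := fun v =>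
    pd_sub v (c₁.differentiable two_ne_zero) (c₂.differentiable two_ne_zero)
  have hvv : ∀ v, pd v (pd v (fun q => u₁ q - u₂ q)) = fun q => pd v (pd v u₁) q - pd v (pd v u₂) q :=
    fun v => by
      rw [hv, pd_sub v (fun q => differentiableAt_pd c₁.contDiffAt v)
        (fun q => differentiableAt_pd c₂.contDiffAt v)]
  refine ⟨H₁.one_le, H₁.K_nonneg, hg, H₁.smooth.sub H₂.smooth, H₁.jetQ, hG, fun p => ?_,
    fun p hp => ?_, fun x hx => ?_, fun x hx => ?_⟩
  · rw [hvv, hvv]; linear_combination H₁.eqn p - H₂.eqn p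
  · rw [H₁.support_G p ((le_max_left _ _).trans hp), H₂.support_G p ((le_max_right _ _).trans hp),
      sub_zero]
  · rw [H₁.support_u x ((le_max_left _ _).trans hx), H₂.support_u x ((le_max_right _ _).trans hx),
      sub_zero]
  · rw [hv]
    simp only
    rw [H₁.support_ut x ((le_max_left _ _).trans hx),
      H₂.support_ut x ((le_max_right _ _).trans hx), sub_zero]

end

/-! ### Approximation by compactly supported problems -/

noncomputable section

theorem tendsto_wt_neg_half : Tendsto (fun n : ℕ => wt 0 (-1 / 2) (0, (n : ℝ))) atTop (𝓝 0) := by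
  have h1 : Tendsto (fun n : ℕ => Real.cosh (2 * (n : ℝ))) atTop atTop := by
    refine tendsto_atTop_mono (fun n => ?_) tendsto_natCast_atTop_atTop
    have := one_add_sq_le_cosh (n : ℝ)
    nlinarith
  have h2 := (tendsto_rpow_neg_atTop (y := 1 / 2) (by norm_num)).comp h1
  refine h2.congr fun n => ?_
  simp only [Function.comp, wt, zero_mul, Real.exp_zero, one_mul]
  norm_num

theorem wt_neg_half_le {ν : ℝ} (hν : 0 ≤ ν) {p : ℝ × ℝ} (h : ν ≤ |p.2|) :
    wt 0 (-1 / 2) p ≤ wt 0 (-1 / 2) (0, ν) := by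
  simp only [wt, zero_mul, Real.exp_zero, one_mul]
  refine Real.rpow_le_rpow_of_nonpos (Real.cosh_pos _) (Real.cosh_le_cosh.2 ?_) (by norm_num)
  rw [abs_mul, abs_mul, abs_of_nonneg hν]
  gcongr

variable {N : ℕ} {C₀ m Cc : ℝ} {A Ai Q G : ℝ × ℝ → ℝ}

/-- Retains the surplus factor cosh(2x)^{-1/2} of the source, which makes differences of truncations
small. The next lemma drops it to match the form used by the energy estimate. -/
theorem CoeffBound.jetLE_cut_mul (hc : CoeffBound N C₀ m A Ai Q G)
    (Hc : ∀ n, JetLE N (cut n) fun _ => Cc) (n : ℕ) : JetLE N (fun p => cut n p * G p) fun p =>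
      3 ^ N * (Cc * C₀) * m * (wt 0 (-1 / 2) p * (bet p.1 * wt 0 (-1) p)) :=
  ((Hc n).mul hc.jetG).congr fun p => by ring

theorem CoeffBound.jetLE_cut_mul' (hC₀ : 0 ≤ C₀) (hCc : 0 ≤ Cc) (hm : 0 ≤ m)
    (hc : CoeffBound N C₀ m A Ai Q G) (Hc : ∀ n, JetLE N (cut n) fun _ => Cc) (n : ℕ) :
    JetLE N (fun p => cut n p * G p) fun p =>
      3 ^ N * (Cc * C₀) * m * (bet p.1 * wt 0 (-1) p) :=
  (hc.jetLE_cut_mul Hc n).mono fun p => mul_le_mul_of_nonneg_left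
    (mul_le_of_le_one_left (mul_nonneg (bet_pos _).le (wt_pos _ _ _).le)
      (wt_neg_one_le_one (by norm_num) p)) (by positivity)

/-- Differences of the truncated sources are small. -/
theorem CoeffBound.jetLE_cut_sub (hC₀ : 0 ≤ C₀) (hCc : 0 ≤ Cc) (hm : 0 ≤ m)
    (hc : CoeffBound N C₀ m A Ai Q G) (Hc : ∀ n, JetLE N (cut n) fun _ => Cc) {ν n l : ℕ}
    (hn : ν ≤ n) (hl : ν ≤ l) : JetLE N (fun p => cut n p * G p - cut l p * G p) fun p =>
      2 * (3 ^ N * (Cc * C₀) * m) * wt 0 (-1 / 2) (0, (ν : ℝ)) * (bet p.1 * wt 0 (-1) p) := by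
  have h := (hc.jetLE_cut_mul Hc n).sub (hc.jetLE_cut_mul Hc l)
  refine ⟨h.1, fun p => ?_⟩
  have hb : 0 ≤ bet p.1 * wt 0 (-1) p := mul_nonneg (bet_pos _).le (wt_pos _ _ _).le
  -- For |x| < ν both cutoffs equal 1 near the point and the jet vanishes; elsewhere cosh(2x)^{-1/2}
  -- is at most its value at ν.
  rcases lt_or_ge |p.2| (ν : ℝ) with hp | hp
  · have hev : (fun p => cut n p * G p - cut l p * G p) =ᶠ[𝓝 p] fun _ => 0 := by
      have : ∀ᶠ q : ℝ × ℝ in 𝓝 p, |q.2| < ν :=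
        (continuous_snd.abs : Continuous fun q : ℝ × ℝ => |q.2|).tendsto p (gt_mem_nhds hp)
      filter_upwards [this] with q hq
      have e1 : (ν : ℝ) ≤ n := by exact_mod_cast hn
      have e2 : (ν : ℝ) ≤ l := by exact_mod_cast hl
      rw [cut_eq_one (hq.le.trans e1), cut_eq_one (hq.le.trans e2), sub_self]
    rw [jet_congr N hev, jet_const, abs_zero]
    have := (wt_pos 0 (-1 / 2) (0, (ν : ℝ))).le
    positivity
  · refine (h.2 p).trans ?_
    have := wt_neg_half_le ν.cast_nonneg hp
    change _ ≤ 2 * (3 ^ N * (Cc * C₀) * m) * wt 0 (-1 / 2) (0, (ν : ℝ)) * (bet p.1 * wt 0 (-1) p)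
    calc _ = 2 * (3 ^ N * (Cc * C₀) * m) * wt 0 (-1 / 2) p * (bet p.1 * wt 0 (-1) p) := by ring
      _ ≤ _ := by gcongr

/-- Approximate solutions with compactly supported data. -/
theorem CoeffBound.exists_approx (hN : 1 ≤ N) (hC₀ : 0 ≤ C₀) (hCc : 0 ≤ Cc) (hm : 0 ≤ m)
    (hc : CoeffBound N C₀ m A Ai Q G) (Hc : ∀ n, JetLE N (cut n) fun _ => Cc) (n : ℕ)
    {φ ψ : ℝ → ℝ} (hφ : CompactCk (N + 1) φ) (hψ : CompactCk N ψ) :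
    ∃ (u : ℝ × ℝ → ℝ) (L : ℝ),
      EnergyHyp N C₀ (3 ^ N * (Cc * C₀) * m) L Q (fun p => cut n p * G p) u ∧
      (∀ x, u (0, x) = Ai (0, x) * φ x) ∧
      (∀ x, pd et u (0, x) = Ai (0, x) * ψ x + pd et Ai (0, x) * φ x) ∧
      (∀ x, pd ex u (0, x) = pd ex Ai (0, x) * φ x + Ai (0, x) * deriv φ x) ∧
      (∀ x, A (0, x) * u (0, x) = φ x) ∧ ∀ x, pd et (fun q => A q * u q) (0, x) = ψ x := by
  have jG := hc.jetLE_cut_mul' hC₀ hCc hm Hc n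
  have wb : ∀ {k : ℕ} {f : ℝ → ℝ}, CompactCk k f → 1 ≤ k → ∀ x,
      |f x| * √(Real.cosh (2 * x)) ≤ 3 * testNorm k f := fun hf hk x => by
    simpa using abs_iteratedDeriv_le_testNorm hf (i := 0) (by omega) x
  obtain ⟨u, hu, heq, h0, h1, h2, h3, h4⟩ := hc.exists_solution hC₀ hN le_rfl jG.1
    (fun p => (jG.abs_le p).trans (mul_le_of_le_one_right (by positivity) (bet_wt_le_one p)))
    hφ.1 hψ.1 (fun x => (wb hφ (by omega) x).trans (le_max_left _ (3 * testNorm N ψ)))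
    (fun x => (wb hψ hN x).trans (le_max_right _ _))
  obtain ⟨L1, -, hL1⟩ := HasCompactSupport.exists_bound_support hφ.2
  obtain ⟨L2, -, hL2⟩ := HasCompactSupport.exists_bound_support hψ.2
  refine ⟨u, max (max L1 L2) (n + 1), ⟨hN, hC₀, by positivity, hu, hc.jetQ, jG, heq,
    fun p hp => ?_, fun x hx => ?_, fun x hx => ?_⟩, h0, h1, h2, h3, h4⟩
  · rw [cut_eq_zero ((le_max_right _ _).trans hp), zero_mul]
  · rw [h0, hL1 x ((le_max_left _ _).trans ((le_max_left _ _).trans hx)), mul_zero]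
  · rw [h1, hL1 x ((le_max_left _ _).trans ((le_max_left _ _).trans hx)),
      hL2 x ((le_max_right _ _).trans ((le_max_left _ _).trans hx))]
    ring

/-- Convergence of the data of the approximate solutions. -/
theorem CoeffBound.data_tendsto (hC₀ : 0 ≤ C₀) (hc : CoeffBound N C₀ m A Ai Q G)
    {φ ψ : ℕ → ℝ → ℝ} {w₀ w₁ : ℝ → ℝ} (hφ : TendstoUniformly φ w₀ atTop)
    (hφ' : TendstoUniformly (fun n => deriv (φ n)) (deriv w₀) atTop)
    (hψ : TendstoUniformly ψ w₁ atTop) {un : ℕ → ℝ × ℝ → ℝ} {u : ℝ × ℝ → ℝ}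
    (h0 : ∀ n x, un n (0, x) = Ai (0, x) * φ n x)
    (h1 : ∀ n x, pd et (un n) (0, x) = Ai (0, x) * ψ n x + pd et Ai (0, x) * φ n x)
    (h2 : ∀ n x, pd ex (un n) (0, x) = pd ex Ai (0, x) * φ n x + Ai (0, x) * deriv (φ n) x)
    (h0' : ∀ x, u (0, x) = Ai (0, x) * w₀ x)
    (h1' : ∀ x, pd et u (0, x) = Ai (0, x) * w₁ x + pd et Ai (0, x) * w₀ x)
    (h2' : ∀ x, pd ex u (0, x) = pd ex Ai (0, x) * w₀ x + Ai (0, x) * deriv w₀ x)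
    (r ε : ℝ) (hε : 0 < ε) : ∀ᶠ n in atTop, ∀ x, |x| ≤ r → |un n (0, x) - u (0, x)| ≤ ε ∧
      |pd et (un n) (0, x) - pd et u (0, x)| ≤ ε ∧ |pd ex (un n) (0, x) - pd ex u (0, x)| ≤ ε := by
  -- A uniform bound on |x| ≤ r for A^{-1} and its first derivatives at t = 0; each difference below
  -- has at most two products of size K η.
  set K := C₀ * √(Real.cosh (2 * r)) with hK
  have hK0 : 0 ≤ K := by positivity
  have hη : 0 < ε / (2 * K + 1) := by positivity
  filter_upwards [Metric.tendstoUniformly_iff.1 hφ _ hη, Metric.tendstoUniformly_iff.1 hφ' _ hη,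
    Metric.tendstoUniformly_iff.1 hψ _ hη] with n e0 e1 e2 x hx
  have f0 := (e0 x).le
  have f1 := (e1 x).le
  have f2 := (e2 x).le
  rw [Real.dist_eq, abs_sub_comm] at f0 f1 f2
  set η := ε / (2 * K + 1)
  have hηε : 2 * (K * η) ≤ ε := by
    have : (2 * K + 1) * η = ε := by simp only [η]; field_simp
    linarith
  have hKη : 0 ≤ K * η := by positivity
  have hcosh : √(Real.cosh (2 * x)) ≤ √(Real.cosh (2 * r)) := by
    refine Real.sqrt_le_sqrt (Real.cosh_le_cosh.2 ?_)
    rw [abs_mul, abs_mul]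
    exact mul_le_mul_of_nonneg_left (hx.trans (le_abs_self r)) (abs_nonneg _)
  have hmono : C₀ * √(Real.cosh (2 * x)) ≤ K := by rw [hK]; gcongr
  obtain ⟨a0, a1, a2⟩ := hc.abs_le_sqrt x
  have pr : ∀ a b : ℝ, |a| ≤ C₀ * √(Real.cosh (2 * x)) → |b| ≤ η → |a * b| ≤ K * η := by
    intro a b ha hb
    rw [abs_mul]
    exact mul_le_mul (ha.trans hmono) hb (abs_nonneg _) hK0
  refine ⟨?_, ?_, ?_⟩
  · rw [h0, h0', ← mul_sub]
    exact (pr _ _ a0 f0).trans (by linarith)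
  · rw [h1, h1', show Ai (0, x) * ψ n x + pd et Ai (0, x) * φ n x
      - (Ai (0, x) * w₁ x + pd et Ai (0, x) * w₀ x) = Ai (0, x) * (ψ n x - w₁ x)
      + pd et Ai (0, x) * (φ n x - w₀ x) by ring]
    exact (abs_add_le _ _).trans ((add_le_add (pr _ _ a0 f2) (pr _ _ a1 f0)).trans (by linarith))
  · rw [h2, h2', show pd ex Ai (0, x) * φ n x + Ai (0, x) * deriv (φ n) x
      - (pd ex Ai (0, x) * w₀ x + Ai (0, x) * deriv w₀ x) = pd ex Ai (0, x) * (φ n x - w₀ x)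
      + Ai (0, x) * (deriv (φ n) x - deriv w₀ x) by ring]
    exact (abs_add_le _ _).trans ((add_le_add (pr _ _ a2 f0) (pr _ _ a0 f1)).trans (by linarith))

end

/-! ### The linear problem in the weighted spaces -/

noncomputable section

theorem decay_le_one {t : ℝ} (ht : 0 ≤ t) : Real.exp (-t) * (1 + t) ≤ 1 := by
  have := bet_le_one t
  rw [bet, abs_of_nonneg ht] at this
  linarith

theorem IsApprox.compactCk {k : ℕ} {f : ℝ → ℝ} {φ : ℕ → ℝ → ℝ} (h : IsApprox k f φ) (n : ℕ) :
    CompactCk k (φ n) := CompactCk.of_smooth (h.1 n)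

/-- The linear problem for `w = A u` in the weighted Sobolev spaces. -/
theorem exists_weighted_solution (N : ℕ) (hN : 2 ≤ N) (C₀ : ℝ) (hC₀ : 0 ≤ C₀) :
    ∃ C, 0 < C ∧ ∀ (m : ℝ) (A Ai Q G : ℝ × ℝ → ℝ) (w₀ w₁ : ℝ → ℝ), 0 ≤ m →
      CoeffBound N C₀ m A Ai Q G → Continuous w₀ → Continuous w₁ → MemHt (N + 1) w₀ → MemHt N w₁ →
      ∃ u : ℝ × ℝ → ℝ, ContDiff ℝ N u ∧
        (∀ p, pd et (pd et u) p - pd ex (pd ex u) p = -((wt 0 (-1) p ^ 2 + Q p) * u p) + G p) ∧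
        (∀ x, A (0, x) * u (0, x) = w₀ x) ∧ (∀ x, pd et (fun q => A q * u q) (0, x) = w₁ x) ∧
        ∀ t, 0 ≤ t → MemHt (N + 1) (fun x => A (t, x) * u (t, x)) ∧
          MemHt N (fun x => pd et (fun q => A q * u q) (t, x)) ∧
          htNorm (N + 1) (fun x => A (t, x) * u (t, x))
            + htNorm N (fun x => pd et (fun q => A q * u q) (t, x))
            ≤ C * Real.exp (-t) * (t + 1) * (htNorm (N + 1) w₀ + htNorm N w₁ + m) := by
  obtain ⟨Cc, hCc, Hc⟩ := jetLE_cut N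
  obtain ⟨C1, hC1, H1⟩ := exists_weighted_estimate N C₀ hC₀
  set γ := 3 ^ N * (Cc * C₀) with hγ
  have hγ0 : 0 ≤ γ := by positivity
  -- The summand 1 only makes the constant strictly positive.
  refine ⟨√(2 * C1) * (1 + γ) + 1, by positivity,
    fun m A Ai Q G w₀ w₁ hm hc hw₀ hw₁ ⟨φ, hφ⟩ ⟨ψ, hψ⟩ => ?_⟩
  obtain ⟨s0, s1, M0, s2⟩ := hφ.regular (by omega) hw₀
  obtain ⟨t0, t1, M1, t2⟩ := hψ.regular (by omega) hw₁
  have u0 := s1 0 (by omega)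
  have u1 := s1 1 (by omega)
  have u2 := t1 0 (by omega)
  simp only [iteratedDeriv_zero, iteratedDeriv_one] at u0 u1 u2
  -- Data in the spaces of orders N + 1 and N are only C^N and C^{N-1}, so the limiting solution is
  -- constructed in C^{j+1} = C^N, one order below its approximations.
  obtain ⟨j, rfl⟩ : ∃ j, N = j + 1 := ⟨N - 1, by omega⟩
  set N := j + 1 with hNj
  -- the solution
  obtain ⟨u, hu, heq, h0', h1', h2', hw0, hw1⟩ := hc.exists_solution hC₀ (j := j) (G' := G)
    (M := C₀ * m) (M₀ := max M0 M1) (by omega) (by omega) (contDiff_le hc.jetG.1 (by omega))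
    (fun p => (hc.jetG.abs_le p).trans (mul_le_of_le_one_right (by positivity)
      (mul_le_one₀ (bet_le_one _) (mul_nonneg (wt_pos _ _ _).le (wt_pos _ _ _).le)
        (mul_le_one₀ (wt_neg_one_le_one (by norm_num) p) (wt_pos _ _ _).le
          (wt_neg_one_le_one (by norm_num) p)))))
    s0 t0
    (fun x => by simpa using (s2 0 (by omega) x).trans (le_max_left M0 M1))
    (fun x => by simpa using (t2 0 (by omega) x).trans (le_max_right M0 M1))
  refine ⟨u, hu, heq, hw0, hw1, fun t ht => ?_⟩
  -- the approximations
  choose un Ln Hn h0 h1 h2 hn0 hn1 using fun n =>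
    hc.exists_approx (by omega : 1 ≤ N) hC₀ hCc hm Hc n (hφ.compactCk n) (hψ.compactCk n)
  have cu2 : ContDiff ℝ 2 u := contDiff_two_of_le hu (by omega)
  have cun2 : ∀ n, ContDiff ℝ 2 (un n) := fun n => contDiff_two_of_le (Hn n).smooth (by omega)
  have cA := hc.jetA.1
  have dA := differentiable_of_succ cA
  have du := cu2.differentiable two_ne_zero
  have dun := fun n => (cun2 n).differentiable two_ne_zero
  have hlim := fun x => tendsto_solution (hc.abs_pot_le hC₀) (G := G)
    (Gn := fun n p => cut n p * G p) cu2 cun2 heq (fun n p => (Hn n).eqn p)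
    (fun r => by
      filter_upwards [tendsto_natCast_atTop_atTop.eventually_ge_atTop r] with n hn p hp
      rw [cut_eq_one (hp.trans hn), one_mul])
    (hc.data_tendsto hC₀ u0 u1 u2 h0 h1 h2 h0' h1' h2') ht x
  have ck := fun n => (Hn n).compactCk cA ht
  -- the Cauchy property
  have hdiff : ∀ (n l : ℕ) (t x : ℝ), A (t, x) * un n (t, x) - A (t, x) * un l (t, x)
      = A (t, x) * (un n (t, x) - un l (t, x)) := fun n l t x => by ring
  have hdiff' : ∀ (n l : ℕ) (t x : ℝ), pd et (fun q => A q * un n q) (t, x)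
      - pd et (fun q => A q * un l q) (t, x)
      = pd et (fun q => A q * (un n q - un l q)) (t, x) := fun n l t x => by
    rw [pd_mul et dA (dun n), pd_mul et dA (dun l), pd_mul et dA ((dun n).fun_sub (dun l)),
      pd_sub et (dun n) (dun l)]
    ring
  have hcau : ∀ ε > 0, ∃ M, ∀ n ≥ M, ∀ l ≥ M,
      testNorm (N + 1) (fun x => A (t, x) * un n (t, x) - A (t, x) * un l (t, x)) < ε ∧
      testNorm N (fun x => pd et (fun q => A q * un n q) (t, x)
        - pd et (fun q => A q * un l q) (t, x)) < ε := by
    intro ε hε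
    -- The two data differences and the source difference each contribute at most η², and 3 C1 η² <
    -- ((3 C1 + 1) η)² = ε².
    set η := ε / (3 * C1 + 1) with hη
    have hη0 : 0 < η := by positivity
    have hηε : (3 * C1 + 1) * η = ε := by rw [hη]; field_simp
    obtain ⟨n1, hn1'⟩ := hφ.2.1 η hη0
    obtain ⟨n2, hn2'⟩ := hψ.2.1 η hη0
    have hδ : Tendsto (fun n : ℕ => 2 * (γ * m) * wt 0 (-1 / 2) (0, (n : ℝ))) atTop (𝓝 0) := by
      simpa using tendsto_wt_neg_half.const_mul (2 * (γ * m))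
    obtain ⟨n3, hn3⟩ := (hδ.eventually (gt_mem_nhds hη0)).exists
    refine ⟨max (max n1 n2) n3, fun n hn l hl => ?_⟩
    have hn1l : testNorm (N + 1) (fun x => φ n x - φ l x) < η :=
      hn1' n (by omega) l (by omega)
    have hn2l : testNorm N (fun x => ψ n x - ψ l x) < η := hn2' n (by omega) l (by omega)
    have jG := hc.jetLE_cut_sub hC₀ hCc hm Hc (ν := n3) (n := n) (l := l) (by omega) (by omega)
    have hg0 : 0 ≤ 2 * (γ * m) * wt 0 (-1 / 2) (0, (n3 : ℝ)) := by
      have := (wt_pos 0 (-1 / 2) (0, (n3 : ℝ))).le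
      positivity
    have hest := H1 m _ _ A Ai Q G _ _ hc ((Hn n).sub (Hn l) hg0 jG) t ht
    have g1 : ∀ s, (fun x => A (s, x) * (un n (s, x) - un l (s, x)))
        = fun x => A (s, x) * un n (s, x) - A (s, x) * un l (s, x) :=
      fun s => funext fun x => (hdiff n l s x).symm
    have g2 : ∀ s, (fun x => pd et (fun q => A q * (un n q - un l q)) (s, x))
        = fun x => pd et (fun q => A q * un n q) (s, x) - pd et (fun q => A q * un l q) (s, x) :=
      fun s => funext fun x => (hdiff' n l s x).symm
    rw [g1 t, g1 0, g2 t, g2 0] at hest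
    simp only [hn0, hn1] at hest
    have e1 : (Real.exp (-t) * (1 + t)) ^ 2 ≤ 1 :=
      pow_le_one₀ (by positivity) (decay_le_one ht)
    set a := testNorm (N + 1) (fun x => A (t, x) * un n (t, x) - A (t, x) * un l (t, x))
    set b := testNorm N (fun x => pd et (fun q => A q * un n q) (t, x)
      - pd et (fun q => A q * un l q) (t, x))
    have sq : ∀ {z : ℝ}, 0 ≤ z → z < η → z ^ 2 ≤ η ^ 2 := fun h h' =>
      pow_le_pow_left₀ h h'.le 2
    have f1 := sq (testNorm_nonneg _ _) hn1l
    have f2 := sq (testNorm_nonneg _ _) hn2l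
    have f3 := sq hg0 hn3
    have hest2 : a ^ 2 + b ^ 2 ≤ 3 * C1 * η ^ 2 := by
      refine hest.trans ?_
      calc _ ≤ C1 * 1 * (η ^ 2 + η ^ 2 + η ^ 2) := by gcongr
        _ = _ := by ring
    have hε2 : 3 * C1 * η ^ 2 < ε ^ 2 := by
      rw [← hηε, mul_pow]
      refine mul_lt_mul_of_pos_right ?_ (by positivity)
      nlinarith
    constructor
    · exact lt_of_pow_lt_pow_left₀ 2 hε.le (by nlinarith [sq_nonneg b])
    · exact lt_of_pow_lt_pow_left₀ 2 hε.le (by nlinarith [sq_nonneg a])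
  -- the limits
  have cw : Continuous fun x => A (t, x) * u (t, x) :=
    (contDiff_slice (cA.continuous.mul hu.continuous |> contDiff_zero.2) t : ContDiff ℝ (0 : ℕ) _).continuous
  have cw1 : ContDiff ℝ (1 + 1 : ℕ) fun q => A q * u q :=
    (contDiff_le cA (by omega)).mul cu2
  have cwt : Continuous fun x => pd et (fun q => A q * u q) (t, x) :=
    (contDiff_slice (contDiff_pd cw1 et) t).continuous
  obtain ⟨m1, l1⟩ := memHt_of_pointwise (by omega) cw (fun n => (ck n).1)
    (fun ε hε => (hcau ε hε).imp fun M hM n hn l hl => (hM n hn l hl).1)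
    (fun x => (hlim x).1.const_mul (A (t, x)))
  obtain ⟨m2, l2⟩ := memHt_of_pointwise (by omega) cwt (fun n => (ck n).2)
    (fun ε hε => (hcau ε hε).imp fun M hM n hn l hl => (hM n hn l hl).2)
    (fun x => by
      rw [pd_mul et dA du]
      simp only [pd_mul et dA (dun _)]
      exact ((hlim x).1.const_mul _).add ((hlim x).2.const_mul _))
  refine ⟨m1, m2, ?_⟩
  have r1 := hφ.tendsto_htNorm hw₀
  have r2 := hψ.tendsto_htNorm hw₁
  -- The estimate for the approximations at the fixed time t passes to the limit, because test norms
  -- converge to the norms of the completion on both sides.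
  have hfin := le_of_tendsto_of_tendsto' ((l1.pow 2).add (l2.pow 2))
    ((((r1.pow 2).add (r2.pow 2)).add_const ((γ * m) ^ 2)).const_mul
      (C1 * (Real.exp (-t) * (1 + t)) ^ 2)) fun n => by
        have := H1 m _ _ A Ai Q G _ _ hc (Hn n) t ht
        simp only [hn0, hn1] at this
        exact this
  set a := htNorm (N + 1) (fun x => A (t, x) * u (t, x))
  set b := htNorm N (fun x => pd et (fun q => A q * u q) (t, x))
  have ha0 : 0 ≤ htNorm (N + 1) w₀ := htNorm_nonneg hw₀
  have hb0 : 0 ≤ htNorm N w₁ := htNorm_nonneg hw₁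
  set a0 := htNorm (N + 1) w₀
  set b0 := htNorm N w₁
  set κ := Real.exp (-t) * (1 + t) with hκ
  have hκ0 : 0 ≤ κ := by positivity
  have hS : (a + b) ^ 2 ≤ (√(2 * C1) * (1 + γ) * κ * (a0 + b0 + m)) ^ 2 := by
    have e1 : (a + b) ^ 2 ≤ 2 * (a ^ 2 + b ^ 2) := by nlinarith [sq_nonneg (a - b)]
    have e2 : a0 ^ 2 + b0 ^ 2 + (γ * m) ^ 2 ≤ ((1 + γ) * (a0 + b0 + m)) ^ 2 := by
      have f1 : a0 ^ 2 + b0 ^ 2 + (γ * m) ^ 2 ≤ (a0 + b0 + γ * m) ^ 2 := by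
        have := mul_nonneg ha0 hb0
        have := mul_nonneg ha0 (mul_nonneg hγ0 hm)
        have := mul_nonneg hb0 (mul_nonneg hγ0 hm)
        nlinarith
      refine f1.trans (pow_le_pow_left₀ (by positivity) ?_ 2)
      have := mul_nonneg hγ0 ha0
      have := mul_nonneg hγ0 hb0
      linarith
    calc _ ≤ 2 * (C1 * κ ^ 2 * (a0 ^ 2 + b0 ^ 2 + (γ * m) ^ 2)) :=
          e1.trans (mul_le_mul_of_nonneg_left hfin (by norm_num))
      _ ≤ 2 * (C1 * κ ^ 2 * ((1 + γ) * (a0 + b0 + m)) ^ 2) := by gcongr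
      _ = (2 * C1) * ((1 + γ) * κ * (a0 + b0 + m)) ^ 2 := by ring
      _ = _ := by
        rw [← Real.sq_sqrt (by positivity : 0 ≤ 2 * C1)]
        rw [Real.sqrt_sq (Real.sqrt_nonneg _)]
        ring
  have hab := abs_le_of_sq_le_sq hS (by positivity)
  refine (le_abs_self _).trans (hab.trans ?_)
  have hx : 0 ≤ κ * (a0 + b0 + m) := by positivity
  calc _ = √(2 * C1) * (1 + γ) * (κ * (a0 + b0 + m)) := by ring
    _ ≤ (√(2 * C1) * (1 + γ) + 1) * (κ * (a0 + b0 + m)) := by gcongr; linarith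
    _ = _ := by rw [hκ]; ring

end

/-! ### Assembling the solution -/

noncomputable section

theorem iteratedDeriv_zero_le_ckNorm {f : ℝ → ℝ} (hf : MemC0 0 f) (x : ℝ) : |f x| ≤ ckNorm 0 f := by
  simpa using hf.abs_le_ckNorm le_rfl x

/-- The solution with polarized data is assembled from the d'Alembert solution `ρ` of the wave
equation and from a solution `u` of the rescaled equation. -/
theorem IsSolution.of_plane {R₀ W₀ W₁ : ℝ} (hR : 0 < R₀) {N : ℕ} (hN : 2 ≤ N) {D : InitialData}
    {u : ℝ × ℝ → ℝ}
    (hf : ContDiff ℝ (N + 1 : ℕ) fun x => D.R x - Rb R₀ 0 x)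
    (hg : ContDiff ℝ N fun x => D.Rt x - dt (Rb R₀) 0 x)
    (hq : ∀ x, D.q x = 0) (hqt : ∀ x, D.qt x = 0)
    {ρ : ℝ × ℝ → ℝ} (hρ : ρ = dalembert (fun x => D.R x - Rb R₀ 0 x)
      fun x => D.Rt x - dt (Rb R₀) 0 x)
    (hσ : ∀ p, 1 / 10 ≤ 1 + sig R₀ ρ p) (hA : ContDiff ℝ (N + 1 : ℕ) (resc R₀ (sig R₀ ρ)))
    (hu : ContDiff ℝ N u)
    (heq : ∀ p, pd et (pd et u) p - pd ex (pd ex u) p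
      = -((wt 0 (-1) p ^ 2 + potQ (sig R₀ ρ) p) * u p) + srcG R₀ W₀ (sig R₀ ρ) p)
    (h0 : ∀ x, resc R₀ (sig R₀ ρ) (0, x) * u (0, x) = D.W x - Wb W₀ W₁ 0 x)
    (h1 : ∀ x, pd et (fun q => resc R₀ (sig R₀ ρ) q * u q) (0, x)
      = D.Wt x - dt (Wb W₀ W₁) 0 x) :
    IsSolution N D (fun t x => planeRb R₀ (t, x) + ρ (t, x))
      (fun t x => planeWb W₀ W₁ (t, x) + resc R₀ (sig R₀ ρ) (t, x) * u (t, x)) fun _ _ => 0 := by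
  obtain ⟨cρ, e1, -⟩ := dalembert_spec hf hg
  rw [← hρ] at cρ e1
  have cu2 : ContDiff ℝ 2 u := contDiff_two_of_le hu hN
  have cρ2 : ContDiff ℝ 2 ρ := contDiff_two_of_le cρ (by omega)
  have hw : ∀ p, pd et (pd et ρ) p = pd ex (pd ex ρ) p := by
    rw [hρ]
    exact dalembert_wave (hf.of_le (by exact_mod_cast (by omega : 2 ≤ N + 1))) (hg.of_le (by exact_mod_cast (by omega : 1 ≤ N)))
  set A := resc R₀ (sig R₀ ρ) with hAd
  have cR : ContDiff ℝ N fun p => planeRb R₀ p + ρ p :=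
    (contDiff_planeRb R₀).add (cρ.of_le (by exact_mod_cast Nat.le_succ N))
  have cw : ContDiff ℝ N fun p => A p * u p := (hA.of_le (by exact_mod_cast Nat.le_succ N)).mul hu
  have cW : ContDiff ℝ N fun p => planeWb W₀ W₁ p + A p * u p := (contDiff_planeWb W₀ W₁).add cw
  have cR2 := contDiff_two_of_le cR hN
  have cW2 := contDiff_two_of_le cW hN
  have cRb : ContDiff ℝ 2 (planeRb R₀) := contDiff_two_of_le (contDiff_planeRb (n := 2) R₀) le_rfl
  have cWb : ContDiff ℝ 2 (planeWb W₀ W₁) :=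
    contDiff_two_of_le (contDiff_planeWb (n := 2) W₀ W₁) le_rfl
  have dR := cR2.differentiable two_ne_zero
  have dW := cW2.differentiable two_ne_zero
  have dRb := cRb.differentiable two_ne_zero
  have dWb := cWb.differentiable two_ne_zero
  have dρ := cρ2.differentiable two_ne_zero
  have dw := (contDiff_two_of_le cw hN).differentiable two_ne_zero
  have z1 : dt (fun _ _ => (0 : ℝ)) = fun _ _ => 0 := by
    funext t x; simp [dt]
  have z2 : dx (fun _ _ => (0 : ℝ)) = fun _ _ => 0 := by
    funext t x; simp [dx]
  have hwR : ∀ p, pd et (pd et fun p => planeRb R₀ p + ρ p) p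
      = pd ex (pd ex fun p => planeRb R₀ p + ρ p) p := fun p => by
    have a1 : ∀ v, pd v (fun p => planeRb R₀ p + ρ p) = fun p => pd v (planeRb R₀) p + pd v ρ p :=
      fun v => funext fun q => by rw [pd_add v dRb dρ]
    rw [a1, a1, pd_add et (fun q => differentiableAt_pd cRb.contDiffAt et)
      (fun q => differentiableAt_pd cρ2.contDiffAt et),
      pd_add ex (fun q => differentiableAt_pd cRb.contDiffAt ex)
      (fun q => differentiableAt_pd cρ2.contDiffAt ex)]
    simp only [hw, pd_pd_planeRb]
  exact {
    smooth_R := cR.contDiffOn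
    smooth_W := cW.contDiffOn
    smooth_q := contDiffOn_const
    R_ne_zero := fun t x ht => (planeR_pos hR hσ (t, x) (by simp only; linarith)).ne'
    eq_R := fun t x ht => by
      rw [dx_dx_plane (u := fun p => planeRb R₀ p + ρ p) cR2,
        dt_dt_plane (u := fun p => planeRb R₀ p + ρ p) cR2 ht, hwR, sub_self]
    eq_W := fun t x ht => by
      have := wave_identity hR cρ2 hσ W₀ W₁ hw cu2 (t, x) (by simp only; linarith) (heq (t, x))
      simp only [z1, z2]
      rw [dx_dx_plane (u := fun p => planeWb W₀ W₁ p + A p * u p) cW2,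
        dt_dt_plane (u := fun p => planeWb W₀ W₁ p + A p * u p) cW2 ht,
        dt_plane (u := fun p => planeWb W₀ W₁ p + A p * u p) dW ht,
        dx_plane (u := fun p => planeWb W₀ W₁ p + A p * u p) dW,
        dt_plane (u := fun p => planeRb R₀ p + ρ p) dR ht,
        dx_plane (u := fun p => planeRb R₀ p + ρ p) dR]
      simpa using this
    eq_q := fun t x ht => by simp [z1, z2]
    init_R := fun x => by
      rw [hρ, dalembert_zero, planeRb]; ring
    init_Rt := fun x => by
      rw [dt_plane (u := fun p => planeRb R₀ p + ρ p) dR le_rfl, pd_add et dRb dρ, e1]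
      beta_reduce
      rw [← dt_plane dRb le_rfl]
      change dt (Rb R₀) 0 x + _ = _
      simp [trav]
    init_W := fun x => by
      rw [h0, planeWb]; ring
    init_Wt := fun x => by
      rw [dt_plane (u := fun p => planeWb W₀ W₁ p + A p * u p) dW le_rfl, pd_add et dWb dw]
      beta_reduce
      rw [h1, ← dt_plane dWb le_rfl]
      change dt (Wb W₀ W₁) 0 x + _ = _
      ring
    init_q := fun x => (hq x).symm
    init_qt := fun x => by rw [z1, hqt] }

theorem Mtilde_eq_of_zero {W₀ W₁ : ℝ} {k : ℕ} (hk : 2 ≤ k) (W : ℝ → ℝ → ℝ) (t : ℝ) :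
    Mtilde W₀ W₁ k W (fun _ _ => 0) t = htNorm k (fun x => W t x - Wb W₀ W₁ t x)
      + htNorm (k - 1) (fun x => dt (fun s y => W s y - Wb W₀ W₁ s y) t x) := by
  have z1 : dt (fun _ _ => (0 : ℝ)) = fun _ _ => 0 := by
    funext t x; simp [dt]
  rw [Mtilde, z1, htNorm_zero (by omega), htNorm_zero (by omega), add_zero, add_zero]

theorem tendsto_exp_neg_mul_add_one :
    Tendsto (fun t : ℝ => Real.exp (-t) * (t + 1)) atTop (𝓝 0) := by
  have h1 := Real.tendsto_pow_mul_exp_neg_atTop_nhds_zero 1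
  have h2 := Real.tendsto_exp_neg_atTop_nhds_zero
  simpa using (h1.add h2).congr fun t => by ring

end

end DoubleCusp

/-! ### The stability theorem -/

theorem mainTheorem3 (R₀ W₀ : ℝ) (hR₀ : 0 < R₀) (hW₀ : W₀ ≠ 0) (k : ℕ) (hk : 3 ≤ k) (B : ℝ) :
    ∃ C : ℝ, 0 < C ∧
      ∀ (W₁ : ℝ) (D : DoubleCusp.InitialData),
        DoubleCusp.IsPolarizedData R₀ W₀ W₁ k D →
        DoubleCusp.mInit R₀ 0 D < 2 * R₀ / 3 →
        DoubleCusp.mInit R₀ k D ≤ B →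
        ∃ R W q : ℝ → ℝ → ℝ,
          DoubleCusp.IsSolution (k - 1) D R W q ∧
          (∀ t x : ℝ, 0 ≤ t → q t x = 0) ∧
          (∀ R' W' q' : ℝ → ℝ → ℝ, DoubleCusp.IsSolution 2 D R' W' q' →
            ∀ t x : ℝ, 0 ≤ t → R' t x = R t x ∧ W' t x = W t x ∧ q' t x = q t x) ∧
          (∀ t : ℝ, 0 ≤ t →
            DoubleCusp.MemHt k (fun x => W t x - DoubleCusp.Wb W₀ W₁ t x) ∧
            DoubleCusp.MemHt (k - 1)
              (fun x => DoubleCusp.dt (fun s y => W s y - DoubleCusp.Wb W₀ W₁ s y) t x) ∧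
            DoubleCusp.Mtilde W₀ W₁ k W q t ≤
              C * Real.exp (-t) * (t + 1) *
                (DoubleCusp.Mtilde W₀ W₁ k W q 0 + DoubleCusp.mInit R₀ k D)) ∧
          Filter.Tendsto (DoubleCusp.Mtilde W₀ W₁ k W q) Filter.atTop (nhds 0) := by
  open DoubleCusp in
  obtain ⟨N, rfl⟩ : ∃ N, k = N + 1 := ⟨k - 1, by omega⟩
  have hN : 2 ≤ N := by omega
  simp only [Nat.add_sub_cancel]
  -- B may be negative while the coefficient bounds ask for a nonnegative one, hence `max B 0`. Both
  -- C₀ and C are fixed before W₁ and the data.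
  obtain ⟨C₀, hC₀, H₀⟩ := exists_coeffBound hR₀ W₀ (max B 0) (le_max_right _ _) N
  obtain ⟨C, hC, H⟩ := exists_weighted_solution N hN C₀ hC₀
  refine ⟨C, hC, fun W₁ D hD h0 hB => ?_⟩
  have mf := hD.mem_R
  have mg := hD.mem_Rt
  have mw := hD.mem_W
  have mwt := hD.mem_Wt
  rw [Nat.add_sub_cancel] at mg mwt
  set f := fun x => D.R x - Rb R₀ 0 x with hf
  set g := fun x => D.Rt x - dt (Rb R₀) 0 x with hg
  have hm : mInit R₀ (N + 1) D = ckNorm (N + 1) f + ckNorm N g := rfl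
  have hm0 : mInit R₀ 0 D = ckNorm 0 f + ckNorm 0 g := rfl
  have nf : 0 ≤ ckNorm (N + 1) f := ckNorm_nonneg _ _
  have ng : 0 ≤ ckNorm N g := ckNorm_nonneg _ _
  set m := mInit R₀ (N + 1) D
  obtain ⟨hσ, hc⟩ := H₀ f g m (ckNorm 0 f) (ckNorm 0 g) mf.1 mg.1
    (fun i hi x => (mf.abs_le_ckNorm hi x).trans (by linarith))
    (fun i hi x => (mg.abs_le_ckNorm hi x).trans (by linarith))
    (iteratedDeriv_zero_le_ckNorm (mf.of_le (Nat.zero_le _)))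
    (iteratedDeriv_zero_le_ckNorm (mg.of_le (Nat.zero_le _))) (hm0 ▸ h0)
    (hB.trans (le_max_left _ _))
  have cw₀ : Continuous fun x => D.W x - Wb W₀ W₁ 0 x :=
    hD.cont_W.sub ((contDiff_planeWb (n := 0) W₀ W₁).continuous.comp (Continuous.prodMk_right 0))
  have cw₁ : Continuous fun x => D.Wt x - dt (Wb W₀ W₁) 0 x := by
    simpa [dt, Wb] using hD.cont_Wt
  obtain ⟨u, cu, heq, hu0, hu1, hest⟩ := H m _ _ _ _ _ _ (by linarith) hc cw₀ cw₁ mw mwt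
  set ρ := dalembert f g with hρ
  set A := resc R₀ (sig R₀ ρ) with hA
  have sol := IsSolution.of_plane hR₀ hN mf.1 mg.1 hD.q_zero hD.qt_zero hρ hσ hc.jetA.1 cu heq
    hu0 hu1
  -- The uniqueness statement compares with arbitrary C² solutions, and here N ≥ 2.
  have sol2 := sol.mono hN
  have cAu : ContDiff ℝ 2 fun p => A p * u p :=
    (contDiff_two_of_le hc.jetA.1 (by omega)).mul (contDiff_two_of_le cu hN)
  have hW : (fun (t : ℝ) (x : ℝ) => planeWb W₀ W₁ (t, x) + A (t, x) * u (t, x) - Wb W₀ W₁ t x)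
      = fun t x => A (t, x) * u (t, x) := by
    funext t x; rw [planeWb]; ring
  have hW' : ∀ t, (fun x => planeWb W₀ W₁ (t, x) + A (t, x) * u (t, x) - Wb W₀ W₁ t x)
      = fun x => A (t, x) * u (t, x) := fun t => congrFun hW t
  have hdW : ∀ t, 0 ≤ t → (fun x => dt (fun (s : ℝ) (y : ℝ) =>
      planeWb W₀ W₁ (s, y) + A (s, y) * u (s, y) - Wb W₀ W₁ s y) t x)
      = fun x => pd et (fun q => A q * u q) (t, x) := fun t ht => by
    rw [hW]
    exact funext fun x => dt_plane (u := fun q => A q * u q) (cAu.differentiable two_ne_zero) ht x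
  have hMt : ∀ t, 0 ≤ t → Mtilde W₀ W₁ (N + 1)
      (fun t x => planeWb W₀ W₁ (t, x) + A (t, x) * u (t, x)) (fun _ _ => 0) t
      = htNorm (N + 1) (fun x => A (t, x) * u (t, x))
        + htNorm N (fun x => pd et (fun q => A q * u q) (t, x)) := fun t ht => by
    rw [Mtilde_eq_of_zero (by omega), hW', hdW t ht, Nat.add_sub_cancel]
  have hM0 := hMt 0 le_rfl
  simp only [hu0, hu1] at hM0
  refine ⟨_, _, _, sol, fun _ _ _ => rfl, fun R' W' q' h' t x ht =>
    ⟨sol2.R_unique h' t x ht, sol2.W_unique h' hD.q_zero hD.qt_zero t x ht,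
      h'.q_eq_zero hD.q_zero hD.qt_zero t x ht⟩, fun t ht => ⟨?_, ?_, ?_⟩, ?_⟩
  · rw [hW']; exact (hest t ht).1
  · rw [hdW t ht]; exact (hest t ht).2.1
  · rw [hMt t ht, hM0]; exact (hest t ht).2.2
  -- Nothing is known about `Mtilde` at negative times, so the squeeze is applied with bounds that
  -- hold eventually.
  · refine squeeze_zero' (g := fun t => C * (htNorm (N + 1) (fun x => D.W x - Wb W₀ W₁ 0 x)
      + htNorm N (fun x => D.Wt x - dt (Wb W₀ W₁) 0 x) + m) * (Real.exp (-t) * (t + 1))) ?_ ?_ ?_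
    · filter_upwards [eventually_ge_atTop 0] with t ht
      rw [hMt t ht]
      refine add_nonneg (htNorm_nonneg ?_) (htNorm_nonneg ?_)
      · exact cAu.continuous.comp (Continuous.prodMk_right t)
      · have c1 : ContDiff ℝ (1 + 1 : ℕ) fun p => A p * u p := cAu
        exact (contDiff_pd c1 et).continuous.comp (Continuous.prodMk_right t)
    · filter_upwards [eventually_ge_atTop 0] with t ht
      rw [hMt t ht]
      exact ((hest t ht).2.2).trans_eq (by ring)
    · simpa using tendsto_exp_neg_mul_add_one.const_mul _
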